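/- **Setting.** Let $X$ be a Hausdorff, second countable complex manifold (of pure finite dimension) with a holomorphic action $\mu:\mathbb{C}^\times\times X\to X$, $\mu(t,x)=tx$, which is free and proper. Let $\mathcal{A}_X$ be a DQ-algebra on $X$: a sheaf of $\mathbb{C}[[\hbar]]$-algebras that is locally isomorphic to some star-algebra $(\mathcal{O}_U[[\hbar]],\star)$, where $f\star g=\sum_{i\ge 0}P_i(f,g)\hbar^i$ for $f,g\in\mathcal O_U$, the $P_i$ are holomorphic bidifferential operators, $P_0(f,g)=fg$, and $\star$ is $\mathbb{C}[[\hbar]]$-bilinear, associative, with unit $1$. Put $\mathcal{A}_X^{loc}=\mathbb{C}((\hbar))\otimes_{\mathbb{C}[[\hbar]]}\mathcal{A}_X$. For a complex manifold $T$ let $\mathcal{A}_{T\times X}=\mathcal{O}_T^\hbar\,\underline{\boxtimes}\,\mathcal{A}_X$ be the DQ-algebra of sections of $\mathcal{A}_X$ depending holomorphically on the parameter in $T$ (locally $\mathcal{O}_{T\times U}[[\hbar]]$ with $\star$ extended $\mathcal{O}_T$-bilinearly), with the Fréchet topology of compact convergence of all coefficients on the spaces of sections, and $\mathcal{A}^{loc}_{T\times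 X}$ its localization in $\hbar$. Write $\widetilde\mu(t,x)=(t,tx)$, let $p_1,p_2$ be the projections of $\mathbb{C}^\times\times X$, $q_{ij}$ those of $\mathbb{C}^\times\times\mathbb{C}^\times\times X$, and $\sigma(t_1,t_2)=t_1t_2$. **F-action.** Let $m\in\mathbb{Z}\setminus\{0\}$ and let an F-action of exponent $m$ on $\mathcal{A}_X$ be given: an isomorphism of $p_1^{-1}\mathcal{O}_{\mathbb{C}^\times}$-algebras $\widetilde\theta:\widetilde\mu^{-1}\mathcal{A}_{\mathbb{C}^\times\times X}\to\mathcal{A}_{\mathbb{C}^\times\times X}$ whose adjoint $\mathcal{A}_{\mathbb{C}^\times\times X}\to\widetilde\mu_*\mathcal{A}_{\mathbb{C}^\times\times X}$ is continuous, and whose evaluations $\theta_t:\mu_t^{-1}\mathcal{A}_X\to\mathcal{A}_X$ at $t\in\mathbb{C}^\times$ satisfy $\theta_1=\mathrm{id}$, $\theta_t(\hbar^n)=t^{mn}\hbar^n$ and $\theta_{t_2}\circ\theta_{t_1}=\theta_{t_1t_2}$. Let $\theta:\mu^{-1}\mathcal{A}_X\to\mathcal{A}_{\mathbb{C}^\times\times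 X}$ be the restriction of $\widetilde\theta$ to sections of $\mathcal{A}_X$, and use the same letters for the extensions to $\mathcal{A}^{loc}$. **The morphism $\lambda$.** For a local section $a$ of $\mathcal{A}_{\mathbb{C}^\times\times X}$, with values $a(t_1)$ in $\mathcal{A}_X$, set $\lambda(a)(t_1,t_2)=\theta_{t_2}(a(t_1))$. Part of the claim is that this family is again holomorphic, so that it defines a morphism of sheaves of algebras $\lambda:(\mathrm{id}\times\mu)^{-1}\mathcal{A}_{\mathbb{C}^\times\times X}\to\mathcal{A}_{\mathbb{C}^\times\times\mathbb{C}^\times\times X}$, where $(\mathrm{id}\times\mu)(t_1,t_2,x)=(t_1,t_2x)$. **The category $\mathrm{Mod}_{\mathrm F}(\mathcal{A}_X^{loc})$.** Objects are pairs $(\mathcal{M},\phi)$ of an arbitrary left $\mathcal{A}_X^{loc}$-module $\mathcal{M}$ and an isomorphism $\phi:\mu^*\mathcal{M}\to p_2^*\mathcal{M}$ of $\mathcal{A}^{loc}_{\mathbb{C}^\times\times X}$-modules such that $$(\sigma\times\mathrm{id})^*\phi=q_{23}^*\phi\circ(\mathrm{id}\times\mu)^*\phi$$ modulo the canonical identifications.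 Here the inverse images are taken along the morphisms of ringed spaces $(\mu,\theta)$ and $(\mathrm{id}\times\mu,\lambda)$ and the canonical ones over $p_2$, $q_{23}$ and $\sigma\times\mathrm{id}$ (the last three act by pulling back families in the parameter or by the inclusion of constant families). Morphisms are $\mathcal{A}_X^{loc}$-linear maps compatible with the $\phi$'s. **Invariants.** Let $Y=X/\mathbb{C}^\times$ with quotient map $p:X\to Y$, and let $\mathcal{B}_Y\subset p_*\mathcal{A}_X^{loc}$ be the sheaf of algebras with $$\mathcal{B}_Y(V)=\{s\in\mathcal{A}_X^{loc}(p^{-1}V):\theta_t(s)=s\text{ for all }t\in\mathbb{C}^\times\}.$$ For $(\mathcal{M},\phi)\in\mathrm{Mod}_{\mathrm F}(\mathcal{A}_X^{loc})$ and a section $s$ of $\mathcal{M}$ let $v(s)=\frac{d}{dt}\phi_t(s)\big|_{t=1}$, where $\phi_t$ is the evaluation of $\phi$ at $t$. Let $p_*^{\mathbb{C}^\times}\mathcal{M}$ be the $\mathcal{B}_Y$-submodule of $p_*\mathcal{M}$ with $$(p_*^{\mathbb{C}^\times}\mathcal{M})(V)=\{s\in\mathcal{M}(p^{-1}V):v(s)=0\}.$$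 For a $\mathcal{B}_Y$-module $\mathcal{N}$ let $p^*_{\mathbb{C}^\times}\mathcal{N}=(p^*\mathcal{N},\phi)$, where $p^*\mathcal{N}=\mathcal{A}_X^{loc}\otimes_{p^{-1}\mathcal{B}_Y}p^{-1}\mathcal{N}$ and $\phi:\mu^*p^*\mathcal{N}\simeq p_2^*p^*\mathcal{N}$ is the canonical isomorphism that comes from the equality $p\circ\mu=p\circ p_2$ of morphisms of ringed spaces. **Proposition.** The morphism $\lambda$ exists, and the functor $$p^*_{\mathbb{C}^\times}:\mathrm{Mod}(\mathcal{B}_Y)\to\mathrm{Mod}_{\mathrm F}(\mathcal{A}_X^{loc})$$ is left adjoint to $$p_*^{\mathbb{C}^\times}:\mathrm{Mod}_{\mathrm F}(\mathcal{A}_X^{loc})\to\mathrm{Mod}(\mathcal{B}_Y).$$ -/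

import Mathlib

open CategoryTheory TopologicalSpace Opposite
open scoped Manifold ContDiff

universe u

/-! ### Holomorphic functions and bidifferential operators -/

section Holomorphic

variable {E : Type} [NormedAddCommGroup E] [NormedSpace ℂ E]
  {X : Type u} [TopologicalSpace X] [ChartedSpace E X]

/-- `f` is a holomorphic function on the (open) set `s` of the complex manifold `X`; the values of
`f` outside `s` are irrelevant. -/
def HolOn (E : Type) [NormedAddCommGroup E] [NormedSpace ℂ E] {X : Type u} [TopologicalSpace X]
    [ChartedSpace E X] (f : X → ℂ) (s : Set X) : Prop :=
  ContMDiffOn 𝓘(ℂ, E) 𝓘(ℂ, ℂ) ω f s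

/-- The iterated partial derivative `∂_{v₁} ⋯ ∂_{v_k} f` at `y`, computed in the chart `e`. -/
noncomputable def chartDeriv (e : OpenPartialHomeomorph X E) {k : ℕ} (v : Fin k → E) (f : X → ℂ)
    (y : X) : ℂ :=
  iteratedFDeriv ℂ k (f ∘ e.symm) (e y) v

/-- `P` is a holomorphic bidifferential operator on `U`: around each point `x₀` of `U` it is, in the
chart at `x₀`, a finite sum of terms `c · ∂_{v₁} ⋯ ∂_{v_k} f · ∂_{w₁} ⋯ ∂_{w_l} g` with
holomorphic `c`, for all functions `f`, `g` that are holomorphic on an open subset of a fixed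
neighbourhood of `x₀`. -/
def IsBidiffOp (E : Type) [NormedAddCommGroup E] [NormedSpace ℂ E] {X : Type u} [TopologicalSpace X]
    [ChartedSpace E X] (U : Opens X) (P : (X → ℂ) → (X → ℂ) → X → ℂ) : Prop :=
  ∀ x₀ ∈ U, ∃ V : Opens X, x₀ ∈ V ∧ V ≤ U ∧ (V : Set X) ⊆ (chartAt E x₀).source ∧
    ∃ (N : ℕ) (c : Fin N → X → ℂ) (k l : Fin N → ℕ) (v : ∀ r, Fin (k r) → E)
      (w : ∀ r, Fin (l r) → E), (∀ r, HolOn E (c r) V) ∧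
      ∀ V' : Opens X, V' ≤ V → ∀ f g : X → ℂ, HolOn E f V' → HolOn E g V' → ∀ y ∈ V',
        P f g y = ∑ r, c r y * chartDeriv (chartAt E x₀) (v r) f y *
          chartDeriv (chartAt E x₀) (w r) g y

/-- The `n`-th coefficient of `f ⋆ g`, where `f = ∑ ħ^j f_j`, `g = ∑ ħ^k g_k` and
`f_j ⋆ g_k = ∑ ħ^i P_i(f_j, g_k)`. -/
def starCoeff (P : ℕ → (X → ℂ) → (X → ℂ) → X → ℂ) (f g : ℕ → X → ℂ) (n : ℕ) (x : X) : ℂ :=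
  ∑ p ∈ Finset.HasAntidiagonal.antidiagonal n, ∑ q ∈ Finset.HasAntidiagonal.antidiagonal p.2, P p.1 (f q.1) (g q.2) x

/-- A star product on `O_U[[ħ]]`, given by its bidifferential operators `P_i`. A section of
`O_U[[ħ]]` over an open set `V ⊆ U` is a sequence of holomorphic functions on `V`. -/
structure StarProduct (E : Type) [NormedAddCommGroup E] [NormedSpace ℂ E] {X : Type u}
    [TopologicalSpace X] [ChartedSpace E X] (U : Opens X) where
  P : ℕ → (X → ℂ) → (X → ℂ) → X → ℂ
  bidiff : ∀ i, IsBidiffOp E U (P i)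
  zero : ∀ V : Opens X, V ≤ U → ∀ f g : X → ℂ, HolOn E f V → HolOn E g V →
    ∀ x ∈ V, P 0 f g x = f x * g x
  one_left : ∀ i, 0 < i → ∀ V : Opens X, V ≤ U → ∀ f : X → ℂ, HolOn E f V →
    ∀ x ∈ V, P i (fun _ => 1) f x = 0
  one_right : ∀ i, 0 < i → ∀ V : Opens X, V ≤ U → ∀ f : X → ℂ, HolOn E f V →
    ∀ x ∈ V, P i f (fun _ => 1) x = 0
  assoc : ∀ V : Opens X, V ≤ U → ∀ f g h : ℕ → X → ℂ, (∀ n, HolOn E (f n) V) →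
    (∀ n, HolOn E (g n) V) → (∀ n, HolOn E (h n) V) → ∀ n, ∀ x ∈ V,
      starCoeff P (starCoeff P f g) h n x = starCoeff P f (starCoeff P g h) n x

end Holomorphic

/-! ### DQ-algebras -/

/-- Sheaves of (not necessarily commutative) rings on a topological space. -/
abbrev RingSheaf (X : TopCat.{u}) := Sheaf (Opens.grothendieckTopology X) RingCat.{u}

/-- Restriction of sections of a sheaf of rings. -/
def RingSheaf.res {X : TopCat.{u}} (F : RingSheaf X) {U V : Opens X} (h : V ≤ U) :
    F.obj.obj (op U) →+* F.obj.obj (op V) :=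
  (F.obj.map (homOfLE h).op).hom

section RingSheafLemmas

variable {X : TopCat.{u}} (F : RingSheaf X)

lemma RingSheaf.res_res {U V W : Opens X} (h : V ≤ U) (h' : W ≤ V) (a : F.obj.obj (op U)) :
    F.res h' (F.res h a) = F.res (h'.trans h) a := by
  change (F.obj.map (homOfLE h').op) (F.obj.map (homOfLE h).op a) = _
  rw [← ConcreteCategory.comp_apply, ← F.obj.map_comp]
  rfl

lemma RingSheaf.res_self {U : Opens X} (h : U ≤ U) (a : F.obj.obj (op U)) :
    F.res h a = a := by
  have : (homOfLE h).op = 𝟙 (op U) := rfl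
  change (F.obj.map (homOfLE h).op) a = a
  rw [this, F.obj.map_id]
  rfl

lemma RingSheaf.app_res {G : RingSheaf X} (f : F ⟶ G) {U V : Opens X} (h : V ≤ U)
    (a : F.obj.obj (op U)) : f.hom.app (op V) (F.res h a) = G.res h (f.hom.app (op U) a) := by
  change (f.hom.app (op V)) (F.obj.map (homOfLE h).op a) = G.obj.map (homOfLE h).op _
  rw [← ConcreteCategory.comp_apply, f.hom.naturality, ConcreteCategory.comp_apply]

/-- Two sections of a sheaf that agree locally are equal. -/
lemma RingSheaf.ext_local {U : Opens X} (a b : F.obj.obj (op U))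
    (h : ∀ x ∈ U, ∃ (V : Opens X) (hV : V ≤ U), x ∈ V ∧ F.res hV a = F.res hV b) : a = b := by
  choose V hV hx hab using h
  refine TopCat.Sheaf.eq_of_locally_eq' (X := X) F (fun x : U => V x.1 x.2) U
    (fun x => homOfLE (hV x.1 x.2)) ?_ a b (fun x => hab x.1 x.2)
  intro x hxU
  exact Opens.mem_iSup.2 ⟨⟨x, hxU⟩, hx x hxU⟩

/-- Gluing of sections given around each point. -/
lemma RingSheaf.glue {U : Opens X} {ι : Type u} (V : ι → Opens X) (hV : ∀ i, V i ≤ U)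
    (hc : ∀ x ∈ U, ∃ i, x ∈ V i) (a : ∀ i, F.obj.obj (op (V i)))
    (hcomp : ∀ i j, F.res (inf_le_left : V i ⊓ V j ≤ V i) (a i) = F.res inf_le_right (a j)) :
    ∃ b : F.obj.obj (op U), ∀ i, F.res (hV i) b = a i := by
  obtain ⟨b, hb, -⟩ := TopCat.Sheaf.existsUnique_gluing' (X := X) F V U
    (fun i => homOfLE (hV i)) (by
      intro x hxU
      obtain ⟨i, hi⟩ := hc x hxU
      exact Opens.mem_iSup.2 ⟨i, hi⟩) a (fun i j => hcomp i j)
  exact ⟨b, hb⟩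

/-- Recognising sheaves of rings through gluing around points. -/
lemma isSheaf_of_glue (P : (Opens X)ᵒᵖ ⥤ RingCat.{u})
    (hext : ∀ (U : Opens X) (a b : P.obj (op U)), (∀ x ∈ U, ∃ (V : Opens X) (hV : V ≤ U), x ∈ V ∧
      P.map (homOfLE hV).op a = P.map (homOfLE hV).op b) → a = b)
    (hglue : ∀ (U : Opens X) {ι : Type u} (V : ι → Opens X) (hV : ∀ i, V i ≤ U)
      (_ : ∀ x ∈ U, ∃ i, x ∈ V i) (a : ∀ i, P.obj (op (V i))),
      (∀ i j, P.map (homOfLE (inf_le_left : V i ⊓ V j ≤ V i)).op (a i) =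
        P.map (homOfLE (inf_le_right : V i ⊓ V j ≤ V j)).op (a j)) →
      ∃ b : P.obj (op U), ∀ i, P.map (homOfLE (hV i)).op b = a i) :
    Presheaf.IsSheaf (Opens.grothendieckTopology X) P := by
  refine (TopCat.Presheaf.isSheaf_iff_isSheafUniqueGluing (X := X) P).2 ?_
  intro ι V a ha
  obtain ⟨b, hb⟩ := hglue (iSup V) V (fun i => le_iSup V i)
    (fun x hx => Opens.mem_iSup.1 hx) a (fun i j => ha i j)
  refine ⟨b, fun i => hb i, ?_⟩
  intro c hc
  refine hext _ _ _ ?_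
  intro x hx
  obtain ⟨i, hi⟩ := Opens.mem_iSup.1 hx
  exact ⟨V i, le_iSup V i, hi, (hc i).trans (hb i).symm⟩

end RingSheafLemmas

section DQ

variable {E : Type} [NormedAddCommGroup E] [NormedSpace ℂ E]
  {X : Type u} [TopologicalSpace X] [ChartedSpace E X]

/-- A sheaf of (unital, associative) `ℂ[[ħ]]`-algebras on `X`. -/
structure HbarAlgebra (X : Type u) [TopologicalSpace X] where
  sheaf : RingSheaf (TopCat.of X)
  scal : ∀ U : Opens X, PowerSeries ℂ →+* sheaf.obj.obj (op U)
  central : ∀ (U : Opens X) (c : PowerSeries ℂ) (a : sheaf.obj.obj (op U)),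
    scal U c * a = a * scal U c
  scal_res : ∀ {U V : Opens X} (h : V ≤ U) (c : PowerSeries ℂ),
    sheaf.res h (scal U c) = scal V c

/-- An isomorphism over the open set `U` of the sheaf of `ℂ[[ħ]]`-algebras `A` with a star-algebra
`(O_U[[ħ]], ⋆)`: a section `a` over `V ⊆ U` corresponds to `∑ ħ^n coeff V a n`, where
`coeff V a n` is holomorphic on `V` (its values outside `V` are irrelevant). -/
structure StarTriv (E : Type) [NormedAddCommGroup E] [NormedSpace ℂ E] {X : Type u}
    [TopologicalSpace X] [ChartedSpace E X] (A : HbarAlgebra X) where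
  U : Opens X
  star : StarProduct E U
  coeff : ∀ V : Opens X, V ≤ U → A.sheaf.obj.obj (op V) → ℕ → X → ℂ
  hol : ∀ (V : Opens X) (h : V ≤ U) a n, HolOn E (coeff V h a n) V
  injective : ∀ (V : Opens X) (h : V ≤ U) a b, (∀ n, Set.EqOn (coeff V h a n) (coeff V h b n) V) → a = b
  surjective : ∀ (V : Opens X) (h : V ≤ U) (f : ℕ → X → ℂ), (∀ n, HolOn E (f n) V) →
    ∃ a, ∀ n, Set.EqOn (coeff V h a n) (f n) V
  res : ∀ (V : Opens X) (h : V ≤ U) (V' : Opens X) (h' : V' ≤ V) a n,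
    Set.EqOn (coeff V' (h'.trans h) (A.sheaf.res h' a) n) (coeff V h a n) V'
  add : ∀ (V : Opens X) (h : V ≤ U) a b n,
    Set.EqOn (coeff V h (a + b) n) (fun x => coeff V h a n x + coeff V h b n x) V
  mul : ∀ (V : Opens X) (h : V ≤ U) a b n,
    Set.EqOn (coeff V h (a * b) n) (starCoeff star.P (coeff V h a) (coeff V h b) n) V
  scal : ∀ (V : Opens X) (h : V ≤ U) (c : PowerSeries ℂ) a n,
    Set.EqOn (coeff V h (A.scal V c * a) n)
      (fun x => ∑ p ∈ Finset.HasAntidiagonal.antidiagonal n,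
        PowerSeries.coeff p.1 c * coeff V h a p.2 x) V

/-- A DQ-algebra on the complex manifold `X`: a sheaf of `ℂ[[ħ]]`-algebras that is locally
isomorphic to a star-algebra. -/
structure DQAlgebra (E : Type) [NormedAddCommGroup E] [NormedSpace ℂ E] (X : Type u)
    [TopologicalSpace X] [ChartedSpace E X] extends HbarAlgebra X where
  locally_star : ∀ x : X, ∃ τ : StarTriv E toHbarAlgebra, x ∈ τ.U

end DQ

/-! ### Families of sections parametrised by a space `T` -/

section Families

variable (T : Type) [TopologicalSpace T] {X : Type u} [TopologicalSpace X]

/-- The slice `{x | (t, x) ∈ W}`. -/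
def slice {T : Type} [TopologicalSpace T] {X : Type u} [TopologicalSpace X]
    (W : Opens (T × X)) (t : T) : Opens X :=
  ⟨{x | (t, x) ∈ W}, W.isOpen.preimage (by fun_prop : Continuous fun x : X => (t, x))⟩

lemma slice_mono {T : Type} [TopologicalSpace T] {X : Type u} [TopologicalSpace X]
    {W W' : Opens (T × X)} (h : W' ≤ W) (t : T) : slice W' t ≤ slice W t :=
  fun _ hx => h hx

/-- All families `(a_t)_{t ∈ T}` of sections `a_t` of `F` over the slices `W_t`. -/
abbrev Fam (F : RingSheaf (TopCat.of X)) (W : Opens (T × X)) : Type u :=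
  ∀ t : T, F.obj.obj (op (slice W t))

/-- Restriction of families. -/
def Fam.res {T : Type} [TopologicalSpace T] {X : Type u} [TopologicalSpace X]
    {F : RingSheaf (TopCat.of X)} {W W' : Opens (T × X)} (h : W' ≤ W) :
    Fam T F W →+* Fam T F W' :=
  RingHom.pi fun t => (F.res (slice_mono h t)).comp (Pi.evalRingHom _ t)

@[simp] lemma Fam.res_apply {T : Type} [TopologicalSpace T] {X : Type u} [TopologicalSpace X]
    {F : RingSheaf (TopCat.of X)} {W W' : Opens (T × X)} (h : W' ≤ W) (a : Fam T F W) (t : T) :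
    Fam.res h a t = F.res (slice_mono h t) (a t) := rfl

/-- A class of families of sections of `F` that is stable under the ring operations and under
restriction, and is defined by a local condition. -/
structure FamClass (F : RingSheaf (TopCat.of X)) where
  carrier : ∀ W : Opens (T × X), Subring (Fam T F W)
  res_mem : ∀ {W W' : Opens (T × X)} (h : W' ≤ W) (a : Fam T F W), a ∈ carrier W →
    Fam.res h a ∈ carrier W'
  of_local : ∀ (W : Opens (T × X)) (a : Fam T F W),
    (∀ p ∈ W, ∃ (W' : Opens (T × X)) (h : W' ≤ W), p ∈ W' ∧ Fam.res h a ∈ carrier W') →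
    a ∈ carrier W

variable {T}

/-- Restriction of families of a given class. -/
def FamClass.resHom {F : RingSheaf (TopCat.of X)} (C : FamClass T F) {W W' : Opens (T × X)}
    (h : W' ≤ W) : C.carrier W →+* C.carrier W' :=
  ((Fam.res h).comp (C.carrier W).subtype).codRestrict (C.carrier W')
    (fun a => C.res_mem h a.1 a.2)

/-- The presheaf of rings on `T × X` formed by the families of a given class. -/
def FamClass.presheaf {F : RingSheaf (TopCat.of X)} (C : FamClass T F) :
    (Opens (TopCat.of (T × X)))ᵒᵖ ⥤ RingCat.{u} where
  obj W := RingCat.of (C.carrier W.unop)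
  map i := RingCat.ofHom (C.resHom (leOfHom i.unop))
  map_id W := RingCat.hom_ext (RingHom.ext fun (a : C.carrier W.unop) =>
    Subtype.ext (a1 := C.resHom le_rfl a) (funext fun _ => F.res_self _ _))
  map_comp {W _ _} i j := RingCat.hom_ext (RingHom.ext fun (a : C.carrier W.unop) =>
    Subtype.ext (a1 := C.resHom (leOfHom (i ≫ j).unop) a)
      (a2 := C.resHom (leOfHom j.unop) (C.resHom (leOfHom i.unop) a))
      (funext fun _ => (F.res_res _ _ _).symm))

lemma FamClass.presheaf_isSheaf {F : RingSheaf (TopCat.of X)} (C : FamClass T F) :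
    Presheaf.IsSheaf (Opens.grothendieckTopology (TopCat.of (T × X))) C.presheaf := by
  refine isSheaf_of_glue _ ?_ ?_
  · intro W (a : C.carrier W) (b : C.carrier W) h
    refine Subtype.ext (a1 := a) (a2 := b) (funext fun t => ?_)
    refine F.ext_local _ _ fun x hx => ?_
    obtain ⟨W', hW', hp, hab⟩ := h (t, x) hx
    replace hab : C.resHom hW' a = C.resHom hW' b := hab
    refine ⟨slice W' t, slice_mono hW' t, hp, ?_⟩
    exact congrFun (congrArg Subtype.val hab) t
  · intro W ι V hV hc (a : ∀ i, C.carrier (V i)) hcomp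
    replace hcomp : ∀ i j, C.resHom (inf_le_left : V i ⊓ V j ≤ V i) (a i) =
      C.resHom (inf_le_right : V i ⊓ V j ≤ V j) (a j) := hcomp
    have key : ∀ t : T, ∃ b : F.obj.obj (op (slice W t)), ∀ i,
        F.res (slice_mono (hV i) t) b = (a i).1 t := by
      intro t
      refine F.glue (fun i => slice (V i) t) (fun i => slice_mono (hV i) t) ?_
        (fun i => (a i).1 t) ?_
      · intro x hx
        exact hc (t, x) hx
      · intro i j
        exact congrFun (congrArg Subtype.val (hcomp i j)) t
    choose b hb using key
    have hres : ∀ i, Fam.res (hV i) b = (a i).1 := fun i => funext fun t => hb t i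
    have hmem : b ∈ C.carrier W := by
      refine C.of_local W b ?_
      intro p hp
      obtain ⟨i, hi⟩ := hc p hp
      refine ⟨V i, hV i, hi, ?_⟩
      rw [hres]
      exact (a i).2
    refine ⟨(⟨b, hmem⟩ : C.carrier W), ?_⟩
    intro i
    exact Subtype.ext (a1 := C.resHom (hV i) ⟨b, hmem⟩) (a2 := a i) (hres i)

/-- The sheaf of rings on `T × X` formed by the families of a given class. -/
def FamClass.sheaf {F : RingSheaf (TopCat.of X)} (C : FamClass T F) :
    RingSheaf (TopCat.of (T × X)) :=
  ⟨C.presheaf, C.presheaf_isSheaf⟩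

end Families

/-! ### Holomorphic families: the sheaf `O_T[[ħ]] ⊠ A` on `T × X` -/

section HolFamilies

variable {E : Type} [NormedAddCommGroup E] [NormedSpace ℂ E]
  {X : Type u} [TopologicalSpace X] [ChartedSpace E X]
  {F H : Type} [NormedAddCommGroup F] [NormedSpace ℂ F] [TopologicalSpace H]
  (I : ModelWithCorners ℂ F H)
  {T : Type} [TopologicalSpace T] [ChartedSpace H T]

/-- `f` is a (jointly) holomorphic function on the open subset `W` of `T × X`. -/
def HolOnProd {F H : Type} [NormedAddCommGroup F] [NormedSpace ℂ F] [TopologicalSpace H]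
    (I : ModelWithCorners ℂ F H) (E : Type) [NormedAddCommGroup E] [NormedSpace ℂ E]
    {T : Type} [TopologicalSpace T] [ChartedSpace H T]
    {X : Type u} [TopologicalSpace X] [ChartedSpace E X] (f : T × X → ℂ) (W : Set (T × X)) : Prop :=
  ContMDiffOn (I.prod 𝓘(ℂ, E)) 𝓘(ℂ, ℂ) ω f W

lemma iteratedFDeriv_family_hol [IsManifold I ω T] (h : T → E → ℂ) {Ω : Set (T × E)}
    (hΩ : IsOpen Ω)
    (hh : ContMDiffOn (I.prod 𝓘(ℂ, E)) 𝓘(ℂ, ℂ) ω (fun p : T × E => h p.1 p.2) Ω) (k : ℕ)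
    (v : Fin k → E) :
    ContMDiffOn (I.prod 𝓘(ℂ, E)) 𝓘(ℂ, ℂ) ω
      (fun p : T × E => iteratedFDeriv ℂ k (h p.1) p.2 v) Ω := by
  have : IsManifold I 1 T := IsManifold.of_le (n := ω) le_top
  have hsmooth : ∀ p ∈ Ω, ContDiffAt ℂ ω (h p.1) p.2 := by
    intro p hp
    rw [← contMDiffAt_iff_contDiffAt]
    have h1 := (hh p hp).contMDiffAt (hΩ.mem_nhds hp)
    exact ContMDiffAt.comp (x := p.2) (I' := I.prod 𝓘(ℂ, E))
      (g := fun p : T × E => h p.1 p.2) (f := fun y : E => (p.1, y)) h1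
      (contMDiffAt_const.prodMk contMDiffAt_id)
  induction k with
  | zero =>
    simpa using hh
  | succ k ih =>
    have ih' := ih (Fin.tail v)
    have hcongr : ∀ p ∈ Ω, iteratedFDeriv ℂ (k + 1) (h p.1) p.2 v =
        fderiv ℂ (fun y => iteratedFDeriv ℂ k (h p.1) y (Fin.tail v)) p.2 (v 0) := by
      intro p hp
      rw [iteratedFDeriv_succ_apply_left]
      have hd : DifferentiableAt ℂ (iteratedFDeriv ℂ k (h p.1)) p.2 :=
        (hsmooth p hp).differentiableAt_iteratedFDeriv (by simp)
      have := ((ContinuousMultilinearMap.apply ℂ (fun _ : Fin k => E) ℂ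
        (Fin.tail v)).hasFDerivAt.comp p.2 hd.hasFDerivAt).fderiv
      exact (congrArg (fun L => L (v 0)) this).symm
    refine ContMDiffOn.congr ?_ hcongr
    intro p hp
    refine ContMDiffAt.contMDiffWithinAt ?_
    have hk := (ih' p hp).contMDiffAt (hΩ.mem_nhds hp)
    have key := ContMDiffAt.mfderiv (I := 𝓘(ℂ, E)) (J := I.prod 𝓘(ℂ, E))
      (I' := 𝓘(ℂ, ℂ)) (x₀ := p) (n := ω) (m := ω)
      (fun (q : T × E) (y : E) => iteratedFDeriv ℂ k (h q.1) y (Fin.tail v)) (fun q => q.2) ?_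
      contMDiffAt_snd le_top
    · have key' : ContMDiffAt (I.prod 𝓘(ℂ, E)) 𝓘(ℂ, E →L[ℂ] ℂ) ω (fun q : T × E =>
          fderiv ℂ (fun y => iteratedFDeriv ℂ k (h q.1) y (Fin.tail v)) q.2) p := by
        refine key.congr_of_eventuallyEq (Filter.Eventually.of_forall fun q => ?_)
        have e := congrFun (inTangentCoordinates_model_space (I := 𝓘(ℂ, E)) (I' := 𝓘(ℂ, ℂ))
          (fun q : T × E => q.2) (fun q => iteratedFDeriv ℂ k (h q.1) q.2 (Fin.tail v))
          (fun q => mfderiv 𝓘(ℂ, E) 𝓘(ℂ, ℂ)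
            (fun y => iteratedFDeriv ℂ k (h q.1) y (Fin.tail v)) q.2) p) q
        exact (mfderiv_eq_fderiv.symm.trans e.symm)
      exact key'.clm_apply contMDiffAt_const
    · exact ContMDiffAt.comp (x := (p, p.2)) (I' := I.prod 𝓘(ℂ, E))
        (g := fun p : T × E => iteratedFDeriv ℂ k (h p.1) p.2 (Fin.tail v))
        (f := fun q : (T × E) × E => (q.1.1, q.2)) hk
        ((contMDiffAt_fst.comp _ contMDiffAt_fst).prodMk contMDiffAt_snd)

lemma chartDeriv_family_hol [IsManifold I ω T] [IsManifold 𝓘(ℂ, E) ω X] (x₀ : X) {k : ℕ}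
    (v : Fin k → E) {f : T → X → ℂ} {W : Set (T × X)} (hW : IsOpen W)
    (hs : ∀ p ∈ W, p.2 ∈ (chartAt E x₀).source)
    (hf : HolOnProd I E (fun p : T × X => f p.1 p.2) W) :
    HolOnProd I E (fun p : T × X => chartDeriv (chartAt E x₀) v (f p.1) p.2) W := by
  set e := chartAt E x₀ with he
  let Ω : Set (T × E) := {q | q.2 ∈ e.target} ∩ (fun q : T × E => (q.1, e.symm q.2)) ⁻¹' W
  have hcont : ContinuousOn (fun q : T × E => (q.1, e.symm q.2)) {q | q.2 ∈ e.target} :=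
    continuousOn_fst.prodMk (e.continuousOn_symm.comp continuousOn_snd fun q hq => hq)
  have hΩ : IsOpen Ω := hcont.isOpen_inter_preimage (e.open_target.preimage continuous_snd) hW
  have hsymm : ContMDiffOn 𝓘(ℂ, E) 𝓘(ℂ, E) ω e.symm e.target :=
    contMDiffOn_chart_symm
  have hchart : ContMDiffOn 𝓘(ℂ, E) 𝓘(ℂ, E) ω e e.source := contMDiffOn_chart
  have h1 : ContMDiffOn (I.prod 𝓘(ℂ, E)) 𝓘(ℂ, ℂ) ω
      (fun q : T × E => (fun t => f t ∘ e.symm) q.1 q.2) Ω := by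
    refine ContMDiffOn.comp (g := fun p : T × X => f p.1 p.2) (t := W) hf
      (f := fun q : T × E => (q.1, e.symm q.2)) ?_ (fun q hq => hq.2)
    exact contMDiffOn_fst.prodMk (hsymm.comp contMDiffOn_snd fun q hq => hq.1)
  have h2 := iteratedFDeriv_family_hol I (fun t => f t ∘ e.symm) hΩ h1 k v
  refine ContMDiffOn.comp (g := fun p : T × E => iteratedFDeriv ℂ k (f p.1 ∘ e.symm) p.2 v)
    (t := Ω) h2 (f := fun q : T × X => (q.1, e q.2)) ?_ ?_
  · exact contMDiffOn_fst.prodMk (hchart.comp contMDiffOn_snd fun q hq => hs q hq)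
  · intro q hq
    have hsrc := hs q hq
    refine ⟨e.map_source hsrc, ?_⟩
    change (q.1, e.symm (e q.2)) ∈ W
    rw [e.left_inv hsrc]
    exact hq

end HolFamilies

section HolClass

variable {E : Type} [NormedAddCommGroup E] [NormedSpace ℂ E]
  {X : Type u} [TopologicalSpace X] [ChartedSpace E X]

namespace StarTriv

variable {A : HbarAlgebra X} (τ : StarTriv E A)

lemma coeff_zero (V : Opens X) (h : V ≤ τ.U) (n : ℕ) :
    Set.EqOn (τ.coeff V h 0 n) (fun _ => 0) V := by
  intro x hx
  have := τ.add V h 0 0 n hx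
  rw [add_zero] at this
  simpa using this

lemma coeff_neg (V : Opens X) (h : V ≤ τ.U) (a) (n : ℕ) :
    Set.EqOn (τ.coeff V h (-a) n) (fun x => -τ.coeff V h a n x) V := by
  intro x hx
  have h1 := τ.add V h a (-a) n hx
  rw [add_neg_cancel, τ.coeff_zero V h n hx] at h1
  exact eq_neg_of_add_eq_zero_right h1.symm

lemma coeff_C (V : Opens X) (h : V ≤ τ.U) (c : ℂ) (a) (n : ℕ) :
    Set.EqOn (τ.coeff V h (A.scal V (PowerSeries.C c) * a) n)
      (fun x => c * τ.coeff V h a n x) V := by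
  intro x hx
  rw [τ.scal V h (PowerSeries.C c) a n hx]
  dsimp only
  rw [Finset.sum_eq_single (0, n)]
  · simp
  · rintro ⟨i, j⟩ hij hne
    have hi : i ≠ 0 := by
      rintro rfl
      apply hne
      have := Finset.HasAntidiagonal.mem_antidiagonal.1 hij
      simp_all
    simp [PowerSeries.coeff_C, hi]
  · intro hn
    exact absurd (Finset.HasAntidiagonal.mem_antidiagonal.2 (by simp)) hn

end StarTriv

variable {F H : Type} [NormedAddCommGroup F] [NormedSpace ℂ F] [TopologicalSpace H]
  (I : ModelWithCorners ℂ F H)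
  {T : Type} [TopologicalSpace T] [ChartedSpace H T]

/-- The `n`-th coefficient, with respect to `τ`, of the family `a`, as a function of `(t, x)`. -/
def StarTriv.famCoeff {A : HbarAlgebra X} (τ : StarTriv E A) {W : Opens (T × X)}
    (a : Fam T A.sheaf W) (n : ℕ) (p : T × X) : ℂ :=
  τ.coeff (slice W p.1 ⊓ τ.U) inf_le_right (A.sheaf.res inf_le_left (a p.1)) n p.2

/-- The part of `W` over which the trivialisation `τ` is defined. -/
def StarTriv.dom {A : HbarAlgebra X} (τ : StarTriv E A) (W : Opens (T × X)) : Set (T × X) :=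
  {p | p ∈ W ∧ p.2 ∈ τ.U}

lemma StarTriv.isOpen_dom {A : HbarAlgebra X} (τ : StarTriv E A) (W : Opens (T × X)) :
    IsOpen (τ.dom W) :=
  W.isOpen.inter (τ.U.isOpen.preimage continuous_snd)

lemma StarTriv.famCoeff_res {A : HbarAlgebra X} (τ : StarTriv E A) {W W' : Opens (T × X)}
    (h : W' ≤ W) (a : Fam T A.sheaf W) (n : ℕ) :
    Set.EqOn (τ.famCoeff (Fam.res h a) n) (τ.famCoeff a n) (τ.dom W') := by
  rintro ⟨t, x⟩ ⟨h1, h2⟩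
  have := τ.res (slice W t ⊓ τ.U) inf_le_right (slice W' t ⊓ τ.U)
    (inf_le_inf_right _ (slice_mono h t)) (A.sheaf.res inf_le_left (a t)) n
    (x := x) ⟨h1, h2⟩
  rw [A.sheaf.res_res] at this
  change τ.coeff _ _ (A.sheaf.res _ (A.sheaf.res _ (a t))) n x = _
  rw [A.sheaf.res_res]
  exact this

/-- A family `(a_t)` of sections of `A` over the slices of `W ⊆ T × X` is holomorphic if in each
local trivialisation of `A` as a star-algebra all its coefficients are holomorphic functions of
`(t, x)`. -/
def IsHolFam (E : Type) [NormedAddCommGroup E] [NormedSpace ℂ E]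
    {X : Type u} [TopologicalSpace X] [ChartedSpace E X]
    {F H : Type} [NormedAddCommGroup F] [NormedSpace ℂ F] [TopologicalSpace H]
    (I : ModelWithCorners ℂ F H) {T : Type} [TopologicalSpace T] [ChartedSpace H T]
    {A : HbarAlgebra X} {W : Opens (T × X)} (a : Fam T A.sheaf W) : Prop :=
  ∀ (τ : StarTriv E A) (n : ℕ), HolOnProd I E (τ.famCoeff a n) (τ.dom W)

variable {A : HbarAlgebra X}

lemma IsHolFam.zero {W : Opens (T × X)} : IsHolFam E I (0 : Fam T A.sheaf W) := by
  intro τ n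
  refine ContMDiffOn.congr (f := fun _ => (0 : ℂ)) contMDiffOn_const ?_
  rintro ⟨t, x⟩ ⟨h1, h2⟩
  change τ.coeff _ _ (A.sheaf.res _ 0) n x = 0
  rw [map_zero]
  exact τ.coeff_zero _ _ n ⟨h1, h2⟩

lemma IsHolFam.add {W : Opens (T × X)} {a b : Fam T A.sheaf W} (ha : IsHolFam E I a)
    (hb : IsHolFam E I b) : IsHolFam E I (a + b) := by
  intro τ n
  refine ContMDiffOn.congr ((ha τ n).add (hb τ n)) ?_
  rintro ⟨t, x⟩ ⟨h1, h2⟩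
  change τ.coeff _ _ (A.sheaf.res _ (a t + b t)) n x = _
  rw [map_add]
  exact τ.add _ _ _ _ n ⟨h1, h2⟩

lemma IsHolFam.neg {W : Opens (T × X)} {a : Fam T A.sheaf W} (ha : IsHolFam E I a) :
    IsHolFam E I (-a) := by
  intro τ n
  refine ContMDiffOn.congr ((contDiff_neg.contMDiff (n := ω)).comp_contMDiffOn (ha τ n)) ?_
  rintro ⟨t, x⟩ ⟨h1, h2⟩
  change τ.coeff _ _ (A.sheaf.res _ (-(a t))) n x = _
  rw [map_neg]
  exact τ.coeff_neg _ _ _ n ⟨h1, h2⟩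

/-- Constant families are holomorphic. -/
lemma IsHolFam.const {U : Opens X} (a : A.sheaf.obj.obj (op U)) (W : Opens (T × X))
    (hW : ∀ t, slice W t ≤ U) :
    IsHolFam E I (fun t => A.sheaf.res (hW t) a : Fam T A.sheaf W) := by
  intro τ n
  have h0 := τ.hol (U ⊓ τ.U) inf_le_right (A.sheaf.res inf_le_left a) n
  have h1 : HolOnProd I E
      (fun p : T × X => τ.coeff (U ⊓ τ.U) inf_le_right (A.sheaf.res inf_le_left a) n p.2)
      (τ.dom W) :=
    ContMDiffOn.comp (t := ((U ⊓ τ.U : Opens X) : Set X)) h0 contMDiffOn_snd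
      (fun p hp => ⟨hW p.1 hp.1, hp.2⟩)
  refine ContMDiffOn.congr h1 ?_
  rintro ⟨t, x⟩ ⟨h1, h2⟩
  have := τ.res (U ⊓ τ.U) inf_le_right (slice W t ⊓ τ.U)
    (inf_le_inf_right _ (hW t)) (A.sheaf.res inf_le_left a) n (x := x) ⟨h1, h2⟩
  rw [A.sheaf.res_res] at this
  change τ.coeff _ _ (A.sheaf.res _ (A.sheaf.res _ a)) n x = _
  rw [A.sheaf.res_res]
  exact this

lemma IsHolFam.one {W : Opens (T × X)} : IsHolFam E I (1 : Fam T A.sheaf W) := by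
  have := IsHolFam.const (E := E) I (A := A) (U := ⊤) 1 W (fun _ => le_top)
  simp only [map_one] at this
  exact this

/-- Holomorphic families can be multiplied by holomorphic functions of the parameter. -/
lemma IsHolFam.smul {W : Opens (T × X)} {a : Fam T A.sheaf W} (ha : IsHolFam E I a)
    (f : T → ℂ) {S : Set T} (hf : ContMDiffOn I 𝓘(ℂ, ℂ) ω f S) (hS : ∀ p ∈ W, p.1 ∈ S) :
    IsHolFam E I (fun t => A.scal _ (PowerSeries.C (f t)) * a t : Fam T A.sheaf W) := by
  intro τ n
  have hf' : HolOnProd I E (fun p : T × X => f p.1) (τ.dom W) :=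
    ContMDiffOn.comp hf contMDiffOn_fst (fun p hp => hS p hp.1)
  refine ContMDiffOn.congr (hf'.mul (ha τ n)) ?_
  rintro ⟨t, x⟩ ⟨h1, h2⟩
  change τ.coeff _ _ (A.sheaf.res _ (A.scal _ _ * a t)) n x = _
  rw [map_mul, A.scal_res]
  exact τ.coeff_C _ _ _ _ n ⟨h1, h2⟩

lemma IsHolFam.mul [IsManifold I ω T] [IsManifold 𝓘(ℂ, E) ω X] {W : Opens (T × X)}
    {a b : Fam T A.sheaf W} (ha : IsHolFam E I a) (hb : IsHolFam E I b) :
    IsHolFam E I (a * b) := by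
  intro τ n
  have hsum : HolOnProd I E (fun p : T × X =>
      starCoeff τ.star.P (fun j x => τ.famCoeff a j (p.1, x)) (fun j x => τ.famCoeff b j (p.1, x))
        n p.2) (τ.dom W) := by
    refine contMDiffOn_finsetSum fun i _ => contMDiffOn_finsetSum fun j _ => ?_
    intro p₀ hp₀
    obtain ⟨V, hx, hVU, hVs, N, c, k, l, v, w, hc, hP⟩ := τ.star.bidiff i.1 p₀.2 hp₀.2
    let Ω : Set (T × X) := τ.dom W ∩ {p | p.2 ∈ V}
    have hΩ : IsOpen Ω := (τ.isOpen_dom W).inter (V.isOpen.preimage continuous_snd)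
    refine ContMDiffAt.contMDiffWithinAt ?_
    refine ContMDiffOn.contMDiffAt (s := Ω) ?_ (hΩ.mem_nhds ⟨hp₀, hx⟩)
    have hformula : HolOnProd I E (fun p : T × X => ∑ r, c r p.2 *
        chartDeriv (chartAt E p₀.2) (v r) (fun x => τ.famCoeff a j.1 (p.1, x)) p.2 *
        chartDeriv (chartAt E p₀.2) (w r) (fun x => τ.famCoeff b j.2 (p.1, x)) p.2) Ω := by
      refine contMDiffOn_finsetSum fun r _ => ?_
      refine ContMDiffOn.mul (ContMDiffOn.mul ?_ ?_) ?_
      · exact (hc r).comp contMDiffOn_snd (fun p hp => hp.2)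
      · exact chartDeriv_family_hol I p₀.2 (v r) (f := fun t x => τ.famCoeff a j.1 (t, x)) hΩ
          (fun p hp => hVs hp.2) ((ha τ j.1).mono fun p hp => hp.1)
      · exact chartDeriv_family_hol I p₀.2 (w r) (f := fun t x => τ.famCoeff b j.2 (t, x)) hΩ
          (fun p hp => hVs hp.2) ((hb τ j.2).mono fun p hp => hp.1)
    refine ContMDiffOn.congr hformula ?_
    rintro ⟨t, x⟩ ⟨h1, h2⟩
    refine hP (slice W t ⊓ τ.U ⊓ V) inf_le_right _ _ ?_ ?_ x ⟨⟨h1.1, h1.2⟩, h2⟩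
    · exact ContMDiffOn.mono (τ.hol (slice W t ⊓ τ.U) inf_le_right
        (A.sheaf.res inf_le_left (a t)) j.1) Set.inter_subset_left
    · exact ContMDiffOn.mono (τ.hol (slice W t ⊓ τ.U) inf_le_right
        (A.sheaf.res inf_le_left (b t)) j.2) Set.inter_subset_left
  refine ContMDiffOn.congr hsum ?_
  rintro ⟨t, x⟩ ⟨h1, h2⟩
  change τ.coeff _ _ (A.sheaf.res _ (a t * b t)) n x = _
  rw [map_mul]
  exact τ.mul _ _ _ _ n ⟨h1, h2⟩

lemma IsHolFam.res {W W' : Opens (T × X)} (h : W' ≤ W) {a : Fam T A.sheaf W}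
    (ha : IsHolFam E I a) : IsHolFam E I (Fam.res h a) := fun τ n =>
  ContMDiffOn.congr ((ha τ n).mono fun _ hp => ⟨h hp.1, hp.2⟩) (τ.famCoeff_res h a n)

lemma IsHolFam.of_local {W : Opens (T × X)} (a : Fam T A.sheaf W)
    (h : ∀ p ∈ W, ∃ (W' : Opens (T × X)) (h : W' ≤ W), p ∈ W' ∧ IsHolFam E I (Fam.res h a)) :
    IsHolFam E I a := by
  intro τ n p hp
  obtain ⟨W', hW', hpW', ha⟩ := h p hp.1
  refine ContMDiffAt.contMDiffWithinAt ?_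
  refine ContMDiffOn.contMDiffAt (s := τ.dom W') ?_ ((τ.isOpen_dom W').mem_nhds ⟨hpW', hp.2⟩)
  exact ContMDiffOn.congr (ha τ n) fun q hq => (τ.famCoeff_res hW' a n hq).symm

/-- Reparametrisation of families along a map `g : T' → T` of the parameter spaces. -/
lemma IsHolFam.reparam {F' H' : Type} [NormedAddCommGroup F'] [NormedSpace ℂ F']
    [TopologicalSpace H'] (I' : ModelWithCorners ℂ F' H')
    {T' : Type} [TopologicalSpace T'] [ChartedSpace H' T'] (g : T' → T) (hg : ContMDiff I' I ω g)
    {W : Opens (T × X)} {a : Fam T A.sheaf W} (ha : IsHolFam E I a) (W' : Opens (T' × X))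
    (hW : ∀ t, slice W' t ≤ slice W (g t)) :
    IsHolFam E I' (fun t => A.sheaf.res (hW t) (a (g t)) : Fam T' A.sheaf W') := by
  intro τ n
  have h1 : HolOnProd I' E (fun p : T' × X => τ.famCoeff a n (g p.1, p.2)) (τ.dom W') := by
    refine ContMDiffOn.comp (g := τ.famCoeff a n) (f := fun p : T' × X => (g p.1, p.2)) (ha τ n)
      ?_ (fun p hp => ⟨hW p.1 hp.1, hp.2⟩)
    exact ((hg.comp contMDiff_fst).prodMk contMDiff_snd).contMDiffOn
  refine ContMDiffOn.congr h1 ?_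
  rintro ⟨t, x⟩ ⟨h1, h2⟩
  have := τ.res (slice W (g t) ⊓ τ.U) inf_le_right (slice W' t ⊓ τ.U)
    (inf_le_inf_right _ (hW t)) (A.sheaf.res inf_le_left (a (g t))) n (x := x) ⟨h1, h2⟩
  rw [A.sheaf.res_res] at this
  change τ.coeff _ _ (A.sheaf.res _ (A.sheaf.res _ (a (g t)))) n x = _
  rw [A.sheaf.res_res]
  exact this

/-- The sheaf of algebras `O_T[[ħ]] ⊠ A` on `T × X`: its sections are the holomorphic families of
sections of `A` with parameter in `T`. -/
def holClass (E : Type) [NormedAddCommGroup E] [NormedSpace ℂ E]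
    {X : Type u} [TopologicalSpace X] [ChartedSpace E X] [IsManifold 𝓘(ℂ, E) ω X]
    {F H : Type} [NormedAddCommGroup F] [NormedSpace ℂ F] [TopologicalSpace H]
    (I : ModelWithCorners ℂ F H) (T : Type) [TopologicalSpace T] [ChartedSpace H T]
    [IsManifold I ω T] (A : HbarAlgebra X) : FamClass T A.sheaf where
  carrier _ :=
    { carrier := {a | IsHolFam E I a}
      mul_mem' := IsHolFam.mul I
      one_mem' := IsHolFam.one I
      add_mem' := IsHolFam.add I
      zero_mem' := IsHolFam.zero I
      neg_mem' := IsHolFam.neg I }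
  res_mem h _ ha := IsHolFam.res I h ha
  of_local _ a h := IsHolFam.of_local I a h

end HolClass

/-! ### The localisation `A^loc = ℂ((ħ)) ⊗ A` -/

section Localisation

variable {X : Type u} [TopologicalSpace X] (A : HbarAlgebra X)

namespace HbarAlgebra

/-- The central section `ħ` of `A`. -/
noncomputable def hbar (U : Opens X) : A.sheaf.obj.obj (op U) := A.scal U PowerSeries.X

lemma hbar_res {U V : Opens X} (h : V ≤ U) : A.sheaf.res h (A.hbar U) = A.hbar V :=
  A.scal_res h _

/-- The multiplicative set of the powers of `ħ`. -/
noncomputable def hbarPow (U : Opens X) : Submonoid (A.sheaf.obj.obj (op U)) :=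
  Submonoid.powers (A.hbar U)

lemma hbarPow_comm {U : Opens X} (s : A.hbarPow U) (a : A.sheaf.obj.obj (op U)) :
    (s : A.sheaf.obj.obj (op U)) * a = a * s := by
  obtain ⟨_, n, rfl⟩ := s
  exact (Commute.pow_left (A.central U PowerSeries.X a) n)

noncomputable instance (U : Opens X) : OreLocalization.OreSet (A.hbarPow U) where
  ore_right_cancel r₁ r₂ s h := ⟨s, by rw [A.hbarPow_comm, A.hbarPow_comm]; exact h⟩
  oreNum r _ := r
  oreDenom _ s := s
  ore_eq r s := A.hbarPow_comm s r

/-- The localisation of the ring of sections of `A` over `U` at the powers of `ħ`. -/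
abbrev LocSec (U : Opens X) : Type u :=
  OreLocalization (A.hbarPow U) (A.sheaf.obj.obj (op U))

variable {A} in
/-- Ring homomorphisms that send `ħ` to a unit extend to the localisation. -/
noncomputable def locSecLift {U : Opens X} {S : Type u} [Ring S]
    (f : A.sheaf.obj.obj (op U) →+* S) (h : IsUnit (f (A.hbar U))) : A.LocSec U →+* S :=
  OreLocalization.universalHom f
    (IsUnit.liftRight ((f : A.sheaf.obj.obj (op U) →* S).comp (A.hbarPow U).subtype) (by
      rintro ⟨_, n, rfl⟩
      change IsUnit (f (A.hbar U ^ n))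
      rw [map_pow]
      exact h.pow n)) (fun s => by rw [IsUnit.coe_liftRight]; rfl)

variable {A} in
lemma locSecLift_numerator {U : Opens X} {S : Type u} [Ring S]
    (f : A.sheaf.obj.obj (op U) →+* S) (h : IsUnit (f (A.hbar U))) (a) :
    locSecLift f h (OreLocalization.numeratorRingHom a) = f a :=
  OreLocalization.universalHom_commutes _ _ _

variable {A} in
lemma locSec_hom_ext {U : Opens X} {S : Type u} [Ring S] {φ ψ : A.LocSec U →+* S}
    (h : ∀ a, φ (OreLocalization.numeratorRingHom a) =
      ψ (OreLocalization.numeratorRingHom a)) : φ = ψ := by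
  let f : A.sheaf.obj.obj (op U) →+* S := φ.comp OreLocalization.numeratorRingHom
  have hu : ∀ s : A.hbarPow U, IsUnit (f s) := fun s =>
    (OreLocalization.numerator_isUnit s).map φ
  let fS := IsUnit.liftRight ((f : A.sheaf.obj.obj (op U) →* S).comp (A.hbarPow U).subtype) hu
  have hf : ∀ s : A.hbarPow U, f s = fS s := fun s => (IsUnit.coe_liftRight (f := (f :
    A.sheaf.obj.obj (op U) →* S).comp (A.hbarPow U).subtype) hu s).symm
  rw [OreLocalization.universalHom_unique f fS hf φ (fun _ => rfl),
    OreLocalization.universalHom_unique f fS hf ψ (fun r => (h r).symm)]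

lemma isUnit_hbar_locSec (U : Opens X) : IsUnit
    ((OreLocalization.numeratorRingHom : _ →+* A.LocSec U) (A.hbar U)) :=
  OreLocalization.numerator_isUnit (S := A.hbarPow U) ⟨A.hbar U, Submonoid.mem_powers _⟩

/-- Restriction on the localisations. -/
noncomputable def locSecRes {U V : Opens X} (h : V ≤ U) : A.LocSec U →+* A.LocSec V :=
  locSecLift (OreLocalization.numeratorRingHom.comp (A.sheaf.res h)) (by
    rw [RingHom.comp_apply, hbar_res]
    exact A.isUnit_hbar_locSec V)

lemma locSecRes_numerator {U V : Opens X} (h : V ≤ U) (a : A.sheaf.obj.obj (op U)) :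
    A.locSecRes h (OreLocalization.numeratorRingHom a) =
      OreLocalization.numeratorRingHom (A.sheaf.res h a) :=
  locSecLift_numerator _ _ a

/-- The presheaf `U ↦ A(U)[ħ⁻¹] = ℂ((ħ)) ⊗ A(U)`. -/
noncomputable def locPresheaf : (Opens (TopCat.of X))ᵒᵖ ⥤ RingCat.{u} where
  obj U := RingCat.of (A.LocSec U.unop)
  map i := RingCat.ofHom (A.locSecRes (leOfHom i.unop))
  map_id U := RingCat.hom_ext (locSec_hom_ext fun a => by
    refine (A.locSecRes_numerator le_rfl a).trans ?_
    rw [A.sheaf.res_self]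
    rfl)
  map_comp {U _ V} i j := RingCat.hom_ext (locSec_hom_ext fun a => by
    refine (A.locSecRes_numerator _ a).trans ?_
    change _ = A.locSecRes _ (A.locSecRes _ _)
    rw [A.locSecRes_numerator, A.locSecRes_numerator, A.sheaf.res_res])

/-- The map `A(U) → A(U)[ħ⁻¹]`. -/
noncomputable def toLocPresheaf : A.sheaf.obj ⟶ A.locPresheaf where
  app U := RingCat.ofHom (OreLocalization.numeratorRingHom : _ →+* A.LocSec U.unop)
  naturality U V i := RingCat.hom_ext (RingHom.ext fun a => by
    exact (A.locSecRes_numerator (leOfHom i.unop) a).symm)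

/-- The sheaf `A^loc = ℂ((ħ)) ⊗ A`, the sheaf associated with `U ↦ A(U)[ħ⁻¹]`. -/
noncomputable def loc : RingSheaf (TopCat.of X) :=
  (presheafToSheaf (Opens.grothendieckTopology (TopCat.of X)) RingCat.{u}).obj A.locPresheaf

/-- The canonical map `A → A^loc`. -/
noncomputable def toLoc : A.sheaf ⟶ A.loc :=
  ⟨A.toLocPresheaf ≫ toSheafify (Opens.grothendieckTopology (TopCat.of X)) A.locPresheaf⟩

/-- The image of a section of `A` in `A^loc`. -/
noncomputable def ι (U : Opens X) : A.sheaf.obj.obj (op U) →+* A.loc.obj.obj (op U) :=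
  (A.toLoc.hom.app (op U)).hom

lemma ι_res {U V : Opens X} (h : V ≤ U) (a : A.sheaf.obj.obj (op U)) :
    A.loc.res h (A.ι U a) = A.ι V (A.sheaf.res h a) :=
  (RingSheaf.app_res A.sheaf A.toLoc h a).symm

lemma isUnit_ι_hbar (U : Opens X) : IsUnit (A.ι U (A.hbar U)) :=
  (A.isUnit_hbar_locSec U).map
    ((toSheafify (Opens.grothendieckTopology (TopCat.of X)) A.locPresheaf).app (op U)).hom

/-- Morphisms of sheaves of rings that send `ħ` to units extend to `A^loc`. -/
noncomputable def locLift {G : RingSheaf (TopCat.of X)} (f : A.sheaf ⟶ G)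
    (h : ∀ U : Opens X, IsUnit (f.hom.app (op U) (A.hbar U))) : A.loc ⟶ G :=
  ⟨sheafifyLift (Opens.grothendieckTopology (TopCat.of X)) (P := A.locPresheaf) (Q := G.obj)
    { app := fun U => RingCat.ofHom (locSecLift (f.hom.app U).hom (h U.unop))
      naturality := fun U V i => RingCat.hom_ext (locSec_hom_ext fun a => by
        change locSecLift (f.hom.app V).hom (h V.unop) (A.locSecRes (leOfHom i.unop) _) =
          G.obj.map i (locSecLift (f.hom.app U).hom (h U.unop)
            (OreLocalization.numeratorRingHom a))
        rw [A.locSecRes_numerator, locSecLift_numerator, locSecLift_numerator]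
        exact RingSheaf.app_res A.sheaf f (leOfHom i.unop) a) } G.property⟩

lemma toLoc_locLift {G : RingSheaf (TopCat.of X)} (f : A.sheaf ⟶ G)
    (h : ∀ U : Opens X, IsUnit (f.hom.app (op U) (A.hbar U))) : A.toLoc ≫ A.locLift f h = f := by
  apply Sheaf.hom_ext
  change (A.toLocPresheaf ≫ toSheafify _ _) ≫ sheafifyLift _ _ _ = _
  rw [Category.assoc, toSheafify_sheafifyLift]
  ext U a
  exact locSecLift_numerator _ (h U.unop) a

lemma locLift_ι {G : RingSheaf (TopCat.of X)} (f : A.sheaf ⟶ G)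
    (h : ∀ U : Opens X, IsUnit (f.hom.app (op U) (A.hbar U))) (U : Opens X)
    (a : A.sheaf.obj.obj (op U)) :
    (A.locLift f h).hom.app (op U) (A.ι U a) = f.hom.app (op U) a := by
  conv_rhs => rw [← A.toLoc_locLift f h]
  rfl

/-- Morphisms out of `A^loc` are determined by their restrictions to `A`. -/
lemma loc_hom_ext {G : RingSheaf (TopCat.of X)} {f g : A.loc ⟶ G}
    (h : ∀ (U : Opens X) (a : A.sheaf.obj.obj (op U)),
      f.hom.app (op U) (A.ι U a) = g.hom.app (op U) (A.ι U a)) : f = g := by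
  apply Sheaf.hom_ext
  refine sheafify_hom_ext _ _ _ G.property ?_
  refine NatTrans.ext (funext fun U => RingCat.hom_ext (locSec_hom_ext fun a => ?_))
  exact h U.unop a

/-- Central sections of `A` remain central in `A^loc`. -/
lemma ι_scal_comm_of_isUnit (c : PowerSeries ℂ) (hc : ∀ V : Opens X, IsUnit (A.ι V (A.scal V c)))
    (U : Opens X) (s : A.loc.obj.obj (op U)) :
    A.ι U (A.scal U c) * s = s * A.ι U (A.scal U c) := by
  let u : ∀ V : Opens X, (A.loc.obj.obj (op V))ˣ := fun V => (hc V).unit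
  let κ : A.loc ⟶ A.loc :=
    ⟨{ app := fun V => RingCat.ofHom
          { toFun := fun x => (u V.unop : A.loc.obj.obj V) * x * ((u V.unop)⁻¹ : Units _)
            map_one' := by simp
            map_mul' := fun x y => by simp [mul_assoc]
            map_zero' := by simp
            map_add' := fun x y => by simp [mul_add, add_mul] }
       naturality := fun V W i => RingCat.hom_ext (RingHom.ext fun x => by
          have h1 : A.loc.res (leOfHom i.unop) (u V.unop : A.loc.obj.obj V) = u W.unop := by
            change A.loc.res _ (A.ι _ _) = A.ι _ _
            rw [A.ι_res, A.scal_res]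
          have h2 : Units.map (A.loc.res (leOfHom i.unop) : _ →* _) (u V.unop) = u W.unop :=
            Units.ext h1
          change (u W.unop : A.loc.obj.obj W) * A.loc.res (leOfHom i.unop) x * ((u W.unop)⁻¹ : Units _)
            = A.loc.res (leOfHom i.unop) ((u V.unop : A.loc.obj.obj V) * x * ((u V.unop)⁻¹ : Units _))
          rw [map_mul, map_mul, h1, ← h2, ← map_inv]
          rfl) }⟩
  have hκ : κ = 𝟙 A.loc := A.loc_hom_ext fun V a => by
    change (u V : A.loc.obj.obj (op V)) * A.ι V a * ((u V)⁻¹ : Units _) = A.ι V a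
    have : (u V : A.loc.obj.obj (op V)) * A.ι V a = A.ι V a * u V := by
      change A.ι V _ * A.ι V a = A.ι V a * A.ι V _
      rw [← map_mul, ← map_mul]
      exact congrArg _ (A.central V _ a)
    rw [this, Units.mul_inv_cancel_right]
  have h3 : κ.hom.app (op U) s = s := by rw [hκ]; rfl
  have h4 : (u U : A.loc.obj.obj (op U)) * s * ((u U)⁻¹ : Units _) = s := h3
  change (u U : A.loc.obj.obj (op U)) * s = s * u U
  nth_rewrite 2 [← h4]
  rw [Units.inv_mul_cancel_right]

lemma ι_hbar_comm (U : Opens X) (s : A.loc.obj.obj (op U)) :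
    A.ι U (A.hbar U) * s = s * A.ι U (A.hbar U) :=
  A.ι_scal_comm_of_isUnit PowerSeries.X A.isUnit_ι_hbar U s

lemma ι_C_comm (c : ℂ) (U : Opens X) (s : A.loc.obj.obj (op U)) :
    A.ι U (A.scal U (PowerSeries.C c)) * s = s * A.ι U (A.scal U (PowerSeries.C c)) := by
  by_cases hc : c = 0
  · rw [hc, map_zero, map_zero, map_zero, zero_mul, mul_zero]
  · exact A.ι_scal_comm_of_isUnit _ (fun V =>
      ((((IsUnit.mk0 c hc).map (PowerSeries.C (R := ℂ))).map (A.scal V)).map (A.ι V))) U s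

end HbarAlgebra

end Localisation

/-! ### Ringed spaces and modules over them -/

lemma homEquiv_conjugate {C D D' E : Type*} [Category C] [Category D] [Category D'] [Category E]
    {L₁ : C ⥤ D} {L₂ : D ⥤ E} {R₁ : D ⥤ C} {R₂ : E ⥤ D} {L₁' : C ⥤ D'} {L₂' : D' ⥤ E}
    {R₁' : D' ⥤ C} {R₂' : E ⥤ D'} (adj₁ : L₁ ⊣ R₁) (adj₂ : L₂ ⊣ R₂) (adj₁' : L₁' ⊣ R₁')
    (adj₂' : L₂' ⊣ R₂') (ρ : R₂' ⋙ R₁' ⟶ R₂ ⋙ R₁) (N : C) (P : E)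
    (w : L₂'.obj (L₁'.obj N) ⟶ P) :
    adj₁.homEquiv _ _ (adj₂.homEquiv _ _
      (((conjugateEquiv (adj₁'.comp adj₂') (adj₁.comp adj₂)).symm ρ).app N ≫ w)) =
      adj₁'.homEquiv _ _ (adj₂'.homEquiv _ _ w) ≫ ρ.app P := by
  have h1 := unit_conjugateEquiv_symm (adj₁'.comp adj₂') (adj₁.comp adj₂) ρ N
  have h2 : ∀ v, adj₁.homEquiv N _ (adj₂.homEquiv _ P v) =
      (adj₁.comp adj₂).unit.app N ≫ (R₂ ⋙ R₁).map v := fun v => by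
    simp [Adjunction.homEquiv_unit]
  have h3 : adj₁'.homEquiv N _ (adj₂'.homEquiv _ P w) =
      (adj₁'.comp adj₂').unit.app N ≫ (R₂' ⋙ R₁').map w := by
    simp [Adjunction.homEquiv_unit]
  have h4 := ρ.naturality w
  refine (h2 _).trans ?_
  rw [h3, Functor.map_comp, ← Category.assoc, ← h1, Category.assoc, Category.assoc]
  exact congrArg _ h4.symm

lemma conjugate_cocycle {C₀ C₁ C₂ C₃ : Type*} [Category C₀] [Category C₁] [Category C₂] [Category C₃]
    {p : C₁ ⥤ C₀} {m₁ m₂ : C₂ ⥤ C₁} {a b c : C₃ ⥤ C₂} {p' : C₀ ⥤ C₁} {m₁' m₂' : C₁ ⥤ C₂}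
    {a' b' c' : C₂ ⥤ C₃} (jp : p' ⊣ p) (j₁ : m₁' ⊣ m₁) (j₂ : m₂' ⊣ m₂) (ja : a' ⊣ a) (jb : b' ⊣ b)
    (jc : c' ⊣ c) (h₀ : m₁ ⋙ p = m₂ ⋙ p) (h₁ : a ⋙ m₁ = c ⋙ m₁) (h₂ : a ⋙ m₂ = b ⋙ m₁)
    (h₃ : b ⋙ m₂ = c ⋙ m₂) (N : C₀)
    (φ : m₁'.obj (p'.obj N) ⟶ m₂'.obj (p'.obj N))
    (hφ : φ = ((conjugateEquiv (jp.comp j₂) (jp.comp j₁)).symm (eqToHom h₀.symm)).app N) :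
    a'.map φ ≫ ((conjugateEquiv (j₁.comp jb) (j₂.comp ja)).symm (eqToHom h₂.symm)).app (p'.obj N) ≫
      b'.map φ ≫ ((conjugateEquiv (j₂.comp jc) (j₂.comp jb)).symm (eqToHom h₃.symm)).app (p'.obj N) =
    ((conjugateEquiv (j₁.comp jc) (j₁.comp ja)).symm (eqToHom h₁.symm)).app (p'.obj N) ≫
      c'.map φ := by
  apply (ja.homEquiv _ _).injective
  apply (j₁.homEquiv _ _).injective
  apply (jp.homEquiv _ _).injective
  have key : ∀ {W : C₂} (v : m₂'.obj (p'.obj N) ⟶ W), jp.homEquiv _ _ (j₁.homEquiv _ _ (φ ≫ v)) =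
      jp.homEquiv _ _ (j₂.homEquiv _ _ v) ≫ (eqToHom h₀.symm : m₂ ⋙ p ⟶ m₁ ⋙ p).app W :=
    fun v => by rw [hφ]; exact homEquiv_conjugate jp j₁ jp j₂ _ N _ v
  rw [ja.homEquiv_naturality_left, key, homEquiv_conjugate, jp.homEquiv_naturality_right,
    jb.homEquiv_naturality_left, key]
  rw [← Category.comp_id ((conjugateEquiv (j₂.comp jc) (j₂.comp jb)).symm _ |>.app _),
    homEquiv_conjugate, jp.homEquiv_naturality_right]
  rw [homEquiv_conjugate, jp.homEquiv_naturality_right, ← Category.comp_id (c'.map φ),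
    jc.homEquiv_naturality_left, key]
  simp only [Category.assoc, eqToHom_app, eqToHom_map, eqToHom_trans]
  rfl

/-- A space with a sheaf of (not necessarily commutative) rings. -/
structure RSp where
  top : TopCat.{u}
  ring : RingSheaf top

namespace RSp

/-- The direct image of a sheaf of rings. -/
abbrev pushRing {X Y : TopCat.{u}} (f : X ⟶ Y) (R : RingSheaf X) : RingSheaf Y :=
  ((Opens.map f).sheafPushforwardContinuous RingCat.{u} (Opens.grothendieckTopology Y)
    (Opens.grothendieckTopology X)).obj R

/-- The functoriality of the direct image. -/
abbrev pushRingMap {X Y : TopCat.{u}} (f : X ⟶ Y) {R S : RingSheaf X} (φ : R ⟶ S) :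
    pushRing f R ⟶ pushRing f S :=
  ((Opens.map f).sheafPushforwardContinuous RingCat.{u} (Opens.grothendieckTopology Y)
    (Opens.grothendieckTopology X)).map φ

/-- A morphism of ringed spaces: a continuous map `f` and a morphism of sheaves of rings
`R_Y ⟶ f_* R_X`. -/
@[ext]
structure Hom (X Y : RSp.{u}) where
  base : X.top ⟶ Y.top
  comap : Y.ring ⟶ pushRing base X.ring

instance : Category RSp.{u} where
  Hom := Hom
  id X := ⟨𝟙 _, ⟨𝟙 X.ring.obj⟩⟩
  comp {X _ _} f g := ⟨f.base ≫ g.base, g.comap ≫ pushRingMap g.base f.comap⟩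

/-- Pulling back a section along a morphism of ringed spaces. -/
def Hom.app {X Y : RSp.{u}} (f : X ⟶ Y) (V : Opens Y.top) :
    Y.ring.obj.obj (op V) →+* X.ring.obj.obj (op ((Opens.map f.base).obj V)) :=
  (f.comap.hom.app (op V)).hom

/-- Morphisms of ringed spaces are equal if they agree on points and on sections. -/
lemma hom_ext' {X Y : RSp.{u}} {f g : X ⟶ Y} (h : f.base = g.base)
    (h' : ∀ (V : Opens Y.top) (b : Y.ring.obj.obj (op V)), f.app V b =
      X.ring.res (le_of_eq (by rw [h])) (g.app V b)) : f = g := by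
  obtain ⟨f, f'⟩ := f
  obtain ⟨g, g'⟩ := g
  dsimp only at h
  subst h
  congr 1
  apply Sheaf.hom_ext
  ext V b
  refine (h' V.unop b).trans ?_
  exact RingSheaf.res_self _ _ _

/-- Sheaves of (left) modules on a ringed space. -/
abbrev Mod (X : RSp.{u}) := SheafOfModules.{u} X.ring

/-- The direct image functor. -/
noncomputable def push {X Y : RSp.{u}} (f : X ⟶ Y) : X.Mod ⥤ Y.Mod :=
  SheafOfModules.pushforward.{u} f.comap

lemma push_comp {X Y Z : RSp.{u}} (f : X ⟶ Y) (g : Y ⟶ Z) :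
    push (f ≫ g) = push f ⋙ push g := rfl

lemma push_eq {X Y Y' Z : RSp.{u}} {f : X ⟶ Y} {g : Y ⟶ Z} {f' : X ⟶ Y'} {g' : Y' ⟶ Z}
    (h : f ≫ g = f' ≫ g') : push f ⋙ push g = push f' ⋙ push g' := by
  rw [← push_comp, ← push_comp, h]

lemma presheaf_pushforward_isRightAdjoint {X Y : TopCat.{u}} (f : X ⟶ Y)
    (R : (Opens X)ᵒᵖ ⥤ RingCat.{u}) (S : (Opens Y)ᵒᵖ ⥤ RingCat.{u})
    (φ : S ⟶ (Opens.map f).op ⋙ R) : (PresheafOfModules.pushforward.{u} φ).IsRightAdjoint :=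
  inferInstance

instance {X Y : RSp.{u}} (f : X ⟶ Y) :
    (SheafOfModules.pushforward.{u} f.comap).IsRightAdjoint :=
  have : (PresheafOfModules.pushforward.{u} f.comap.hom).IsRightAdjoint :=
    presheaf_pushforward_isRightAdjoint f.base X.ring.obj Y.ring.obj f.comap.hom
  (SheafOfModules.PullbackConstruction.adjunction.{u} f.comap).isRightAdjoint

/-- The inverse image functor `f^* M = R_X ⊗ f⁻¹ M`. -/
noncomputable def pull {X Y : RSp.{u}} (f : X ⟶ Y) : Y.Mod ⥤ X.Mod :=
  SheafOfModules.pullback.{u} f.comap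

/-- The inverse image is left adjoint to the direct image. -/
noncomputable def adj {X Y : RSp.{u}} (f : X ⟶ Y) : pull f ⊣ push f :=
  SheafOfModules.pullbackPushforwardAdjunction.{u} f.comap

/-- The canonical isomorphism `f^* g^* ≅ f'^* g'^*` for a commutative square. -/
noncomputable def pullSq {X Y Y' Z : RSp.{u}} {f : X ⟶ Y} {g : Y ⟶ Z} {f' : X ⟶ Y'} {g' : Y' ⟶ Z}
    (h : f ≫ g = f' ≫ g') : pull g ⋙ pull f ≅ pull g' ⋙ pull f' :=
  (conjugateIsoEquiv ((adj g').comp (adj f')) ((adj g).comp (adj f))).symm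
    (eqToIso (push_eq h).symm)

lemma pullSq_hom {X Y Y' Z : RSp.{u}} {f : X ⟶ Y} {g : Y ⟶ Z} {f' : X ⟶ Y'} {g' : Y' ⟶ Z}
    (h : f ≫ g = f' ≫ g') : (pullSq h).hom =
      (conjugateEquiv ((adj g').comp (adj f')) ((adj g).comp (adj f))).symm
        (eqToHom (push_eq h).symm) := rfl

end RSp

/-- The ringed spaces and morphisms that express an action of a group `G` on a ringed space `X₀`:
`X₁ = G × X₀` with the action `mu` and the projection `p₂`, and `X₂ = G × G × X₀` with
`idMu = id × mu`, `sig = (multiplication of G) × id` and the projection `q₂₃`. -/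
structure ActionDiagram where
  (X₂ X₁ X₀ : RSp.{u})
  (mu p₂ : X₁ ⟶ X₀)
  (idMu sig q₂₃ : X₂ ⟶ X₁)
  idMu_mu : idMu ≫ mu = sig ≫ mu
  idMu_p₂ : idMu ≫ p₂ = q₂₃ ≫ mu
  q₂₃_p₂ : q₂₃ ≫ p₂ = sig ≫ p₂

/-- A module `M` on `X₀` with an equivariant structure: an isomorphism `φ : mu^* M ≅ p₂^* M` with
`sig^* φ = q₂₃^* φ ∘ idMu^* φ` modulo the canonical isomorphisms. -/
structure EquivMod (D : ActionDiagram.{u}) where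
  mod : D.X₀.Mod
  iso : (RSp.pull D.mu).obj mod ≅ (RSp.pull D.p₂).obj mod
  cocycle : (RSp.pull D.idMu).map iso.hom ≫ (RSp.pullSq D.idMu_p₂).hom.app mod ≫
      (RSp.pull D.q₂₃).map iso.hom ≫ (RSp.pullSq D.q₂₃_p₂).hom.app mod =
    (RSp.pullSq D.idMu_mu).hom.app mod ≫ (RSp.pull D.sig).map iso.hom

namespace EquivMod

variable {D : ActionDiagram.{u}}

/-- Morphisms of modules that are compatible with the equivariant structures. -/
@[ext]
structure Hom (M N : EquivMod D) where
  hom : M.mod ⟶ N.mod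
  comm : M.iso.hom ≫ (RSp.pull D.p₂).map hom = (RSp.pull D.mu).map hom ≫ N.iso.hom

instance : Category (EquivMod D) where
  Hom := Hom
  id M := ⟨𝟙 _, by rw [(RSp.pull _).map_id, (RSp.pull _).map_id, Category.comp_id, Category.id_comp]⟩
  comp f g := ⟨f.hom ≫ g.hom, by
    rw [Functor.map_comp, Functor.map_comp, ← Category.assoc, f.comm, Category.assoc, g.comm,
      Category.assoc]⟩
  id_comp _ := Hom.ext (Category.id_comp _)
  comp_id _ := Hom.ext (Category.comp_id _)
  assoc _ _ _ := Hom.ext (Category.assoc _ _ _)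

lemma pullSq_cocycle {Y : RSp.{u}} (p : D.X₀ ⟶ Y) (hp : D.mu ≫ p = D.p₂ ≫ p) (N : Y.Mod) :
    (RSp.pull D.idMu).map ((RSp.pullSq hp).hom.app N) ≫
      (RSp.pullSq D.idMu_p₂).hom.app ((RSp.pull p).obj N) ≫
      (RSp.pull D.q₂₃).map ((RSp.pullSq hp).hom.app N) ≫
      (RSp.pullSq D.q₂₃_p₂).hom.app ((RSp.pull p).obj N) =
    (RSp.pullSq D.idMu_mu).hom.app ((RSp.pull p).obj N) ≫
      (RSp.pull D.sig).map ((RSp.pullSq hp).hom.app N) := by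
  rw [RSp.pullSq_hom D.idMu_p₂, RSp.pullSq_hom D.q₂₃_p₂, RSp.pullSq_hom D.idMu_mu]
  exact conjugate_cocycle (RSp.adj p) (RSp.adj D.mu) (RSp.adj D.p₂) (RSp.adj D.idMu)
        (RSp.adj D.q₂₃) (RSp.adj D.sig) (RSp.push_eq hp) (RSp.push_eq D.idMu_mu)
        (RSp.push_eq D.idMu_p₂) (RSp.push_eq D.q₂₃_p₂) N ((RSp.pullSq hp).hom.app N)
        (congrArg (fun α => NatTrans.app α N) (RSp.pullSq_hom hp))

/-- The inverse image along an invariant morphism `p`, with the equivariant structure given by the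
canonical isomorphism `mu^* p^* N ≅ (p ∘ mu)^* N = (p ∘ p₂)^* N ≅ p₂^* p^* N`. -/
noncomputable def invariantPull {Y : RSp.{u}} (p : D.X₀ ⟶ Y) (hp : D.mu ≫ p = D.p₂ ≫ p) :
    Y.Mod ⥤ EquivMod D where
  obj N :=
    { mod := (RSp.pull p).obj N
      iso := (RSp.pullSq hp).app N
      cocycle := pullSq_cocycle p hp N }
  map f :=
    { hom := (RSp.pull p).map f
      comm := ((RSp.pullSq hp).hom.naturality f).symm }
  map_id _ := Hom.ext ((RSp.pull p).map_id _)
  map_comp _ _ := Hom.ext ((RSp.pull p).map_comp _ _)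

end EquivMod

/-! ### Families in `A^loc` -/

section LocFamilies

variable {E : Type} [NormedAddCommGroup E] [NormedSpace ℂ E]
  {X : Type u} [TopologicalSpace X] [ChartedSpace E X]
  {F H : Type} [NormedAddCommGroup F] [NormedSpace ℂ F] [TopologicalSpace H]
  (I : ModelWithCorners ℂ F H)
  {T : Type} [TopologicalSpace T] [ChartedSpace H T]
  (A : HbarAlgebra X)

namespace HbarAlgebra

/-- The constant family `ħ`. -/
noncomputable def hbarFam (W : Opens (T × X)) : Fam T A.sheaf W := fun _ => A.hbar _

lemma res_hbarFam {W W' : Opens (T × X)} (h : W' ≤ W) :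
    Fam.res h (A.hbarFam W) = A.hbarFam W' :=
  funext fun t => A.hbar_res (slice_mono h t)

lemma isHolFam_hbarFam (W : Opens (T × X)) : IsHolFam E I (A.hbarFam W) := by
  have := IsHolFam.const (E := E) I (A := A) (U := ⊤) (A.hbar ⊤) W (fun _ => le_top)
  exact (funext fun t => A.hbar_res _ : (fun t => A.sheaf.res _ (A.hbar ⊤)) = A.hbarFam W) ▸ this

lemma isHolFam_hbarFam_pow_mul [IsManifold I ω T] [IsManifold 𝓘(ℂ, E) ω X] {W : Opens (T × X)}
    {a : Fam T A.sheaf W} (ha : IsHolFam E I a) (N : ℕ) :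
    IsHolFam E I (A.hbarFam W ^ N * a) := by
  induction N with
  | zero => simpa using ha
  | succ N ih =>
    rw [pow_succ', mul_assoc]
    exact IsHolFam.mul I (A.isHolFam_hbarFam I W) ih

/-- The image in `A^loc` of a family of sections of `A`. -/
noncomputable def famι (W : Opens (T × X)) : Fam T A.sheaf W →+* Fam T A.loc W :=
  RingHom.pi fun t => (A.ι _).comp (Pi.evalRingHom _ t)

lemma res_famι {W W' : Opens (T × X)} (h : W' ≤ W) (a : Fam T A.sheaf W) :
    Fam.res h (A.famι W a) = A.famι W' (Fam.res h a) :=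
  funext fun t => A.ι_res (slice_mono h t) (a t)

lemma famι_hbarFam_comm (W : Opens (T × X)) (s : Fam T A.loc W) :
    Commute (A.famι W (A.hbarFam W)) s :=
  funext fun t => A.ι_hbar_comm _ (s t)

/-- A family of sections of `A^loc` over the slices of `W ⊆ T × X` is holomorphic if, locally on
`W`, it becomes a holomorphic family of sections of `A` after multiplication by a power of `ħ`. -/
def IsHolLocFam (E : Type) [NormedAddCommGroup E] [NormedSpace ℂ E]
    {X : Type u} [TopologicalSpace X] [ChartedSpace E X]
    {F H : Type} [NormedAddCommGroup F] [NormedSpace ℂ F] [TopologicalSpace H]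
    (I : ModelWithCorners ℂ F H) {T : Type} [TopologicalSpace T] [ChartedSpace H T]
    (A : HbarAlgebra X) {W : Opens (T × X)} (s : Fam T A.loc W) : Prop :=
  ∀ p ∈ W, ∃ (W' : Opens (T × X)) (h : W' ≤ W), p ∈ W' ∧ ∃ (N : ℕ) (a : Fam T A.sheaf W'),
    IsHolFam E I a ∧ A.famι W' (A.hbarFam W') ^ N * Fam.res h s = A.famι W' a

variable {A}

lemma IsHolLocFam.famι {W : Opens (T × X)} {a : Fam T A.sheaf W} (ha : IsHolFam E I a) :
    A.IsHolLocFam E I (A.famι W a) := fun p hp =>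
  ⟨W, le_rfl, hp, 0, a, ha, by
    rw [pow_zero, one_mul, A.res_famι]
    exact congrArg _ (funext fun t => A.sheaf.res_self _ _)⟩

lemma IsHolLocFam.res {W W' : Opens (T × X)} (h : W' ≤ W) {s : Fam T A.loc W}
    (hs : A.IsHolLocFam E I s) : A.IsHolLocFam E I (Fam.res h s) := by
  intro p hp
  obtain ⟨V, hV, hpV, N, a, ha, heq⟩ := hs p (h hp)
  refine ⟨V ⊓ W', inf_le_right, ⟨hpV, hp⟩, N, Fam.res inf_le_left a, ha.res I _, ?_⟩
  have := congrArg (Fam.res (inf_le_left : V ⊓ W' ≤ V)) heq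
  rw [map_mul, map_pow, A.res_famι, A.res_famι, A.res_hbarFam] at this
  rw [← this]
  congr 1
  exact funext fun t => (A.loc.res_res _ _ _).trans (A.loc.res_res _ _ _).symm

lemma IsHolLocFam.of_local {W : Opens (T × X)} (s : Fam T A.loc W)
    (h : ∀ p ∈ W, ∃ (W' : Opens (T × X)) (h : W' ≤ W), p ∈ W' ∧ A.IsHolLocFam E I (Fam.res h s)) :
    A.IsHolLocFam E I s := by
  intro p hp
  obtain ⟨W', hW', hp', hs⟩ := h p hp
  obtain ⟨V, hV, hpV, N, a, ha, heq⟩ := hs p hp'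
  refine ⟨V, hV.trans hW', hpV, N, a, ha, ?_⟩
  rw [← heq]
  congr 1
  exact funext fun t => (A.loc.res_res _ _ _).symm

lemma IsHolLocFam.neg {W : Opens (T × X)} {s : Fam T A.loc W} (hs : A.IsHolLocFam E I s) :
    A.IsHolLocFam E I (-s) := by
  intro p hp
  obtain ⟨V, hV, hpV, N, a, ha, heq⟩ := hs p hp
  refine ⟨V, hV, hpV, N, -a, ha.neg I, ?_⟩
  rw [map_neg, map_neg, mul_neg, heq]

/-- Two families can be put over a common neighbourhood and a common power of `ħ`. -/
lemma IsHolLocFam.common [IsManifold I ω T] [IsManifold 𝓘(ℂ, E) ω X] {W : Opens (T × X)}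
    {s s' : Fam T A.loc W} (hs : A.IsHolLocFam E I s) (hs' : A.IsHolLocFam E I s') (p : T × X)
    (hp : p ∈ W) : ∃ (V : Opens (T × X)) (h : V ≤ W), p ∈ V ∧ ∃ (N : ℕ) (a a' : Fam T A.sheaf V),
      IsHolFam E I a ∧ IsHolFam E I a' ∧
      A.famι V (A.hbarFam V) ^ N * Fam.res h s = A.famι V a ∧
      A.famι V (A.hbarFam V) ^ N * Fam.res h s' = A.famι V a' := by
  obtain ⟨V, hV, hpV, N, a, ha, heq⟩ := hs p hp
  obtain ⟨V', hV', hpV', N', a', ha', heq'⟩ := hs' p hp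
  refine ⟨V ⊓ V', inf_le_left.trans hV, ⟨hpV, hpV'⟩, N' + N,
    A.hbarFam _ ^ N' * Fam.res inf_le_left a, A.hbarFam _ ^ N * Fam.res inf_le_right a',
    A.isHolFam_hbarFam_pow_mul I (ha.res I _) N', A.isHolFam_hbarFam_pow_mul I (ha'.res I _) N,
    ?_, ?_⟩
  · have := congrArg (Fam.res (inf_le_left : V ⊓ V' ≤ V)) heq
    rw [map_mul, map_pow, A.res_famι, A.res_famι, A.res_hbarFam] at this
    rw [map_mul, map_pow, ← this, ← mul_assoc, ← pow_add]
    congr 1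
    exact funext fun t => (A.loc.res_res _ _ _).symm
  · have := congrArg (Fam.res (inf_le_right : V ⊓ V' ≤ V')) heq'
    rw [map_mul, map_pow, A.res_famι, A.res_famι, A.res_hbarFam] at this
    rw [map_mul, map_pow, ← this, ← mul_assoc, ← pow_add, add_comm N' N]
    congr 1
    exact funext fun t => (A.loc.res_res _ _ _).symm

lemma IsHolLocFam.add [IsManifold I ω T] [IsManifold 𝓘(ℂ, E) ω X] {W : Opens (T × X)}
    {s s' : Fam T A.loc W} (hs : A.IsHolLocFam E I s) (hs' : A.IsHolLocFam E I s') :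
    A.IsHolLocFam E I (s + s') := by
  intro p hp
  obtain ⟨V, hV, hpV, N, a, a', ha, ha', heq, heq'⟩ := hs.common I hs' p hp
  exact ⟨V, hV, hpV, N, a + a', ha.add I ha', by rw [map_add, map_add, mul_add, heq, heq']⟩

lemma IsHolLocFam.mul [IsManifold I ω T] [IsManifold 𝓘(ℂ, E) ω X] {W : Opens (T × X)}
    {s s' : Fam T A.loc W} (hs : A.IsHolLocFam E I s) (hs' : A.IsHolLocFam E I s') :
    A.IsHolLocFam E I (s * s') := by
  intro p hp
  obtain ⟨V, hV, hpV, N, a, a', ha, ha', heq, heq'⟩ := hs.common I hs' p hp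
  refine ⟨V, hV, hpV, N + N, a * a', ha.mul I ha', ?_⟩
  rw [map_mul, map_mul, ← heq, ← heq', pow_add]
  exact (((A.famι_hbarFam_comm V (Fam.res hV s)).pow_left N).symm.mul_mul_mul_comm _ _).symm

variable (E A)

/-- The class of the holomorphic families of sections of `A^loc`. -/
noncomputable def locClass [IsManifold 𝓘(ℂ, E) ω X] (T : Type) [TopologicalSpace T] [ChartedSpace H T]
    [IsManifold I ω T] : FamClass T A.loc where
  carrier W :=
    { carrier := {s | A.IsHolLocFam E I s}
      mul_mem' := IsHolLocFam.mul I
      one_mem' := by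
        have := IsHolLocFam.famι (A := A) I (IsHolFam.one (E := E) I (W := W))
        rwa [map_one] at this
      add_mem' := IsHolLocFam.add I
      zero_mem' := by
        have := IsHolLocFam.famι (A := A) I (IsHolFam.zero (E := E) I (W := W))
        rwa [map_zero] at this
      neg_mem' := IsHolLocFam.neg I }
  res_mem h _ ha := IsHolLocFam.res I h ha
  of_local _ a h := IsHolLocFam.of_local I a h

variable [IsManifold 𝓘(ℂ, E) ω X] (T : Type) [TopologicalSpace T] [ChartedSpace H T]
    [IsManifold I ω T]

/-- The sheaf of algebras `A_{T × X} = O_T[[ħ]] ⊠ A` on `T × X`. -/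
abbrev famSheaf : RingSheaf (TopCat.of (T × X)) := (holClass E I T A).sheaf

/-- The sheaf of algebras `A^loc_{T × X} = ℂ((ħ)) ⊗ A_{T × X}` on `T × X`. -/
noncomputable abbrev famLoc : RingSheaf (TopCat.of (T × X)) := (A.locClass E I T).sheaf

/-- The canonical map `A_{T × X} → A^loc_{T × X}`. -/
noncomputable def toFamLoc : A.famSheaf E I T ⟶ A.famLoc E I T :=
  ⟨{ app := fun W => RingCat.ofHom (((A.famι W.unop).comp
        ((holClass E I T A).carrier W.unop).subtype).codRestrict ((A.locClass E I T).carrier W.unop)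
          fun a => IsHolLocFam.famι I a.2)
     naturality := fun W W' i => RingCat.hom_ext (RingHom.ext fun
        (a : (holClass E I T A).carrier W.unop) => Subtype.ext
        (a1 := (⟨A.famι W'.unop (Fam.res (leOfHom i.unop) a.1), _⟩ :
          (A.locClass E I T).carrier W'.unop))
        (a2 := (⟨Fam.res (leOfHom i.unop) (A.famι W.unop a.1), _⟩ :
          (A.locClass E I T).carrier W'.unop))
        (A.res_famι (leOfHom i.unop) a.1).symm) }⟩

/-- The holomorphic family `ħ` is invertible in `A^loc_{T × X}`. -/
lemma exists_hbarFam_inv (W : Opens (T × X)) : ∃ s ∈ (A.locClass E I T).carrier W,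
    A.famι W (A.hbarFam W) * s = 1 ∧ s * A.famι W (A.hbarFam W) = 1 := by
  let s : Fam T A.loc W := fun t => ((A.isUnit_ι_hbar (slice W t)).unit⁻¹ : Units _)
  have h1 : A.famι W (A.hbarFam W) * s = 1 :=
    funext fun t => (A.isUnit_ι_hbar (slice W t)).mul_val_inv
  have h2 : s * A.famι W (A.hbarFam W) = 1 :=
    funext fun t => (A.isUnit_ι_hbar (slice W t)).val_inv_mul
  refine ⟨s, ?_, h1, h2⟩
  intro p hp
  refine ⟨W, le_rfl, hp, 1, 1, IsHolFam.one I, ?_⟩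
  have h3 : Fam.res le_rfl s = s := funext fun t => A.loc.res_self _ _
  rw [pow_one, h3, h1, map_one]

end HbarAlgebra

end LocFamilies

/-! ### F-actions -/

section FAction

variable {E : Type} [NormedAddCommGroup E] [NormedSpace ℂ E]
  {X : Type u} [TopologicalSpace X] [ChartedSpace E X]

/-- The map `g × id : T' × X → T × X`. -/
def paramMap {T T' : Type} [TopologicalSpace T] [TopologicalSpace T'] (X : Type u)
    [TopologicalSpace X] (g : T' → T) (hg : Continuous g) :
    TopCat.of (T' × X) ⟶ TopCat.of (T × X) :=
  TopCat.ofHom ⟨fun p => (g p.1, p.2), by fun_prop⟩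

/-- Reparametrisation of families: the morphism `(g × id)⁻¹ A_{T × X} → A_{T' × X}`. -/
def famPull {T T' : Type} [TopologicalSpace T] [TopologicalSpace T'] {F : RingSheaf (TopCat.of X)}
    (C : FamClass T F) (C' : FamClass T' F) (g : T' → T) (hg : Continuous g)
    (hC : ∀ (W : Opens (T × X)) (s : Fam T F W), s ∈ C.carrier W →
      (fun t => s (g t) : Fam T' F ((Opens.map (paramMap X g hg)).obj W)) ∈
        C'.carrier ((Opens.map (paramMap X g hg)).obj W)) :
    C.sheaf ⟶ RSp.pushRing (paramMap X g hg) C'.sheaf :=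
  ⟨{ app := fun W => RingCat.ofHom
        { toFun := fun s : C.carrier W.unop => (⟨fun t => s.1 (g t), hC _ s.1 s.2⟩ :
            C'.carrier ((Opens.map (paramMap X g hg)).obj W.unop))
          map_one' := rfl
          map_mul' := fun _ _ => rfl
          map_zero' := rfl
          map_add' := fun _ _ => rfl }
     naturality := fun _ _ _ => rfl }⟩

lemma famPull_locClass {F H F' H' : Type} [NormedAddCommGroup F] [NormedSpace ℂ F]
    [TopologicalSpace H] (I : ModelWithCorners ℂ F H) [NormedAddCommGroup F'] [NormedSpace ℂ F']
    [TopologicalSpace H'] (I' : ModelWithCorners ℂ F' H') [IsManifold 𝓘(ℂ, E) ω X]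
    {T T' : Type} [TopologicalSpace T] [ChartedSpace H T] [IsManifold I ω T]
    [TopologicalSpace T'] [ChartedSpace H' T'] [IsManifold I' ω T'] (A : HbarAlgebra X)
    (g : T' → T) (hg : Continuous g) (hg' : ContMDiff I' I ω g)
    (W : Opens (T × X)) (s : Fam T A.loc W) (hs : s ∈ (A.locClass E I T).carrier W) :
    (fun t => s (g t) : Fam T' A.loc ((Opens.map (paramMap X g hg)).obj W)) ∈
      (A.locClass E I' T').carrier ((Opens.map (paramMap X g hg)).obj W) := by
  rintro ⟨t, x⟩ hp
  obtain ⟨V, hV, hpV, N, a, ha, heq⟩ := hs (g t, x) hp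
  refine ⟨(Opens.map (paramMap X g hg)).obj V, fun q hq => hV hq, hpV, N, fun t => a (g t), ?_, ?_⟩
  · have := IsHolFam.reparam I I' g hg' ha ((Opens.map (paramMap X g hg)).obj V) (fun t => le_rfl)
    exact (funext fun t => A.sheaf.res_self _ _ : (fun t => A.sheaf.res _ (a (g t))) =
      (fun t => a (g t) : Fam T' A.sheaf ((Opens.map (paramMap X g hg)).obj V))) ▸ this
  · exact funext fun t => congrFun heq (g t)

variable [MulAction ℂˣ X] [ContinuousSMul ℂˣ X]

/-- The action `μ : ℂˣ × X → X`, `(t, x) ↦ t x`. -/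
noncomputable def actMap (X : Type u) [TopologicalSpace X] [MulAction ℂˣ X] [ContinuousSMul ℂˣ X] :
    TopCat.of (ℂˣ × X) ⟶ TopCat.of X :=
  TopCat.ofHom ⟨fun p => p.1 • p.2, by fun_prop⟩

/-- The map `μ̃ : ℂˣ × X → ℂˣ × X`, `(t, x) ↦ (t, t x)`. -/
noncomputable def actTilde (X : Type u) [TopologicalSpace X] [MulAction ℂˣ X] [ContinuousSMul ℂˣ X] :
    TopCat.of (ℂˣ × X) ⟶ TopCat.of (ℂˣ × X) :=
  TopCat.ofHom ⟨fun p => (p.1, p.1 • p.2), by fun_prop⟩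

/-- The projection `T × X → X`. -/
def projMap (T : Type) [TopologicalSpace T] (X : Type u) [TopologicalSpace X] :
    TopCat.of (T × X) ⟶ TopCat.of X :=
  TopCat.ofHom ⟨fun p => p.2, by fun_prop⟩

/-- The open set `t⁻¹ U = {x | t x ∈ U}`. -/
noncomputable abbrev actInv (t : ℂˣ) (U : Opens X) : Opens X := slice ((Opens.map (actMap X)).obj U) t

variable [IsManifold 𝓘(ℂ, E) ω X]

/-- The canonical map `p₂⁻¹ A → A_{ℂˣ × X}`, given by the constant families. -/
noncomputable def constFam (A : HbarAlgebra X) :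
    A.sheaf ⟶ RSp.pushRing (projMap ℂˣ X) (A.famSheaf E 𝓘(ℂ, ℂ) ℂˣ) :=
  ⟨{ app := fun U => RingCat.ofHom
        { toFun := fun a => (⟨fun t => A.sheaf.res (le_refl U.unop) a,
            IsHolFam.const _ a ((Opens.map (projMap ℂˣ X)).obj U.unop) (fun t => le_rfl)⟩ :
            (holClass E 𝓘(ℂ, ℂ) ℂˣ A).carrier ((Opens.map (projMap ℂˣ X)).obj U.unop))
          map_one' := Subtype.ext (funext fun t => map_one _)
          map_mul' := fun a b => Subtype.ext (funext fun t => map_mul _ a b)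
          map_zero' := Subtype.ext (funext fun t => map_zero _)
          map_add' := fun a b => Subtype.ext (funext fun t => map_add _ a b) }
     naturality := fun U V i => RingCat.hom_ext (RingHom.ext fun a => by
       refine Subtype.ext (funext fun t => ?_)
       change A.sheaf.res _ (A.sheaf.res (leOfHom i.unop) a) = A.sheaf.res _ (A.sheaf.res _ a)
       exact (A.sheaf.res_res _ _ _).trans (A.sheaf.res_res _ _ _).symm) }⟩

/-- The product of a holomorphic family by a holomorphic function of the parameter. -/
noncomputable def smulFam {A : HbarAlgebra X} {W : Opens (ℂˣ × X)} (f : ℂˣ → ℂ)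
    (hf : ContMDiffOn 𝓘(ℂ, ℂ) 𝓘(ℂ, ℂ) ω f (Prod.fst '' (W : Set (ℂˣ × X))))
    (a : (holClass E 𝓘(ℂ, ℂ) ℂˣ A).carrier W) : (holClass E 𝓘(ℂ, ℂ) ℂˣ A).carrier W :=
  ⟨fun t => A.scal _ (PowerSeries.C (f t)) * a.1 t,
    IsHolFam.smul _ a.2 f hf (fun p hp => ⟨p, hp, rfl⟩)⟩

/-- The Fréchet topology on the sections of `A_{ℂˣ × X}`: uniform convergence, on the compact
subsets of the domain of each local trivialisation, of each coefficient. -/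
noncomputable abbrev famTopology (E : Type) [NormedAddCommGroup E] [NormedSpace ℂ E] {X : Type u}
    [TopologicalSpace X] [ChartedSpace E X] [IsManifold 𝓘(ℂ, E) ω X] (A : HbarAlgebra X)
    (W : Opens (ℂˣ × X)) : TopologicalSpace ((holClass E 𝓘(ℂ, ℂ) ℂˣ A).carrier W) :=
  ⨅ (τ : StarTriv E A) (n : ℕ), TopologicalSpace.induced
    (fun a => UniformOnFun.ofFun {K : Set (ℂˣ × X) | IsCompact K ∧ K ⊆ τ.dom W}
      (τ.famCoeff a.1 n)) inferInstance

/-- The map `θ : μ⁻¹ A → A_{ℂˣ × X}` induced by `ψ̃ : A_{ℂˣ × X} → μ̃_* A_{ℂˣ × X}`, that is, the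
restriction of `ψ̃` to the constant families. -/
noncomputable def thetaMap (A : HbarAlgebra X) (psi : A.famSheaf E 𝓘(ℂ, ℂ) ℂˣ ⟶
    RSp.pushRing (actTilde X) (A.famSheaf E 𝓘(ℂ, ℂ) ℂˣ)) :
    A.sheaf ⟶ RSp.pushRing (actMap X) (A.famSheaf E 𝓘(ℂ, ℂ) ℂˣ) :=
  constFam A ≫ RSp.pushRingMap (projMap ℂˣ X) psi

/-- The value `θ_t : A(U) → A(t⁻¹ U)` at `t` of the map `θ`. -/
noncomputable def thetaAt (A : HbarAlgebra X) (psi : A.famSheaf E 𝓘(ℂ, ℂ) ℂˣ ⟶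
    RSp.pushRing (actTilde X) (A.famSheaf E 𝓘(ℂ, ℂ) ℂˣ)) (t : ℂˣ) (U : Opens X) :
    A.sheaf.obj.obj (op U) →+* A.sheaf.obj.obj (op (actInv t U)) :=
  ((Pi.evalRingHom _ t).comp
    ((holClass E 𝓘(ℂ, ℂ) ℂˣ A).carrier ((Opens.map (actMap X)).obj U)).subtype).comp
    ((thetaMap A psi).hom.app (op U)).hom

lemma actInv_mono (t : ℂˣ) {U V : Opens X} (h : V ≤ U) : actInv t V ≤ actInv t U :=
  fun _ hx => h hx

lemma actInv_one (U : Opens X) : actInv 1 U ≤ U := fun x (hx : (1 : ℂˣ) • x ∈ U) => by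
  rwa [one_smul] at hx

lemma actInv_mul (t₁ t₂ : ℂˣ) (U : Opens X) :
    actInv t₂ (actInv t₁ U) ≤ actInv (t₁ * t₂) U := fun x (hx : t₁ • t₂ • x ∈ U) => by
  change (t₁ * t₂) • x ∈ U
  rwa [mul_smul]

/-- An F-action with exponent `m` on the DQ-algebra `A`: an isomorphism
`θ̃ : μ̃⁻¹ A_{ℂˣ × X} → A_{ℂˣ × X}` of algebras over the holomorphic functions on `ℂˣ`, given here
by its adjoint `ψ̃ : A_{ℂˣ × X} → μ̃_* A_{ℂˣ × X}` (note that `μ̃` is a homeomorphism), which has to be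
continuous for the Fréchet topologies, with `θ_1 = id`, `θ_t(ħ^n) = t^{mn} ħ^n` and
`θ_{t₂} ∘ θ_{t₁} = θ_{t₁ t₂}`. -/
structure FAction (A : DQAlgebra E X) (m : ℤ) where
  psi : A.famSheaf E 𝓘(ℂ, ℂ) ℂˣ ⟶ RSp.pushRing (actTilde X) (A.famSheaf E 𝓘(ℂ, ℂ) ℂˣ)
  isIso : IsIso psi
  linear : ∀ (W : Opens (ℂˣ × X)) (f : ℂˣ → ℂ)
    (hf : ContMDiffOn 𝓘(ℂ, ℂ) 𝓘(ℂ, ℂ) ω f (Prod.fst '' (W : Set (ℂˣ × X))))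
    (a : (holClass E 𝓘(ℂ, ℂ) ℂˣ A.toHbarAlgebra).carrier W) (t : ℂˣ),
    (psi.hom.app (op W) (smulFam f hf a) : (holClass E 𝓘(ℂ, ℂ) ℂˣ A.toHbarAlgebra).carrier
        ((Opens.map (actTilde X)).obj W)).1 t =
      A.scal _ (PowerSeries.C (f t)) * (psi.hom.app (op W) a :
        (holClass E 𝓘(ℂ, ℂ) ℂˣ A.toHbarAlgebra).carrier ((Opens.map (actTilde X)).obj W)).1 t
  continuous : ∀ W : Opens (ℂˣ × X),
    @Continuous _ _ (famTopology E A.toHbarAlgebra W)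
      (famTopology E A.toHbarAlgebra ((Opens.map (actTilde X)).obj W))
      (fun a : (holClass E 𝓘(ℂ, ℂ) ℂˣ A.toHbarAlgebra).carrier W =>
        (psi.hom.app (op W) a : (holClass E 𝓘(ℂ, ℂ) ℂˣ A.toHbarAlgebra).carrier
          ((Opens.map (actTilde X)).obj W)))
  one : ∀ (U : Opens X) (a : A.sheaf.obj.obj (op U)),
    thetaAt A.toHbarAlgebra psi 1 U a = A.sheaf.res (actInv_one U) a
  hbar : ∀ (t : ℂˣ) (n : ℕ) (U : Opens X), thetaAt A.toHbarAlgebra psi t U (A.hbar U ^ n) =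
    A.scal _ (PowerSeries.C ((t ^ (m * n) : ℂˣ) : ℂ)) * A.hbar (actInv t U) ^ n
  assoc : ∀ (t₁ t₂ : ℂˣ) (U : Opens X) (a : A.sheaf.obj.obj (op U)),
    thetaAt A.toHbarAlgebra psi t₂ (actInv t₁ U) (thetaAt A.toHbarAlgebra psi t₁ U a) =
      A.sheaf.res (actInv_mul t₁ t₂ U) (thetaAt A.toHbarAlgebra psi (t₁ * t₂) U a)

namespace FAction

variable {A : DQAlgebra E X} {m : ℤ} (θ : FAction A m)

/-- The map `θ_t : A(U) → A(t⁻¹ U)`. -/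
noncomputable abbrev at_ (t : ℂˣ) (U : Opens X) :
    A.sheaf.obj.obj (op U) →+* A.sheaf.obj.obj (op (actInv t U)) :=
  thetaAt A.toHbarAlgebra θ.psi t U

lemma at_res (t : ℂˣ) {U V : Opens X} (h : V ≤ U) (a : A.sheaf.obj.obj (op U)) :
    θ.at_ t V (A.sheaf.res h a) =
      A.sheaf.res (actInv_mono t h) (θ.at_ t U a) := by
  have := RingSheaf.app_res A.sheaf (thetaMap A.toHbarAlgebra θ.psi) h a
  exact congrFun (congrArg Subtype.val this) t

lemma isHolFam_at (U : Opens X) (a : A.sheaf.obj.obj (op U)) :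
    IsHolFam E 𝓘(ℂ, ℂ) (fun t => θ.at_ t U a :
      Fam ℂˣ A.sheaf ((Opens.map (actMap X)).obj U)) :=
  ((thetaMap A.toHbarAlgebra θ.psi).hom.app (op U) a :
    (holClass E 𝓘(ℂ, ℂ) ℂˣ A.toHbarAlgebra).carrier ((Opens.map (actMap X)).obj U)).2

end FAction

end FAction

/-! ### The extension of an F-action to `A^loc` -/

section LocAction

/-- Morphisms into `(X, A^loc)` are determined by their effect on points and on sections of `A`. -/
lemma HbarAlgebra.rsp_hom_ext {X : Type u} [TopologicalSpace X] {A : HbarAlgebra X} {Z : RSp.{u}}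
    {f g : Z ⟶ (⟨TopCat.of X, A.loc⟩ : RSp.{u})} (h : f.base = g.base)
    (h' : ∀ (U : Opens X) (a : A.sheaf.obj.obj (op U)), f.app U (A.ι U a) =
      Z.ring.res (le_of_eq (by rw [h])) (g.app U (A.ι U a))) : f = g := by
  obtain ⟨f, f'⟩ := f
  obtain ⟨g, g'⟩ := g
  dsimp only at h
  subst h
  congr 1
  refine A.loc_hom_ext fun U a => ?_
  exact (h' U a).trans (RingSheaf.res_self _ _ _)

variable {E : Type} [NormedAddCommGroup E] [NormedSpace ℂ E]
  {X : Type u} [TopologicalSpace X] [ChartedSpace E X] [IsManifold 𝓘(ℂ, E) ω X]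
  [MulAction ℂˣ X] [ContinuousSMul ℂˣ X]

/-- The map `id × μ : ℂˣ × ℂˣ × X → ℂˣ × X`. -/
noncomputable def idActMap (X : Type u) [TopologicalSpace X] [MulAction ℂˣ X]
    [ContinuousSMul ℂˣ X] : TopCat.of ((ℂˣ × ℂˣ) × X) ⟶ TopCat.of (ℂˣ × X) :=
  TopCat.ofHom ⟨fun p => (p.1.1, p.1.2 • p.2), by fun_prop⟩

namespace FAction

variable {A : DQAlgebra E X} {m : ℤ} (θ : FAction A m)

/-- The morphism `λ : (id × μ)⁻¹ A_{ℂˣ × X} → A_{ℂˣ × ℂˣ × X}` exists, which extends `θ` to families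
with a parameter: for each holomorphic family `(a_t)` of sections of `A`, the family
`(t₁, t₂) ↦ θ_{t₂}(a_{t₁})` is holomorphic. -/
def LambdaExists : Prop :=
  ∀ (W : Opens (ℂˣ × X)) (a : Fam ℂˣ A.sheaf W), IsHolFam E 𝓘(ℂ, ℂ) a →
    IsHolFam E (𝓘(ℂ, ℂ).prod 𝓘(ℂ, ℂ)) (A := A.toHbarAlgebra) (T := ℂˣ × ℂˣ)
      (W := (Opens.map (idActMap X)).obj W) (fun t => θ.at_ t.2 (slice W t.1) (a t.1))

lemma at_hbar (t : ℂˣ) (U : Opens X) : θ.at_ t U (A.hbar U) =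
    A.scal _ (PowerSeries.C ((t ^ m : ℂˣ) : ℂ)) * A.hbar (actInv t U) := by
  have := θ.hbar t 1 U
  rwa [pow_one, pow_one, Nat.cast_one, mul_one] at this

lemma contMDiff_zpow (k : ℤ) : ContMDiff 𝓘(ℂ, ℂ) 𝓘(ℂ, ℂ) ω (fun t : ℂˣ => ((t ^ k : ℂˣ) : ℂ)) := by
  have h : ContMDiff 𝓘(ℂ, ℂ) 𝓘(ℂ, ℂ) ω (fun t : ℂˣ => t ^ k) := by
    cases k with
    | ofNat n => simpa using contMDiff_pow n
    | negSucc n =>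
      simp only [zpow_negSucc]
      exact (contMDiff_pow (n + 1)).inv
  exact Units.contMDiff_val.comp h

/-- The section `t^k` of `A_{ℂˣ × X}`. -/
noncomputable def powFam (A : HbarAlgebra X) (k : ℤ) (W : Opens (ℂˣ × X)) :
    (holClass E 𝓘(ℂ, ℂ) ℂˣ A).carrier W :=
  smulFam (fun t : ℂˣ => ((t ^ k : ℂˣ) : ℂ)) (contMDiff_zpow k).contMDiffOn 1

/-- The map `μ⁻¹ A → A^loc_{ℂˣ × X}` induced by `θ`. -/
noncomputable def thetaToLoc :
    A.sheaf ⟶ RSp.pushRing (actMap X) (A.famLoc E 𝓘(ℂ, ℂ) ℂˣ) :=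
  thetaMap A.toHbarAlgebra θ.psi ≫ RSp.pushRingMap (actMap X) (A.toFamLoc E 𝓘(ℂ, ℂ) ℂˣ)

lemma thetaToLoc_apply (U : Opens X) (a : A.sheaf.obj.obj (op U)) (t : ℂˣ) :
    (θ.thetaToLoc.hom.app (op U) a : (A.locClass E 𝓘(ℂ, ℂ) ℂˣ).carrier
      ((Opens.map (actMap X)).obj U)).1 t = A.ι _ (θ.at_ t U a) := rfl

lemma isUnit_thetaToLoc_hbar (U : Opens X) :
    IsUnit (θ.thetaToLoc.hom.app (op U) (A.hbar U)) := by
  let W : Opens (ℂˣ × X) := (Opens.map (actMap X)).obj U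
  obtain ⟨s, hs, h1, h2⟩ := A.exists_hbarFam_inv E 𝓘(ℂ, ℂ) ℂˣ W
  let x : (A.locClass E 𝓘(ℂ, ℂ) ℂˣ).carrier W := θ.thetaToLoc.hom.app (op U) (A.hbar U)
  let y : (A.locClass E 𝓘(ℂ, ℂ) ℂˣ).carrier W := ⟨s, hs⟩ *
    ⟨A.famι W (powFam (E := E) A.toHbarAlgebra (-m) W).1,
      HbarAlgebra.IsHolLocFam.famι _ (powFam (E := E) A.toHbarAlgebra (-m) W).2⟩
  have hc : ∀ t : ℂˣ, (PowerSeries.C ((t ^ m : ℂˣ) : ℂ)) * PowerSeries.C ((t ^ (-m) : ℂˣ) : ℂ) = 1 := by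
    intro t
    rw [← map_mul, ← Units.val_mul, ← zpow_add, add_neg_cancel, zpow_zero, Units.val_one, map_one]
  have hx : ∀ t, x.1 t = A.ι _ (A.scal _ (PowerSeries.C ((t ^ m : ℂˣ) : ℂ))) *
      A.famι W (A.hbarFam W) t := fun t => by
    change A.ι _ (θ.at_ t U (A.hbar U)) = _
    rw [at_hbar, map_mul]
    rfl
  have hy : ∀ t, y.1 t = s t * A.ι _ (A.scal _ (PowerSeries.C ((t ^ (-m) : ℂˣ) : ℂ))) := fun t => by
    change s t * A.ι _ (A.scal _ _ * 1) = _
    rw [mul_one]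
  have hcc : ∀ (t : ℂˣ), A.ι (slice W t) (A.scal _ (PowerSeries.C ((t ^ m : ℂˣ) : ℂ))) *
      A.ι (slice W t) (A.scal _ (PowerSeries.C ((t ^ (-m) : ℂˣ) : ℂ))) = 1 := fun t => by
    rw [← map_mul, ← map_mul, hc, map_one, map_one]
  have hcc' : ∀ (t : ℂˣ), A.ι (slice W t) (A.scal _ (PowerSeries.C ((t ^ (-m) : ℂˣ) : ℂ))) *
      A.ι (slice W t) (A.scal _ (PowerSeries.C ((t ^ m : ℂˣ) : ℂ))) = 1 := fun t => by
    rw [← map_mul, ← map_mul, mul_comm, hc, map_one, map_one]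
  refine isUnit_iff_exists.2 ⟨y, ?_, ?_⟩
  · refine Subtype.ext (a1 := x * y) (funext fun t => ?_)
    change x.1 t * y.1 t = 1
    rw [hx, hy, mul_assoc, ← mul_assoc (A.famι W (A.hbarFam W) t)]
    have := congrFun h1 t
    rw [Pi.mul_apply] at this
    rw [this, Pi.one_apply, one_mul, hcc]
  · refine Subtype.ext (a1 := y * x) (funext fun t => ?_)
    change y.1 t * x.1 t = 1
    rw [hx, hy, mul_assoc, ← mul_assoc (A.ι _ _), hcc', one_mul]
    exact congrFun h2 t

/-- The extension of `θ` to `A^loc`, as a map `μ⁻¹ A^loc → A^loc_{ℂˣ × X}`. -/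
noncomputable def locMap : A.loc ⟶ RSp.pushRing (actMap X) (A.famLoc E 𝓘(ℂ, ℂ) ℂˣ) :=
  A.locLift θ.thetaToLoc θ.isUnit_thetaToLoc_hbar

/-- The map `θ_t : A^loc(U) → A^loc(t⁻¹ U)`. -/
noncomputable def locAt (t : ℂˣ) (U : Opens X) :
    A.loc.obj.obj (op U) →+* A.loc.obj.obj (op (actInv t U)) :=
  ((Pi.evalRingHom _ t).comp
    ((A.locClass E 𝓘(ℂ, ℂ) ℂˣ).carrier ((Opens.map (actMap X)).obj U)).subtype).comp
    (θ.locMap.hom.app (op U)).hom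

lemma locAt_ι (t : ℂˣ) (U : Opens X) (a : A.sheaf.obj.obj (op U)) :
    θ.locAt t U (A.ι U a) = A.ι _ (θ.at_ t U a) := by
  have := A.locLift_ι θ.thetaToLoc θ.isUnit_thetaToLoc_hbar U a
  exact congrFun (congrArg Subtype.val this) t

lemma locAt_res (t : ℂˣ) {U V : Opens X} (h : V ≤ U) (a : A.loc.obj.obj (op U)) :
    θ.locAt t V (A.loc.res h a) =
      A.loc.res (actInv_mono t h) (θ.locAt t U a) := by
  have := RingSheaf.app_res A.loc θ.locMap h a
  exact congrFun (congrArg Subtype.val this) t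

end FAction

end LocAction

/-! ### The ringed spaces and morphisms given by an F-action -/

section Diagram

variable {E : Type} [NormedAddCommGroup E] [NormedSpace ℂ E]
  {X : Type u} [TopologicalSpace X] [ChartedSpace E X] [IsManifold 𝓘(ℂ, E) ω X]

namespace HbarAlgebra

variable (A : HbarAlgebra X)

/-- The map `p₂⁻¹ A → A^loc_{ℂˣ × X}`. -/
noncomputable def constToLoc (E : Type) [NormedAddCommGroup E] [NormedSpace ℂ E]
    {X : Type u} [TopologicalSpace X] [ChartedSpace E X] [IsManifold 𝓘(ℂ, E) ω X]
    (A : HbarAlgebra X) : A.sheaf ⟶ RSp.pushRing (projMap ℂˣ X) (A.famLoc E 𝓘(ℂ, ℂ) ℂˣ) :=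
  constFam A ≫ RSp.pushRingMap (projMap ℂˣ X) (A.toFamLoc E 𝓘(ℂ, ℂ) ℂˣ)

lemma isUnit_constToLoc_hbar (U : Opens X) :
    IsUnit ((A.constToLoc E).hom.app (op U) (A.hbar U)) := by
  let W : Opens (ℂˣ × X) := (Opens.map (projMap ℂˣ X)).obj U
  obtain ⟨s, hs, h1, h2⟩ := A.exists_hbarFam_inv E 𝓘(ℂ, ℂ) ℂˣ W
  let x : (A.locClass E 𝓘(ℂ, ℂ) ℂˣ).carrier W := (A.constToLoc E).hom.app (op U) (A.hbar U)
  have hx : x.1 = A.famι W (A.hbarFam W) := funext fun t => by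
    exact congrArg (A.ι U) (A.hbar_res (le_refl U))
  refine isUnit_iff_exists.2 ⟨(⟨s, hs⟩ : (A.locClass E 𝓘(ℂ, ℂ) ℂˣ).carrier W), ?_, ?_⟩
  · refine Subtype.ext (a1 := x * ⟨s, hs⟩) ?_
    change x.1 * s = 1
    rw [hx, h1]
  · refine Subtype.ext (a1 := ⟨s, hs⟩ * x) ?_
    change s * x.1 = 1
    rw [hx, h2]

/-- The canonical map `p₂⁻¹ A^loc → A^loc_{ℂˣ × X}`. -/
noncomputable def constLoc (E : Type) [NormedAddCommGroup E] [NormedSpace ℂ E]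
    {X : Type u} [TopologicalSpace X] [ChartedSpace E X] [IsManifold 𝓘(ℂ, E) ω X]
    (A : HbarAlgebra X) : A.loc ⟶ RSp.pushRing (projMap ℂˣ X) (A.famLoc E 𝓘(ℂ, ℂ) ℂˣ) :=
  A.locLift (A.constToLoc E) A.isUnit_constToLoc_hbar

lemma constLoc_ι (U : Opens X) (a : A.sheaf.obj.obj (op U)) (t : ℂˣ) :
    ((A.constLoc E).hom.app (op U) (A.ι U a) : (A.locClass E 𝓘(ℂ, ℂ) ℂˣ).carrier
      ((Opens.map (projMap ℂˣ X)).obj U)).1 t = A.ι _ (A.sheaf.res (le_refl U) a) := by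
  have := A.locLift_ι (A.constToLoc E) A.isUnit_constToLoc_hbar U a
  exact congrFun (congrArg Subtype.val this) t

/-- The map `p₂⁻¹ A^loc → A^loc_{ℂˣ × X}` is given by the constant families. -/
lemma constLoc_apply (U : Opens X) (s : A.loc.obj.obj (op U)) (t : ℂˣ) :
    ((A.constLoc E).hom.app (op U) s : (A.locClass E 𝓘(ℂ, ℂ) ℂˣ).carrier
      ((Opens.map (projMap ℂˣ X)).obj U)).1 t = s := by
  let ev : A.loc ⟶ A.loc :=
    ⟨{ app := fun U => RingCat.ofHom (((Pi.evalRingHom _ t).comp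
          ((A.locClass E 𝓘(ℂ, ℂ) ℂˣ).carrier ((Opens.map (projMap ℂˣ X)).obj U.unop)).subtype).comp
          ((A.constLoc E).hom.app U).hom :
            A.loc.obj.obj U →+* A.loc.obj.obj (op (slice ((Opens.map (projMap ℂˣ X)).obj U.unop) t)))
       naturality := fun U V i => RingCat.hom_ext (RingHom.ext fun a => by
          have := RingSheaf.app_res A.loc (A.constLoc E) (leOfHom i.unop) a
          exact congrFun (congrArg Subtype.val this) t) }⟩
  have hev : ev = 𝟙 A.loc := A.loc_hom_ext fun U a => by
    refine (A.constLoc_ι U a t).trans ?_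
    rw [A.sheaf.res_self]
    rfl
  have h2 : ev.hom.app (op U) s = s := by rw [hev]; rfl
  exact h2

/-- The ringed space `(X, A^loc)`. -/
noncomputable def sp₀ : RSp.{u} := ⟨TopCat.of X, A.loc⟩

/-- The ringed space `(ℂˣ × X, A^loc_{ℂˣ × X})`. -/
noncomputable def sp₁ (E : Type) [NormedAddCommGroup E] [NormedSpace ℂ E]
    {X : Type u} [TopologicalSpace X] [ChartedSpace E X] [IsManifold 𝓘(ℂ, E) ω X]
    (A : HbarAlgebra X) : RSp.{u} := ⟨TopCat.of (ℂˣ × X), A.famLoc E 𝓘(ℂ, ℂ) ℂˣ⟩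

/-- The ringed space `(ℂˣ × ℂˣ × X, A^loc_{ℂˣ × ℂˣ × X})`. -/
noncomputable def sp₂ (E : Type) [NormedAddCommGroup E] [NormedSpace ℂ E]
    {X : Type u} [TopologicalSpace X] [ChartedSpace E X] [IsManifold 𝓘(ℂ, E) ω X]
    (A : HbarAlgebra X) : RSp.{u} :=
  ⟨TopCat.of ((ℂˣ × ℂˣ) × X), A.famLoc E (𝓘(ℂ, ℂ).prod 𝓘(ℂ, ℂ)) (ℂˣ × ℂˣ)⟩

/-- The projection `(ℂˣ × X, A^loc_{ℂˣ × X}) → (X, A^loc)`. -/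
noncomputable def projHom : A.sp₁ E ⟶ A.sp₀ where
  base := projMap ℂˣ X
  comap := A.constLoc E

/-- The morphism `(σ × id, α)`, where `σ` is the multiplication of `ℂˣ`. -/
noncomputable def sigHom : A.sp₂ E ⟶ A.sp₁ E where
  base := paramMap X (fun t : ℂˣ × ℂˣ => t.1 * t.2) (by fun_prop)
  comap := famPull (A.locClass E 𝓘(ℂ, ℂ) ℂˣ) (A.locClass E (𝓘(ℂ, ℂ).prod 𝓘(ℂ, ℂ)) (ℂˣ × ℂˣ)) _ _
    (famPull_locClass _ _ A _ _ (contMDiff_fst.mul contMDiff_snd))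

/-- The projection `q₂₃ : (t₁, t₂, x) ↦ (t₂, x)`. -/
noncomputable def q₂₃Hom : A.sp₂ E ⟶ A.sp₁ E where
  base := paramMap X (fun t : ℂˣ × ℂˣ => t.2) (by fun_prop)
  comap := famPull (A.locClass E 𝓘(ℂ, ℂ) ℂˣ) (A.locClass E (𝓘(ℂ, ℂ).prod 𝓘(ℂ, ℂ)) (ℂˣ × ℂˣ)) _ _
    (famPull_locClass _ _ A _ _ contMDiff_snd)

end HbarAlgebra

variable [MulAction ℂˣ X] [ContinuousSMul ℂˣ X]

namespace FAction

variable {A : DQAlgebra E X} {m : ℤ} (θ : FAction A m)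

/-- The morphism `(μ, θ)`. -/
noncomputable def muHom : A.sp₁ E ⟶ A.sp₀ where
  base := actMap X
  comap := θ.locMap

variable {θ} in
/-- The map `λ` on `A^loc`: it preserves holomorphic families. -/
lemma LambdaExists.loc (hθ : θ.LambdaExists) (W : Opens (ℂˣ × X)) (s : Fam ℂˣ A.loc W)
    (hs : A.IsHolLocFam E 𝓘(ℂ, ℂ) s) :
    HbarAlgebra.IsHolLocFam E (𝓘(ℂ, ℂ).prod 𝓘(ℂ, ℂ)) A.toHbarAlgebra (T := ℂˣ × ℂˣ)
      (W := (Opens.map (idActMap X)).obj W) (fun t => θ.locAt t.2 (slice W t.1) (s t.1)) := by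
  rintro ⟨⟨t₁, t₂⟩, x⟩ hp
  obtain ⟨V, hV, hpV, N, a, ha, heq⟩ := hs (t₁, t₂ • x) hp
  have hl := hθ V a ha
  have hsm := IsHolFam.smul (𝓘(ℂ, ℂ).prod 𝓘(ℂ, ℂ)) hl
    (fun t : ℂˣ × ℂˣ => ((t.2 ^ (-(m * N)) : ℂˣ) : ℂ)) (S := Set.univ)
    ((contMDiff_zpow (-(m * N))).comp contMDiff_snd).contMDiffOn (fun _ _ => trivial)
  refine ⟨(Opens.map (idActMap X)).obj V, fun q hq => hV hq, hpV, N, _, hsm, ?_⟩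
  funext t
  have h1 := congrArg (θ.locAt t.2 (slice V t.1)) (congrFun heq t.1)
  change θ.locAt t.2 (slice V t.1) (A.ι _ (A.hbar _) ^ N * A.loc.res _ (s t.1)) =
    θ.locAt t.2 (slice V t.1) (A.ι _ (a t.1)) at h1
  rw [map_mul, ← map_pow, locAt_ι, locAt_ι, locAt_res, hbar] at h1
  change A.ι _ (A.hbar _) ^ N * A.loc.res _ (θ.locAt t.2 (slice W t.1) (s t.1)) =
    A.ι _ (A.scal _ (PowerSeries.C ((t.2 ^ (-(m * N)) : ℂˣ) : ℂ)) *
      θ.at_ t.2 (slice V t.1) (a t.1))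
  rw [map_mul, ← h1, map_mul, ← mul_assoc, ← mul_assoc, ← map_mul, ← map_mul, ← map_mul,
    ← map_mul, ← Units.val_mul, ← zpow_add, neg_add_cancel, zpow_zero, Units.val_one, map_one, map_one,
    one_mul, map_pow]

/-- The morphism `(id × μ, λ)`. -/
noncomputable def idMuHom (hθ : θ.LambdaExists) : A.sp₂ E ⟶ A.sp₁ E where
  base := idActMap X
  comap := ⟨{
    app := fun W => RingCat.ofHom
      { toFun := fun s : (A.locClass E 𝓘(ℂ, ℂ) ℂˣ).carrier W.unop =>
          (⟨fun t => θ.locAt t.2 (slice W.unop t.1) (s.1 t.1), hθ.loc W.unop s.1 s.2⟩ :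
          (A.locClass E (𝓘(ℂ, ℂ).prod 𝓘(ℂ, ℂ)) (ℂˣ × ℂˣ)).carrier
            ((Opens.map (idActMap X)).obj W.unop))
        map_one' := Subtype.ext (funext fun t => map_one (θ.locAt t.2 (slice W.unop t.1)))
        map_mul' := fun _ _ => Subtype.ext (funext fun t => map_mul (θ.locAt t.2 _) _ _)
        map_zero' := Subtype.ext (funext fun t => map_zero (θ.locAt t.2 (slice W.unop t.1)))
        map_add' := fun _ _ => Subtype.ext (funext fun t => map_add (θ.locAt t.2 _) _ _) }
    naturality := fun W _ i => RingCat.hom_ext (RingHom.ext fun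
        (s : (A.locClass E 𝓘(ℂ, ℂ) ℂˣ).carrier W.unop) =>
      Subtype.ext (funext fun t => θ.locAt_res t.2 (slice_mono (leOfHom i.unop) t.1) (s.1 t.1))) }⟩

/-- The diagram of ringed spaces given by an F-action. -/
noncomputable def diagram (hθ : θ.LambdaExists) : ActionDiagram.{u} where
  X₂ := A.sp₂ E
  X₁ := A.sp₁ E
  X₀ := A.sp₀
  mu := θ.muHom
  p₂ := A.projHom
  idMu := θ.idMuHom hθ
  sig := A.sigHom
  q₂₃ := A.q₂₃Hom
  idMu_mu := by
    refine HbarAlgebra.rsp_hom_ext (A := A.toHbarAlgebra) ?_ ?_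
    · refine TopCat.hom_ext (ContinuousMap.ext fun p => ?_)
      exact smul_smul p.1.1 p.1.2 p.2
    · intro U a
      refine Subtype.ext (funext fun t => ?_)
      change θ.locAt t.2 (actInv t.1 U) (θ.locAt t.1 U (A.ι U a)) =
        A.loc.res (actInv_mul t.1 t.2 U) (θ.locAt (t.1 * t.2) U (A.ι U a))
      rw [locAt_ι, locAt_ι, locAt_ι, θ.assoc, A.ι_res]
  idMu_p₂ := by
    refine HbarAlgebra.rsp_hom_ext (A := A.toHbarAlgebra) rfl ?_
    intro U a
    refine Subtype.ext (funext fun t => ?_)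
    have h1 := A.constLoc_ι (E := E) U a t.1
    rw [A.sheaf.res_self] at h1
    refine (congrArg (θ.locAt t.2 U) h1).trans ?_
    exact (A.loc.res_self _ _).symm
  q₂₃_p₂ := by
    refine HbarAlgebra.rsp_hom_ext (A := A.toHbarAlgebra) rfl ?_
    intro U a
    refine Subtype.ext (funext fun t => ?_)
    have h1 := A.constLoc_ι (E := E) U a t.2
    have h2 := A.constLoc_ι (E := E) U a (t.1 * t.2)
    exact h1.trans (h2.symm.trans (A.loc.res_self _ _).symm)

end FAction

end Diagram

/-! ### Sections of modules -/

namespace RSp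

section Sections

variable {X Y : RSp.{u}}

/-- The sections of the module `M` over `U`. -/
abbrev Sec (M : X.Mod) (U : Opens X.top) : Type u := M.val.obj (op U)

/-- Restriction of sections. -/
noncomputable def secRes (M : X.Mod) {U V : Opens X.top} (h : V ≤ U) : Sec M U →+ Sec M V :=
  AddMonoidHom.mk' (M.val.map (homOfLE h).op) (map_add (M.val.map (homOfLE h).op).hom)

lemma secRes_smul (M : X.Mod) {U V : Opens X.top} (h : V ≤ U) (r : X.ring.obj.obj (op U))
    (s : Sec M U) : secRes M h (r • s) = X.ring.res h r • secRes M h s :=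
  M.val.map_smul (homOfLE h).op r s

lemma secRes_secRes (M : X.Mod) {U V W : Opens X.top} (h : V ≤ U) (h' : W ≤ V) (s : Sec M U) :
    secRes M h' (secRes M h s) = secRes M (h'.trans h) s :=
  (M.val.map_comp_apply (homOfLE h).op (homOfLE h').op s).symm

/-- The effect of a morphism of modules on sections. -/
noncomputable def homSec {M N : X.Mod} (φ : M ⟶ N) (U : Opens X.top) :
    Sec M U →ₗ[X.ring.obj.obj (op U)] Sec N U := (φ.val.app (op U)).hom

lemma homSec_res {M N : X.Mod} (φ : M ⟶ N) {U V : Opens X.top} (h : V ≤ U) (s : Sec M U) :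
    homSec φ V (secRes M h s) = secRes N h (homSec φ U s) :=
  PresheafOfModules.naturality_apply φ.val (homOfLE h).op s

lemma homSec_comp {M N P : X.Mod} (φ : M ⟶ N) (ψ : N ⟶ P) (U : Opens X.top) (s : Sec M U) :
    homSec (φ ≫ ψ) U s = homSec ψ U (homSec φ U s) := rfl

/-- The canonical map `N(V) → (f^* N)(f⁻¹ V)`, `s ↦ 1 ⊗ s`. -/
noncomputable def pullSec (f : X ⟶ Y) (N : Y.Mod) (V : Opens Y.top) :
    Sec N V →+ Sec ((pull f).obj N) ((Opens.map f.base).obj V) :=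
  AddMonoidHom.mk' (homSec ((adj f).unit.app N) V) (map_add (homSec ((adj f).unit.app N) V))

lemma pullSec_smul (f : X ⟶ Y) (N : Y.Mod) (V : Opens Y.top) (r : Y.ring.obj.obj (op V))
    (s : Sec N V) : pullSec f N V (r • s) = f.app V r • pullSec f N V s :=
  (homSec ((adj f).unit.app N) V).map_smul r s

lemma pullSec_res (f : X ⟶ Y) (N : Y.Mod) {U V : Opens Y.top} (h : V ≤ U) (s : Sec N U) :
    pullSec f N V (secRes N h s) =
      secRes ((pull f).obj N) ((Opens.map f.base).map (homOfLE h)).le (pullSec f N U s) :=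
  homSec_res ((adj f).unit.app N) h s

lemma homSec_pullSec (f : X ⟶ Y) {M N : Y.Mod} (φ : M ⟶ N) (V : Opens Y.top) (s : Sec M V) :
    homSec ((pull f).map φ) _ (pullSec f M V s) = pullSec f N V (homSec φ V s) := by
  have := (adj f).unit.naturality φ
  exact congrArg (fun α : M ⟶ (push f).obj ((pull f).obj N) => homSec α V s) this.symm

/-- A subsheaf of modules of `M`. -/
structure SubMod (M : X.Mod) where
  carrier : ∀ V : Opens X.top, Submodule (X.ring.obj.obj (op V)) (Sec M V)
  res_mem : ∀ {U V : Opens X.top} (h : V ≤ U) (s : Sec M U), s ∈ carrier U →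
    secRes M h s ∈ carrier V
  of_local : ∀ (U : Opens X.top) (s : Sec M U),
    (∀ x ∈ U, ∃ (V : Opens X.top) (h : V ≤ U), x ∈ V ∧ secRes M h s ∈ carrier V) → s ∈ carrier U

/-- A subsheaf as a presheaf of submodules. -/
def SubMod.pre {M : X.Mod} (N : SubMod M) : PresheafOfModules.Submodule M.val where
  obj V := N.carrier V.unop
  map i _ hs := N.res_mem (leOfHom i.unop) _ hs

lemma SubMod.pre_isSheaf {M : X.Mod} (N : SubMod M) :
    Presheaf.IsSheaf (Opens.grothendieckTopology X.top) N.pre.toPresheafOfModules.presheaf := by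
  have hM := (TopCat.Presheaf.isSheaf_iff_isSheafUniqueGluing (X := X.top) M.val.presheaf).1
    M.isSheaf
  refine (TopCat.Presheaf.isSheaf_iff_isSheafUniqueGluing (X := X.top) _).2 ?_
  intro ι V (a : ∀ i, N.carrier (V i)) ha
  obtain ⟨b, hb, huniq⟩ := hM V (fun i => ((a i).1 : Sec M (V i)))
    (fun i j => congrArg Subtype.val (ha i j))
  have hmem : (b : Sec M (iSup V)) ∈ N.carrier (iSup V) := by
    refine N.of_local _ b fun x hx => ?_
    obtain ⟨i, hi⟩ := Opens.mem_iSup.1 hx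
    refine ⟨V i, le_iSup V i, hi, ?_⟩
    have : secRes M (le_iSup V i) b = (a i).1 := hb i
    rw [this]
    exact (a i).2
  refine ⟨(⟨b, hmem⟩ : N.carrier (iSup V)), fun i => Subtype.ext (hb i), ?_⟩
  intro (c : N.carrier (iSup V)) hc
  exact Subtype.ext (huniq c.1 fun i => congrArg Subtype.val (hc i))

/-- A subsheaf of modules as a module. -/
noncomputable def SubMod.toMod {M : X.Mod} (N : SubMod M) : X.Mod :=
  ⟨N.pre.toPresheafOfModules, N.pre_isSheaf⟩

/-- Restriction of a morphism of modules to subsheaves. -/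
noncomputable def SubMod.map {M M' : X.Mod} (N : SubMod M) (N' : SubMod M') (φ : M ⟶ M')
    (h : ∀ V, ∀ s ∈ N.carrier V, homSec φ V s ∈ N'.carrier V) : N.toMod ⟶ N'.toMod :=
  ⟨{ app := fun V => ModuleCat.ofHom ((homSec φ V.unop).restrict (h V.unop))
     naturality := fun {V V'} i => by
       ext (s : N.carrier V.unop)
       exact Subtype.ext (homSec_res φ (leOfHom i.unop) s.1) }⟩

end Sections

end RSp

/-! ### Infinitesimally invariant sections -/

/-- The diagram of an action of `ℂˣ`, with the map `e : x ↦ (1, x)` and the central section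
`tau = t - 1` of the structure sheaf of `X₁ = ℂˣ × X₀`. -/
structure CStarDiagram extends ActionDiagram.{u} where
  e : X₀.top → X₁.top
  tau : ∀ O : Opens X₁.top, X₁.ring.obj.obj (op O)
  tau_comm : ∀ (O : Opens X₁.top) (r : X₁.ring.obj.obj (op O)), tau O * r = r * tau O
  res_tau : ∀ {O O' : Opens X₁.top} (h : O' ≤ O), X₁.ring.res h (tau O) = tau O'

namespace EquivMod

open RSp

variable {D : CStarDiagram.{u}} (M : EquivMod D.toActionDiagram)

/-- The section `φ(s) = "(φ_t(s))_t"` of `p₂^* M`, for a section `s` of `M`. -/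
noncomputable def act (U : Opens D.X₀.top) (s : Sec M.mod U) :
    Sec ((pull D.p₂).obj M.mod) ((Opens.map D.mu.base).obj U) :=
  homSec M.iso.hom _ (pullSec D.mu M.mod U s)

/-- The relation `w = v(s)`, where `v(s)` is the derivative of `φ_t(s)` with respect to `t` at
`t = 1`: near the points `(1, x)` with `x ∈ U`, the section `φ(s)` of `p₂^* M` is congruent to
`1 ⊗ s + (t - 1) ⊗ w` modulo `(t - 1)² p₂^* M`. -/
def IsDerivOne (U : Opens D.X₀.top) (s w : Sec M.mod U) : Prop :=
  ∀ x ∈ U, ∃ (O : Opens D.X₁.top) (h : O ≤ (Opens.map D.mu.base).obj U)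
    (h' : O ≤ (Opens.map D.p₂.base).obj U), D.e x ∈ O ∧ ∃ c : Sec ((pull D.p₂).obj M.mod) O,
      secRes _ h (M.act U s) = secRes _ h' (pullSec D.p₂ M.mod U s) +
        D.tau O • secRes _ h' (pullSec D.p₂ M.mod U w) + D.tau O ^ 2 • c

/-- A section `s` of `M` is invariant if `v(s) = 0`. -/
def IsInvariant (U : Opens D.X₀.top) (s : Sec M.mod U) : Prop := M.IsDerivOne U s 0

lemma isInvariant_iff (U : Opens D.X₀.top) (s : Sec M.mod U) :
    M.IsInvariant U s ↔ ∀ x ∈ U, ∃ (O : Opens D.X₁.top) (h : O ≤ (Opens.map D.mu.base).obj U)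
    (h' : O ≤ (Opens.map D.p₂.base).obj U), D.e x ∈ O ∧ ∃ c : Sec ((pull D.p₂).obj M.mod) O,
      secRes _ h (M.act U s) = secRes _ h' (pullSec D.p₂ M.mod U s) + D.tau O ^ 2 • c := by
  simp only [IsInvariant, IsDerivOne, map_zero, smul_zero, add_zero]

lemma act_add (U : Opens D.X₀.top) (s s' : Sec M.mod U) :
    M.act U (s + s') = M.act U s + M.act U s' := by
  simp only [act, map_add]

lemma act_smul (U : Opens D.X₀.top) (r : D.X₀.ring.obj.obj (op U)) (s : Sec M.mod U) :
    M.act U (r • s) = D.mu.app U r • M.act U s := by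
  rw [act, pullSec_smul, map_smul]
  rfl

lemma act_res {U V : Opens D.X₀.top} (h : V ≤ U) (s : Sec M.mod U) :
    M.act V (secRes M.mod h s) =
      secRes _ ((Opens.map D.mu.base).map (homOfLE h)).le (M.act U s) := by
  rw [act, pullSec_res, homSec_res]
  rfl

lemma isInvariant_zero (U : Opens D.X₀.top) (hU : ∀ x ∈ U, D.mu.base (D.e x) ∈ U)
    (hU' : ∀ x ∈ U, D.p₂.base (D.e x) ∈ U) : M.IsInvariant U 0 := by
  rw [isInvariant_iff]
  intro x hx
  refine ⟨(Opens.map D.mu.base).obj U ⊓ (Opens.map D.p₂.base).obj U, inf_le_left, inf_le_right,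
    ⟨hU x hx, hU' x hx⟩, 0, ?_⟩
  simp only [act, map_zero, smul_zero, add_zero]

lemma tau_sq_comm (O : Opens D.X₁.top) (r : D.X₁.ring.obj.obj (op O)) :
    r * D.tau O ^ 2 = D.tau O ^ 2 * r :=
  ((show Commute (D.tau O) r from D.tau_comm O r).pow_left 2).symm

variable {M}

lemma IsInvariant.add {U : Opens D.X₀.top} {s s' : Sec M.mod U} (hs : M.IsInvariant U s)
    (hs' : M.IsInvariant U s') : M.IsInvariant U (s + s') := by
  rw [isInvariant_iff] at hs hs' ⊢
  intro x hx
  obtain ⟨O, h, h', hxO, c, hc⟩ := hs x hx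
  obtain ⟨O', k, k', hxO', c', hc'⟩ := hs' x hx
  refine ⟨O ⊓ O', inf_le_left.trans h, inf_le_left.trans h', ⟨hxO, hxO'⟩,
    secRes _ inf_le_left c + secRes _ inf_le_right c', ?_⟩
  have e1 := congrArg (secRes _ (inf_le_left : O ⊓ O' ≤ O)) hc
  have e2 := congrArg (secRes _ (inf_le_right : O ⊓ O' ≤ O')) hc'
  rw [map_add, secRes_smul, secRes_secRes, secRes_secRes, map_pow, D.res_tau] at e1 e2
  rw [act_add, map_add, map_add, map_add, e1, e2, smul_add]
  abel

lemma IsInvariant.res {U V : Opens D.X₀.top} {s : Sec M.mod U} (hs : M.IsInvariant U s) (h : V ≤ U)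
    (hV : ∀ x ∈ V, D.mu.base (D.e x) ∈ V) (hV' : ∀ x ∈ V, D.p₂.base (D.e x) ∈ V) :
    M.IsInvariant V (secRes M.mod h s) := by
  rw [isInvariant_iff] at hs ⊢
  intro x hx
  obtain ⟨O, k, k', hxO, c, hc⟩ := hs x (h hx)
  refine ⟨O ⊓ ((Opens.map D.mu.base).obj V ⊓ (Opens.map D.p₂.base).obj V),
    inf_le_right.trans inf_le_left, inf_le_right.trans inf_le_right, ⟨hxO, hV x hx, hV' x hx⟩,
    secRes _ inf_le_left c, ?_⟩
  have e1 := congrArg (secRes _ (inf_le_left : O ⊓ ((Opens.map D.mu.base).obj V ⊓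
    (Opens.map D.p₂.base).obj V) ≤ O)) hc
  rw [map_add, secRes_smul, secRes_secRes, secRes_secRes, map_pow, D.res_tau] at e1
  rw [act_res, pullSec_res, secRes_secRes, secRes_secRes, e1]

lemma IsInvariant.of_local {U : Opens D.X₀.top} {s : Sec M.mod U}
    (hs : ∀ x ∈ U, ∃ (V : Opens D.X₀.top) (h : V ≤ U), x ∈ V ∧
      M.IsInvariant V (secRes M.mod h s)) : M.IsInvariant U s := by
  rw [isInvariant_iff]
  intro x hx
  obtain ⟨V, h, hxV, hV⟩ := hs x hx
  obtain ⟨O, k, k', hxO, c, hc⟩ := (M.isInvariant_iff V _).1 hV x hxV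
  rw [act_res, pullSec_res, secRes_secRes, secRes_secRes] at hc
  exact ⟨O, _, _, hxO, c, hc⟩

/-- The product of an invariant section of `M` by a section `r` with `mu^* r = p₂^* r`. -/
lemma IsInvariant.smul {U : Opens D.X₀.top} {s : Sec M.mod U} (hs : M.IsInvariant U s)
    (r : D.X₀.ring.obj.obj (op U))
    (hr : ∀ (O : Opens D.X₁.top) (h : O ≤ (Opens.map D.mu.base).obj U)
      (h' : O ≤ (Opens.map D.p₂.base).obj U),
      D.X₁.ring.res h (D.mu.app U r) = D.X₁.ring.res h' (D.p₂.app U r)) :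
    M.IsInvariant U (r • s) := by
  rw [isInvariant_iff] at hs ⊢
  intro x hx
  obtain ⟨O, k, k', hxO, c, hc⟩ := hs x hx
  refine ⟨O, k, k', hxO, D.X₁.ring.res k' (D.p₂.app U r) • c, ?_⟩
  rw [act_smul, pullSec_smul, secRes_smul, secRes_smul, hc, hr O k k', smul_add, smul_smul,
    smul_smul, tau_sq_comm]

lemma IsInvariant.map {N : EquivMod D.toActionDiagram} (f : M ⟶ N) {U : Opens D.X₀.top}
    {s : Sec M.mod U} (hs : M.IsInvariant U s) : N.IsInvariant U (homSec f.hom U s) := by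
  rw [isInvariant_iff] at hs ⊢
  intro x hx
  obtain ⟨O, k, k', hxO, c, hc⟩ := hs x hx
  refine ⟨O, k, k', hxO, homSec ((pull D.p₂).map f.hom) O c, ?_⟩
  have e1 := congrArg (homSec ((pull D.p₂).map f.hom) O) hc
  have e2 : homSec ((pull D.p₂).map f.hom) _ (M.act U s) = N.act U (homSec f.hom U s) := by
    rw [act, ← homSec_comp, f.comm, homSec_comp, homSec_pullSec]
    rfl
  rwa [homSec_res, e2, map_add, homSec_res, homSec_pullSec, map_smul] at e1

variable {Y : RSp.{u}} (p : D.X₀ ⟶ Y) (hp : D.mu ≫ p = D.p₂ ≫ p)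
  (h₁ : ∀ x, D.mu.base (D.e x) = x) (h₂ : ∀ x, D.p₂.base (D.e x) = x)

lemma app_app_eq {X₁ X₀ Y : RSp.{u}} {f g : X₁ ⟶ X₀} {p : X₀ ⟶ Y} (hp : f ≫ p = g ≫ p)
    {V : Opens Y.top} (b : Y.ring.obj.obj (op V)) (O : Opens X₁.top)
    (h : O ≤ (Opens.map (f ≫ p).base).obj V) (h' : O ≤ (Opens.map (g ≫ p).base).obj V) :
    X₁.ring.res h ((f ≫ p).app V b) = X₁.ring.res h' ((g ≫ p).app V b) := by
  revert h h'
  rw [hp]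
  intro h h'
  rfl

/-- The subsheaf of `p_* M` formed by the invariant sections, for an invariant morphism `p`. -/
noncomputable def invSub (M : EquivMod D.toActionDiagram) : SubMod ((push p).obj M.mod) where
  carrier V :=
    { carrier := {s : Sec M.mod ((Opens.map p.base).obj V) |
        M.IsInvariant ((Opens.map p.base).obj V) s}
      add_mem' := fun hs hs' => IsInvariant.add hs hs'
      zero_mem' := M.isInvariant_zero _ (fun x hx => (h₁ x).symm ▸ hx) (fun x hx => (h₂ x).symm ▸ hx)
      smul_mem' := fun b s hs => IsInvariant.smul (M := M) hs (p.app V b)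
        (fun O h h' => app_app_eq hp b O h h') }
  res_mem h s hs := IsInvariant.res (M := M) hs _ (fun x hx => (h₁ x).symm ▸ hx)
    (fun x hx => (h₂ x).symm ▸ hx)
  of_local U s hs := IsInvariant.of_local (M := M) fun x hx => by
    obtain ⟨V, h, hxV, hV⟩ := hs (p.base x) hx
    exact ⟨(Opens.map p.base).obj V, ((Opens.map p.base).map (homOfLE h)).le, hxV, hV⟩

/-- The functor of invariant sections, `M ↦ {s ∈ p_* M | v(s) = 0}`. -/
noncomputable def invariants : EquivMod D.toActionDiagram ⥤ Y.Mod where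
  obj M := (invSub p hp h₁ h₂ M).toMod
  map {M N} f := SubMod.map (invSub p hp h₁ h₂ M) (invSub p hp h₁ h₂ N) ((push p).map f.hom)
    (fun _ _ hs => IsInvariant.map (M := M) f hs)
  map_id _ := rfl
  map_comp _ _ := rfl

end EquivMod

/-! ### The sheaf of invariant sections and the two functors -/

section Invariants

variable {E : Type} [NormedAddCommGroup E] [NormedSpace ℂ E]
  {X : Type u} [TopologicalSpace X] [ChartedSpace E X] [IsManifold 𝓘(ℂ, E) ω X]
  [MulAction ℂˣ X] [ContinuousSMul ℂˣ X]

/-- The quotient map `p : X → Y = X / ℂˣ`. -/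
noncomputable def quotMap (X : Type u) [TopologicalSpace X] [MulAction ℂˣ X]
    [ContinuousSMul ℂˣ X] :
    TopCat.of X ⟶ TopCat.of (MulAction.orbitRel.Quotient ℂˣ X) :=
  TopCat.ofHom ⟨Quotient.mk _, continuous_quotient_mk'⟩

lemma quotMap_smul (t : ℂˣ) (x : X) : quotMap X (t • x) = quotMap X x :=
  Quotient.sound ⟨t, rfl⟩

/-- The open set `p⁻¹ V`. -/
noncomputable abbrev quotInv (V : Opens (MulAction.orbitRel.Quotient ℂˣ X)) : Opens X :=
  (Opens.map (quotMap X)).obj V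

lemma quotInv_mono {V V' : Opens (MulAction.orbitRel.Quotient ℂˣ X)} (h : V' ≤ V) :
    quotInv V' ≤ quotInv V := fun _ hx => h hx

lemma actInv_quotInv (t : ℂˣ) (V : Opens (MulAction.orbitRel.Quotient ℂˣ X)) :
    actInv t (quotInv V) ≤ quotInv V := fun x (hx : quotMap X (t • x) ∈ V) => by
  rw [quotMap_smul] at hx
  exact hx

namespace FAction

variable {A : DQAlgebra E X} {m : ℤ} (θ : FAction A m)

/-- The ring of the invariant sections `s` of `A^loc` over `p⁻¹ V`: those with `θ_t(s) = s` for all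
`t`. -/
noncomputable def invRing (V : Opens (MulAction.orbitRel.Quotient ℂˣ X)) :
    Subring (A.loc.obj.obj (op (quotInv V))) where
  carrier := {s | ∀ t : ℂˣ, θ.locAt t (quotInv V) s = A.loc.res (actInv_quotInv t V) s}
  mul_mem' hs hs' t := by rw [map_mul, map_mul, hs t, hs' t]
  one_mem' t := by rw [map_one, map_one]
  add_mem' hs hs' t := by rw [map_add, map_add, hs t, hs' t]
  zero_mem' t := by rw [map_zero, map_zero]
  neg_mem' hs t := by rw [map_neg, map_neg, hs t]

lemma res_mem_invRing {V V' : Opens (MulAction.orbitRel.Quotient ℂˣ X)} (h : V' ≤ V)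
    (s : A.loc.obj.obj (op (quotInv V))) (hs : s ∈ θ.invRing V) :
    A.loc.res (quotInv_mono h) s ∈ θ.invRing V' := by
  intro t
  rw [locAt_res, hs t, A.loc.res_res, A.loc.res_res]

/-- Restriction of invariant sections. -/
noncomputable def invRes {V V' : Opens (MulAction.orbitRel.Quotient ℂˣ X)} (h : V' ≤ V) :
    θ.invRing V →+* θ.invRing V' :=
  ((A.loc.res (quotInv_mono h)).comp
    (θ.invRing V).subtype).codRestrict (θ.invRing V') (fun s => θ.res_mem_invRing h s.1 s.2)

/-- The presheaf `V ↦ {s ∈ A^loc(p⁻¹ V) | θ_t(s) = s for all t}`. -/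
noncomputable def invPresheaf :
    (Opens (TopCat.of (MulAction.orbitRel.Quotient ℂˣ X)))ᵒᵖ ⥤ RingCat.{u} where
  obj V := RingCat.of (θ.invRing V.unop)
  map i := RingCat.ofHom (θ.invRes (leOfHom i.unop))
  map_id V := RingCat.hom_ext (RingHom.ext fun (s : θ.invRing V.unop) =>
    Subtype.ext (a1 := θ.invRes le_rfl s) (A.loc.res_self _ _))
  map_comp {V _ _} i j := RingCat.hom_ext (RingHom.ext fun (s : θ.invRing V.unop) =>
    Subtype.ext (a1 := θ.invRes (leOfHom (i ≫ j).unop) s)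
      (a2 := θ.invRes (leOfHom j.unop) (θ.invRes (leOfHom i.unop) s)) (A.loc.res_res _ _ _).symm)

lemma invPresheaf_isSheaf : Presheaf.IsSheaf
    (Opens.grothendieckTopology (TopCat.of (MulAction.orbitRel.Quotient ℂˣ X))) θ.invPresheaf := by
  refine isSheaf_of_glue _ ?_ ?_
  · intro V (a : θ.invRing V) (b : θ.invRing V) h
    refine Subtype.ext (a1 := a) (a2 := b) (A.loc.ext_local _ _ fun x hx => ?_)
    obtain ⟨V', hV', hp, hab⟩ := h (quotMap X x) hx
    replace hab : θ.invRes hV' a = θ.invRes hV' b := hab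
    exact ⟨quotInv V', quotInv_mono hV', hp, congrArg Subtype.val hab⟩
  · intro V ι W hW hc (a : ∀ i, θ.invRing (W i)) hcomp
    replace hcomp : ∀ i j, θ.invRes (inf_le_left : W i ⊓ W j ≤ W i) (a i) =
      θ.invRes (inf_le_right : W i ⊓ W j ≤ W j) (a j) := hcomp
    obtain ⟨b, hb⟩ := A.loc.glue (U := quotInv V) (fun i => quotInv (W i))
      (fun i => quotInv_mono (hW i)) (fun x hx => hc (quotMap X x) hx) (fun i => (a i).1)
      (fun i j => congrArg Subtype.val (hcomp i j))
    have hmem : b ∈ θ.invRing V := by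
      intro t
      refine A.loc.ext_local _ _ fun x (hx : quotMap X (t • x) ∈ V) => ?_
      obtain ⟨i, hi⟩ := hc (quotMap X (t • x)) hx
      refine ⟨actInv t (quotInv (W i)), actInv_mono t (quotInv_mono (hW i)), hi, ?_⟩
      have h1 := θ.locAt_res t (quotInv_mono (hW i)) b
      rw [hb i] at h1
      refine h1.symm.trans (((a i).2 t).trans ?_)
      rw [← hb i, A.loc.res_res, A.loc.res_res]
    exact ⟨(⟨b, hmem⟩ : θ.invRing V), fun i =>
      Subtype.ext (a1 := θ.invRes (hW i) ⟨b, hmem⟩) (a2 := a i) (hb i)⟩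

/-- The ringed space `(Y, B)`, where `B` is the sheaf of the invariant sections of `A^loc`. -/
noncomputable def quot : RSp.{u} :=
  ⟨TopCat.of (MulAction.orbitRel.Quotient ℂˣ X), ⟨θ.invPresheaf, θ.invPresheaf_isSheaf⟩⟩

/-- The morphism `p : (X, A^loc) → (Y, B)`. -/
noncomputable def quotHom : A.sp₀ ⟶ θ.quot where
  base := quotMap X
  comap := ⟨{ app := fun V => RingCat.ofHom (θ.invRing V.unop).subtype
              naturality := fun _ _ _ => rfl }⟩

lemma muHom_quotHom : θ.muHom ≫ θ.quotHom = A.projHom ≫ θ.quotHom := by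
  refine RSp.hom_ext' ?_ ?_
  · exact TopCat.hom_ext (ContinuousMap.ext fun p => quotMap_smul p.1 p.2)
  · intro V (b : θ.invRing V)
    refine Subtype.ext (funext fun t => ?_)
    have h1 := A.constLoc_apply (E := E) (quotInv V) b.1 t
    refine (b.2 t).trans ?_
    exact (congrArg (A.loc.res (actInv_quotInv t V)) h1).symm

end FAction

end Invariants

section Functors

variable {E : Type} [NormedAddCommGroup E] [NormedSpace ℂ E]
  {X : Type u} [TopologicalSpace X] [ChartedSpace E X] [IsManifold 𝓘(ℂ, E) ω X]

namespace FAction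

/-- The section `t - 1` of `A^loc_{ℂˣ × X}`. -/
noncomputable def tau (A : DQAlgebra E X) (O : Opens (ℂˣ × X)) :
    (A.sp₁ E).ring.obj.obj (op O) :=
  (A.toFamLoc E 𝓘(ℂ, ℂ) ℂˣ).hom.app (op O)
    (smulFam (fun t : ℂˣ => (t : ℂ) - 1)
      (Units.contMDiff_val.sub contMDiff_const).contMDiffOn 1 :
        (holClass E 𝓘(ℂ, ℂ) ℂˣ A.toHbarAlgebra).carrier O)

lemma tau_comm (A : DQAlgebra E X) (O : Opens (ℂˣ × X)) (r : (A.sp₁ E).ring.obj.obj (op O)) :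
    tau A O * r = r * tau A O := by
  refine Subtype.ext (funext fun t => ?_)
  have h := A.ι_C_comm ((t : ℂ) - 1) (slice O t)
    ((r : (A.locClass E 𝓘(ℂ, ℂ) ℂˣ).carrier O).1 t)
  have h2 : A.ι (slice O t) (A.scal _ (PowerSeries.C ((t : ℂ) - 1)) * 1) =
      A.ι (slice O t) (A.scal _ (PowerSeries.C ((t : ℂ) - 1))) := by rw [mul_one]
  rw [← h2] at h
  exact h

lemma res_tau (A : DQAlgebra E X) {O O' : Opens (ℂˣ × X)} (h : O' ≤ O) :
    (A.sp₁ E).ring.res h (tau A O) = tau A O' := by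
  refine Subtype.ext (funext fun t => ?_)
  refine (A.ι_res (slice_mono h t) (A.scal _ (PowerSeries.C ((t : ℂ) - 1)) * 1)).trans ?_
  rw [map_mul, A.scal_res, map_one]
  rfl

variable [MulAction ℂˣ X] [ContinuousSMul ℂˣ X]
  {A : DQAlgebra E X} {m : ℤ} (θ : FAction A m) (hθ : θ.LambdaExists)

/-- The diagram of ringed spaces given by an F-action, with the map `x ↦ (1, x)` and the section
`t - 1`. -/
noncomputable def cDiagram : CStarDiagram.{u} where
  toActionDiagram := θ.diagram hθ
  e := fun x => ((1 : ℂˣ), x)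
  tau := tau A
  tau_comm := tau_comm A
  res_tau := res_tau A

/-- The category `Mod_F(A^loc)` of the `A^loc`-modules with an F-action. -/
abbrev ModF := EquivMod (θ.cDiagram hθ).toActionDiagram

/-- The functor `Mod(B) → Mod_F(A^loc)` that sends `N` to `p^* N = A^loc ⊗ p⁻¹ N` with its
canonical F-action. -/
noncomputable def pStar : θ.quot.Mod ⥤ θ.ModF hθ :=
  EquivMod.invariantPull (D := (θ.cDiagram hθ).toActionDiagram) θ.quotHom θ.muHom_quotHom

/-- The functor `Mod_F(A^loc) → Mod(B)` that sends `M` to the sheaf of the invariant sections of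
`p_* M`. -/
noncomputable def pInv : θ.ModF hθ ⥤ θ.quot.Mod :=
  EquivMod.invariants (D := θ.cDiagram hθ) θ.quotHom θ.muHom_quotHom
    (fun x => one_smul ℂˣ (show X from x)) (fun _ => rfl)

end FAction

end Functors

/-!
The statement has two independent parts, both resting on the function theory of families of sections
of a DQ-algebra.

**Existence of `λ`** (`FAction.lambdaExists`). In a trivialisation, the coefficients of the family
`θ_{t₂}(a(t₁))` are functions of `(t₁, t₂, x)`. For fixed `t₁` they are holomorphic in `(t₂, x)`,
by the definition of an F-action, and the continuity of the F-action makes them jointly continuous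
(`FAction.continuousOn_famCoeff_orbitFam`). For the dependence on `t₁`, a holomorphic family is
divided by `t₁ - t₀` (`DQAlgebra.exists_fam_quotient`), which shows that each coefficient is
holomorphic in `t₁`. Cauchy's formula in `t₁` then writes the coefficients as circle integrals
depending holomorphically on the remaining variables (`contMDiffOn_circleIntegral`, which rests on
Osgood's lemma `osgoodProperty`). Finally, holomorphy of a family may be tested in any one
trivialisation (`StarTriv.isHolFam_of_holCoeff`). Here two star-algebras are
compared by an isomorphism about which nothing is known but that it is `ℂ[[ħ]]`-linear and
multiplicative. Hadamard's lemma (`exists_hadamard`) writes a function as its value at a variable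
point plus a combination of products `u v`, where `u` is a coordinate function vanishing at that
point; there, the coefficients of the transform of `u v` only involve those of lower order of the
transform of `v`, which allows an induction on the order in `ħ`.

**The adjunction.** The functors `p^*` and `p_*` of modules over ringed spaces are adjoint. A
morphism `p^* N ⟶ M` commutes with the actions as soon as the corresponding sections `s` of `M` over
the sets `p⁻¹ V` satisfy `φ(s) = 1 ⊗ s`, while the functor of invariants only imposes the
infinitesimal condition `v(s) = 0`. So everything reduces to one fact: on sets stable under `ℂˣ`,
`v(s) = 0` implies `φ(s) = 1 ⊗ s` (`FAction.secRes_act`); `EquivMod.invariantAdjunction` then gives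
the adjunction. For a vector bundle this would be the uniqueness of solutions of a differential
equation; for an arbitrary module an algebraic argument takes its place.

The condition `v(s) = 0` says that `φ(s) = 1 ⊗ s` modulo `(t - 1)²`. By the cocycle condition,
`σ^* φ(s) = q₂₃^* φ(s)` modulo `(t₁ - 1)²` at the points `(1, t, x)`. Near such a point every function
`b(t₁, t₂, x)` can be written as `c(t₁ t₂, x) + β(t₂, x) + (t₁ - 1)² e(t₁, t₂, x)` with `c` vanishing
at the chosen value of `t`, and `c` is determined by `b`: up to a factor, it is the primitive in the
group variable of the derivative of `b` along `t₁ = 1` (`DQAlgebra.exists_fam_decomposition`,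
`DQAlgebra.exists_fam_decomposition_unique`, `exists_locFam_decomposition`). The *residue map*
`b ↦ c` (`CStarDiagram.Residue`) is additive and linear over functions of `x`, kills the multiples of
`(t₁ - 1)²` and the functions `a(t₂, x)`, and sends `a(t₁ t₂, x)` to `a` minus its value at the chosen
`t`. Being linear over the algebra of `X`, it extends to the inverse images of `M`, with values in a
skyscraper module (`RSp.exists_hom_sky`). Applied to the cocycle congruence, the extension shows that
each germ of `φ(s)` is the pull-back of a germ of `M` (`EquivMod.IsInvariant.exists_secGerm_act`):
`φ(s)` is locally constant along `ℂˣ`. At `t = 1` it equals `1 ⊗ s`, so it does so along the orbit of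
each point, as `ℂˣ` is connected (`EquivMod.IsInvariant.secGerm_act`).
-/

set_option linter.unusedSectionVars false

/-! ### Holomorphic functions of several variables -/

section Osgood

/-- Integration over the interval `[a, b]` as a continuous linear functional. -/
noncomputable def intervalCLM {a b : ℝ} (hab : a ≤ b) : C(Set.Icc a b, ℂ) →L[ℂ] ℂ :=
  LinearMap.mkContinuous
    { toFun := fun g => ∫ x in a..b, g (Set.projIcc a b hab x)
      map_add' := fun g h => by
        simp only [ContinuousMap.add_apply]
        exact intervalIntegral.integral_add
          ((g.continuous.comp continuous_projIcc).intervalIntegrable _ _)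
          ((h.continuous.comp continuous_projIcc).intervalIntegrable _ _)
      map_smul' := fun c g => by
        simp }
    |b - a| (fun g => by
      refine (intervalIntegral.norm_integral_le_of_norm_le_const
        (C := ‖g‖) (fun x _ => g.norm_coe_le_norm _)).trans_eq (mul_comm _ _))

lemma intervalCLM_apply {a b : ℝ} (hab : a ≤ b) (g : C(Set.Icc a b, ℂ)) (f : ℝ → ℂ)
    (h : ∀ x (hx : x ∈ Set.Icc a b), g ⟨x, hx⟩ = f x) :
    intervalCLM hab g = ∫ x in a..b, f x := by
  change ∫ x in a..b, g (Set.projIcc a b hab x) = _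
  refine intervalIntegral.integral_congr fun x hx => ?_
  rw [Set.uIcc_of_le hab] at hx
  simp only [Set.projIcc_of_mem hab hx, h x hx]

/-- A functional on `C(L, ℂ)` applied to the second variable of functions in `C(K × L, ℂ)`. -/
noncomputable def partialCLM {K L : Type*} [TopologicalSpace K] [CompactSpace K]
    [TopologicalSpace L] [CompactSpace L] (ℓ : C(L, ℂ) →L[ℂ] ℂ) : C(K × L, ℂ) →L[ℂ] C(K, ℂ) :=
  LinearMap.mkContinuous
    { toFun := fun g => (⟨ℓ, ℓ.continuous⟩ : C(C(L, ℂ), ℂ)).comp g.curry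
      map_add' := fun g h => by
        ext k
        exact map_add ℓ (g.curry k) (h.curry k)
      map_smul' := fun c g => by
        ext k
        exact map_smul ℓ c (g.curry k) }
    ‖ℓ‖ (fun g => by
      rw [ContinuousMap.norm_le _ (by positivity)]
      intro k
      refine (ℓ.le_opNorm _).trans (mul_le_mul_of_nonneg_left ?_ (norm_nonneg _))
      rw [ContinuousMap.norm_le _ (norm_nonneg _)]
      exact fun l => g.norm_coe_le_norm _)

/-- Osgood's lemma with a compact parameter: a function on `K × Ω`, `Ω ⊆ E` open, that is
continuous and holomorphic on the complex lines of `E` is locally an analytic map to `C(K, ℂ)`. -/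
def OsgoodProperty (E : Type) [NormedAddCommGroup E] [NormedSpace ℂ E] : Prop :=
  ∀ (K : Type) [TopologicalSpace K] [CompactSpace K] (f : K × E → ℂ) (Ω : Set E), IsOpen Ω →
    ContinuousOn f (Set.univ ×ˢ Ω) →
    (∀ k, ∀ w ∈ Ω, ∀ v : E, DifferentiableAt ℂ (fun z : ℂ => f (k, w + z • v)) 0) →
    ∀ w₀ ∈ Ω, ∃ Φ : E → C(K, ℂ), AnalyticAt ℂ Φ w₀ ∧ ∀ᶠ w in nhds w₀, ∀ k, Φ w k = f (k, w)

variable {E E' : Type} [NormedAddCommGroup E] [NormedSpace ℂ E] [NormedAddCommGroup E']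
  [NormedSpace ℂ E']

lemma OsgoodProperty.of_subsingleton [Subsingleton E] : OsgoodProperty E := by
  intro K _ _ f Ω _ hf _ w₀ hw₀
  let g : C(K, ℂ) := ⟨fun k => f (k, w₀),
    hf.comp_continuous (by fun_prop) fun k => ⟨trivial, hw₀⟩⟩
  refine ⟨fun _ => g, analyticAt_const (v := g), Filter.Eventually.of_forall fun w k => ?_⟩
  · rw [Subsingleton.elim w w₀]
    rfl

lemma OsgoodProperty.of_equiv (h : OsgoodProperty E) (e : E ≃L[ℂ] E') : OsgoodProperty E' := by
  intro K _ _ f Ω hΩ hf hd w₀ hw₀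
  obtain ⟨Φ, hΦ, hev⟩ := h K (fun p => f (p.1, e p.2)) (e ⁻¹' Ω) (hΩ.preimage e.continuous)
    (hf.comp (f := fun p : K × E => (p.1, e p.2)) (by fun_prop) fun p hp => ⟨trivial, hp.2⟩)
    (fun k w hw v => by
      have := hd k (e w) hw (e v)
      simpa only [map_add, map_smul] using this)
    (e.symm w₀) (by simpa using hw₀)
  refine ⟨fun w => Φ (e.symm w), hΦ.comp (e.symm.analyticAt w₀), ?_⟩
  have := e.symm.continuous.continuousAt.eventually hev
  filter_upwards [this] with w hw k
  simpa using hw k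

lemma OsgoodProperty.prod_complex (h : OsgoodProperty E) : OsgoodProperty (ℂ × E) := by
  intro K _ _ f Ω hΩ hf hd w₀ hw₀
  obtain ⟨r, hr, hball⟩ := Metric.nhds_basis_closedBall.mem_iff.1 (hΩ.mem_nhds hw₀)
  obtain ⟨z₀, e₀⟩ := w₀
  rw [← closedBall_prod_same] at hball
  have hmem : ∀ z ∈ Metric.closedBall z₀ r, ∀ e ∈ Metric.ball e₀ r, (z, e) ∈ Ω :=
    fun z hz e he => hball ⟨hz, Metric.ball_subset_closedBall he⟩
  let L := Set.Icc (0 : ℝ) (2 * Real.pi)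
  have hL : (0 : ℝ) ≤ 2 * Real.pi := by positivity
  obtain ⟨Φ, hΦ, hev⟩ := h (K × L) (fun p => f (p.1.1, (circleMap z₀ r p.1.2, p.2)))
    (Metric.ball e₀ r) Metric.isOpen_ball
    (hf.comp (f := fun p : (K × L) × E => (p.1.1, (circleMap z₀ r p.1.2, p.2)))
      (((continuous_fst.comp continuous_fst).prodMk (((continuous_circleMap z₀ r).comp
        (continuous_subtype_val.comp (continuous_snd.comp continuous_fst))).prodMk
          continuous_snd)).continuousOn)
      fun p hp => ⟨trivial, hmem _ (circleMap_mem_closedBall z₀ hr.le _) _ hp.2⟩)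
    (fun k w hw v => by
      have := hd k.1 _ (hmem (circleMap z₀ r k.2) (circleMap_mem_closedBall z₀ hr.le _) w hw)
        (0, v)
      simpa using this)
    e₀ (Metric.mem_ball_self hr)
  let S : C(K × L, ℂ) := ⟨fun p => circleMap z₀ r p.2,
    (continuous_circleMap z₀ r).comp (continuous_subtype_val.comp continuous_snd)⟩
  let J : C(K × L, ℂ) := ⟨fun p => (2 * Real.pi * Complex.I)⁻¹ * deriv (circleMap z₀ r) p.2, by
    simp only [deriv_circleMap]
    exact continuous_const.mul (((continuous_circleMap 0 r).comp
      (continuous_subtype_val.comp continuous_snd)).mul continuous_const)⟩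
  have hne : ∀ z ∈ Metric.ball z₀ r, ∀ p, S p - z ≠ 0 := by
    intro z hz p hp
    have h1 : circleMap z₀ r p.2 = z := sub_eq_zero.1 hp
    have h2 := circleMap_mem_sphere z₀ hr.le (p.2 : ℝ)
    rw [h1, Metric.mem_sphere] at h2
    rw [Metric.mem_ball, h2] at hz
    exact lt_irrefl _ hz
  have hunit : ∀ z ∈ Metric.ball z₀ r, IsUnit (S - algebraMap ℂ C(K × L, ℂ) z) := fun z hz =>
    (ContinuousMap.isUnit_iff_forall_ne_zero _).2 fun p => hne z hz p
  let Ψ : ℂ × E → C(K, ℂ) := fun w => partialCLM (intervalCLM hL)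
    (J * Ring.inverse (S - algebraMap ℂ C(K × L, ℂ) w.1) * Φ w.2)
  refine ⟨Ψ, ?_, ?_⟩
  · refine (ContinuousLinearMap.analyticAt (𝕜 := ℂ) (E := C(K × L, ℂ)) (F := C(K, ℂ))
      (partialCLM (intervalCLM hL)) _).comp ?_
    refine (analyticAt_const.mul ?_).mul (hΦ.comp_of_eq analyticAt_snd rfl)
    have h1 : AnalyticAt ℂ (fun w : ℂ × E => S - algebraMap ℂ C(K × L, ℂ) w.1) (z₀, e₀) :=
      analyticAt_const.sub (((Algebra.linearMap ℂ C(K × L, ℂ)).mkContinuousOfExistsBound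
        ⟨‖(1 : C(K × L, ℂ))‖, fun z => by
          change ‖algebraMap ℂ C(K × L, ℂ) z‖ ≤ _
          rw [Algebra.algebraMap_eq_smul_one]
          exact (norm_smul_le z (1 : C(K × L, ℂ))).trans_eq (mul_comm _ _)⟩).analyticAt _ |>.comp_of_eq analyticAt_fst rfl)
    obtain ⟨c, hc⟩ := hunit z₀ (Metric.mem_ball_self hr)
    exact (analyticAt_inverse (𝕜 := ℂ) c).comp_of_eq h1 hc.symm
  · have h1 : ∀ᶠ w : ℂ × E in nhds (z₀, e₀), w.1 ∈ Metric.ball z₀ r :=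
      continuous_fst.continuousAt.eventually (Metric.ball_mem_nhds z₀ hr)
    have h2 : ∀ᶠ w : ℂ × E in nhds (z₀, e₀), w.2 ∈ Metric.ball e₀ r :=
      continuous_snd.continuousAt.eventually (Metric.ball_mem_nhds e₀ hr)
    have h3 : ∀ᶠ w : ℂ × E in nhds (z₀, e₀), ∀ k : K × L,
        Φ w.2 k = f (k.1, (circleMap z₀ r k.2, w.2)) :=
      (continuous_snd.continuousAt (x := (z₀, e₀))).eventually hev
    filter_upwards [h1, h2, h3] with ⟨z, e⟩ hz he hΦe k
    have hdiff : DifferentiableOn ℂ (fun s => f (k, (s, e))) (Metric.closedBall z₀ r) := by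
      intro s hs
      have := hd k (s, e) (hmem s hs e he) (1, 0)
      have h4 : DifferentiableAt ℂ (fun x : ℂ => f (k, (s, e) + (x - s) • ((1, 0) : ℂ × E))) s := by
        refine DifferentiableAt.comp (f := fun x : ℂ => x - s)
          (g := fun x : ℂ => f (k, (s, e) + x • ((1, 0) : ℂ × E))) s ?_
          (differentiableAt_id.sub_const s)
        simpa using this
      refine DifferentiableAt.differentiableWithinAt ?_
      simpa using h4
    have hcauchy := (hdiff.diffContOnCl_ball
      subset_rfl).two_pi_i_inv_smul_circleIntegral_sub_inv_smul hz
    change intervalCLM hL _ = f (k, (z, e))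
    rw [← hcauchy, intervalCLM_apply hL _ (fun θ => (2 * Real.pi * Complex.I)⁻¹ *
      (deriv (circleMap z₀ r) θ * ((circleMap z₀ r θ - z)⁻¹ * f (k, (circleMap z₀ r θ, e)))))]
    · rw [intervalIntegral.integral_const_mul]
      simp only [circleIntegral, smul_eq_mul]
    · intro θ hθ
      have hinv : Ring.inverse (S - algebraMap ℂ C(K × L, ℂ) z) (k, ⟨θ, hθ⟩) =
          (circleMap z₀ r θ - z)⁻¹ := by
        have := Ring.mul_inverse_cancel _ (hunit z hz)
        have h5 := congrArg (fun g : C(K × L, ℂ) => g (k, ⟨θ, hθ⟩)) this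
        exact eq_inv_of_mul_eq_one_right h5
      change J (k, ⟨θ, hθ⟩) * Ring.inverse (S - algebraMap ℂ C(K × L, ℂ) z) (k, ⟨θ, hθ⟩) *
        Φ e (k, ⟨θ, hθ⟩) = _
      rw [hinv, hΦe]
      simp only [J, ContinuousMap.coe_mk]
      ring

lemma osgoodProperty [FiniteDimensional ℂ E] : OsgoodProperty E := by
  have h : ∀ n, OsgoodProperty (Fin n → ℂ) := by
    intro n
    induction n with
    | zero => exact OsgoodProperty.of_subsingleton
    | succ n ih =>
      exact ih.prod_complex.of_equiv (Fin.consEquivL ℂ fun _ : Fin (n + 1) => ℂ)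
  exact (h _).of_equiv (ContinuousLinearEquiv.ofFinrankEq (by simp) :
    (Fin (Module.finrank ℂ E) → ℂ) ≃L[ℂ] E)

/-- The integral over `[a, b]` of a continuous function that depends holomorphically on a
parameter is holomorphic. -/
lemma analyticAt_integral [FiniteDimensional ℂ E] {a b : ℝ} (hab : a ≤ b) (F : ℝ × E → ℂ)
    {Ω : Set E} (hΩ : IsOpen Ω) (hF : ContinuousOn F (Set.Icc a b ×ˢ Ω))
    (hd : ∀ s ∈ Set.Icc a b, ∀ w ∈ Ω, AnalyticAt ℂ (fun w => F (s, w)) w) {w₀ : E}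
    (hw₀ : w₀ ∈ Ω) : AnalyticAt ℂ (fun w => ∫ s in a..b, F (s, w)) w₀ := by
  obtain ⟨Φ, hΦ, hev⟩ := osgoodProperty (E := E) (Set.Icc a b) (fun p => F (p.1, p.2)) Ω hΩ
    (hF.comp (f := fun p : Set.Icc a b × E => ((p.1 : ℝ), p.2)) (by fun_prop)
      fun p hp => ⟨p.1.2, hp.2⟩)
    (fun k w hw v => by
      have h1 := (hd k.1 k.2 w hw).differentiableAt
      refine DifferentiableAt.comp (0 : ℂ) (g := fun w => F (k.1, w))
        (f := fun z : ℂ => w + z • v) (by simpa using h1) (by fun_prop)) w₀ hw₀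
  refine (((intervalCLM hab).analyticAt _).comp hΦ).congr ?_
  filter_upwards [hev] with w hw
  exact intervalCLM_apply _ _ _ fun x hx => hw ⟨x, hx⟩

end Osgood

/-! ### Integrals of holomorphic functions on manifolds -/

section ManifoldIntegral

/-- The integral over `[a, b]` of a continuous function that depends holomorphically on a point of
a manifold is holomorphic. -/
lemma contMDiffOn_integral {F H : Type} [NormedAddCommGroup F] [NormedSpace ℂ F]
    [FiniteDimensional ℂ F] [TopologicalSpace H] (I : ModelWithCorners ℂ F H) [I.Boundaryless]
    {M : Type*} [TopologicalSpace M] [ChartedSpace H M] [IsManifold I ω M] {a b : ℝ} (hab : a ≤ b)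
    (G : ℝ → M → ℂ) {Ω : Set M} (hΩ : IsOpen Ω)
    (hG : ContinuousOn (fun p : ℝ × M => G p.1 p.2) (Set.Icc a b ×ˢ Ω))
    (hd : ∀ s ∈ Set.Icc a b, ContMDiffOn I 𝓘(ℂ, ℂ) ω (G s) Ω) :
    ContMDiffOn I 𝓘(ℂ, ℂ) ω (fun p => ∫ s in a..b, G s p) Ω := by
  intro p₀ hp₀
  refine ContMDiffAt.contMDiffWithinAt ?_
  set φ := extChartAt I p₀ with hφ
  have hcs : ContinuousOn φ.symm φ.target := continuousOn_extChartAt_symm p₀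
  let Ω' : Set F := φ.target ∩ φ.symm ⁻¹' Ω
  have hΩ' : IsOpen Ω' := hcs.isOpen_inter_preimage (isOpen_extChartAt_target p₀) hΩ
  have hp₀' : φ p₀ ∈ Ω' := by
    refine ⟨mem_extChartAt_target p₀, ?_⟩
    change φ.symm (φ p₀) ∈ Ω
    rwa [extChartAt_to_inv]
  have han : AnalyticAt ℂ (fun w => ∫ s in a..b, G s (φ.symm w)) (φ p₀) := by
    refine analyticAt_integral hab (fun q => G q.1 (φ.symm q.2)) hΩ' ?_ ?_ hp₀'
    · refine hG.comp (f := fun q : ℝ × F => (q.1, φ.symm q.2)) ?_ fun q hq => ⟨hq.1, hq.2.2⟩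
      exact continuousOn_fst.prodMk (hcs.comp continuousOn_snd fun q hq => hq.2.1)
    · intro s hs w hw
      have h1 : ContMDiffAt 𝓘(ℂ, F) 𝓘(ℂ, ℂ) ω (fun w => G s (φ.symm w)) w := by
        refine ContMDiffAt.comp (g := G s) w ((hd s hs _ hw.2).contMDiffAt (hΩ.mem_nhds hw.2)) ?_
        exact (contMDiffOn_extChartAt_symm p₀ w hw.1).contMDiffAt
          ((isOpen_extChartAt_target p₀).mem_nhds hw.1)
      exact (contMDiffAt_iff_contDiffAt.1 h1).analyticAt
  have h2 : ContMDiffAt I 𝓘(ℂ, ℂ) ω (fun p => ∫ s in a..b, G s (φ.symm (φ p))) p₀ :=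
    ContMDiffAt.comp p₀ (g := fun w => ∫ s in a..b, G s (φ.symm w)) (f := φ)
      han.contDiffAt.contMDiffAt contMDiffAt_extChartAt
  refine h2.congr_of_eventuallyEq ?_
  filter_upwards [extChartAt_source_mem_nhds (I := I) p₀] with p hp
  rw [φ.left_inv hp]

/-- The integral over a circle of a continuous function that depends holomorphically on a point of
a manifold is holomorphic. -/
lemma contMDiffOn_circleIntegral {F H : Type} [NormedAddCommGroup F] [NormedSpace ℂ F]
    [FiniteDimensional ℂ F] [TopologicalSpace H] (I : ModelWithCorners ℂ F H) [I.Boundaryless]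
    {M : Type*} [TopologicalSpace M] [ChartedSpace H M] [IsManifold I ω M] {c : ℂ} {r : ℝ}
    (hr : 0 ≤ r) (G : ℂ → M → ℂ) {Ω : Set M} (hΩ : IsOpen Ω)
    (hG : ContinuousOn (fun p : ℂ × M => G p.1 p.2) (Metric.sphere c r ×ˢ Ω))
    (hd : ∀ s ∈ Metric.sphere c r, ContMDiffOn I 𝓘(ℂ, ℂ) ω (G s) Ω) :
    ContMDiffOn I 𝓘(ℂ, ℂ) ω (fun p => ∮ s in C(c, r), G s p) Ω := by
  refine contMDiffOn_integral I (by positivity)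
    (fun θ p => deriv (circleMap c r) θ * G (circleMap c r θ) p) hΩ ?_ ?_
  · simp only [deriv_circleMap]
    refine ContinuousOn.mul (((continuous_circleMap 0 r).comp continuous_fst).mul
      continuous_const).continuousOn (hG.comp (f := fun p : ℝ × M => (circleMap c r p.1, p.2)) ?_ ?_)
    · exact (((continuous_circleMap c r).comp continuous_fst).prodMk continuous_snd).continuousOn
    · exact fun p hp => ⟨circleMap_mem_sphere c hr _, hp.2⟩
  · intro θ _
    exact (contMDiffOn_const (c := deriv (circleMap c r) θ)).mul (hd _ (circleMap_mem_sphere c hr _))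

end ManifoldIntegral

/-! ### Holomorphic functions on the punctured line -/

section UnitOf

/-- The inverse of the inclusion `ℂˣ → ℂ`, extended by the junk value `1` at `0`. -/
noncomputable def unitOf (z : ℂ) : ℂˣ := if h : z = 0 then 1 else Units.mk0 z h

lemma val_unitOf {z : ℂ} (h : z ≠ 0) : (unitOf z : ℂ) = z := by
  rw [unitOf, dif_neg h, Units.val_mk0]

@[simp] lemma unitOf_val (t : ℂˣ) : unitOf (t : ℂ) = t := Units.ext (val_unitOf t.ne_zero)

lemma contMDiffAt_unitOf {z : ℂ} (hz : z ≠ 0) :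
    ContMDiffAt 𝓘(ℂ, ℂ) 𝓘(ℂ, ℂ) ω unitOf z := by
  have h := contMDiffOn_isOpenEmbedding_symm (I := 𝓘(ℂ, ℂ)) (n := ω)
    (Units.isOpenEmbedding_val (R := ℂ))
  have hr : Set.range (Units.val : ℂˣ → ℂ) ∈ nhds z :=
    (Units.isOpenEmbedding_val (R := ℂ)).isOpen_range.mem_nhds ⟨Units.mk0 z hz, rfl⟩
  refine ((h z ⟨Units.mk0 z hz, rfl⟩).contMDiffAt hr).congr_of_eventuallyEq ?_
  filter_upwards [hr] with w hw
  obtain ⟨t, rfl⟩ := hw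
  rw [unitOf_val]
  exact ((Units.isOpenEmbedding_val (R := ℂ)).toOpenPartialHomeomorph_left_inv).symm

lemma continuousAt_unitOf {z : ℂ} (hz : z ≠ 0) : ContinuousAt unitOf z :=
  (contMDiffAt_unitOf hz).continuousAt

end UnitOf

/-! ### Division by `t₁ - h(t₂)` and primitives, for holomorphic functions -/

section Division

lemma differentiableAt_comp_curve {F H : Type*} [NormedAddCommGroup F] [NormedSpace ℂ F]
    [TopologicalSpace H] {I : ModelWithCorners ℂ F H} {M : Type*} [TopologicalSpace M]
    [ChartedSpace H M] {f : M → ℂ} {Ω : Set M} (hΩ : IsOpen Ω) (hf : ContMDiffOn I 𝓘(ℂ, ℂ) ω f Ω)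
    {γ : ℂ → M} {s : ℂ} (hγ : ContMDiffAt 𝓘(ℂ, ℂ) I ω γ s) (hs : γ s ∈ Ω) :
    DifferentiableAt ℂ (fun z => f (γ z)) s := by
  have h : ContMDiffAt 𝓘(ℂ, ℂ) 𝓘(ℂ, ℂ) ω (fun z => f (γ z)) s :=
    ContMDiffAt.comp (g := f) s ((hf _ hs).contMDiffAt (hΩ.mem_nhds hs)) hγ
  exact (contMDiffAt_iff_contDiffAt.1 h).differentiableAt (by simp)

variable {E : Type} [NormedAddCommGroup E] [NormedSpace ℂ E]
  {X : Type u} [TopologicalSpace X] [ChartedSpace E X]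

lemma HolOnProd.differentiableAt_fst {f : ℂˣ × X → ℂ} {Ω : Set (ℂˣ × X)} (hΩ : IsOpen Ω)
    (hf : HolOnProd 𝓘(ℂ, ℂ) E f Ω) {s : ℂ} (hs : s ≠ 0) {x : X} (hx : (unitOf s, x) ∈ Ω) :
    DifferentiableAt ℂ (fun z => f (unitOf z, x)) s :=
  differentiableAt_comp_curve hΩ hf ((contMDiffAt_unitOf hs).prodMk contMDiffAt_const) hx

lemma HolOnProd.differentiableAt_fst_fst {f : (ℂˣ × ℂˣ) × X → ℂ} {Ω : Set ((ℂˣ × ℂˣ) × X)}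
    (hΩ : IsOpen Ω) (hf : HolOnProd (𝓘(ℂ, ℂ).prod 𝓘(ℂ, ℂ)) E f Ω) {s : ℂ} (hs : s ≠ 0) {t : ℂˣ}
    {x : X} (hx : ((unitOf s, t), x) ∈ Ω) :
    DifferentiableAt ℂ (fun z => f ((unitOf z, t), x)) s :=
  differentiableAt_comp_curve hΩ hf
    (((contMDiffAt_unitOf hs).prodMk contMDiffAt_const).prodMk contMDiffAt_const) hx

/-- A polydisc around a point of an open subset of `ℂˣ × N`. -/
lemma exists_closedBall_prod {N : Type*} [TopologicalSpace N] {Ω : Set (ℂˣ × N)} (hΩ : IsOpen Ω)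
    {t : ℂˣ} {y : N} (hp : (t, y) ∈ Ω) : ∃ r > 0, (∀ s ∈ Metric.closedBall (t : ℂ) r, s ≠ 0) ∧
      ∃ V : Set N, IsOpen V ∧ y ∈ V ∧
        ∀ s ∈ Metric.closedBall (t : ℂ) r, ∀ y' ∈ V, (unitOf s, y') ∈ Ω := by
  obtain ⟨A, V, hA, hV, htA, hyV, hAV⟩ := isOpen_prod_iff.1 hΩ t y hp
  have h1 : Units.val '' A ∈ nhds (t : ℂ) :=
    ((Units.isOpenEmbedding_val (R := ℂ)).isOpenMap A hA).mem_nhds ⟨t, htA, rfl⟩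
  obtain ⟨r, hr, hball⟩ := Metric.nhds_basis_closedBall.mem_iff.1 h1
  refine ⟨r, hr, fun s hs => ?_, V, hV, hyV, fun s hs y' hy' => ?_⟩
  · obtain ⟨u, -, rfl⟩ := hball hs
    exact u.ne_zero
  · obtain ⟨u, hu, rfl⟩ := hball hs
    rw [unitOf_val]
    exact hAV ⟨hu, hy'⟩

/-- A holomorphic function that vanishes for `t₁ = h(t₂)` is locally divisible by `t₁ - h(t₂)`. -/
lemma exists_nhds_quotient [FiniteDimensional ℂ E] [IsManifold 𝓘(ℂ, E) ω X] (h : ℂˣ → ℂˣ)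
    (hh : ContMDiff 𝓘(ℂ, ℂ) 𝓘(ℂ, ℂ) ω h) {Ω : Set ((ℂˣ × ℂˣ) × X)} (hΩ : IsOpen Ω) {t : ℂˣ}
    {x₀ : X} (hp : ((h t, t), x₀) ∈ Ω) : ∃ Ω' : Set ((ℂˣ × ℂˣ) × X), IsOpen Ω' ∧
      ((h t, t), x₀) ∈ Ω' ∧ Ω' ⊆ Ω ∧ ∀ f : (ℂˣ × ℂˣ) × X → ℂ,
        HolOnProd (𝓘(ℂ, ℂ).prod 𝓘(ℂ, ℂ)) E f Ω →
        (∀ s x, ((h s, s), x) ∈ Ω → f ((h s, s), x) = 0) →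
        ∃ q : (ℂˣ × ℂˣ) × X → ℂ, HolOnProd (𝓘(ℂ, ℂ).prod 𝓘(ℂ, ℂ)) E q Ω' ∧
          ∀ p ∈ Ω', f p = ((p.1.1 : ℂ) - h p.1.2) * q p := by
  have hΩ₁ : IsOpen {p : ℂˣ × (ℂˣ × X) | ((p.1, p.2.1), p.2.2) ∈ Ω} :=
    hΩ.preimage (by fun_prop)
  obtain ⟨r, hr, hne, V, hV, hyV, hrV⟩ := exists_closedBall_prod hΩ₁ (t := h t) (y := (t, x₀)) hp
  have hval : Continuous (Units.val : ℂˣ → ℂ) := Units.continuous_val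
  let Ω' : Set ((ℂˣ × ℂˣ) × X) := {p | (p.1.1 : ℂ) ∈ Metric.ball (h t : ℂ) r ∧
    (h p.1.2 : ℂ) ∈ Metric.ball (h t : ℂ) r ∧ (p.1.2, p.2) ∈ V}
  have hΩ' : IsOpen Ω' := by
    refine IsOpen.inter ?_ (IsOpen.inter ?_ ?_)
    · exact Metric.isOpen_ball.preimage (hval.comp (by fun_prop))
    · exact Metric.isOpen_ball.preimage (hval.comp (hh.continuous.comp (by fun_prop)))
    · exact hV.preimage (by fun_prop)
  have hsub : ∀ p ∈ Ω', ∀ s ∈ Metric.closedBall (h t : ℂ) r, ((unitOf s, p.1.2), p.2) ∈ Ω :=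
    fun p hp s hs => hrV s hs _ hp.2.2
  refine ⟨Ω', hΩ', ⟨Metric.mem_ball_self hr, Metric.mem_ball_self hr, hyV⟩, ?_, ?_⟩
  · rintro ⟨⟨a, b⟩, x⟩ hp
    have := hsub _ hp a (Metric.ball_subset_closedBall hp.1)
    rwa [unitOf_val] at this
  intro f hf hzero
  have hsph : ∀ s ∈ Metric.sphere (h t : ℂ) r, ∀ w ∈ Metric.ball (h t : ℂ) r, s - w ≠ 0 := by
    intro s hs w hw h0
    rw [sub_eq_zero] at h0
    rw [Metric.mem_ball, ← h0, Metric.mem_sphere.1 hs] at hw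
    exact lt_irrefl _ hw
  let G : ℂ → (ℂˣ × ℂˣ) × X → ℂ := fun s p =>
    (s - p.1.1)⁻¹ * (s - h p.1.2)⁻¹ * f ((unitOf s, p.1.2), p.2)
  have hv1 : ContMDiff ((𝓘(ℂ, ℂ).prod 𝓘(ℂ, ℂ)).prod 𝓘(ℂ, E)) 𝓘(ℂ, ℂ) ω
      (fun p : (ℂˣ × ℂˣ) × X => (p.1.1 : ℂ)) :=
    Units.contMDiff_val.comp (contMDiff_fst.comp contMDiff_fst)
  have hv2 : ContMDiff ((𝓘(ℂ, ℂ).prod 𝓘(ℂ, ℂ)).prod 𝓘(ℂ, E)) 𝓘(ℂ, ℂ) ω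
      (fun p : (ℂˣ × ℂˣ) × X => (h p.1.2 : ℂ)) :=
    Units.contMDiff_val.comp (hh.comp (contMDiff_snd.comp contMDiff_fst))
  have hinv : ∀ {g : (ℂˣ × ℂˣ) × X → ℂ}, ContMDiffOn ((𝓘(ℂ, ℂ).prod 𝓘(ℂ, ℂ)).prod 𝓘(ℂ, E))
      𝓘(ℂ, ℂ) ω g Ω' → (∀ p ∈ Ω', g p ≠ 0) → ContMDiffOn ((𝓘(ℂ, ℂ).prod 𝓘(ℂ, ℂ)).prod 𝓘(ℂ, E))
      𝓘(ℂ, ℂ) ω (fun p => (g p)⁻¹) Ω' := fun hg hn p hp =>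
    ContMDiffAt.comp_contMDiffWithinAt (g := fun z : ℂ => z⁻¹) p
      ((contDiffAt_inv ℂ (hn p hp)).contMDiffAt) (hg p hp)
  have hGhol : HolOnProd (𝓘(ℂ, ℂ).prod 𝓘(ℂ, ℂ)) E (fun p => ∮ s in C((h t : ℂ), r), G s p) Ω' := by
    refine contMDiffOn_circleIntegral _ hr.le G hΩ' ?_ ?_
    · have c1 : ∀ (g : (ℂˣ × ℂˣ) × X → ℂ), Continuous g →
          (∀ p ∈ Ω', g p ∈ Metric.ball (h t : ℂ) r) → ContinuousOn
            (fun p : ℂ × ((ℂˣ × ℂˣ) × X) => (p.1 - g p.2)⁻¹) (Metric.sphere (h t : ℂ) r ×ˢ Ω') :=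
        fun g hg hb => ContinuousOn.inv₀ (by fun_prop) fun p hp => hsph _ hp.1 _ (hb _ hp.2)
      refine ((c1 _ hv1.continuous fun p hp => hp.1).mul
        (c1 _ hv2.continuous fun p hp => hp.2.1)).mul ?_
      refine hf.continuousOn.comp
        (f := fun p : ℂ × ((ℂˣ × ℂˣ) × X) => ((unitOf p.1, p.2.1.2), p.2.2)) ?_
        fun p hp => hsub _ hp.2 _ (Metric.sphere_subset_closedBall hp.1)
      refine ContinuousOn.prodMk (ContinuousOn.prodMk ?_ (by fun_prop)) (by fun_prop)
      exact fun p hp => ContinuousAt.continuousWithinAt (ContinuousAt.comp (g := unitOf)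
        (continuousAt_unitOf (hne _ (Metric.sphere_subset_closedBall hp.1))) continuousAt_fst)
    · intro s hs
      refine ContMDiffOn.mul (ContMDiffOn.mul (hinv ?_ ?_) (hinv ?_ ?_)) ?_
      · exact contMDiffOn_const.sub hv1.contMDiffOn
      · exact fun p hp => hsph _ hs _ hp.1
      · exact contMDiffOn_const.sub hv2.contMDiffOn
      · exact fun p hp => hsph _ hs _ hp.2.1
      · refine ContMDiffOn.comp hf
          (f := fun p : (ℂˣ × ℂˣ) × X => ((unitOf s, p.1.2), p.2)) ?_
          fun p hp => hsub _ hp _ (Metric.sphere_subset_closedBall hs)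
        exact ((contMDiff_const.prodMk (contMDiff_snd.comp contMDiff_fst)).prodMk
          contMDiff_snd).contMDiffOn
  refine ⟨fun p => (2 * Real.pi * Complex.I)⁻¹ * ∮ s in C((h t : ℂ), r), G s p,
    contMDiffOn_const.mul hGhol, ?_⟩
  intro p hp
  have hd : DifferentiableOn ℂ (fun s => f ((unitOf s, p.1.2), p.2))
      (Metric.closedBall (h t : ℂ) r) := fun s hs =>
    (hf.differentiableAt_fst_fst hΩ (hne s hs) (hsub p hp s hs)).differentiableWithinAt
  have hcl := hd.diffContOnCl_ball subset_rfl
  have e1 := hcl.two_pi_i_inv_smul_circleIntegral_sub_inv_smul hp.1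
  have e2 := hcl.two_pi_i_inv_smul_circleIntegral_sub_inv_smul hp.2.1
  have hz : f ((unitOf (h p.1.2 : ℂ), p.1.2), p.2) = 0 := by
    rw [unitOf_val]
    refine hzero _ _ ?_
    have := hsub p hp (h p.1.2) (Metric.ball_subset_closedBall hp.2.1)
    rwa [unitOf_val] at this
  rw [hz] at e2
  have e3 : f ((unitOf (p.1.1 : ℂ), p.1.2), p.2) = f p := by rw [unitOf_val]
  rw [e3] at e1
  have hci : ∀ w ∈ Metric.ball (h t : ℂ) r, CircleIntegrable
      (fun s => (s - w)⁻¹ • f ((unitOf s, p.1.2), p.2)) (h t) r := fun w hw =>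
    ContinuousOn.circleIntegrable hr.le (ContinuousOn.smul
      (ContinuousOn.inv₀ (by fun_prop) fun s hs => hsph s hs w hw)
      (hd.continuousOn.mono Metric.sphere_subset_closedBall))
  rw [← sub_zero (f p), ← e1, ← e2, ← smul_sub, ← circleIntegral.integral_sub (hci _ hp.1)
    (hci _ hp.2.1), smul_eq_mul, mul_left_comm]
  congr 1
  rw [← circleIntegral.integral_const_mul]
  refine circleIntegral.integral_congr (E := ℂ) hr.le fun s hs => ?_
  have n1 := hsph s hs _ hp.1
  have n2 := hsph s hs _ hp.2.1
  simp only [smul_eq_mul, G]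
  field_simp
  ring

/-- Holomorphic functions `d(t, x)` have primitives with respect to `dt / t`. -/
lemma exists_nhds_primitive [FiniteDimensional ℂ E] [IsManifold 𝓘(ℂ, E) ω X]
    {Ω : Set (ℂˣ × X)} (hΩ : IsOpen Ω) {t : ℂˣ} {x₀ : X} (hp : (t, x₀) ∈ Ω) :
    ∃ Ω' : Set (ℂˣ × X), IsOpen Ω' ∧ (t, x₀) ∈ Ω' ∧ Ω' ⊆ Ω ∧ ∀ d : ℂˣ × X → ℂ,
      HolOnProd 𝓘(ℂ, ℂ) E d Ω → ∃ c : ℂˣ × X → ℂ, HolOnProd 𝓘(ℂ, ℂ) E c Ω' ∧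
        (∀ x, c (t, x) = 0) ∧
        ∀ p ∈ Ω', HasDerivAt (fun z => c (unitOf z, p.2)) (d p / p.1) p.1 := by
  obtain ⟨r, hr, hne, V, hV, hyV, hrV⟩ := exists_closedBall_prod hΩ hp
  have hval : Continuous (Units.val : ℂˣ → ℂ) := Units.continuous_val
  let Ω' : Set (ℂˣ × X) := {p | (p.1 : ℂ) ∈ Metric.ball (t : ℂ) r ∧ p.2 ∈ V}
  have hΩ' : IsOpen Ω' :=
    (Metric.isOpen_ball.preimage (hval.comp continuous_fst)).inter (hV.preimage continuous_snd)
  refine ⟨Ω', hΩ', ⟨Metric.mem_ball_self hr, hyV⟩, ?_, ?_⟩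
  · rintro ⟨a, x⟩ hp
    have := hrV a (Metric.ball_subset_closedBall hp.1) _ hp.2
    rwa [unitOf_val] at this
  intro d hd
  have hseg : ∀ w ∈ Metric.ball (t : ℂ) r, ∀ s ∈ Set.Icc (0 : ℝ) 1,
      (t : ℂ) + s • (w - t) ∈ Metric.ball (t : ℂ) r := fun w hw s hs =>
    (convex_ball (t : ℂ) r).add_smul_sub_mem (Metric.mem_ball_self hr) hw hs
  have hseg' := fun w hw s hs => Metric.ball_subset_closedBall (hseg w hw s hs)
  let D : X → ℂ → ℂ := fun x z => d (unitOf z, x) / z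
  let G : ℝ → ℂˣ × X → ℂ := fun s p => D p.2 ((t : ℂ) + s • ((p.1 : ℂ) - t))
  let c : ℂˣ × X → ℂ := fun p => ((p.1 : ℂ) - t) * ∫ s in (0 : ℝ)..1, G s p
  have hv1 : ContMDiff (𝓘(ℂ, ℂ).prod 𝓘(ℂ, E)) 𝓘(ℂ, ℂ) ω (fun p : ℂˣ × X => (p.1 : ℂ)) :=
    Units.contMDiff_val.comp contMDiff_fst
  have hD : ∀ x ∈ V, DifferentiableOn ℂ (D x) (Metric.ball (t : ℂ) r) := by
    intro x hx z hz
    have hz' := Metric.ball_subset_closedBall hz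
    refine DifferentiableAt.differentiableWithinAt ?_
    exact (hd.differentiableAt_fst hΩ (hne z hz') (hrV z hz' x hx)).div differentiableAt_id
      (hne z hz')
  have hn : ∀ p ∈ Ω', ∀ s ∈ Set.Icc (0 : ℝ) 1, (t : ℂ) + s • ((p.1 : ℂ) - t) ≠ 0 :=
    fun p hp s hs => hne _ (hseg' _ hp.1 _ hs)
  have hm : ∀ p ∈ Ω', ∀ s ∈ Set.Icc (0 : ℝ) 1,
      (unitOf ((t : ℂ) + s • ((p.1 : ℂ) - t)), p.2) ∈ Ω :=
    fun p hp s hs => hrV _ (hseg' _ hp.1 _ hs) _ hp.2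
  have hGc : ContinuousOn (fun p : ℝ × (ℂˣ × X) => G p.1 p.2) (Set.Icc 0 1 ×ˢ Ω') := by
    have hc1 : Continuous (fun p : ℝ × (ℂˣ × X) => (t : ℂ) + p.1 • ((p.2.1 : ℂ) - t)) :=
      continuous_const.add (continuous_fst.smul
        ((hv1.continuous.comp continuous_snd).sub continuous_const))
    refine ContinuousOn.div ?_ hc1.continuousOn fun p hp => hn _ hp.2 _ hp.1
    refine hd.continuousOn.comp
      (f := fun p : ℝ × (ℂˣ × X) => (unitOf ((t : ℂ) + p.1 • ((p.2.1 : ℂ) - t)), p.2.2)) ?_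
      fun p hp => hm _ hp.2 _ hp.1
    refine ContinuousOn.prodMk ?_ (by fun_prop)
    exact fun p hp => ContinuousAt.continuousWithinAt (ContinuousAt.comp (g := unitOf)
      (continuousAt_unitOf (hn _ hp.2 _ hp.1)) hc1.continuousAt)
  have hGh : ∀ s ∈ Set.Icc (0 : ℝ) 1,
      ContMDiffOn (𝓘(ℂ, ℂ).prod 𝓘(ℂ, E)) 𝓘(ℂ, ℂ) ω (G s) Ω' := by
    intro s hs
    have hc2 : ContMDiff (𝓘(ℂ, ℂ).prod 𝓘(ℂ, E)) 𝓘(ℂ, ℂ) ω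
        (fun p : ℂˣ × X => (t : ℂ) + s • ((p.1 : ℂ) - t)) := by
      have h2 : (fun p : ℂˣ × X => (t : ℂ) + s • ((p.1 : ℂ) - t)) =
          fun p => (t : ℂ) + (s : ℂ) * ((p.1 : ℂ) - t) := by
        funext z
        rw [Complex.real_smul]
      rw [h2]
      exact contMDiff_const.add (contMDiff_const.mul (hv1.sub contMDiff_const))
    intro p hp
    refine ContMDiffAt.contMDiffWithinAt ?_
    have k0 : ContMDiffAt (𝓘(ℂ, ℂ).prod 𝓘(ℂ, E)) 𝓘(ℂ, ℂ) ω (fun p : ℂˣ × X =>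
        unitOf ((t : ℂ) + s • ((p.1 : ℂ) - t))) p :=
      ContMDiffAt.comp (g := unitOf) p (contMDiffAt_unitOf (hn p hp s hs)) hc2.contMDiffAt
    have k1 : ContMDiffAt (𝓘(ℂ, ℂ).prod 𝓘(ℂ, E)) 𝓘(ℂ, ℂ) ω (fun p : ℂˣ × X =>
        d (unitOf ((t : ℂ) + s • ((p.1 : ℂ) - t)), p.2)) p :=
      ContMDiffAt.comp (g := d) (f := fun p : ℂˣ × X =>
        (unitOf ((t : ℂ) + s • ((p.1 : ℂ) - t)), p.2)) p
        ((hd _ (hm p hp s hs)).contMDiffAt (hΩ.mem_nhds (hm p hp s hs)))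
        (k0.prodMk contMDiffAt_snd)
    have k2 : ContMDiffAt (𝓘(ℂ, ℂ).prod 𝓘(ℂ, E)) 𝓘(ℂ, ℂ) ω (fun p : ℂˣ × X =>
        ((t : ℂ) + s • ((p.1 : ℂ) - t))⁻¹) p :=
      ContMDiffAt.comp (g := fun z : ℂ => z⁻¹) p
        ((contDiffAt_inv ℂ (hn p hp s hs)).contMDiffAt) hc2.contMDiffAt
    exact k1.mul k2
  refine ⟨c, (hv1.contMDiffOn.sub contMDiffOn_const).mul
    (contMDiffOn_integral (𝓘(ℂ, ℂ).prod 𝓘(ℂ, E)) zero_le_one G hΩ' hGc hGh),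
    fun x => by simp [c], ?_⟩
  · rintro ⟨a, x⟩ hp
    obtain ⟨g, hg⟩ := (hD x hp.2).isExactOn_ball
    have hcg : ∀ z ∈ Metric.ball (t : ℂ) r, c (unitOf z, x) = g z - g t := by
      intro z hz
      have hz0 := hne z (Metric.ball_subset_closedBall hz)
      have := intervalIntegral.integral_unitInterval_deriv_eq_sub (f := g) (f' := D x)
        (z₀ := (t : ℂ)) (z₁ := z - t)
        ((hD x hp.2).continuousOn.comp (by fun_prop) fun s hs => hseg z hz s hs)
        (fun s hs => hg _ (hseg z hz s hs))
      rw [add_sub_cancel] at this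
      rw [← this, smul_eq_mul]
      change ((unitOf z : ℂ) - t) * ∫ s in (0 : ℝ)..1, D x ((t : ℂ) + s • ((unitOf z : ℂ) - t)) = _
      rw [val_unitOf hz0]
    have h1 : HasDerivAt (fun z => g z - g t) (D x a) a := (hg a hp.1).sub_const _
    have h2 : D x a = d (a, x) / a := by simp [D]
    rw [← h2]
    refine h1.congr_of_eventuallyEq ?_
    filter_upwards [Metric.isOpen_ball.mem_nhds hp.1] with z hz
    exact hcg z hz

end Division

/-! ### First-order expansions along the group `ℂˣ` -/

section Expansion

variable {E : Type} [NormedAddCommGroup E] [NormedSpace ℂ E]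
  {X : Type u} [TopologicalSpace X] [ChartedSpace E X]

lemma hasDerivAt_mul_unit {g : ℂ → ℂ} {g' : ℂ} {t : ℂˣ} (h : HasDerivAt g (g' / t) t) :
    HasDerivAt (fun z : ℂ => g (z * t)) g' 1 := by
  have h1 : HasDerivAt (fun z : ℂ => z * (t : ℂ)) (t : ℂ) 1 := by
    simpa using (hasDerivAt_id (1 : ℂ)).mul_const (t : ℂ)
  have h2 : HasDerivAt g (g' / t) ((fun z : ℂ => z * (t : ℂ)) 1) := by simpa using h
  have := HasDerivAt.comp (1 : ℂ) h2 h1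
  rwa [div_mul_cancel₀ _ t.ne_zero] at this

lemma unitOf_mul {z : ℂ} (hz : z ≠ 0) (t : ℂˣ) : unitOf (z * t) = unitOf z * t := by
  refine Units.ext ?_
  rw [val_unitOf (mul_ne_zero hz t.ne_zero), Units.val_mul, val_unitOf hz]

@[simp] lemma unitOf_one : unitOf 1 = 1 := unitOf_val 1

lemma HolOnProd.slide {c : ℂˣ × X → ℂ} {Ω : Set (ℂˣ × X)} (hc : HolOnProd 𝓘(ℂ, ℂ) E c Ω)
    {g : ℂˣ × ℂˣ → ℂˣ} (hg : ContMDiff (𝓘(ℂ, ℂ).prod 𝓘(ℂ, ℂ)) 𝓘(ℂ, ℂ) ω g)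
    {Ω' : Set ((ℂˣ × ℂˣ) × X)} (h : ∀ p ∈ Ω', (g p.1, p.2) ∈ Ω) :
    HolOnProd (𝓘(ℂ, ℂ).prod 𝓘(ℂ, ℂ)) E (fun p : (ℂˣ × ℂˣ) × X => c (g p.1, p.2)) Ω' :=
  ContMDiffOn.comp (g := c) (f := fun p : (ℂˣ × ℂˣ) × X => (g p.1, p.2)) hc
    ((hg.comp contMDiff_fst).prodMk contMDiff_snd).contMDiffOn h

lemma HolOnProd.section_one {c : (ℂˣ × ℂˣ) × X → ℂ} {Ω : Set ((ℂˣ × ℂˣ) × X)}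
    (hc : HolOnProd (𝓘(ℂ, ℂ).prod 𝓘(ℂ, ℂ)) E c Ω) {Ω' : Set (ℂˣ × X)}
    (h : ∀ p ∈ Ω', ((1, p.1), p.2) ∈ Ω) :
    HolOnProd 𝓘(ℂ, ℂ) E (fun p : ℂˣ × X => c ((1, p.1), p.2)) Ω' :=
  ContMDiffOn.comp (g := c) (f := fun p : ℂˣ × X => ((1, p.1), p.2)) hc
    (((contMDiff_const.prodMk contMDiff_fst)).prodMk contMDiff_snd).contMDiffOn h

/-- Near `t₁ = 1` each holomorphic function is the sum of `c(t₁ t₂, x)`, with `c(t, x) = 0`, of a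
function of `(t₂, x)` and of a multiple of `(t₁ - 1)²`. -/
lemma exists_nhds_decomposition [FiniteDimensional ℂ E] [IsManifold 𝓘(ℂ, E) ω X]
    {Ω : Set ((ℂˣ × ℂˣ) × X)} (hΩ : IsOpen Ω) {t : ℂˣ} {x₀ : X} (hp : ((1, t), x₀) ∈ Ω) :
    ∃ (Ω₁ : Set (ℂˣ × X)) (Ω₂ : Set ((ℂˣ × ℂˣ) × X)), IsOpen Ω₁ ∧ IsOpen Ω₂ ∧ (t, x₀) ∈ Ω₁ ∧
      ((1, t), x₀) ∈ Ω₂ ∧ Ω₂ ⊆ Ω ∧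
      (∀ p ∈ Ω₁, ((1, p.1), p.2) ∈ Ω) ∧
      (∀ p ∈ Ω₂, (p.1.1 * p.1.2, p.2) ∈ Ω₁) ∧ (∀ p ∈ Ω₂, (p.1.2, p.2) ∈ Ω₁) ∧
      ∀ b : (ℂˣ × ℂˣ) × X → ℂ, HolOnProd (𝓘(ℂ, ℂ).prod 𝓘(ℂ, ℂ)) E b Ω →
        ∃ (c β : ℂˣ × X → ℂ) (e : (ℂˣ × ℂˣ) × X → ℂ), HolOnProd 𝓘(ℂ, ℂ) E c Ω₁ ∧
          HolOnProd 𝓘(ℂ, ℂ) E β Ω₁ ∧ HolOnProd (𝓘(ℂ, ℂ).prod 𝓘(ℂ, ℂ)) E e Ω₂ ∧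
          (∀ x, c (t, x) = 0) ∧
          ∀ p ∈ Ω₂, b p = c (p.1.1 * p.1.2, p.2) + β (p.1.2, p.2) +
            ((p.1.1 : ℂ) - 1) * (((p.1.1 : ℂ) - 1) * e p) := by
  have hone : ContMDiff 𝓘(ℂ, ℂ) 𝓘(ℂ, ℂ) ω (fun _ : ℂˣ => (1 : ℂˣ)) := contMDiff_const
  have hmul : ContMDiff (𝓘(ℂ, ℂ).prod 𝓘(ℂ, ℂ)) 𝓘(ℂ, ℂ) ω (fun p : ℂˣ × ℂˣ => p.1 * p.2) :=
    contMDiff_fst.mul contMDiff_snd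
  have hsnd : ContMDiff (𝓘(ℂ, ℂ).prod 𝓘(ℂ, ℂ)) 𝓘(ℂ, ℂ) ω (fun p : ℂˣ × ℂˣ => p.2) :=
    contMDiff_snd
  let Ω₀ : Set ((ℂˣ × ℂˣ) × X) := Ω ∩ {p | ((1, p.1.2), p.2) ∈ Ω}
  have hΩ₀ : IsOpen Ω₀ := hΩ.inter (hΩ.preimage (by fun_prop))
  obtain ⟨Ωa, hΩa, hpa, hsa, hqa⟩ := exists_nhds_quotient (E := E) (fun _ => 1) hone hΩ₀
    (t := t) (x₀ := x₀) ⟨hp, hp⟩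
  let Ωb : Set (ℂˣ × X) := {p | ((1, p.1), p.2) ∈ Ωa}
  have hΩb : IsOpen Ωb := hΩa.preimage (by fun_prop)
  obtain ⟨Ω₁, hΩ₁, hp₁, hs₁, hprim⟩ := exists_nhds_primitive (E := E) hΩb (t := t) (x₀ := x₀) hpa
  let Ωc : Set ((ℂˣ × ℂˣ) × X) :=
    Ωa ∩ ({p | (p.1.1 * p.1.2, p.2) ∈ Ω₁} ∩ {p | (p.1.2, p.2) ∈ Ω₁})
  have hΩc : IsOpen Ωc :=
    hΩa.inter ((hΩ₁.preimage (by fun_prop)).inter (hΩ₁.preimage (by fun_prop)))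
  obtain ⟨Ωd, hΩd, hpd, hsd, hqd⟩ := exists_nhds_quotient (E := E) (fun _ => 1) hone hΩc
    (t := t) (x₀ := x₀) ⟨hpa, by simpa using hp₁, hp₁⟩
  obtain ⟨Ω₂, hΩ₂, hp₂, hs₂, hq₂⟩ := exists_nhds_quotient (E := E) (fun _ => 1) hone hΩd
    (t := t) (x₀ := x₀) hpd
  refine ⟨Ω₁, Ω₂, hΩ₁, hΩ₂, hp₁, hp₂, fun p hp => (hsa (hsd (hs₂ hp)).1).1,
    fun p hp => (hsa (hs₁ hp)).1,
    fun p hp => (hsd (hs₂ hp)).2.1, fun p hp => (hsd (hs₂ hp)).2.2, ?_⟩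
  intro b hb
  have hb1 : HolOnProd (𝓘(ℂ, ℂ).prod 𝓘(ℂ, ℂ)) E
      (fun p : (ℂˣ × ℂˣ) × X => b ((1, p.1.2), p.2)) Ω₀ :=
    ContMDiffOn.comp (g := b) (f := fun p : (ℂˣ × ℂˣ) × X => ((1, p.1.2), p.2)) hb
      (((contMDiff_const.prodMk (contMDiff_snd.comp contMDiff_fst))).prodMk
        contMDiff_snd).contMDiffOn fun p hp => hp.2
  obtain ⟨q, hq, hbq⟩ := hqa (fun p => b p - b ((1, p.1.2), p.2))
    ((hb.mono Set.inter_subset_left).sub hb1) (fun s x _ => sub_self _)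
  obtain ⟨c, hc, hc0, hcd⟩ := hprim (fun p => q ((1, p.1), p.2)) (hq.section_one fun p hp => hp)
  obtain ⟨q', hq', hcq'⟩ := hqd (fun p => c (p.1.1 * p.1.2, p.2) - c (p.1.2, p.2))
    ((hc.slide hmul fun p hp => hp.2.1).sub (hc.slide hsnd fun p hp => hp.2.2))
    (fun s x _ => by rw [one_mul, sub_self])
  have hdiag : ∀ s x, ((1, s), x) ∈ Ωd → q ((1, s), x) - q' ((1, s), x) = 0 := by
    intro s x hsx
    have d1 := hasDerivAt_mul_unit (hcd (s, x) (hsd hsx).2.2)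
    have d2 : HasDerivAt (fun z : ℂ => (z - 1) * q' ((unitOf z, s), x)) (q' ((1, s), x)) 1 := by
      have h1 := (hq'.differentiableAt_fst_fst hΩd one_ne_zero (t := s) (x := x)
        (by rwa [unitOf_one])).hasDerivAt
      have h2 := ((hasDerivAt_id (1 : ℂ)).sub_const 1).mul h1
      refine h2.congr_deriv ?_
      simp
    have hev : (fun z : ℂ => c (unitOf (z * s), x)) =ᶠ[nhds 1]
        fun z => (z - 1) * q' ((unitOf z, s), x) + c (s, x) := by
      have h0 : ∀ᶠ z : ℂ in nhds 1, z ≠ 0 := isOpen_ne.mem_nhds one_ne_zero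
      have hcont : ContinuousAt (fun z : ℂ => (((unitOf z, s), x) : (ℂˣ × ℂˣ) × X)) 1 :=
        ((continuousAt_unitOf one_ne_zero).prodMk continuousAt_const).prodMk continuousAt_const
      have h1 := hcont.eventually (hΩd.mem_nhds (by simpa using hsx))
      filter_upwards [h0, h1] with z hz hz1
      have := hcq' _ hz1
      simp only [val_unitOf hz, Units.val_one] at this
      rw [← this, unitOf_mul hz]
      ring
    have d3 := (d2.add_const (c (s, x))).congr_of_eventuallyEq hev
    rw [d1.unique d3, sub_self]
  obtain ⟨e, he, hqe⟩ := hq₂ (fun p => q p - q' p) ((hq.mono fun p hp => (hsd hp).1).sub hq') hdiag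
  refine ⟨c, fun p => b ((1, p.1), p.2) - c p, e, hc,
    (hb.section_one fun p hp => (hsa (hs₁ hp)).1).sub hc, he, hc0, ?_⟩
  rintro ⟨⟨a, s⟩, x⟩ hp
  have h1 := hbq _ (hsd (hs₂ hp)).1
  have h2 := hcq' _ (hs₂ hp)
  have h3 := hqe _ hp
  simp only [Units.val_one] at h1 h2 h3 ⊢
  linear_combination h1 - h2 + ((a : ℂ) - 1) * h3

/-- The summand `c(t₁ t₂, x)`, with `c(t, x) = 0`, in the decomposition of a function is unique. -/
lemma exists_nhds_decomposition_unique {Ω₁ : Set (ℂˣ × X)} {Ω₂ : Set ((ℂˣ × ℂˣ) × X)}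
    (hΩ₁ : IsOpen Ω₁) (hΩ₂ : IsOpen Ω₂) {t : ℂˣ} {x₀ : X} (hp₁ : (t, x₀) ∈ Ω₁)
    (hp₂ : ((1, t), x₀) ∈ Ω₂) :
    ∃ Ω : Set (ℂˣ × X), IsOpen Ω ∧ (t, x₀) ∈ Ω ∧ Ω ⊆ Ω₁ ∧
      ∀ (c β : ℂˣ × X → ℂ) (e : (ℂˣ × ℂˣ) × X → ℂ), HolOnProd 𝓘(ℂ, ℂ) E c Ω₁ →
        HolOnProd (𝓘(ℂ, ℂ).prod 𝓘(ℂ, ℂ)) E e Ω₂ → (∀ x, (t, x) ∈ Ω₁ → c (t, x) = 0) →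
        (∀ p ∈ Ω₂, c (p.1.1 * p.1.2, p.2) + β (p.1.2, p.2) =
            ((p.1.1 : ℂ) - 1) * (((p.1.1 : ℂ) - 1) * e p)) → ∀ p ∈ Ω, c p = 0 := by
  let Ω₃ : Set (ℂˣ × X) := Ω₁ ∩ {p | ((1, p.1), p.2) ∈ Ω₂}
  have hΩ₃ : IsOpen Ω₃ := hΩ₁.inter (hΩ₂.preimage (by fun_prop))
  obtain ⟨r, hr, hne, V, hV, hyV, hrV⟩ := exists_closedBall_prod hΩ₃ (t := t) (y := x₀) ⟨hp₁, hp₂⟩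
  refine ⟨{p | (p.1 : ℂ) ∈ Metric.ball (t : ℂ) r ∧ p.2 ∈ V}, ?_, ⟨Metric.mem_ball_self hr, hyV⟩,
    ?_, ?_⟩
  · exact (Metric.isOpen_ball.preimage (Units.continuous_val.comp continuous_fst)).inter
      (hV.preimage continuous_snd)
  · rintro ⟨a, x⟩ hp
    have := hrV a (Metric.ball_subset_closedBall hp.1) _ hp.2
    rw [unitOf_val] at this
    exact this.1
  rintro c β e hc he hc0 hrel ⟨a, x⟩ ⟨ha, hx⟩
  have hmem : ∀ z ∈ Metric.ball (t : ℂ) r, z ≠ 0 ∧ (unitOf z, x) ∈ Ω₃ := fun z hz =>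
    ⟨hne z (Metric.ball_subset_closedBall hz), hrV z (Metric.ball_subset_closedBall hz) x hx⟩
  have hd : ∀ z ∈ Metric.ball (t : ℂ) r, HasDerivAt (fun z => c (unitOf z, x)) 0 z := by
    intro z hz
    obtain ⟨hz0, hz1⟩ := hmem z hz
    have h1 := (hc.differentiableAt_fst hΩ₁ hz0 hz1.1).hasDerivAt
    set c' := deriv (fun z => c (unitOf z, x)) z with hc'
    obtain ⟨s, rfl⟩ : ∃ s : ℂˣ, (s : ℂ) = z := ⟨Units.mk0 z hz0, rfl⟩
    rw [unitOf_val] at hz1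
    have h2 : HasDerivAt (fun z : ℂ => c (unitOf (z * s), x)) (c' * s) 1 :=
      hasDerivAt_mul_unit (g := fun z => c (unitOf z, x))
        (by rwa [mul_div_cancel_right₀ _ s.ne_zero])
    have h3 : HasDerivAt (fun z : ℂ => (z - 1) * ((z - 1) * e ((unitOf z, s), x))) 0 1 := by
      have k1 := (he.differentiableAt_fst_fst hΩ₂ one_ne_zero (t := s) (x := x)
        (by rw [unitOf_one]; exact hz1.2)).hasDerivAt
      have k0 := (hasDerivAt_id (1 : ℂ)).sub_const 1
      exact (k0.mul (k0.mul k1)).congr_deriv (by simp)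
    have hev : (fun z : ℂ => c (unitOf (z * s), x)) =ᶠ[nhds 1]
        fun z => (z - 1) * ((z - 1) * e ((unitOf z, s), x)) - β (s, x) := by
      have h0 : ∀ᶠ z : ℂ in nhds 1, z ≠ 0 := isOpen_ne.mem_nhds one_ne_zero
      have hcont : ContinuousAt (fun z : ℂ => (((unitOf z, s), x) : (ℂˣ × ℂˣ) × X)) 1 :=
        ((continuousAt_unitOf one_ne_zero).prodMk continuousAt_const).prodMk continuousAt_const
      have h1 := hcont.eventually (hΩ₂.mem_nhds (by simpa using hz1.2))
      filter_upwards [h0, h1] with z hz hz1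
      have := hrel _ hz1
      simp only [val_unitOf hz] at this
      rw [← this, unitOf_mul hz]
      ring
    have h4 := h2.unique ((h3.sub_const (β (s, x))).congr_of_eventuallyEq hev)
    have h5 : c' = 0 := by simpa using h4
    rwa [h5] at h1
  have hconst := Metric.isOpen_ball.is_const_of_deriv_eq_zero (convex_ball (t : ℂ) r).isPreconnected
    (fun z hz => (hd z hz).differentiableAt.differentiableWithinAt) (fun z hz => (hd z hz).deriv)
    ha (Metric.mem_ball_self hr)
  simp only [unitOf_val] at hconst
  rw [hconst]
  have := (hmem t (Metric.mem_ball_self hr)).2.1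
  rw [unitOf_val] at this
  exact hc0 x this

end Expansion

/-! ### Hadamard's lemma on a manifold -/

section Hadamard

variable {E : Type} [NormedAddCommGroup E] [NormedSpace ℂ E] [FiniteDimensional ℂ E]
  {X : Type u} [TopologicalSpace X] [ChartedSpace E X] [IsManifold 𝓘(ℂ, E) ω X]
  {F H : Type} [NormedAddCommGroup F] [NormedSpace ℂ F] [FiniteDimensional ℂ F]
  [TopologicalSpace H] (I : ModelWithCorners ℂ F H) [I.Boundaryless]
  {T : Type} [TopologicalSpace T] [ChartedSpace H T] [IsManifold I ω T]

/-- The fundamental theorem of calculus along a segment, in coordinates. -/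
lemma sub_eq_sum_coord_mul_integral {g : E → ℂ} {B : Set E} (hB : IsOpen B) (hconv : Convex ℝ B)
    (hg : ContDiffOn ℂ ω g B) {η ξ : E} (hη : η ∈ B) (hξ : ξ ∈ B) :
    g ξ - g η = ∑ i, (Module.finBasis ℂ E).coord i (ξ - η) * ∫ s in (0 : ℝ)..1,
      iteratedFDeriv ℂ 1 g (η + s • (ξ - η)) fun _ => Module.finBasis ℂ E i := by
  have hseg : ∀ s ∈ Set.Icc (0 : ℝ) 1, η + s • (ξ - η) ∈ B := fun s hs =>
    hconv.add_smul_sub_mem hη hξ hs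
  have hcont : ∀ v : E, ContinuousOn (fun s : ℝ => fderiv ℂ g (η + s • (ξ - η)) v)
      (Set.Icc 0 1) := by
    intro v
    have h1 : ContinuousOn (fderiv ℂ g) B := hg.continuousOn_fderiv_of_isOpen hB (by simp)
    exact (h1.comp (f := fun s : ℝ => η + s • (ξ - η)) (by fun_prop) hseg).clm_apply
      continuousOn_const
  have hint : ∀ v : E, IntervalIntegrable (fun s : ℝ => fderiv ℂ g (η + s • (ξ - η)) v)
      MeasureTheory.volume 0 1 := fun v =>
    ContinuousOn.intervalIntegrable (by rw [Set.uIcc_of_le zero_le_one]; exact hcont v)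
  have hderiv : ∀ s ∈ Set.uIcc (0 : ℝ) 1, HasDerivAt (fun s : ℝ => g (η + s • (ξ - η)))
      (fderiv ℂ g (η + s • (ξ - η)) (ξ - η)) s := by
    intro s hs
    rw [Set.uIcc_of_le zero_le_one] at hs
    have h1 := (((hg _ (hseg s hs)).contDiffAt (hB.mem_nhds (hseg s hs))).differentiableAt
      (by simp)).hasFDerivAt.restrictScalars ℝ
    have h2 : HasDerivAt (fun s : ℝ => η + s • (ξ - η)) (ξ - η) s := by
      simpa using ((hasDerivAt_id s).smul_const (ξ - η)).const_add η
    exact h1.comp_hasDerivAt s h2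
  have hftc := intervalIntegral.integral_eq_sub_of_hasDerivAt hderiv (hint _)
  simp only [one_smul, zero_smul, add_zero, add_sub_cancel] at hftc
  rw [← hftc]
  have hsum : ∀ s : ℝ, fderiv ℂ g (η + s • (ξ - η)) (ξ - η) =
      ∑ i, (Module.finBasis ℂ E).coord i (ξ - η) *
        fderiv ℂ g (η + s • (ξ - η)) (Module.finBasis ℂ E i) := by
    intro s
    generalize fderiv ℂ g (η + s • (ξ - η)) = L
    conv_lhs => rw [← (Module.finBasis ℂ E).sum_repr (ξ - η), map_sum]
    simp [Module.Basis.coord_apply]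
  simp only [hsum]
  rw [intervalIntegral.integral_finsetSum fun i _ => (hint _).const_mul _]
  refine Finset.sum_congr rfl fun i _ => ?_
  rw [intervalIntegral.integral_const_mul]
  simp [iteratedFDeriv_one_apply]

/-- The points `((t, η), x)` with `t ∈ D`, with `x` in the domain of the chart `e`, and with
`η`, `e x` in `B`. -/
def chartDomain (e : OpenPartialHomeomorph X E) (D : Set T) (B : Set E) : Set ((T × E) × X) :=
  {p | p.1.1 ∈ D ∧ p.1.2 ∈ B ∧ p.2 ∈ e.source ∧ e p.2 ∈ B}

lemma isOpen_chartDomain (e : OpenPartialHomeomorph X E) {D : Set T} {B : Set E} (hD : IsOpen D)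
    (hB : IsOpen B) : IsOpen (chartDomain e D B) := by
  refine (hD.preimage (by fun_prop)).inter ((hB.preimage (by fun_prop)).inter ?_)
  exact (e.isOpen_inter_preimage hB).preimage continuous_snd

lemma exists_chart_ball {Ω : Set (T × X)} (hΩ : IsOpen Ω) {t₀ : T} {x₀ : X}
    (hp : (t₀, x₀) ∈ Ω) : ∃ (D : Set T) (ρ : ℝ), 0 < ρ ∧ IsOpen D ∧ t₀ ∈ D ∧
      Metric.ball (chartAt E x₀ x₀) ρ ⊆ (chartAt E x₀).target ∧
      ∀ t ∈ D, ∀ ξ ∈ Metric.ball (chartAt E x₀ x₀) ρ, (t, (chartAt E x₀).symm ξ) ∈ Ω := by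
  obtain ⟨D, V, hD, hV, htD, hxV, hDV⟩ := isOpen_prod_iff.1 hΩ t₀ x₀ hp
  have h1 := (chartAt E x₀).symm.isOpen_inter_preimage hV
  have h2 : chartAt E x₀ x₀ ∈ (chartAt E x₀).symm.source ∩ (chartAt E x₀).symm ⁻¹' V := by
    refine ⟨mem_chart_target E x₀, ?_⟩
    rw [Set.mem_preimage, (chartAt E x₀).left_inv (mem_chart_source E x₀)]
    exact hxV
  obtain ⟨ρ, hρ, hball⟩ := Metric.isOpen_iff.1 h1 _ h2
  exact ⟨D, ρ, hρ, hD, htD, fun ξ hξ => (hball hξ).1, fun t ht ξ hξ => hDV ⟨ht, (hball hξ).2⟩⟩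

/-- Hadamard's lemma with parameters: `f(t, x) - f(t, y)` is a combination of the differences of the
coordinates of `x` and `y`, with holomorphic coefficients; the point `y` is given by its image `η`
in the chart. -/
lemma exists_hadamard (x₀ : X) {D : Set T} {B : Set E} (hD : IsOpen D) (hB : IsOpen B)
    (hconv : Convex ℝ B) (hBt : B ⊆ (chartAt E x₀).target) {f : T × X → ℂ} {Ω : Set (T × X)}
    (hf : HolOnProd I E f Ω)
    (hDB : ∀ t ∈ D, ∀ ξ ∈ B, (t, (chartAt E x₀).symm ξ) ∈ Ω) :
    ∃ g : Fin (Module.finrank ℂ E) → (T × E) × X → ℂ,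
      (∀ i, HolOnProd (I.prod 𝓘(ℂ, E)) E (g i) (chartDomain (chartAt E x₀) D B)) ∧
      ∀ p ∈ chartDomain (chartAt E x₀) D B,
        f (p.1.1, p.2) - f (p.1.1, (chartAt E x₀).symm p.1.2) =
          ∑ i, (Module.finBasis ℂ E).coord i (chartAt E x₀ p.2 - p.1.2) * g i p := by
  set e := chartAt E x₀ with he
  let h : T → E → ℂ := fun t ξ => f (t, e.symm ξ)
  have hsymm : ContMDiffOn 𝓘(ℂ, E) 𝓘(ℂ, E) ω e.symm e.target := contMDiffOn_chart_symm
  have hchart : ContMDiffOn 𝓘(ℂ, E) 𝓘(ℂ, E) ω e e.source := contMDiffOn_chart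
  have hh : ContMDiffOn (I.prod 𝓘(ℂ, E)) 𝓘(ℂ, ℂ) ω (fun p : T × E => h p.1 p.2) (D ×ˢ B) :=
    ContMDiffOn.comp (g := f) (f := fun p : T × E => (p.1, e.symm p.2)) hf
      (contMDiffOn_fst.prodMk (hsymm.comp contMDiffOn_snd fun p hp => hBt hp.2))
      fun p hp => hDB _ hp.1 _ hp.2
  have hk : ∀ i, ContMDiffOn (I.prod 𝓘(ℂ, E)) 𝓘(ℂ, ℂ) ω (fun p : T × E =>
      iteratedFDeriv ℂ 1 (h p.1) p.2 fun _ => Module.finBasis ℂ E i) (D ×ˢ B) := fun i =>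
    iteratedFDeriv_family_hol I h (hD.prod hB) hh 1 _
  have hseg : ∀ p ∈ chartDomain e D B, ∀ s ∈ Set.Icc (0 : ℝ) 1,
      p.1.2 + s • (e p.2 - p.1.2) ∈ B := fun p hp s hs =>
    hconv.add_smul_sub_mem hp.2.1 hp.2.2.2 hs
  let G : Fin (Module.finrank ℂ E) → ℝ → (T × E) × X → ℂ := fun i s p =>
    iteratedFDeriv ℂ 1 (h p.1.1) (p.1.2 + s • (e p.2 - p.1.2)) fun _ => Module.finBasis ℂ E i
  refine ⟨fun i p => ∫ s in (0 : ℝ)..1, G i s p, fun i => ?_, ?_⟩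
  · refine contMDiffOn_integral _ zero_le_one (G i) (isOpen_chartDomain e hD hB) ?_ ?_
    · refine (hk i).continuousOn.comp (f := fun q : ℝ × ((T × E) × X) =>
        (q.2.1.1, q.2.1.2 + q.1 • (e q.2.2 - q.2.1.2))) ?_ fun q hq =>
          ⟨hq.2.1, hseg _ hq.2 _ hq.1⟩
      have he' : ContinuousOn (fun q : ℝ × ((T × E) × X) => e q.2.2)
          (Set.Icc (0 : ℝ) 1 ×ˢ chartDomain e D B) :=
        e.continuousOn.comp (by fun_prop) fun q hq => hq.2.2.2.1
      exact ContinuousOn.prodMk (by fun_prop) (ContinuousOn.add (by fun_prop)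
        (continuousOn_fst.smul (he'.sub (by fun_prop))))
    · intro s hs
      refine (hk i).comp (f := fun p : (T × E) × X => (p.1.1, p.1.2 + s • (e p.2 - p.1.2))) ?_
        fun p hp => ⟨hp.1, hseg p hp s hs⟩
      have h1 : ContMDiffOn ((I.prod 𝓘(ℂ, E)).prod 𝓘(ℂ, E)) 𝓘(ℂ, E) ω
          (fun p : (T × E) × X => p.1.2) (chartDomain e D B) :=
        (contMDiff_snd.comp contMDiff_fst).contMDiffOn
      have h2 : ContMDiffOn ((I.prod 𝓘(ℂ, E)).prod 𝓘(ℂ, E)) 𝓘(ℂ, E) ω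
          (fun p : (T × E) × X => e p.2) (chartDomain e D B) :=
        hchart.comp contMDiffOn_snd fun p hp => hp.2.2.1
      have h3 : ContDiff ℂ ω (fun q : E × E => q.1 + s • (q.2 - q.1)) := by
        have : (fun q : E × E => q.1 + s • (q.2 - q.1)) =
            fun q : E × E => q.1 + (s : ℂ) • (q.2 - q.1) := by
          funext q
          rw [Complex.coe_smul]
        rw [this]
        exact contDiff_fst.add (contDiff_const.smul (contDiff_snd.sub contDiff_fst))
      have h4 : ContMDiffOn ((I.prod 𝓘(ℂ, E)).prod 𝓘(ℂ, E)) I ω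
          (fun p : (T × E) × X => p.1.1) (chartDomain e D B) :=
        (contMDiff_fst.comp contMDiff_fst).contMDiffOn
      exact h4.prodMk (h3.contMDiff.comp_contMDiffOn (h1.prodMk_space h2))
  · intro p hp
    have hg : ContDiffOn ℂ ω (h p.1.1) B := by
      rw [← contMDiffOn_iff_contDiffOn]
      exact hh.comp (f := fun ξ : E => (p.1.1, ξ))
        (contMDiff_const.prodMk contMDiff_id).contMDiffOn fun ξ hξ => ⟨hp.1, hξ⟩
    have := sub_eq_sum_coord_mul_integral hB hconv hg hp.2.1 hp.2.2.2
    rw [← this]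
    change f _ - _ = f (p.1.1, e.symm (e p.2)) - f (p.1.1, e.symm p.1.2)
    rw [e.left_inv hp.2.2.1]

end Hadamard

/-! ### Symbols and divisibility by `ħ` in a star-algebra -/

section StarAlgebra

variable {E : Type} [NormedAddCommGroup E] [NormedSpace ℂ E]
  {X : Type u} [TopologicalSpace X] [ChartedSpace E X]

/-- The terms of `f ⋆ g` in degree `n` that involve the coefficient `g_n` reduce to `f_0 g_n`. -/
lemma StarProduct.starCoeff_eq_of_mul_eq_zero {U : Opens X} (S : StarProduct E U) {V : Opens X}
    (hV : V ≤ U) {f g : ℕ → X → ℂ} (hf : ∀ n, HolOn E (f n) V) (hg : ∀ n, HolOn E (g n) V) (n : ℕ)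
    {x : X} (hx : x ∈ V) (h0 : f 0 x * g n x = 0) :
    starCoeff S.P f g n x = ∑ p ∈ Finset.HasAntidiagonal.antidiagonal n,
      ∑ q ∈ Finset.HasAntidiagonal.antidiagonal p.2,
        if q.2 < n then S.P p.1 (f q.1) (g q.2) x else 0 := by
  refine Finset.sum_congr rfl fun p hp => Finset.sum_congr rfl fun q hq => ?_
  split_ifs with h
  · rfl
  · have h1 := Finset.HasAntidiagonal.mem_antidiagonal.1 hp
    have h2 := Finset.HasAntidiagonal.mem_antidiagonal.1 hq
    have h3 : p.1 = 0 := by omega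
    have h4 : q.1 = 0 := by omega
    have h5 : q.2 = n := by omega
    rw [h3, h4, h5, S.zero V hV _ _ (hf 0) (hg n) x hx, h0]

namespace StarTriv

variable {A : HbarAlgebra X} (τ : StarTriv E A)

lemma coeff_mul_zero {V : Opens X} (h : V ≤ τ.U) (a b : A.sheaf.obj.obj (op V)) :
    Set.EqOn (τ.coeff V h (a * b) 0) (fun x => τ.coeff V h a 0 x * τ.coeff V h b 0 x) V := by
  intro x hx
  rw [τ.mul V h a b 0 hx, starCoeff, Finset.HasAntidiagonal.antidiagonal_zero, Finset.sum_singleton,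
    Finset.HasAntidiagonal.antidiagonal_zero, Finset.sum_singleton]
  exact τ.star.zero V h _ _ (τ.hol V h a 0) (τ.hol V h b 0) x hx

lemma coeff_one_zero {V : Opens X} (h : V ≤ τ.U) :
    Set.EqOn (τ.coeff V h 1 0) (fun _ => 1) V := by
  intro x hx
  obtain ⟨a, ha⟩ := τ.surjective V h (fun _ _ => 1) (fun _ => contMDiffOn_const)
  have h1 := τ.coeff_mul_zero h 1 a hx
  rw [one_mul] at h1
  dsimp only at h1
  rw [ha 0 hx, mul_one] at h1
  exact h1.symm

lemma coeff_hbar_mul {V : Opens X} (h : V ≤ τ.U) (a : A.sheaf.obj.obj (op V)) (n : ℕ) :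
    Set.EqOn (τ.coeff V h (A.hbar V * a) n) (fun x => PowerSeries.coeff n
      (PowerSeries.X * PowerSeries.mk fun k => τ.coeff V h a k x)) V := by
  intro x hx
  rw [HbarAlgebra.hbar, τ.scal V h _ a n hx]
  dsimp only
  rw [PowerSeries.coeff_mul]
  simp only [PowerSeries.coeff_mk]

lemma coeff_hbar_mul_zero {V : Opens X} (h : V ≤ τ.U) (a : A.sheaf.obj.obj (op V)) :
    Set.EqOn (τ.coeff V h (A.hbar V * a) 0) (fun _ => 0) V := by
  intro x hx
  rw [τ.coeff_hbar_mul h a 0 hx]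
  simp

lemma coeff_hbar_mul_succ {V : Opens X} (h : V ≤ τ.U) (a : A.sheaf.obj.obj (op V)) (n : ℕ) :
    Set.EqOn (τ.coeff V h (A.hbar V * a) (n + 1)) (τ.coeff V h a n) V := by
  intro x hx
  rw [τ.coeff_hbar_mul h a (n + 1) hx]
  dsimp only
  rw [PowerSeries.coeff_succ_X_mul, PowerSeries.coeff_mk]

/-- Sections with vanishing symbol are divisible by `ħ`. -/
lemma exists_eq_hbar_mul {V : Opens X} (h : V ≤ τ.U) (a : A.sheaf.obj.obj (op V))
    (ha : Set.EqOn (τ.coeff V h a 0) (fun _ => 0) V) :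
    ∃ y, a = A.hbar V * y ∧ ∀ n, Set.EqOn (τ.coeff V h y n) (τ.coeff V h a (n + 1)) V := by
  obtain ⟨y, hy⟩ := τ.surjective V h (fun n => τ.coeff V h a (n + 1)) (fun n => τ.hol V h a _)
  refine ⟨y, τ.injective V h _ _ fun n => ?_, hy⟩
  cases n with
  | zero => exact ha.trans (τ.coeff_hbar_mul_zero h y).symm
  | succ n => exact (hy n).symm.trans (τ.coeff_hbar_mul_succ h y n).symm

lemma eq_zero_of_hbar_mul {V : Opens X} (h : V ≤ τ.U) {a : A.sheaf.obj.obj (op V)}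
    (ha : A.hbar V * a = 0) : a = 0 := by
  refine τ.injective V h _ _ fun n x hx => ?_
  rw [← τ.coeff_hbar_mul_succ h a n hx, ha, τ.coeff_zero V h _ hx, τ.coeff_zero V h _ hx]

/-- Whether the symbol of a section vanishes at a point does not depend on the trivialisation: a
section with nonzero symbol at `x` is invertible modulo `ħ` near `x`. -/
lemma coeff_zero_eq_zero (τ' : StarTriv E A) {V : Opens X} (h : V ≤ τ.U) (h' : V ≤ τ'.U)
    (a : A.sheaf.obj.obj (op V)) {x : X} (hx : x ∈ V) (ha : τ.coeff V h a 0 x = 0) :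
    τ'.coeff V h' a 0 x = 0 := by
  by_contra hne
  have hc : ContinuousOn (τ'.coeff V h' a 0) V := (τ'.hol V h' a 0).continuousOn
  let V₁ : Opens X := ⟨V ∩ τ'.coeff V h' a 0 ⁻¹' {0}ᶜ,
    hc.isOpen_inter_preimage V.isOpen isOpen_compl_singleton⟩
  have hV₁ : V₁ ≤ V := fun y hy => hy.1
  have hx₁ : x ∈ V₁ := ⟨hx, hne⟩
  obtain ⟨e, he⟩ := τ'.surjective V₁ (hV₁.trans h')
    (fun n y => if n = 0 then (τ'.coeff V h' a 0 y)⁻¹ else 0) (fun n => by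
      split_ifs
      · intro y hy
        have := (τ'.hol V h' a 0 y hy.1).mono hV₁
        exact (contDiffAt_inv ℂ (show τ'.coeff V h' a 0 y ≠ 0 from hy.2)).contMDiffAt.comp_contMDiffWithinAt
          y this
      · exact contMDiffOn_const)
  have h1 : Set.EqOn (τ'.coeff V₁ (hV₁.trans h') (A.sheaf.res hV₁ a * e + -1) 0) (fun _ => 0) V₁ := by
    intro y hy
    rw [τ'.add _ _ _ _ _ hy]
    dsimp only
    rw [τ'.coeff_neg _ _ _ _ hy, τ'.coeff_mul_zero _ _ _ hy]
    dsimp only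
    rw [τ'.coeff_one_zero _ hy, he 0 hy, τ'.res V h' V₁ hV₁ a 0 hy]
    have : τ'.coeff V h' a 0 y ≠ 0 := hy.2
    simp [this]
  obtain ⟨r, hr, -⟩ := τ'.exists_eq_hbar_mul _ _ h1
  have h2 := congrArg (fun s => τ.coeff V₁ (hV₁.trans h) s 0 x) hr
  dsimp only at h2
  rw [τ.coeff_hbar_mul_zero _ _ hx₁, τ.add _ _ _ _ _ hx₁] at h2
  dsimp only at h2
  rw [τ.coeff_neg _ _ _ _ hx₁, τ.coeff_mul_zero _ _ _ hx₁] at h2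
  dsimp only at h2
  rw [τ.coeff_one_zero _ hx₁, τ.res V h V₁ hV₁ a 0 hx₁, ha] at h2
  norm_num at h2

/-- The symbol of a section does not depend on the trivialisation. -/
lemma coeff_zero_eq (τ' : StarTriv E A) {V : Opens X} (h : V ≤ τ.U) (h' : V ≤ τ'.U)
    (a : A.sheaf.obj.obj (op V)) : Set.EqOn (τ.coeff V h a 0) (τ'.coeff V h' a 0) V := by
  intro x hx
  have key : ∀ (σ : StarTriv E A) (hσ : V ≤ σ.U), σ.coeff V hσ
      (a + -(A.scal V (PowerSeries.C (τ.coeff V h a 0 x)) * 1)) 0 x =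
        σ.coeff V hσ a 0 x - τ.coeff V h a 0 x := by
    intro σ hσ
    rw [σ.add _ _ _ _ _ hx]
    dsimp only
    rw [σ.coeff_neg _ _ _ _ hx]
    dsimp only
    rw [σ.coeff_C _ _ _ _ _ hx]
    dsimp only
    rw [σ.coeff_one_zero _ hx]
    ring
  have h1 := τ.coeff_zero_eq_zero τ' h h' _ hx ((key τ h).trans (sub_self _))
  rw [key τ' h'] at h1
  exact (sub_eq_zero.1 h1).symm

end StarTriv

end StarAlgebra

/-! ### The coefficients of families -/

section FamilyCoefficients

variable {E : Type} [NormedAddCommGroup E] [NormedSpace ℂ E]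
  {X : Type u} [TopologicalSpace X] [ChartedSpace E X]
  {F H : Type} [NormedAddCommGroup F] [NormedSpace ℂ F] [TopologicalSpace H]
  (I : ModelWithCorners ℂ F H)
  {T : Type} [TopologicalSpace T] [ChartedSpace H T]

/-- Bidifferential operators in the variable of `X` preserve holomorphic dependence on
parameters. -/
lemma StarProduct.holOnProd_P [IsManifold I ω T] [IsManifold 𝓘(ℂ, E) ω X] {U : Opens X}
    (S : StarProduct E U) (i : ℕ) {f g : T × X → ℂ} {Ω : Set (T × X)} (hΩ : IsOpen Ω)
    (hU : ∀ p ∈ Ω, p.2 ∈ U) (hf : HolOnProd I E f Ω) (hg : HolOnProd I E g Ω) :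
    HolOnProd I E (fun p : T × X => S.P i (fun x => f (p.1, x)) (fun x => g (p.1, x)) p.2) Ω := by
  intro p₀ hp₀
  obtain ⟨V, hx, hVU, hVs, N, c, k, l, v, w, hc, hP⟩ := S.bidiff i p₀.2 (hU p₀ hp₀)
  let Ω' : Set (T × X) := Ω ∩ {p | p.2 ∈ V}
  have hΩ' : IsOpen Ω' := hΩ.inter (V.isOpen.preimage continuous_snd)
  refine ContMDiffAt.contMDiffWithinAt ?_
  refine ContMDiffOn.contMDiffAt (s := Ω') ?_ (hΩ'.mem_nhds ⟨hp₀, hx⟩)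
  have hformula : HolOnProd I E (fun p : T × X => ∑ r, c r p.2 *
      chartDeriv (chartAt E p₀.2) (v r) (fun x => f (p.1, x)) p.2 *
      chartDeriv (chartAt E p₀.2) (w r) (fun x => g (p.1, x)) p.2) Ω' := by
    refine contMDiffOn_finsetSum fun r _ => ?_
    refine ContMDiffOn.mul (ContMDiffOn.mul ?_ ?_) ?_
    · exact (hc r).comp contMDiffOn_snd (fun p hp => hp.2)
    · exact chartDeriv_family_hol I p₀.2 (v r) (f := fun t x => f (t, x)) hΩ'
        (fun p hp => hVs hp.2) (hf.mono fun p hp => hp.1)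
    · exact chartDeriv_family_hol I p₀.2 (w r) (f := fun t x => g (t, x)) hΩ'
        (fun p hp => hVs hp.2) (hg.mono fun p hp => hp.1)
  refine ContMDiffOn.congr hformula ?_
  rintro ⟨t, x⟩ hp
  let V' : Opens X := slice ⟨Ω', hΩ'⟩ t
  have hslice : ∀ {h : T × X → ℂ}, HolOnProd I E h Ω → HolOn E (fun x => h (t, x)) V' := fun hh =>
    ContMDiffOn.comp hh (f := fun x => (t, x)) (contMDiff_const.prodMk contMDiff_id).contMDiffOn
      fun y hy => hy.1
  exact hP V' (fun y hy => hy.2) _ _ (hslice hf) (hslice hg) x hp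

namespace StarTriv

variable {A : HbarAlgebra X} (τ : StarTriv E A) {W : Opens (T × X)}

lemma holOn_famCoeff (a : Fam T A.sheaf W) (n : ℕ) (t : T) :
    HolOn E (fun x => τ.famCoeff a n (t, x)) (slice W t ⊓ τ.U : Opens X) :=
  τ.hol _ inf_le_right (A.sheaf.res inf_le_left (a t)) n

lemma famCoeff_add (a b : Fam T A.sheaf W) (n : ℕ) :
    Set.EqOn (τ.famCoeff (a + b) n) (fun p => τ.famCoeff a n p + τ.famCoeff b n p) (τ.dom W) := by
  rintro ⟨t, x⟩ hp
  change τ.coeff _ _ (A.sheaf.res _ (a t + b t)) n x = _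
  rw [map_add]
  exact τ.add _ _ _ _ n hp

lemma famCoeff_zero (n : ℕ) :
    Set.EqOn (τ.famCoeff (0 : Fam T A.sheaf W) n) (fun _ => 0) (τ.dom W) := by
  rintro ⟨t, x⟩ hp
  change τ.coeff _ _ (A.sheaf.res _ 0) n x = _
  rw [map_zero]
  exact τ.coeff_zero _ _ n hp

lemma famCoeff_neg (a : Fam T A.sheaf W) (n : ℕ) :
    Set.EqOn (τ.famCoeff (-a) n) (fun p => -τ.famCoeff a n p) (τ.dom W) := by
  rintro ⟨t, x⟩ hp
  change τ.coeff _ _ (A.sheaf.res _ (-(a t))) n x = _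
  rw [map_neg]
  exact τ.coeff_neg _ _ _ n hp

lemma famCoeff_sum {ι : Type*} (s : Finset ι) (a : ι → Fam T A.sheaf W) (n : ℕ) {p : T × X}
    (hp : p ∈ τ.dom W) : τ.famCoeff (∑ i ∈ s, a i) n p = ∑ i ∈ s, τ.famCoeff (a i) n p := by
  classical
  induction s using Finset.induction_on with
  | empty => simpa using τ.famCoeff_zero n hp
  | insert i s hi ih =>
    rw [Finset.sum_insert hi, Finset.sum_insert hi, ← ih]
    exact τ.famCoeff_add _ _ n hp

lemma famCoeff_mul (a b : Fam T A.sheaf W) (n : ℕ) :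
    Set.EqOn (τ.famCoeff (a * b) n) (fun p => starCoeff τ.star.P
      (fun j x => τ.famCoeff a j (p.1, x)) (fun j x => τ.famCoeff b j (p.1, x)) n p.2)
      (τ.dom W) := by
  rintro ⟨t, x⟩ hp
  change τ.coeff _ _ (A.sheaf.res _ (a t * b t)) n x = _
  rw [map_mul]
  exact τ.mul _ _ _ _ n hp

lemma famCoeff_mul_zero (a b : Fam T A.sheaf W) :
    Set.EqOn (τ.famCoeff (a * b) 0) (fun p => τ.famCoeff a 0 p * τ.famCoeff b 0 p) (τ.dom W) := by
  rintro ⟨t, x⟩ hp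
  change τ.coeff _ _ (A.sheaf.res _ (a t * b t)) 0 x = _
  rw [map_mul]
  exact τ.coeff_mul_zero _ _ _ hp

/-- The product of a family by a function of the parameter. -/
noncomputable def _root_.Fam.smul (f : T → ℂ) (a : Fam T A.sheaf W) : Fam T A.sheaf W :=
  fun t => A.scal _ (PowerSeries.C (f t)) * a t

lemma famCoeff_smul (f : T → ℂ) (a : Fam T A.sheaf W) (n : ℕ) :
    Set.EqOn (τ.famCoeff (Fam.smul f a) n) (fun p => f p.1 * τ.famCoeff a n p) (τ.dom W) := by
  rintro ⟨t, x⟩ hp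
  change τ.coeff _ _ (A.sheaf.res _ (A.scal _ _ * a t)) n x = _
  rw [map_mul, A.scal_res]
  exact τ.coeff_C _ _ _ _ n hp

lemma famCoeff_one_zero :
    Set.EqOn (τ.famCoeff (1 : Fam T A.sheaf W) 0) (fun _ => 1) (τ.dom W) := by
  rintro ⟨t, x⟩ hp
  change τ.coeff _ _ (A.sheaf.res _ 1) 0 x = _
  rw [map_one]
  exact τ.coeff_one_zero _ hp

lemma famCoeff_hbar_mul_zero (a : Fam T A.sheaf W) :
    Set.EqOn (τ.famCoeff (A.hbarFam W * a) 0) (fun _ => 0) (τ.dom W) := by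
  rintro ⟨t, x⟩ hp
  change τ.coeff _ _ (A.sheaf.res _ (A.hbar _ * a t)) 0 x = _
  rw [map_mul, A.hbar_res]
  exact τ.coeff_hbar_mul_zero _ _ hp

lemma famCoeff_hbar_mul_succ (a : Fam T A.sheaf W) (n : ℕ) :
    Set.EqOn (τ.famCoeff (A.hbarFam W * a) (n + 1)) (τ.famCoeff a n) (τ.dom W) := by
  rintro ⟨t, x⟩ hp
  change τ.coeff _ _ (A.sheaf.res _ (A.hbar _ * a t)) (n + 1) x = _
  rw [map_mul, A.hbar_res]
  exact τ.coeff_hbar_mul_succ _ _ n hp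

/-- The symbol of a family does not depend on the trivialisation. -/
lemma famCoeff_zero_eq (τ' : StarTriv E A) (a : Fam T A.sheaf W) {p : T × X} (hp : p ∈ τ.dom W)
    (hp' : p.2 ∈ τ'.U) : τ.famCoeff a 0 p = τ'.famCoeff a 0 p := by
  obtain ⟨t, x⟩ := p
  let V : Opens X := slice W t ⊓ τ.U ⊓ τ'.U
  have hx : x ∈ V := ⟨hp, hp'⟩
  have hV : V ≤ slice W t ⊓ τ.U := inf_le_left
  have hV' : V ≤ slice W t ⊓ τ'.U := le_inf (hV.trans inf_le_left) inf_le_right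
  have h1 := τ.res _ inf_le_right V hV (A.sheaf.res inf_le_left (a t)) 0 hx
  have h2 := τ'.res _ inf_le_right V hV' (A.sheaf.res inf_le_left (a t)) 0 hx
  rw [A.sheaf.res_res] at h1 h2
  exact h1.symm.trans ((τ.coeff_zero_eq τ' _ _ _ hx).trans h2)

/-- The coefficients of a section, compared with those of a family that has it as its value. -/
lemma famCoeff_apply (a : Fam T A.sheaf W) (n : ℕ) {t : T} {V : Opens X} (hV : V ≤ τ.U)
    (hVW : V ≤ slice W t) {x : X} (hx : x ∈ V) :
    τ.famCoeff a n (t, x) = τ.coeff V hV (A.sheaf.res hVW (a t)) n x := by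
  have := τ.res (slice W t ⊓ τ.U) inf_le_right V (le_inf hVW hV) (A.sheaf.res inf_le_left (a t)) n hx
  rw [A.sheaf.res_res] at this
  exact this.symm

lemma fam_ext (hW : ∀ p ∈ W, p.2 ∈ τ.U) {a b : Fam T A.sheaf W}
    (h : ∀ n, Set.EqOn (τ.famCoeff a n) (τ.famCoeff b n) W) : a = b := by
  funext t
  have ht : slice W t ≤ τ.U := fun x hx => hW (t, x) hx
  refine τ.injective _ ht _ _ fun n x hx => ?_
  have h1 := h n (show (t, x) ∈ W from hx)
  rw [τ.famCoeff_apply a n ht le_rfl hx, τ.famCoeff_apply b n ht le_rfl hx, A.sheaf.res_self,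
    A.sheaf.res_self] at h1
  exact h1

lemma exists_fam (hW : ∀ p ∈ W, p.2 ∈ τ.U) (f : ℕ → T × X → ℂ)
    (hf : ∀ n, HolOnProd I E (f n) W) :
    ∃ a : Fam T A.sheaf W, ∀ n, Set.EqOn (τ.famCoeff a n) (f n) W := by
  have ht : ∀ t, slice W t ≤ τ.U := fun t x hx => hW (t, x) hx
  have h1 : ∀ t, ∃ a, ∀ n, Set.EqOn (τ.coeff (slice W t) (ht t) a n) (fun x => f n (t, x))
      (slice W t) := fun t => τ.surjective _ (ht t) (fun n x => f n (t, x)) fun n =>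
    ContMDiffOn.comp (hf n) (f := fun x => (t, x))
      (contMDiff_const.prodMk contMDiff_id).contMDiffOn fun y hy => hy
  choose a ha using h1
  refine ⟨a, fun n => ?_⟩
  rintro ⟨t, x⟩ hx
  rw [τ.famCoeff_apply a n (ht t) le_rfl hx, A.sheaf.res_self]
  exact ha t n hx

lemma exists_fam_eq_hbar_mul (hW : ∀ p ∈ W, p.2 ∈ τ.U) (a : Fam T A.sheaf W)
    (ha : ∀ p ∈ W, τ.famCoeff a 0 p = 0) : ∃ y : Fam T A.sheaf W, a = A.hbarFam W * y ∧
      ∀ n, Set.EqOn (τ.famCoeff y n) (τ.famCoeff a (n + 1)) W := by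
  have ht : ∀ t, slice W t ≤ τ.U := fun t x hx => hW (t, x) hx
  have h1 : ∀ t, ∃ y, a t = A.hbar (slice W t) * y ∧ ∀ n, Set.EqOn (τ.coeff _ (ht t) y n)
      (τ.coeff _ (ht t) (a t) (n + 1)) (slice W t) := fun t =>
    τ.exists_eq_hbar_mul (ht t) (a t) fun x hx => by
      have := ha (t, x) hx
      rwa [τ.famCoeff_apply a 0 (ht t) le_rfl hx, A.sheaf.res_self] at this
  choose y hy hy' using h1
  refine ⟨y, funext hy, fun n => ?_⟩
  rintro ⟨t, x⟩ hx
  rw [τ.famCoeff_apply _ _ (ht t) le_rfl hx, τ.famCoeff_apply _ _ (ht t) le_rfl hx,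
    A.sheaf.res_self, A.sheaf.res_self]
  exact hy' t n hx

/-- Reparametrisation of a family along a map of the parameter spaces. -/
def _root_.Fam.reparam {T' : Type} [TopologicalSpace T'] {G : RingSheaf (TopCat.of X)} (g : T' → T)
    {W' : Opens (T' × X)} (hW : ∀ t, slice W' t ≤ slice W (g t)) (a : Fam T G W) : Fam T' G W' :=
  fun t => G.res (hW t) (a (g t))

lemma famCoeff_reparam {T' : Type} [TopologicalSpace T'] (g : T' → T)
    {W' : Opens (T' × X)} (hW : ∀ t, slice W' t ≤ slice W (g t)) (a : Fam T A.sheaf W) (n : ℕ) :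
    Set.EqOn (τ.famCoeff (Fam.reparam g hW a) n) (fun p => τ.famCoeff a n (g p.1, p.2))
      (τ.dom W') := by
  rintro ⟨t, x⟩ ⟨h1, h2⟩
  dsimp only
  rw [τ.famCoeff_apply (t := g t) (V := slice W' t ⊓ τ.U) a n inf_le_right
    (inf_le_left.trans (hW t)) ⟨h1, h2⟩]
  change τ.coeff _ _ (A.sheaf.res _ (A.sheaf.res _ (a (g t)))) n x = _
  rw [A.sheaf.res_res]

end StarTriv

end FamilyCoefficients

/-! ### Independence of the trivialisation -/

section Transfer

variable {E : Type} [NormedAddCommGroup E] [NormedSpace ℂ E] [FiniteDimensional ℂ E]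
  {X : Type u} [TopologicalSpace X] [ChartedSpace E X] [IsManifold 𝓘(ℂ, E) ω X]
  {A : HbarAlgebra X}

namespace StarTriv

variable {F H : Type} [NormedAddCommGroup F] [NormedSpace ℂ F] [TopologicalSpace H]
  (I : ModelWithCorners ℂ F H) {T : Type} [TopologicalSpace T] [ChartedSpace H T]
  (τ : StarTriv E A) {W : Opens (T × X)}

/-- The family `a` has holomorphic coefficients with respect to the trivialisation `τ`. -/
def HolCoeff (a : Fam T A.sheaf W) : Prop :=
  ∀ n, HolOnProd I E (τ.famCoeff a n) (τ.dom W)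

variable {I τ}

lemma HolCoeff.add {a b : Fam T A.sheaf W} (ha : τ.HolCoeff I a) (hb : τ.HolCoeff I b) :
    τ.HolCoeff I (a + b) := fun n =>
  ContMDiffOn.congr ((ha n).add (hb n)) (τ.famCoeff_add a b n)

lemma HolCoeff.neg {a : Fam T A.sheaf W} (ha : τ.HolCoeff I a) : τ.HolCoeff I (-a) := fun n =>
  ContMDiffOn.congr ((contDiff_neg.contMDiff (n := ω)).comp_contMDiffOn (ha n))
    (τ.famCoeff_neg a n)

lemma HolCoeff.sum {ι : Type*} (s : Finset ι) {a : ι → Fam T A.sheaf W}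
    (ha : ∀ i ∈ s, τ.HolCoeff I (a i)) : τ.HolCoeff I (∑ i ∈ s, a i) := fun n =>
  ContMDiffOn.congr (contMDiffOn_finsetSum fun i hi => ha i hi n)
    fun _ hp => τ.famCoeff_sum s a n hp

lemma HolCoeff.mul [IsManifold I ω T] {a b : Fam T A.sheaf W} (ha : τ.HolCoeff I a)
    (hb : τ.HolCoeff I b) : τ.HolCoeff I (a * b) := by
  intro n
  refine ContMDiffOn.congr ?_ (τ.famCoeff_mul a b n)
  refine contMDiffOn_finsetSum fun i _ => contMDiffOn_finsetSum fun j _ => ?_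
  exact τ.star.holOnProd_P I i.1 (τ.isOpen_dom W) (fun _ hp => hp.2) (ha j.1) (hb j.2)

lemma HolCoeff.reparam {F' H' : Type} [NormedAddCommGroup F'] [NormedSpace ℂ F']
    [TopologicalSpace H'] {I' : ModelWithCorners ℂ F' H'} {T' : Type} [TopologicalSpace T']
    [ChartedSpace H' T'] {a : Fam T A.sheaf W} (ha : τ.HolCoeff I a) (g : T' → T)
    (hg : ContMDiff I' I ω g) {W' : Opens (T' × X)} (hW : ∀ t, slice W' t ≤ slice W (g t)) :
    τ.HolCoeff I' (Fam.reparam g hW a) := by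
  intro n
  refine ContMDiffOn.congr ?_ (τ.famCoeff_reparam g hW a n)
  exact ContMDiffOn.comp (g := τ.famCoeff a n) (f := fun p : T' × X => (g p.1, p.2)) (ha n)
    ((hg.comp contMDiff_fst).prodMk contMDiff_snd).contMDiffOn (fun p hp => ⟨hW p.1 hp.1, hp.2⟩)

/-- A coefficient of a product `u * v` is holomorphic where the symbol of `u` vanishes if the
coefficients of `v` of lower order are. -/
lemma holOnProd_famCoeff_mul_comp [IsManifold I ω T] {u v : Fam T A.sheaf W}
    (hu : τ.HolCoeff I u) (n : ℕ) (hv : ∀ k < n, HolOnProd I E (τ.famCoeff v k) (τ.dom W)) :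
    ∃ f : T × X → ℂ, HolOnProd I E f (τ.dom W) ∧ ∀ p ∈ τ.dom W, τ.famCoeff u 0 p = 0 →
      τ.famCoeff (u * v) n p = f p := by
  refine ⟨fun p => ∑ i ∈ Finset.HasAntidiagonal.antidiagonal n,
    ∑ j ∈ Finset.HasAntidiagonal.antidiagonal i.2, if j.2 < n then τ.star.P i.1
      (fun x => τ.famCoeff u j.1 (p.1, x)) (fun x => τ.famCoeff v j.2 (p.1, x)) p.2 else 0, ?_, ?_⟩
  · refine contMDiffOn_finsetSum fun i _ => contMDiffOn_finsetSum fun j _ => ?_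
    split_ifs with h
    · exact τ.star.holOnProd_P I i.1 (τ.isOpen_dom W) (fun _ hp => hp.2) (hu j.1) (hv _ h)
    · exact contMDiffOn_const
  · rintro ⟨t, x⟩ hp h0
    rw [τ.famCoeff_mul u v n hp]
    exact τ.star.starCoeff_eq_of_mul_eq_zero (V := slice W t ⊓ τ.U) inf_le_right
      (fun k => τ.holOn_famCoeff u k t) (fun k => τ.holOn_famCoeff v k t) n hp
      (by rw [h0, zero_mul])

variable (τ)

/-- A family `a` with holomorphic coefficients with respect to `τ` decomposes, after adding a point
`η` of a chart to the parameters, into a family that is holomorphic with respect to all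
trivialisations, a combination of families whose symbols vanish on the diagonal, and a multiple of
`ħ`. -/
lemma exists_symbol_decomposition [I.Boundaryless] [FiniteDimensional ℂ F] [IsManifold I ω T]
    (x₀ : X) {D : Set T} {B : Set E} (hD : IsOpen D) (hB : IsOpen B) (hconv : Convex ℝ B)
    (hBt : B ⊆ (chartAt E x₀).target) {a : Fam T A.sheaf W} (ha : τ.HolCoeff I a)
    (hDB : ∀ t ∈ D, ∀ ξ ∈ B, (t, (chartAt E x₀).symm ξ) ∈ τ.dom W)
    (hDne : D.Nonempty) {W' : Opens ((T × E) × X)}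
    (hW' : (W' : Set ((T × E) × X)) = chartDomain (chartAt E x₀) D B)
    (hg : ∀ t, slice W' t ≤ slice W t.1) :
    ∃ (k y : Fam (T × E) A.sheaf W') (u v : Fin (Module.finrank ℂ E) → Fam (T × E) A.sheaf W'),
      IsHolFam E (I.prod 𝓘(ℂ, E)) k ∧ (∀ i, IsHolFam E (I.prod 𝓘(ℂ, E)) (u i)) ∧
      (∀ i, τ.HolCoeff (I.prod 𝓘(ℂ, E)) (v i)) ∧ τ.HolCoeff (I.prod 𝓘(ℂ, E)) y ∧
      (∀ i, ∀ p ∈ W', p.1.2 = chartAt E x₀ p.2 → τ.famCoeff (u i) 0 p = 0) ∧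
      Fam.reparam Prod.fst hg a = k + ∑ i, u i * v i + A.hbarFam W' * y := by
  set e := chartAt E x₀ with he
  obtain ⟨g, hghol, hgeq⟩ := exists_hadamard I x₀ hD hB hconv hBt (ha 0) hDB
  have hmem : ∀ {p : (T × E) × X}, p ∈ W' ↔ p ∈ chartDomain e D B := fun {p} => by
    rw [← hW']; rfl
  have hWU : ∀ p ∈ W', p.2 ∈ τ.U := by
    intro p hp
    have hp' := hmem.1 hp
    have := hDB p.1.1 hp'.1 _ hp'.2.2.2
    rw [e.left_inv hp'.2.2.1] at this
    exact this.2
  have hdom : τ.dom W' = W' := Set.ext fun p => ⟨fun h => h.1, fun h => ⟨h, hWU p h⟩⟩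
  obtain ⟨t₁, ht₁⟩ := hDne
  let V₀ : Opens X := ⟨e.source ∩ e ⁻¹' B, e.isOpen_inter_preimage hB⟩
  have hV₀ : V₀ ≤ τ.U := by
    intro x hx
    have := hDB t₁ ht₁ _ hx.2
    rw [e.left_inv hx.1] at this
    exact this.2
  have hslice : ∀ t, slice W' t ≤ V₀ := fun t x hx => (hmem.1 hx).2.2
  let b := Module.finBasis ℂ E
  have hcoord : ∀ i, ContDiff ℂ ω (fun v : E => b.coord i v) := fun i =>
    (LinearMap.toContinuousLinearMap (b.coord i)).contDiff
  -- the sections whose only coefficient is the `i`-th coordinate function of the chart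
  have hw : ∀ i, ∃ w : A.sheaf.obj.obj (op V₀), ∀ n, Set.EqOn (τ.coeff V₀ hV₀ w n)
      (fun x => if n = 0 then b.coord i (e x) else 0) V₀ := fun i =>
    τ.surjective V₀ hV₀ _ fun n => by
      split_ifs
      · exact (hcoord i).contMDiff.comp_contMDiffOn
          ((contMDiffOn_chart (I := 𝓘(ℂ, E)) (x := x₀)).mono fun x hx => hx.1)
      · exact contMDiffOn_const
  choose w hw using hw
  let u₁ : Fin (Module.finrank ℂ E) → Fam (T × E) A.sheaf W' := fun i t =>
    A.sheaf.res (hslice t) (w i)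
  let u₂ : Fin (Module.finrank ℂ E) → Fam (T × E) A.sheaf W' := fun i =>
    Fam.smul (fun t => b.coord i t.2) 1
  have hu₁ : ∀ i, IsHolFam E (I.prod 𝓘(ℂ, E)) (u₁ i) := fun i => IsHolFam.const _ (w i) W' hslice
  have hu₂ : ∀ i, IsHolFam E (I.prod 𝓘(ℂ, E)) (u₂ i) := fun i =>
    IsHolFam.smul _ (IsHolFam.one _) _ (S := Set.univ)
      ((hcoord i).contMDiff.comp contMDiff_snd).contMDiffOn fun _ _ => trivial
  let u : Fin (Module.finrank ℂ E) → Fam (T × E) A.sheaf W' := fun i => u₁ i + -u₂ i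
  have hu : ∀ i, IsHolFam E (I.prod 𝓘(ℂ, E)) (u i) := fun i => (hu₁ i).add _ ((hu₂ i).neg _)
  have hu0 : ∀ i, ∀ p ∈ W', τ.famCoeff (u i) 0 p = b.coord i (e p.2 - p.1.2) := by
    rintro i ⟨t, x⟩ hp
    have hp' : (t, x) ∈ τ.dom W' := hdom ▸ hp
    have hx : x ∈ V₀ := hslice t hp
    rw [τ.famCoeff_add _ _ 0 hp']
    dsimp only
    rw [τ.famCoeff_neg _ 0 hp']
    dsimp only
    rw [τ.famCoeff_smul _ _ 0 hp']
    dsimp only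
    rw [τ.famCoeff_one_zero hp', mul_one, map_sub, ← sub_eq_add_neg]
    congr 1
    rw [τ.famCoeff_apply (u₁ i) 0 (V := slice W' t) ((hslice t).trans hV₀) le_rfl hp,
      A.sheaf.res_self, τ.res V₀ hV₀ _ (hslice t) (w i) 0 hp, hw i 0 hx]
    exact if_pos rfl
  have hv : ∀ i, ∃ v : Fam (T × E) A.sheaf W', ∀ n, Set.EqOn (τ.famCoeff v n)
      (fun p => if n = 0 then g i p else 0) W' := fun i =>
    τ.exists_fam (I.prod 𝓘(ℂ, E)) hWU _ fun n => by
      split_ifs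
      · rw [hW']
        exact hghol i
      · exact contMDiffOn_const
  choose v hv using hv
  have hvhol : ∀ i, τ.HolCoeff (I.prod 𝓘(ℂ, E)) (v i) := by
    intro i n
    rw [hdom]
    refine ContMDiffOn.congr ?_ (hv i n)
    split_ifs
    · rw [hW']
      exact hghol i
    · exact contMDiffOn_const
  let k : Fam (T × E) A.sheaf W' := Fam.smul (fun t => τ.famCoeff a 0 (t.1, e.symm t.2)) 1
  have hk : IsHolFam E (I.prod 𝓘(ℂ, E)) k := by
    refine IsHolFam.smul _ (IsHolFam.one _) _ (S := D ×ˢ B) ?_ fun p hp =>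
      ⟨(hmem.1 hp).1, (hmem.1 hp).2.1⟩
    have hsymm : ContMDiffOn 𝓘(ℂ, E) 𝓘(ℂ, E) ω e.symm e.target := contMDiffOn_chart_symm
    exact ContMDiffOn.comp (g := τ.famCoeff a 0) (f := fun p : T × E => (p.1, e.symm p.2)) (ha 0)
      (contMDiffOn_fst.prodMk (hsymm.comp contMDiffOn_snd fun p hp => hBt hp.2))
      fun p hp => hDB _ hp.1 _ hp.2
  have hrhol : τ.HolCoeff (I.prod 𝓘(ℂ, E)) (Fam.reparam Prod.fst hg a + -(k + ∑ i, u i * v i)) :=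
    (ha.reparam _ contMDiff_fst hg).add (HolCoeff.neg ((show τ.HolCoeff _ k from hk τ).add
      (HolCoeff.sum _ fun i _ => (show τ.HolCoeff _ (u i) from hu i τ).mul (hvhol i))))
  obtain ⟨y, hy, hy'⟩ := τ.exists_fam_eq_hbar_mul hWU
    (Fam.reparam Prod.fst hg a + -(k + ∑ i, u i * v i)) (by
      intro p hp
      have hp' : p ∈ τ.dom W' := hdom ▸ hp
      rw [τ.famCoeff_add _ _ 0 hp']
      dsimp only
      rw [τ.famCoeff_neg _ 0 hp']
      dsimp only
      rw [τ.famCoeff_add _ _ 0 hp', τ.famCoeff_reparam _ hg a 0 hp']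
      dsimp only
      rw [τ.famCoeff_smul _ _ 0 hp', τ.famCoeff_sum _ _ 0 hp']
      dsimp only
      rw [τ.famCoeff_one_zero hp', mul_one]
      have h1 : ∀ i, τ.famCoeff (u i * v i) 0 p = b.coord i (e p.2 - p.1.2) * g i p := by
        intro i
        rw [τ.famCoeff_mul_zero _ _ hp']
        dsimp only
        rw [hu0 i p hp, hv i 0 hp]
        rfl
      simp only [h1]
      have h2 := hgeq p (hmem.1 hp)
      rw [← h2]
      ring)
  refine ⟨k, y, u, v, hk, hu, hvhol, ?_, ?_, ?_⟩
  · intro n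
    have := hrhol (n + 1)
    rw [hdom] at this ⊢
    exact ContMDiffOn.congr this (hy' n)
  · intro i p hp hpe
    rw [hu0 i p hp, hpe, sub_self, map_zero]
  · rw [← hy]
    abel

end StarTriv

open StarTriv

/-- A family with holomorphic coefficients with respect to one trivialisation has holomorphic
coefficients with respect to all trivialisations, where both are defined. -/
theorem StarTriv.holOnProd_famCoeff_of_holCoeff (τ τ' : StarTriv E A) (n : ℕ) :
    ∀ {F H : Type} [NormedAddCommGroup F] [NormedSpace ℂ F] [FiniteDimensional ℂ F]
      [TopologicalSpace H] (I : ModelWithCorners ℂ F H) [I.Boundaryless]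
      {T : Type} [TopologicalSpace T] [ChartedSpace H T] [IsManifold I ω T] {W : Opens (T × X)}
      (a : Fam T A.sheaf W), τ.HolCoeff I a →
      HolOnProd I E (τ'.famCoeff a n) (τ.dom W ∩ {p | p.2 ∈ τ'.U}) := by
  induction n using Nat.strong_induction_on with
  | _ n ih =>
  intro F H _ _ _ _ I _ T _ _ _ W a ha p₀ hp₀
  obtain ⟨t₀, x₀⟩ := p₀
  have hΩ : IsOpen (τ.dom W ∩ {p | p.2 ∈ τ'.U}) :=
    (τ.isOpen_dom W).inter (τ'.U.isOpen.preimage continuous_snd)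
  obtain ⟨D, ρ, hρ, hD, htD, hBt, hDB⟩ := exists_chart_ball (E := E) hΩ hp₀
  set e := chartAt E x₀ with he
  set B := Metric.ball (e x₀) ρ with hB
  let W' : Opens ((T × E) × X) := ⟨chartDomain e D B, isOpen_chartDomain e hD Metric.isOpen_ball⟩
  have hback : ∀ p ∈ W', (p.1.1, p.2) ∈ τ.dom W ∩ {p | p.2 ∈ τ'.U} := by
    rintro p hp
    have := hDB p.1.1 hp.1 _ hp.2.2.2
    rwa [e.left_inv hp.2.2.1] at this
  have hg : ∀ t, slice W' t ≤ slice W t.1 := fun t x hx => (hback (t, x) hx).1.1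
  obtain ⟨k, y, u, v, hk, hu, hv, hy, hu0, hdec⟩ := τ.exists_symbol_decomposition (I := I) x₀ hD
    Metric.isOpen_ball (convex_ball _ _) hBt ha (fun t ht ξ hξ => (hDB t ht ξ hξ).1) ⟨t₀, htD⟩
    (W' := W') rfl hg
  have hdom : ∀ p ∈ W', p ∈ τ.dom W' := fun p hp => ⟨hp, (hback p hp).1.2⟩
  have hdom' : ∀ p ∈ W', p ∈ τ'.dom W' := fun p hp => ⟨hp, (hback p hp).2⟩
  -- the induction hypothesis applies to the factors `v i` and to `y`
  have hlow : ∀ j < n, ∀ c : Fam (T × E) A.sheaf W', τ.HolCoeff (I.prod 𝓘(ℂ, E)) c →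
      HolOnProd (I.prod 𝓘(ℂ, E)) E (τ'.famCoeff c j) (τ'.dom W') := fun j hj c hc =>
    (ih j hj (I.prod 𝓘(ℂ, E)) c hc).mono fun p hp => ⟨hdom p hp.1, hp.2⟩
  have hmul : ∀ i, ∃ f : (T × E) × X → ℂ, HolOnProd (I.prod 𝓘(ℂ, E)) E f (τ'.dom W') ∧
      ∀ p ∈ τ'.dom W', τ'.famCoeff (u i) 0 p = 0 → τ'.famCoeff (u i * v i) n p = f p := fun i =>
    holOnProd_famCoeff_mul_comp (τ := τ') (hu i τ') n fun j hj => hlow j hj _ (hv i)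
  choose f hf hf' using hmul
  have hyn : HolOnProd (I.prod 𝓘(ℂ, E)) E (τ'.famCoeff (A.hbarFam W' * y) n) (τ'.dom W') := by
    cases n with
    | zero => exact contMDiffOn_const.congr (τ'.famCoeff_hbar_mul_zero y)
    | succ n => exact (hlow n (Nat.lt_succ_self n) y hy).congr (τ'.famCoeff_hbar_mul_succ y n)
  have hsum : HolOnProd (I.prod 𝓘(ℂ, E)) E (fun p => τ'.famCoeff k n p + ∑ i, f i p +
      τ'.famCoeff (A.hbarFam W' * y) n p) (τ'.dom W') :=
    ((hk τ' n).add (contMDiffOn_finsetSum fun i _ => hf i)).add hyn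
  let N : Set (T × X) := {p | p.1 ∈ D ∧ p.2 ∈ e.source ∩ e ⁻¹' B}
  have hN : IsOpen N := (hD.preimage continuous_fst).inter
    ((e.isOpen_inter_preimage Metric.isOpen_ball).preimage continuous_snd)
  have hNW : ∀ p ∈ N, ((p.1, e p.2), p.2) ∈ W' := fun p hp => ⟨hp.1, hp.2.2, hp.2.1, hp.2.2⟩
  have hchart : ContMDiffOn 𝓘(ℂ, E) 𝓘(ℂ, E) ω e e.source := contMDiffOn_chart
  have hfin := ContMDiffOn.comp (I := I.prod 𝓘(ℂ, E)) (f := fun p : T × X => ((p.1, e p.2), p.2))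
    (s := N) hsum
    ((contMDiffOn_fst.prodMk (hchart.comp contMDiffOn_snd fun p hp => hp.2.1)).prodMk
      contMDiffOn_snd) fun p hp => hdom' _ (hNW p hp)
  refine ContMDiffAt.contMDiffWithinAt ?_
  refine ContMDiffOn.contMDiffAt (s := N) ?_ (hN.mem_nhds
    ⟨htD, mem_chart_source E x₀, Metric.mem_ball_self hρ⟩)
  refine hfin.congr fun p hp => ?_
  have hp' := hNW p hp
  have h1 := τ'.famCoeff_reparam Prod.fst hg a n (hdom' _ hp')
  dsimp only at h1
  rw [← h1, hdec, τ'.famCoeff_add _ _ n (hdom' _ hp')]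
  dsimp only
  rw [τ'.famCoeff_add _ _ n (hdom' _ hp')]
  dsimp only
  rw [τ'.famCoeff_sum _ _ n (hdom' _ hp')]
  change _ + _ + _ = _ + _ + _
  congr 2
  refine Finset.sum_congr rfl fun i _ => hf' i _ (hdom' _ hp') ?_
  rw [← τ.famCoeff_zero_eq τ' (u i) (hdom _ hp') (hdom' _ hp').2]
  exact hu0 i _ hp' rfl

/-- Holomorphy of a family can be checked in one trivialisation. -/
theorem StarTriv.isHolFam_of_holCoeff {F H : Type} [NormedAddCommGroup F] [NormedSpace ℂ F]
    [FiniteDimensional ℂ F] [TopologicalSpace H] (I : ModelWithCorners ℂ F H) [I.Boundaryless]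
    {T : Type} [TopologicalSpace T] [ChartedSpace H T] [IsManifold I ω T] {W : Opens (T × X)}
    (τ : StarTriv E A) (hW : ∀ p ∈ W, p.2 ∈ τ.U) {a : Fam T A.sheaf W} (ha : τ.HolCoeff I a) :
    IsHolFam E I a := fun τ' n =>
  (τ.holOnProd_famCoeff_of_holCoeff τ' n I a ha).mono fun p hp => ⟨⟨hp.1, hW p hp.1⟩, hp.2⟩

/-- Existence of holomorphic families with given coefficients. -/
theorem StarTriv.exists_isHolFam {F H : Type} [NormedAddCommGroup F] [NormedSpace ℂ F]
    [FiniteDimensional ℂ F] [TopologicalSpace H] (I : ModelWithCorners ℂ F H) [I.Boundaryless]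
    {T : Type} [TopologicalSpace T] [ChartedSpace H T] [IsManifold I ω T] {W : Opens (T × X)}
    (τ : StarTriv E A) (hW : ∀ p ∈ W, p.2 ∈ τ.U) (f : ℕ → T × X → ℂ)
    (hf : ∀ n, HolOnProd I E (f n) W) : ∃ a : Fam T A.sheaf W, IsHolFam E I a ∧
      ∀ n, Set.EqOn (τ.famCoeff a n) (f n) W := by
  obtain ⟨a, ha⟩ := τ.exists_fam I hW f hf
  refine ⟨a, τ.isHolFam_of_holCoeff I hW fun n => ?_, ha⟩
  exact ((hf n).mono fun p hp => hp.1).congr fun p hp => ha n hp.1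

end Transfer

/-! ### Division and decomposition of holomorphic families -/

section FamilyDivision

variable {E : Type} [NormedAddCommGroup E] [NormedSpace ℂ E] [FiniteDimensional ℂ E]
  {X : Type u} [TopologicalSpace X] [ChartedSpace E X] [IsManifold 𝓘(ℂ, E) ω X]

/-- A family that vanishes for `t₁ = h(t₂)` is locally a multiple of `t₁ - h(t₂)`. -/
lemma DQAlgebra.exists_fam_quotient (A : DQAlgebra E X) (h : ℂˣ → ℂˣ)
    (hh : ContMDiff 𝓘(ℂ, ℂ) 𝓘(ℂ, ℂ) ω h) {W : Opens ((ℂˣ × ℂˣ) × X)} {t : ℂˣ} {x₀ : X}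
    (hp : ((h t, t), x₀) ∈ W) : ∃ (W' : Opens ((ℂˣ × ℂˣ) × X)) (hW : W' ≤ W),
      ((h t, t), x₀) ∈ W' ∧ ∀ a : Fam (ℂˣ × ℂˣ) A.sheaf W,
        IsHolFam E (𝓘(ℂ, ℂ).prod 𝓘(ℂ, ℂ)) a → (∀ s, a (h s, s) = 0) →
        ∃ q : Fam (ℂˣ × ℂˣ) A.sheaf W', IsHolFam E (𝓘(ℂ, ℂ).prod 𝓘(ℂ, ℂ)) q ∧
          Fam.res hW a = Fam.smul (fun s : ℂˣ × ℂˣ => (s.1 : ℂ) - h s.2) q := by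
  obtain ⟨τ, hτ⟩ := A.locally_star x₀
  obtain ⟨Ω, hΩ, hpΩ, hΩW, hq⟩ := exists_nhds_quotient (E := E) h hh (τ.isOpen_dom W) (t := t)
    (x₀ := x₀) ⟨hp, hτ⟩
  let W' : Opens ((ℂˣ × ℂˣ) × X) := ⟨Ω, hΩ⟩
  have hW : W' ≤ W := fun p hp => (hΩW hp).1
  have hU : ∀ p ∈ W', p.2 ∈ τ.U := fun p hp => (hΩW hp).2
  refine ⟨W', hW, hpΩ, fun a ha ha0 => ?_⟩
  have hq' := fun n => hq (τ.famCoeff a n) (ha τ n) (fun s x hx => by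
    rw [τ.famCoeff_apply a n (V := slice W (h s, s) ⊓ τ.U) inf_le_right inf_le_left hx, ha0 s,
      map_zero]
    exact τ.coeff_zero _ _ n hx)
  choose q hqh hqe using hq'
  obtain ⟨Q, hQ, hQe⟩ := τ.exists_isHolFam (𝓘(ℂ, ℂ).prod 𝓘(ℂ, ℂ)) (W := W') hU q hqh
  refine ⟨Q, hQ, τ.fam_ext hU fun n p hp => ?_⟩
  have hp' : p ∈ τ.dom W' := ⟨hp, hU p hp⟩
  rw [τ.famCoeff_res hW a n hp', τ.famCoeff_smul _ _ n hp']
  dsimp only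
  rw [hQe n hp]
  exact hqe n p hp

/-- Near `t₁ = 1` each family `b(t₁, t₂)` is the sum of `c(t₁ t₂)`, with `c(t) = 0`, of a family that
depends on `t₂` only, and of a multiple of `(t₁ - 1)²`. -/
lemma DQAlgebra.exists_fam_decomposition (A : DQAlgebra E X) {W : Opens ((ℂˣ × ℂˣ) × X)} {t : ℂˣ}
    {x₀ : X} (hp : ((1, t), x₀) ∈ W) : ∃ (W₁ : Opens (ℂˣ × X)) (W₂ : Opens ((ℂˣ × ℂˣ) × X))
      (hW : W₂ ≤ W) (h₁ : ∀ s : ℂˣ × ℂˣ, slice W₂ s ≤ slice W₁ (s.1 * s.2))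
      (h₂ : ∀ s : ℂˣ × ℂˣ, slice W₂ s ≤ slice W₁ s.2),
      (t, x₀) ∈ W₁ ∧ ((1, t), x₀) ∈ W₂ ∧ ∀ b : Fam (ℂˣ × ℂˣ) A.sheaf W,
        IsHolFam E (𝓘(ℂ, ℂ).prod 𝓘(ℂ, ℂ)) b → ∃ (c β : Fam ℂˣ A.sheaf W₁)
          (e : Fam (ℂˣ × ℂˣ) A.sheaf W₂), IsHolFam E 𝓘(ℂ, ℂ) c ∧ IsHolFam E 𝓘(ℂ, ℂ) β ∧
            IsHolFam E (𝓘(ℂ, ℂ).prod 𝓘(ℂ, ℂ)) e ∧ c t = 0 ∧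
            Fam.res hW b = Fam.reparam (fun s : ℂˣ × ℂˣ => s.1 * s.2) h₁ c +
              Fam.reparam (fun s : ℂˣ × ℂˣ => s.2) h₂ β +
              Fam.smul (fun s : ℂˣ × ℂˣ => (s.1 : ℂ) - 1)
                (Fam.smul (fun s : ℂˣ × ℂˣ => (s.1 : ℂ) - 1) e) := by
  obtain ⟨τ, hτ⟩ := A.locally_star x₀
  obtain ⟨Ω₁, Ω₂, hΩ₁, hΩ₂, hp₁, hp₂, hs, hs₁, hs₂, hs₃, hdec⟩ := exists_nhds_decomposition (E := E)
    (τ.isOpen_dom W) (t := t) (x₀ := x₀) ⟨hp, hτ⟩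
  let W₁ : Opens (ℂˣ × X) := ⟨Ω₁, hΩ₁⟩
  let W₂ : Opens ((ℂˣ × ℂˣ) × X) := ⟨Ω₂, hΩ₂⟩
  have hW : W₂ ≤ W := fun p hp => (hs hp).1
  have hU₁ : ∀ p ∈ W₁, p.2 ∈ τ.U := fun p hp => (hs₁ p hp).2
  have hU₂ : ∀ p ∈ W₂, p.2 ∈ τ.U := fun p hp => (hs hp).2
  have h₁ : ∀ s : ℂˣ × ℂˣ, slice W₂ s ≤ slice W₁ (s.1 * s.2) := fun s x hx => hs₂ (s, x) hx
  have h₂ : ∀ s : ℂˣ × ℂˣ, slice W₂ s ≤ slice W₁ s.2 := fun s x hx => hs₃ (s, x) hx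
  refine ⟨W₁, W₂, hW, h₁, h₂, hp₁, hp₂, fun b hb => ?_⟩
  have hdec' := fun n => hdec (τ.famCoeff b n) (hb τ n)
  choose c β e hc hβ he hc0 heq using hdec'
  obtain ⟨c', hc', hce⟩ := τ.exists_isHolFam 𝓘(ℂ, ℂ) (W := W₁) hU₁ c hc
  obtain ⟨β', hβ', hβe⟩ := τ.exists_isHolFam 𝓘(ℂ, ℂ) (W := W₁) hU₁ β hβ
  obtain ⟨e', he', hee⟩ := τ.exists_isHolFam (𝓘(ℂ, ℂ).prod 𝓘(ℂ, ℂ)) (W := W₂) hU₂ e he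
  refine ⟨c', β', e', hc', hβ', he', ?_, τ.fam_ext hU₂ fun n p hp => ?_⟩
  · have ht : slice W₁ t ≤ τ.U := fun x hx => hU₁ (t, x) hx
    refine τ.injective _ ht _ _ fun n x hx => ?_
    have h1 := hce n (show (t, x) ∈ W₁ from hx)
    rw [τ.famCoeff_apply _ _ ht le_rfl hx, A.sheaf.res_self] at h1
    rw [h1, hc0 n x, τ.coeff_zero _ _ n hx]
  · have hp' : p ∈ τ.dom W₂ := ⟨hp, hU₂ p hp⟩
    rw [τ.famCoeff_res hW b n hp', heq n p hp, τ.famCoeff_add _ _ n hp']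
    dsimp only
    rw [τ.famCoeff_add _ _ n hp', τ.famCoeff_smul _ _ n hp']
    dsimp only
    rw [τ.famCoeff_smul _ _ n hp']
    dsimp only
    rw [hee n hp, τ.famCoeff_reparam _ _ c' n hp', τ.famCoeff_reparam _ _ β' n hp']
    dsimp only
    rw [hce n (show (p.1.1 * p.1.2, p.2) ∈ W₁ from hs₂ p hp),
      hβe n (show (p.1.2, p.2) ∈ W₁ from hs₃ p hp)]

/-- The part `c` of the preceding decomposition is unique. -/
lemma DQAlgebra.exists_fam_decomposition_unique (A : DQAlgebra E X) {W₁ : Opens (ℂˣ × X)}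
    {W₂ : Opens ((ℂˣ × ℂˣ) × X)} (h₁ : ∀ s : ℂˣ × ℂˣ, slice W₂ s ≤ slice W₁ (s.1 * s.2))
    (h₂ : ∀ s : ℂˣ × ℂˣ, slice W₂ s ≤ slice W₁ s.2) {t : ℂˣ} {x₀ : X} (hp₁ : (t, x₀) ∈ W₁)
    (hp₂ : ((1, t), x₀) ∈ W₂) : ∃ (W : Opens (ℂˣ × X)) (hW : W ≤ W₁), (t, x₀) ∈ W ∧
      ∀ (c β : Fam ℂˣ A.sheaf W₁) (e : Fam (ℂˣ × ℂˣ) A.sheaf W₂), IsHolFam E 𝓘(ℂ, ℂ) c →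
        IsHolFam E (𝓘(ℂ, ℂ).prod 𝓘(ℂ, ℂ)) e → c t = 0 →
        Fam.reparam (fun s : ℂˣ × ℂˣ => s.1 * s.2) h₁ c +
              Fam.reparam (fun s : ℂˣ × ℂˣ => s.2) h₂ β =
          Fam.smul (fun s : ℂˣ × ℂˣ => (s.1 : ℂ) - 1)
                (Fam.smul (fun s : ℂˣ × ℂˣ => (s.1 : ℂ) - 1) e) → Fam.res hW c = 0 := by
  obtain ⟨τ, hτ⟩ := A.locally_star x₀
  obtain ⟨Ω, hΩ, hpΩ, hΩs, huniq⟩ := exists_nhds_decomposition_unique (E := E)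
    (τ.isOpen_dom W₁) (τ.isOpen_dom W₂) (t := t) (x₀ := x₀) ⟨hp₁, hτ⟩ ⟨hp₂, hτ⟩
  let W : Opens (ℂˣ × X) := ⟨Ω, hΩ⟩
  have hW : W ≤ W₁ := fun p hp => (hΩs hp).1
  have hU : ∀ p ∈ W, p.2 ∈ τ.U := fun p hp => (hΩs hp).2
  refine ⟨W, hW, hpΩ, fun c β e hc he hc0 heq => τ.fam_ext hU fun n p hp => ?_⟩
  have hp' : p ∈ τ.dom W := ⟨hp, hU p hp⟩
  rw [τ.famCoeff_res hW c n hp', τ.famCoeff_zero n hp']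
  refine huniq (τ.famCoeff c n) (τ.famCoeff β n) (τ.famCoeff e n) (hc τ n) (he τ n) ?_ ?_ p hp
  · intro x hx
    rw [τ.famCoeff_apply c n (V := slice W₁ t ⊓ τ.U) inf_le_right inf_le_left hx, hc0, map_zero]
    exact τ.coeff_zero _ _ n hx
  · intro q hq
    have h3 := congrArg (fun a => τ.famCoeff a n q) heq
    beta_reduce at h3
    rw [τ.famCoeff_add _ _ n hq, τ.famCoeff_smul _ _ n hq] at h3
    dsimp only at h3
    rw [τ.famCoeff_smul _ _ n hq, τ.famCoeff_reparam _ _ c n hq,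
      τ.famCoeff_reparam _ _ β n hq] at h3
    exact h3

end FamilyDivision

/-! ### The morphism `λ` -/

section Lambda

variable {E : Type} [NormedAddCommGroup E] [NormedSpace ℂ E]
  {X : Type u} [TopologicalSpace X] [ChartedSpace E X]

open Classical in
/-- The value at `t` of the family `a`, as a section over `V`; it is `0` by convention if `V` is not
contained in the slice at `t`. -/
noncomputable def Fam.valueOn {T : Type} [TopologicalSpace T] {G : RingSheaf (TopCat.of X)}
    {W : Opens (T × X)} (a : Fam T G W) (V : Opens X) (t : T) : G.obj.obj (op V) :=
  if h : V ≤ slice W t then G.res h (a t) else 0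

lemma Fam.valueOn_eq {T : Type} [TopologicalSpace T] {G : RingSheaf (TopCat.of X)}
    {W : Opens (T × X)} (a : Fam T G W) {V : Opens X} {t : T} (h : V ≤ slice W t) :
    a.valueOn V t = G.res h (a t) := dif_pos h

/-- The coefficients of the values of a holomorphic family are jointly continuous. -/
lemma IsHolFam.continuousOn_coeff_valueOn {F H : Type} [NormedAddCommGroup F] [NormedSpace ℂ F]
    [TopologicalSpace H] {I : ModelWithCorners ℂ F H} {T : Type} [TopologicalSpace T]
    [ChartedSpace H T] {A : HbarAlgebra X} {W : Opens (T × X)} {a : Fam T A.sheaf W}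
    (ha : IsHolFam E I a) {D : Set T} {V : Opens X} (hD : ∀ t ∈ D, V ≤ slice W t)
    (τ : StarTriv E A) (n : ℕ) : ContinuousOn (fun q : T × X => τ.coeff (V ⊓ τ.U) inf_le_right
      (A.sheaf.res inf_le_left (a.valueOn V q.1)) n q.2) (D ×ˢ ((V ⊓ τ.U : Opens X) : Set X)) := by
  refine ((ha τ n).continuousOn.mono (t := D ×ˢ ((V ⊓ τ.U : Opens X) : Set X))
    fun q hq => ⟨hD q.1 hq.1 hq.2.1, hq.2.2⟩).congr ?_
  rintro ⟨t, x⟩ ⟨ht, hx⟩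
  dsimp only
  rw [a.valueOn_eq (hD t ht), A.sheaf.res_res]
  exact (τ.famCoeff_apply a n inf_le_right (inf_le_left.trans (hD t ht)) hx).symm

variable [IsManifold 𝓘(ℂ, E) ω X]

lemma tendsto_famTopology_iff {A : HbarAlgebra X} {W : Opens (ℂˣ × X)} {α : Type*} {l : Filter α}
    {f : α → (holClass E 𝓘(ℂ, ℂ) ℂˣ A).carrier W} {c : (holClass E 𝓘(ℂ, ℂ) ℂˣ A).carrier W} :
    Filter.Tendsto f l (@nhds _ (famTopology E A W) c) ↔ ∀ (τ : StarTriv E A) (n : ℕ)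
      (K : Set (ℂˣ × X)), IsCompact K → K ⊆ τ.dom W →
        TendstoUniformlyOn (fun i => τ.famCoeff (f i).1 n) (τ.famCoeff c.1 n) l K := by
  simp only [nhds_iInf, Filter.tendsto_iInf, nhds_induced, Filter.tendsto_comap_iff,
    UniformOnFun.tendsto_iff_tendstoUniformlyOn]
  exact ⟨fun h τ n K hK hKd => h τ n K ⟨hK, hKd⟩, fun h τ n K hK => h τ n K hK.1 hK.2⟩

/-- The constant family given by a section. -/
noncomputable def constSec {A : HbarAlgebra X} (V : Opens X) (s : A.sheaf.obj.obj (op V)) :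
    (holClass E 𝓘(ℂ, ℂ) ℂˣ A).carrier ((Opens.map (projMap ℂˣ X)).obj V) :=
  (constFam A).hom.app (op V) s

lemma StarTriv.famCoeff_constSec {A : HbarAlgebra X} (τ : StarTriv E A) {V : Opens X}
    (s : A.sheaf.obj.obj (op V)) (n : ℕ) {p : ℂˣ × X}
    (hp : p ∈ τ.dom ((Opens.map (projMap ℂˣ X)).obj V)) :
    τ.famCoeff (constSec V s : (holClass E 𝓘(ℂ, ℂ) ℂˣ A).carrier _).1 n p =
      τ.coeff (V ⊓ τ.U) inf_le_right (A.sheaf.res inf_le_left s) n p.2 := by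
  have h : (constSec V s : (holClass E 𝓘(ℂ, ℂ) ℂˣ A).carrier _).1 p.1 = s := A.sheaf.res_self _ _
  refine (τ.famCoeff_apply _ n (t := p.1) (V := V ⊓ τ.U) inf_le_right inf_le_left hp).trans ?_
  exact congrArg (fun s' => τ.coeff (V ⊓ τ.U) inf_le_right (A.sheaf.res inf_le_left s') n p.2) h

variable [MulAction ℂˣ X] [ContinuousSMul ℂˣ X]

namespace FAction

variable {A : DQAlgebra E X} {m : ℤ} (θ : FAction A m)

/-- The family `(θ_t(s))_t`, for a section `s` of `A` over `V`. -/
noncomputable def orbitFam (V : Opens X) (s : A.sheaf.obj.obj (op V)) :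
    Fam ℂˣ A.sheaf ((Opens.map (actMap X)).obj V) := fun t => θ.at_ t V s

lemma at_C (t : ℂˣ) (V : Opens X) (c : ℂ) (s : A.sheaf.obj.obj (op V)) :
    θ.at_ t V (A.scal V (PowerSeries.C c) * s) =
      A.scal _ (PowerSeries.C c) * θ.at_ t V s := by
  have h := θ.linear ((Opens.map (projMap ℂˣ X)).obj V) (fun _ => c) contMDiffOn_const
    (constSec V s) t
  refine Eq.trans ?_ h
  have h2 : (constSec V (A.scal V (PowerSeries.C c) * s) :
      (holClass E 𝓘(ℂ, ℂ) ℂˣ A.toHbarAlgebra).carrier ((Opens.map (projMap ℂˣ X)).obj V)) =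
      smulFam (fun _ => c) contMDiffOn_const (constSec V s) := by
    refine Subtype.ext (funext fun t' => ?_)
    change A.sheaf.res _ (A.scal V _ * s) = A.scal _ _ * A.sheaf.res _ s
    rw [map_mul, A.scal_res]
    rfl
  rw [← h2]
  rfl

variable [FiniteDimensional ℂ E]

/-- If a section `b_s` depends continuously on the parameter `s`, then so do the coefficients of
`θ_t(b_s)`; this is where the continuity of the F-action enters. -/
lemma continuousOn_famCoeff_orbitFam {T : Type} [TopologicalSpace T] {D : Set T} {V : Opens X}
    {b : T → A.sheaf.obj.obj (op V)}
    (hb : ∀ (τ : StarTriv E A.toHbarAlgebra) (n : ℕ), ContinuousOn (fun q : T × X =>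
      τ.coeff (V ⊓ τ.U) inf_le_right (A.sheaf.res inf_le_left (b q.1)) n q.2)
        (D ×ˢ ((V ⊓ τ.U : Opens X) : Set X)))
    (τ : StarTriv E A.toHbarAlgebra) (n : ℕ) :
    ContinuousOn (fun q : T × (ℂˣ × X) => τ.famCoeff (θ.orbitFam V (b q.1)) n q.2)
      (D ×ˢ τ.dom ((Opens.map (actMap X)).obj V)) := by
  rintro ⟨s, p⟩ ⟨hs, hp⟩
  -- the constant families given by `b_s` depend continuously on `s`
  have h1 : Filter.Tendsto (fun s => (constSec V (b s) :
      (holClass E 𝓘(ℂ, ℂ) ℂˣ A.toHbarAlgebra).carrier ((Opens.map (projMap ℂˣ X)).obj V)))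
      (nhdsWithin s D) (@nhds _ (famTopology E A.toHbarAlgebra _) (constSec V (b s))) := by
    rw [tendsto_famTopology_iff]
    intro σ k K hK hKd
    have hK' : IsCompact (Prod.snd '' K) := hK.image continuous_snd
    have hKs : Prod.snd '' K ⊆ ((V ⊓ σ.U : Opens X) : Set X) := by
      rintro _ ⟨q, hq, rfl⟩
      exact hKd hq
    intro u hu
    obtain ⟨v, hv, hvu⟩ := hK'.mem_uniformity_of_prod
      (f := fun s x => σ.coeff (V ⊓ σ.U) inf_le_right (A.sheaf.res inf_le_left (b s)) k x)
      ((hb σ k).mono (Set.prod_mono_right hKs)) hs (symm_le_uniformity hu)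
    filter_upwards [hv] with s' hs' q hq
    have h2 := hvu s' hs' q.2 ⟨q, hq, rfl⟩
    have h2' : (σ.coeff (V ⊓ σ.U) inf_le_right (A.sheaf.res inf_le_left (b s)) k q.2,
      σ.coeff (V ⊓ σ.U) inf_le_right (A.sheaf.res inf_le_left (b s')) k q.2) ∈ u := h2
    rw [← σ.famCoeff_constSec (b s) k (hKd hq), ← σ.famCoeff_constSec (b s') k (hKd hq)] at h2'
    exact h2'
  have h2 := @Continuous.tendsto _ _ (famTopology E A.toHbarAlgebra _)
    (famTopology E A.toHbarAlgebra _) _ (θ.continuous ((Opens.map (projMap ℂˣ X)).obj V))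
    (constSec V (b s))
  have h4 := tendsto_famTopology_iff.1 (h2.comp h1) τ n
  have : LocallyCompactSpace X := ChartedSpace.locallyCompactSpace E X
  have : LocallyCompactSpace ℂˣ := ChartedSpace.locallyCompactSpace ℂ ℂˣ
  obtain ⟨K, hK, hKd, hKc⟩ := local_compact_nhds ((τ.isOpen_dom _).mem_nhds hp)
  have h5 := h4 K hKc hKd
  refine tendsto_comp_of_locally_uniform_limit (F := fun q : T × (ℂˣ × X) =>
    τ.famCoeff (θ.orbitFam V (b q.1)) n) (f := τ.famCoeff (θ.orbitFam V (b s)) n)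
    (g := Prod.snd) (x := p) ?_ ?_ ?_
  · exact (((θ.isHolFam_at V (b s)) τ n).continuousOn.continuousAt
      ((τ.isOpen_dom _).mem_nhds hp))
  · exact continuous_snd.continuousAt.tendsto.mono_left nhdsWithin_le_nhds
  · intro u hu
    refine ⟨K, hK, ?_⟩
    have h6 := h5 u hu
    have h7 : Filter.Tendsto (Prod.fst : T × (ℂˣ × X) → T)
        (nhdsWithin (s, p) (D ×ˢ τ.dom ((Opens.map (actMap X)).obj V))) (nhdsWithin s D) :=
      tendsto_nhdsWithin_of_tendsto_nhds_of_eventually_within _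
        (continuous_fst.continuousAt.tendsto.mono_left nhdsWithin_le_nhds)
        (by filter_upwards [self_mem_nhdsWithin] with q hq using hq.1)
    exact h7.eventually h6

end FAction

end Lambda

section LambdaExists

variable {E : Type} [NormedAddCommGroup E] [NormedSpace ℂ E] [FiniteDimensional ℂ E]
  {X : Type u} [TopologicalSpace X] [ChartedSpace E X] [IsManifold 𝓘(ℂ, E) ω X]
  [MulAction ℂˣ X] [ContinuousSMul ℂˣ X]

namespace FAction

variable {A : DQAlgebra E X} {m : ℤ} (θ : FAction A m)

lemma famCoeff_orbitFam_sub {V : Opens X} {b b' c : A.sheaf.obj.obj (op V)} {z : ℂ}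
    (h : b - b' = A.scal V (PowerSeries.C z) * c) (τ : StarTriv E A.toHbarAlgebra) (n : ℕ)
    {p : ℂˣ × X} (hp : p ∈ τ.dom ((Opens.map (actMap X)).obj V)) :
    τ.famCoeff (θ.orbitFam V b) n p - τ.famCoeff (θ.orbitFam V b') n p =
      z * τ.famCoeff (θ.orbitFam V c) n p := by
  have h1 : θ.orbitFam V b = θ.orbitFam V b' + Fam.smul (fun _ => z) (θ.orbitFam V c) := by
    funext t
    change θ.at_ t V b = θ.at_ t V b' + A.scal _ (PowerSeries.C z) * θ.at_ t V c
    rw [← at_C, ← map_add, ← h, add_sub_cancel]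
  rw [h1, τ.famCoeff_add _ _ n hp]
  dsimp only
  rw [τ.famCoeff_smul _ _ n hp]
  ring

/-- The family `(s, t) ↦ θ_t(a_s)`. -/
noncomputable def lambdaFam {W : Opens (ℂˣ × X)} (a : Fam ℂˣ A.sheaf W) :
    Fam (ℂˣ × ℂˣ) A.sheaf ((Opens.map (idActMap X)).obj W) :=
  fun t => θ.at_ t.2 (slice W t.1) (a t.1)

lemma famCoeff_lambda {W : Opens (ℂˣ × X)} (a : Fam ℂˣ A.sheaf W) {V : Opens X} {s t : ℂˣ} {x : X}
    (hV : V ≤ slice W s) (τ : StarTriv E A.toHbarAlgebra) (n : ℕ)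
    (hp : (t, x) ∈ τ.dom ((Opens.map (actMap X)).obj V)) :
    τ.famCoeff (θ.lambdaFam a) n ((s, t), x) =
        τ.famCoeff (θ.orbitFam V (a.valueOn V s)) n (t, x) := by
  let V' : Opens X := actInv t V ⊓ τ.U
  have hV' : V' ≤ slice ((Opens.map (idActMap X)).obj W) (s, t) :=
    inf_le_left.trans (actInv_mono t hV)
  have h1 := τ.famCoeff_apply (θ.lambdaFam a) n (t := (s, t)) (V := V')
      inf_le_right hV' (x := x) hp
  have h2 := τ.famCoeff_apply (θ.orbitFam V (a.valueOn V s)) n (t := t) (V := V')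
      inf_le_right inf_le_left (x := x) hp
  rw [h1, h2]
  have h3 : θ.orbitFam V (a.valueOn V s) t =
      A.sheaf.res (actInv_mono t hV) (θ.at_ t (slice W s) (a s)) := by
    rw [← at_res (h := hV), ← a.valueOn_eq hV]
    rfl
  rw [h3, A.sheaf.res_res]
  rfl

/-- Cauchy integrals over a circle in `ℂˣ` of functions that depend continuously on the point of
the circle and holomorphically on `(t, x)`. -/
lemma holOnProd_cauchyIntegral {s₁ : ℂˣ} {r : ℝ} (hr : 0 < r) {D : Set ℂˣ} {N : Set (ℂˣ × X)}
    {Ω : Set ((ℂˣ × ℂˣ) × X)} (hΩ : IsOpen Ω)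
    (hΩr : ∀ P ∈ Ω, (P.1.1 : ℂ) ∈ Metric.ball (s₁ : ℂ) r) (hΩN : ∀ P ∈ Ω, (P.1.2, P.2) ∈ N)
    (hball : ∀ z ∈ Metric.closedBall (s₁ : ℂ) r, z ≠ 0 ∧ unitOf z ∈ D)
    {g : ℂˣ → ℂˣ × X → ℂ} (hg : ContinuousOn (fun p : ℂˣ × (ℂˣ × X) => g p.1 p.2) (D ×ˢ N))
    (hgN : ∀ s ∈ D, HolOnProd 𝓘(ℂ, ℂ) E (g s) N) :
    HolOnProd (𝓘(ℂ, ℂ).prod 𝓘(ℂ, ℂ)) E (fun P : (ℂˣ × ℂˣ) × X =>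
      ∮ ζ in C((s₁ : ℂ), r), (ζ - P.1.1)⁻¹ * g (unitOf ζ) (P.1.2, P.2)) Ω := by
  have hne : ∀ ζ ∈ Metric.sphere (s₁ : ℂ) r, ∀ P ∈ Ω, ζ - (P.1.1 : ℂ) ≠ 0 := by
    intro ζ hζ P hP h0
    have h1 : ζ = (P.1.1 : ℂ) := sub_eq_zero.1 h0
    have h2 : dist (P.1.1 : ℂ) s₁ < r := hΩr P hP
    rw [← h1, Metric.mem_sphere.1 hζ] at h2
    exact lt_irrefl _ h2
  let G : ℂ → (ℂˣ × ℂˣ) × X → ℂ := fun ζ P => (ζ - P.1.1)⁻¹ * g (unitOf ζ) (P.1.2, P.2)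
  have h1 : ContinuousOn (fun p : ℂ × ((ℂˣ × ℂˣ) × X) => G p.1 p.2)
      (Metric.sphere (s₁ : ℂ) r ×ˢ Ω) := by
    refine ContinuousOn.mul (ContinuousOn.inv₀ (by fun_prop) ?_) ?_
    · exact fun p hp => hne _ hp.1 _ hp.2
    · refine hg.comp (f := fun q : ℂ × ((ℂˣ × ℂˣ) × X) => (unitOf q.1, (q.2.1.2, q.2.2))) ?_ ?_
      · refine ContinuousOn.prodMk ?_ (by fun_prop)
        intro q hq
        exact (ContinuousAt.comp (f := fun q : ℂ × ((ℂˣ × ℂˣ) × X) => q.1) (g := unitOf)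
          (continuousAt_unitOf (hball q.1 (Metric.sphere_subset_closedBall hq.1)).1)
          continuousAt_fst).continuousWithinAt
      · exact fun q hq => ⟨(hball q.1 (Metric.sphere_subset_closedBall hq.1)).2, hΩN _ hq.2⟩
  have h2 : ∀ ζ ∈ Metric.sphere (s₁ : ℂ) r,
      HolOnProd (𝓘(ℂ, ℂ).prod 𝓘(ℂ, ℂ)) E (G ζ) Ω := by
    intro ζ hζ
    have hinv : HolOnProd (𝓘(ℂ, ℂ).prod 𝓘(ℂ, ℂ)) E
        (fun P : (ℂˣ × ℂˣ) × X => (ζ - (P.1.1 : ℂ))⁻¹) Ω := by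
      intro P hP
      have h3 : ContMDiffAt ((𝓘(ℂ, ℂ).prod 𝓘(ℂ, ℂ)).prod 𝓘(ℂ, E)) 𝓘(ℂ, ℂ) ω
          (fun P : (ℂˣ × ℂˣ) × X => ζ - (P.1.1 : ℂ)) P :=
        contMDiffAt_const.sub ((Units.contMDiff_val.comp
          (contMDiff_fst.comp contMDiff_fst)).contMDiffAt)
      exact ((contDiffAt_inv ℂ (hne ζ hζ P hP)).contMDiffAt.comp P h3).contMDiffWithinAt
    have hcomp : HolOnProd (𝓘(ℂ, ℂ).prod 𝓘(ℂ, ℂ)) E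
        (fun P : (ℂˣ × ℂˣ) × X => g (unitOf ζ) (P.1.2, P.2)) Ω :=
      ContMDiffOn.comp (g := g (unitOf ζ)) (f := fun P : (ℂˣ × ℂˣ) × X => (P.1.2, P.2))
        (hgN _ (hball ζ (Metric.sphere_subset_closedBall hζ)).2)
        ((contMDiff_snd.comp contMDiff_fst).prodMk contMDiff_snd).contMDiffOn hΩN
    exact ContMDiffOn.mul hinv hcomp
  exact contMDiffOn_circleIntegral _ hr.le G hΩ h1 h2

set_option maxHeartbeats 800000 in
/-- The morphism `λ` exists. The coefficients of `θ_{t₂}(a_{t₁})` are continuous and holomorphic in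
`(t₂, x)`. Since `a_s - a_u = (s - u) q(s, u)` with a holomorphic family `q`, and
`θ_{t₂}(q(s, u))` depends continuously on `s`, they are also holomorphic in `t₁`. Cauchy's integral
formula in the variable `t₁` then shows that they are holomorphic. -/
theorem lambdaExists : θ.LambdaExists := by
  intro W a ha τ n
  rintro ⟨⟨s₁, s₂⟩, x₀⟩ ⟨hpW, hxτ⟩
  replace hpW : (s₁, s₂ • x₀) ∈ W := hpW
  let Wd : Opens ((ℂˣ × ℂˣ) × X) := ⟨{p | (p.1.1, p.2) ∈ W ∧ (p.1.2, p.2) ∈ W},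
    (W.isOpen.preimage (by fun_prop : Continuous fun p : (ℂˣ × ℂˣ) × X => (p.1.1, p.2))).inter
      (W.isOpen.preimage (by fun_prop : Continuous fun p : (ℂˣ × ℂˣ) × X => (p.1.2, p.2)))⟩
  have hd₁ : ∀ t : ℂˣ × ℂˣ, slice Wd t ≤ slice W t.1 := fun t x hx => hx.1
  have hd₂ : ∀ t : ℂˣ × ℂˣ, slice Wd t ≤ slice W t.2 := fun t x hx => hx.2
  let d : Fam (ℂˣ × ℂˣ) A.sheaf Wd := Fam.reparam Prod.fst hd₁ a + -Fam.reparam Prod.snd hd₂ a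
  have hd : IsHolFam E (𝓘(ℂ, ℂ).prod 𝓘(ℂ, ℂ)) d :=
    (ha.reparam _ _ Prod.fst contMDiff_fst Wd hd₁).add _
      ((ha.reparam _ _ Prod.snd contMDiff_snd Wd hd₂).neg _)
  obtain ⟨W', hW', hpW', hq⟩ := A.exists_fam_quotient (fun s => s) contMDiff_id (W := Wd) (t := s₁)
    (x₀ := s₂ • x₀) ⟨hpW, hpW⟩
  obtain ⟨q, hq, hqe⟩ := hq d hd fun s => add_neg_cancel _
  obtain ⟨A₀, V, hA₀, hV, hsA₀, hyV, hAV⟩ := isOpen_prod_iff.1 W'.isOpen _ _ hpW'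
  obtain ⟨A₁, A₂, hA₁, hA₂, hsA₁, hsA₂, hAA⟩ := isOpen_prod_iff.1 hA₀ _ _ hsA₀
  obtain ⟨r, hr, hr0, V', hV', hyV', hrV⟩ := exists_closedBall_prod
    ((hA₁.inter hA₂).prod hV) (t := s₁) (y := s₂ • x₀) ⟨⟨hsA₁, hsA₂⟩, hyV⟩
  let D : Set ℂˣ := A₁ ∩ A₂
  have hDo : IsOpen D := hA₁.inter hA₂
  let U : Opens X := ⟨V, hV⟩
  have hUW' : ∀ t ∈ D ×ˢ D, U ≤ slice W' t := fun t ht x hx =>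
    hAV (⟨hAA ⟨ht.1.1, ht.2.2⟩, hx⟩ : (t, x) ∈ A₀ ×ˢ V)
  have hUW : ∀ s ∈ D, U ≤ slice W s := fun s hs x hx => (hW' (hUW' (s, s) ⟨hs, hs⟩ hx)).1
  have hball : ∀ z ∈ Metric.closedBall (s₁ : ℂ) r, z ≠ 0 ∧ unitOf z ∈ D := fun z hz =>
    ⟨hr0 z hz, (hrV z hz _ hyV').1⟩
  let N : Set (ℂˣ × X) := τ.dom ((Opens.map (actMap X)).obj U)
  have hN : IsOpen N := τ.isOpen_dom _
  let g : ℂˣ → ℂˣ × X → ℂ := fun s => τ.famCoeff (θ.orbitFam U (a.valueOn U s)) n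
  have hg : ContinuousOn (fun p : ℂˣ × (ℂˣ × X) => g p.1 p.2) (D ×ˢ N) :=
    θ.continuousOn_famCoeff_orbitFam (b := a.valueOn U)
      (fun σ k => ha.continuousOn_coeff_valueOn hUW σ k) τ n
  have hgq := θ.continuousOn_famCoeff_orbitFam (b := q.valueOn U)
      (fun σ k => hq.continuousOn_coeff_valueOn hUW' σ k) τ n
  have hdiff : ∀ s ∈ D, ∀ u ∈ D, ∀ p ∈ N, g s p - g u p = ((s : ℂ) - u) *
      τ.famCoeff (θ.orbitFam U (q.valueOn U (s, u))) n p := by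
    intro s hs u hu p hp
    refine θ.famCoeff_orbitFam_sub ?_ τ n hp
    have h1 := congrArg (A.sheaf.res (hUW' (s, u) ⟨hs, hu⟩)) (congrFun hqe (s, u))
    rw [Fam.res_apply, A.sheaf.res_res] at h1
    rw [a.valueOn_eq (hUW s hs), a.valueOn_eq (hUW u hu), q.valueOn_eq (hUW' (s, u) ⟨hs, hu⟩)]
    change A.sheaf.res _ (A.sheaf.res _ (a s) + -A.sheaf.res _ (a u)) =
      A.sheaf.res _ (A.scal _ (PowerSeries.C ((s : ℂ) - u)) * q (s, u)) at h1
    rw [map_add, map_neg, A.sheaf.res_res, A.sheaf.res_res, map_mul, A.scal_res,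
      ← sub_eq_add_neg] at h1
    exact h1
  have hderiv : ∀ p ∈ N, ∀ z : ℂ, z ≠ 0 → unitOf z ∈ D →
      DifferentiableAt ℂ (fun z => g (unitOf z) p) z := by
    intro p hp z hz hzD
    have hu : ContinuousAt unitOf z := continuousAt_unitOf hz
    have h1 : ContinuousAt (fun w : ℂ =>
        τ.famCoeff (θ.orbitFam U (q.valueOn U (unitOf w, unitOf z))) n p) z := by
      have h2 := hgq.continuousAt (x := ((unitOf z, unitOf z), p))
        (((hDo.prod hDo).prod hN).mem_nhds ⟨⟨hzD, hzD⟩, hp⟩)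
      exact ContinuousAt.comp (f := fun w : ℂ => ((unitOf w, unitOf z), p)) h2
        ((hu.prodMk continuousAt_const).prodMk continuousAt_const)
    refine (hasDerivAt_iff_tendsto_slope.2 ((h1.tendsto.mono_left
      nhdsWithin_le_nhds).congr' ?_)).differentiableAt
    have hne : ∀ᶠ w in nhdsWithin z {z}ᶜ, w ≠ 0 :=
      (eventually_ne_nhds hz).filter_mono nhdsWithin_le_nhds
    have hD' : ∀ᶠ w in nhdsWithin z {z}ᶜ, unitOf w ∈ D :=
      (hu.eventually_mem (hDo.mem_nhds hzD)).filter_mono nhdsWithin_le_nhds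
    filter_upwards [hne, hD', self_mem_nhdsWithin] with w hw hwD hwz
    rw [slope_def_field, hdiff _ hwD _ hzD p hp, val_unitOf hw, val_unitOf hz,
      mul_div_cancel_left₀ _ (sub_ne_zero.2 hwz)]
  let Ω : Set ((ℂˣ × ℂˣ) × X) := {P | (P.1.1 : ℂ) ∈ Metric.ball (s₁ : ℂ) r ∧ (P.1.2, P.2) ∈ N}
  have hΩ : IsOpen Ω := (Metric.isOpen_ball.preimage (by fun_prop :
    Continuous fun P : (ℂˣ × ℂˣ) × X => (P.1.1 : ℂ))).inter (hN.preimage (by fun_prop))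
  have hint : HolOnProd (𝓘(ℂ, ℂ).prod 𝓘(ℂ, ℂ)) E (fun P : (ℂˣ × ℂˣ) × X =>
      (2 * Real.pi * Complex.I : ℂ)⁻¹ * ∮ ζ in C((s₁ : ℂ), r),
        (ζ - P.1.1)⁻¹ * g (unitOf ζ) (P.1.2, P.2)) Ω := by
    exact ContMDiffOn.mul (contMDiffOn_const (c := (2 * Real.pi * Complex.I : ℂ)⁻¹))
      (holOnProd_cauchyIntegral hr hΩ (fun _ hP => hP.1) (fun _ hP => hP.2) hball hg
        fun s _ => θ.isHolFam_at U (a.valueOn U s) τ n)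
  refine ContMDiffAt.contMDiffWithinAt ?_
  refine ContMDiffOn.contMDiffAt (s := Ω) ?_ (hΩ.mem_nhds
    ⟨Metric.mem_ball_self hr, show s₂ • x₀ ∈ V from hyV, hxτ⟩)
  refine hint.congr ?_
  rintro ⟨⟨s, t⟩, x⟩ ⟨hs, hp⟩
  have hsD : s ∈ D := by
    have := (hball _ (Metric.ball_subset_closedBall hs)).2
    rwa [unitOf_val] at this
  refine (θ.famCoeff_lambda a (hUW s hsD) τ n hp).trans ?_
  have hdo : DifferentiableOn ℂ (fun z => g (unitOf z) (t, x)) (Metric.closedBall (s₁ : ℂ) r) :=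
    fun z hz => (hderiv (t, x) hp z (hball z hz).1 (hball z hz).2).differentiableWithinAt
  have hcauchy := (hdo.diffContOnCl_ball subset_rfl).two_pi_i_inv_smul_circleIntegral_sub_inv_smul hs
  simp only [smul_eq_mul, unitOf_val] at hcauchy
  exact hcauchy.symm

end FAction

end LambdaExists

/-! ### Families of sections of `A^loc` -/

section Localised

variable {E : Type} [NormedAddCommGroup E] [NormedSpace ℂ E]
  {X : Type u} [TopologicalSpace X] [ChartedSpace E X]

namespace HbarAlgebra

variable (A : HbarAlgebra X)

lemma exists_hbar_pow_mul_eq_zero {U : Opens X} {a : A.sheaf.obj.obj (op U)}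
    (h : (OreLocalization.numeratorRingHom : _ →+* A.LocSec U) a = 0) :
    ∃ k : ℕ, A.hbar U ^ k * a = 0 := by
  have h1 : a /ₒ (1 : A.hbarPow U) = 0 := h
  rw [OreLocalization.zero_def, OreLocalization.oreDiv_eq_iff] at h1
  obtain ⟨⟨_, k, rfl⟩, v, h2, h3⟩ := h1
  simp only [OneMemClass.coe_one, mul_one] at h3
  refine ⟨k, ?_⟩
  rw [smul_zero] at h2
  change 0 = v * a at h2
  rw [h2, ← h3]

/-- The kernel of `A → A^loc` consists of the sections that are locally killed by a power of
`ħ`. -/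
lemma exists_hbar_pow_mul_of_ι_eq_zero {U : Opens X} {a : A.sheaf.obj.obj (op U)}
    (h : A.ι U a = 0) {x : X} (hx : x ∈ U) : ∃ (V : Opens X) (hV : V ≤ U), x ∈ V ∧
      ∃ k : ℕ, A.hbar V ^ k * A.sheaf.res hV a = 0 := by
  have h1 : (toSheafify (Opens.grothendieckTopology (TopCat.of X)) A.locPresheaf).app (op U)
      ((OreLocalization.numeratorRingHom : _ →+* A.LocSec U) a) =
      (toSheafify (Opens.grothendieckTopology (TopCat.of X)) A.locPresheaf).app (op U) 0 :=
    h.trans (map_zero ((toSheafify (Opens.grothendieckTopology (TopCat.of X))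
      A.locPresheaf).app (op U)).hom).symm
  have h2 := Presheaf.equalizerSieve_mem (Opens.grothendieckTopology (TopCat.of X))
    (toSheafify (Opens.grothendieckTopology (TopCat.of X)) A.locPresheaf) _ _ h1
  obtain ⟨V, f, hf, hxV⟩ := h2 x hx
  refine ⟨V, leOfHom f, hxV, A.exists_hbar_pow_mul_eq_zero ?_⟩
  have h3 : A.locSecRes (leOfHom f) ((OreLocalization.numeratorRingHom : _ →+* A.LocSec U) a) =
    A.locSecRes (leOfHom f) 0 := hf
  rw [A.locSecRes_numerator, map_zero] at h3
  exact h3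

/-- The image of `ħ` in `A^loc`. -/
noncomputable def hbarLoc (U : Opens X) : A.loc.obj.obj (op U) := A.ι U (A.hbar U)

lemma hbarLoc_res {U V : Opens X} (h : V ≤ U) : A.loc.res h (A.hbarLoc U) = A.hbarLoc V := by
  rw [hbarLoc, ι_res, hbar_res]
  rfl

lemma isUnit_hbarLoc_pow (U : Opens X) (n : ℕ) : IsUnit (A.hbarLoc U ^ n) :=
  (A.isUnit_ι_hbar U).pow n

/-- The image of the scalar `c` in `A^loc`. -/
noncomputable def scalLoc (U : Opens X) (c : ℂ) : A.loc.obj.obj (op U) :=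
  A.ι U (A.scal U (PowerSeries.C c))

lemma scalLoc_comm (U : Opens X) (c : ℂ) (s : A.loc.obj.obj (op U)) :
    Commute (A.scalLoc U c) s := A.ι_C_comm c U s

lemma scalLoc_res {U V : Opens X} (h : V ≤ U) (c : ℂ) :
    A.loc.res h (A.scalLoc U c) = A.scalLoc V c := by
  rw [scalLoc, ι_res, scal_res]
  rfl

variable {A} in
/-- Local numerators of a family of sections of `A^loc`. -/
lemma IsHolLocFam.exists_num {F H : Type} [NormedAddCommGroup F] [NormedSpace ℂ F]
    [TopologicalSpace H] {I : ModelWithCorners ℂ F H} {T : Type} [TopologicalSpace T]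
    [ChartedSpace H T] {W : Opens (T × X)} {s : Fam T A.loc W} (hs : A.IsHolLocFam E I s)
    {p : T × X} (hp : p ∈ W) : ∃ (V : Opens (T × X)) (h : V ≤ W), p ∈ V ∧
      ∃ (N : ℕ) (a : Fam T A.sheaf V), IsHolFam E I a ∧
        ∀ t, A.hbarLoc (slice V t) ^ N * A.loc.res (slice_mono h t) (s t) = A.ι _ (a t) := by
  obtain ⟨V, h, hpV, N, a, ha, heq⟩ := hs p hp
  exact ⟨V, h, hpV, N, a, ha, fun t => congrFun heq t⟩

end HbarAlgebra

namespace DQAlgebra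

variable (A : DQAlgebra E X)

lemma ι_injective (U : Opens X) : Function.Injective (A.ι U) := by
  refine (injective_iff_map_eq_zero _).2 fun a ha => A.sheaf.ext_local _ _ fun x hx => ?_
  obtain ⟨V, hV, hxV, k, hk⟩ := A.exists_hbar_pow_mul_of_ι_eq_zero ha hx
  obtain ⟨τ, hτ⟩ := A.locally_star x
  refine ⟨V ⊓ τ.U, inf_le_left.trans hV, ⟨hxV, hτ⟩, ?_⟩
  replace hk := congrArg (A.sheaf.res (inf_le_left : V ⊓ τ.U ≤ V)) hk
  rw [map_mul, map_pow, A.hbar_res, map_zero] at hk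
  have key : ∀ (k : ℕ) (b : A.sheaf.obj.obj (op (V ⊓ τ.U))), A.hbar _ ^ k * b = 0 → b = 0 := by
    intro k
    induction k with
    | zero => exact fun b hb => by rwa [pow_zero, one_mul] at hb
    | succ k ih => exact fun b hb => ih b (τ.eq_zero_of_hbar_mul inf_le_right (by
        rwa [pow_succ', mul_assoc] at hb))
  exact ((A.sheaf.res_res _ _ _).symm.trans ((key k _ hk).trans (map_zero _).symm))

end DQAlgebra

end Localised

section LocDecomposition

variable {E : Type} [NormedAddCommGroup E] [NormedSpace ℂ E] [FiniteDimensional ℂ E]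
  {X : Type u} [TopologicalSpace X] [ChartedSpace E X] [IsManifold 𝓘(ℂ, E) ω X]

namespace DQAlgebra

variable (A : DQAlgebra E X)

/-- The decomposition of families of sections of `A^loc`. -/
lemma exists_locFam_decomposition {W : Opens ((ℂˣ × ℂˣ) × X)} {b : Fam (ℂˣ × ℂˣ) A.loc W}
    (hb : A.IsHolLocFam E (𝓘(ℂ, ℂ).prod 𝓘(ℂ, ℂ)) b) {t : ℂˣ} {x₀ : X} (hp : ((1, t), x₀) ∈ W) :
    ∃ (W₁ : Opens (ℂˣ × X)) (W₂ : Opens ((ℂˣ × ℂˣ) × X))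
      (hW : W₂ ≤ W) (h₁ : ∀ s : ℂˣ × ℂˣ, slice W₂ s ≤ slice W₁ (s.1 * s.2))
      (h₂ : ∀ s : ℂˣ × ℂˣ, slice W₂ s ≤ slice W₁ s.2) (c β : Fam ℂˣ A.loc W₁)
      (e : Fam (ℂˣ × ℂˣ) A.loc W₂), (t, x₀) ∈ W₁ ∧ ((1, t), x₀) ∈ W₂ ∧
        A.IsHolLocFam E 𝓘(ℂ, ℂ) c ∧ A.IsHolLocFam E 𝓘(ℂ, ℂ) β ∧
        A.IsHolLocFam E (𝓘(ℂ, ℂ).prod 𝓘(ℂ, ℂ)) e ∧ c t = 0 ∧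
        ∀ s : ℂˣ × ℂˣ, A.loc.res (slice_mono hW s) (b s) =
          A.loc.res (h₁ s) (c (s.1 * s.2)) + A.loc.res (h₂ s) (β s.2) +
            A.scalLoc _ ((s.1 : ℂ) - 1) * (A.scalLoc _ ((s.1 : ℂ) - 1) * e s) := by
  obtain ⟨V, hV, hpV, N, a, ha, heq⟩ := hb.exists_num hp
  obtain ⟨W₁, W₂, hW, h₁, h₂, hp₁, hp₂, hdec⟩ := A.exists_fam_decomposition hpV
  obtain ⟨c, β, e, hc, hβ, he, hc0, hce⟩ := hdec a ha
  obtain ⟨u₁, hu₁, hu₁', -⟩ := A.exists_hbarFam_inv E 𝓘(ℂ, ℂ) ℂˣ W₁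
  obtain ⟨u₂, hu₂, hu₂', -⟩ := A.exists_hbarFam_inv E (𝓘(ℂ, ℂ).prod 𝓘(ℂ, ℂ)) (ℂˣ × ℂˣ) W₂
  have hu₁N := pow_mem hu₁ N
  have hu₂N := pow_mem hu₂ N
  have k₁ : ∀ s, A.hbarLoc (slice W₁ s) ^ N * u₁ s ^ N = 1 := fun s => by
    have h1 : A.hbarLoc (slice W₁ s) * u₁ s = 1 := congrFun hu₁' s
    have h2 : Commute (A.hbarLoc (slice W₁ s)) (u₁ s) := A.ι_hbar_comm _ _
    rw [← h2.mul_pow, h1, one_pow]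
  have k₂ : ∀ s, A.hbarLoc (slice W₂ s) ^ N * u₂ s ^ N = 1 := fun s => by
    have h1 : A.hbarLoc (slice W₂ s) * u₂ s = 1 := congrFun hu₂' s
    have h2 : Commute (A.hbarLoc (slice W₂ s)) (u₂ s) := A.ι_hbar_comm _ _
    rw [← h2.mul_pow, h1, one_pow]
  refine ⟨W₁, W₂, hW.trans hV, h₁, h₂, fun s => u₁ s ^ N * A.ι _ (c s),
    fun s => u₁ s ^ N * A.ι _ (β s), fun s => u₂ s ^ N * A.ι _ (e s), hp₁, hp₂,
    (show A.IsHolLocFam E 𝓘(ℂ, ℂ) (u₁ ^ N * A.famι W₁ c) from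
      HbarAlgebra.IsHolLocFam.mul _ hu₁N (HbarAlgebra.IsHolLocFam.famι _ hc)),
    (show A.IsHolLocFam E 𝓘(ℂ, ℂ) (u₁ ^ N * A.famι W₁ β) from
      HbarAlgebra.IsHolLocFam.mul _ hu₁N (HbarAlgebra.IsHolLocFam.famι _ hβ)),
    (show A.IsHolLocFam E (𝓘(ℂ, ℂ).prod 𝓘(ℂ, ℂ)) (u₂ ^ N * A.famι W₂ e) from
      HbarAlgebra.IsHolLocFam.mul _ hu₂N (HbarAlgebra.IsHolLocFam.famι _ he)), ?_, fun s => ?_⟩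
  · dsimp only
    rw [hc0, map_zero, mul_zero]
  · refine (A.isUnit_hbarLoc_pow (slice W₂ s) N).mul_left_cancel ?_
    have h3 := congrArg (A.ι (slice W₂ s)) (congrFun hce s)
    have h4 := congrArg (A.loc.res (slice_mono hW s)) (heq s)
    rw [map_mul, map_pow, A.hbarLoc_res, A.loc.res_res, A.ι_res] at h4
    refine h4.trans (h3.trans ?_)
    change A.ι _ (A.sheaf.res (h₁ s) (c (s.1 * s.2)) + A.sheaf.res (h₂ s) (β s.2) +
      A.scal _ (PowerSeries.C ((s.1 : ℂ) - 1)) * (A.scal _ (PowerSeries.C ((s.1 : ℂ) - 1)) * e s)) = _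
    have h5 : ∀ (r : ℂˣ) (h : slice W₂ s ≤ slice W₁ r) (a : A.sheaf.obj.obj (op (slice W₁ r))),
        A.hbarLoc (slice W₂ s) ^ N * A.loc.res h (u₁ r ^ N * A.ι _ a) =
          A.ι _ (A.sheaf.res h a) := fun r h a => by
      rw [← A.hbarLoc_res h, ← map_pow, ← map_mul, ← mul_assoc, k₁, one_mul, A.ι_res]
    have h6 := A.scalLoc_comm (slice W₂ s) ((s.1 : ℂ) - 1) (A.hbarLoc (slice W₂ s) ^ N)
    dsimp only
    rw [mul_add, mul_add, h5, h5, h6.symm.left_comm, h6.symm.left_comm,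
      ← mul_assoc (A.hbarLoc (slice W₂ s) ^ N), k₂, one_mul, map_add, map_add, map_mul, map_mul]
    rfl

/-- The uniqueness of the decomposition of families of sections of `A^loc`. -/
lemma exists_locFam_res_eq_zero {W₁ : Opens (ℂˣ × X)}
    {W₂ : Opens ((ℂˣ × ℂˣ) × X)} (h₁ : ∀ s : ℂˣ × ℂˣ, slice W₂ s ≤ slice W₁ (s.1 * s.2))
    (h₂ : ∀ s : ℂˣ × ℂˣ, slice W₂ s ≤ slice W₁ s.2) {t : ℂˣ} {x₀ : X} (hp₁ : (t, x₀) ∈ W₁)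
    (hp₂ : ((1, t), x₀) ∈ W₂) {c β : Fam ℂˣ A.loc W₁} {e : Fam (ℂˣ × ℂˣ) A.loc W₂}
    (hc : A.IsHolLocFam E 𝓘(ℂ, ℂ) c) (hβ : A.IsHolLocFam E 𝓘(ℂ, ℂ) β)
    (he : A.IsHolLocFam E (𝓘(ℂ, ℂ).prod 𝓘(ℂ, ℂ)) e) (hc0 : c t = 0)
    (heq : ∀ s : ℂˣ × ℂˣ, A.loc.res (h₁ s) (c (s.1 * s.2)) + A.loc.res (h₂ s) (β s.2) =
      A.scalLoc _ ((s.1 : ℂ) - 1) * (A.scalLoc _ ((s.1 : ℂ) - 1) * e s)) :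
    ∃ (W : Opens (ℂˣ × X)) (hW : W ≤ W₁), (t, x₀) ∈ W ∧ Fam.res hW c = 0 := by
  obtain ⟨V, hV, hpV, N₁, c₁, hc₁, hcc⟩ := hc.exists_num hp₁
  obtain ⟨V', hV', hpV', N₂, β₁, hβ₁, hββ⟩ := hβ.exists_num hp₁
  obtain ⟨V₂, hV₂, hpV₂, M, e₁, he₁, hee⟩ := he.exists_num hp₂
  let W₁' : Opens (ℂˣ × X) := V ⊓ V'
  let W₂' : Opens ((ℂˣ × ℂˣ) × X) := ⟨{p | p ∈ V₂ ∧ (p.1.1 * p.1.2, p.2) ∈ W₁' ∧ (p.1.2, p.2) ∈ W₁'},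
    V₂.isOpen.inter ((W₁'.isOpen.preimage
      (by fun_prop : Continuous fun p : (ℂˣ × ℂˣ) × X => (p.1.1 * p.1.2, p.2))).inter
      (W₁'.isOpen.preimage (by fun_prop : Continuous fun p : (ℂˣ × ℂˣ) × X => (p.1.2, p.2))))⟩
  have hW₂' : W₂' ≤ V₂ := fun p hp => hp.1
  have g₁ : ∀ s : ℂˣ × ℂˣ, slice W₂' s ≤ slice W₁' (s.1 * s.2) := fun s x hx => hx.2.1
  have g₂ : ∀ s : ℂˣ × ℂˣ, slice W₂' s ≤ slice W₁' s.2 := fun s x hx => hx.2.2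
  have hp₁' : (t, x₀) ∈ W₁' := ⟨hpV, hpV'⟩
  have hp₂' : ((1, t), x₀) ∈ W₂' := ⟨hpV₂, (one_mul t).symm ▸ hp₁', hp₁'⟩
  obtain ⟨W, hW, hpW, huniq⟩ := A.exists_fam_decomposition_unique g₁ g₂ hp₁' hp₂'
  let c₂ : Fam ℂˣ A.sheaf W₁' := A.hbarFam W₁' ^ (N₂ + M) * Fam.res inf_le_left c₁
  let β₂ : Fam ℂˣ A.sheaf W₁' := A.hbarFam W₁' ^ (N₁ + M) * Fam.res inf_le_right β₁
  let e₂ : Fam (ℂˣ × ℂˣ) A.sheaf W₂' := A.hbarFam W₂' ^ (N₁ + N₂) * Fam.res hW₂' e₁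
  have hc₂ : IsHolFam E 𝓘(ℂ, ℂ) c₂ := A.isHolFam_hbarFam_pow_mul _ (hc₁.res _ _) _
  have he₂ : IsHolFam E (𝓘(ℂ, ℂ).prod 𝓘(ℂ, ℂ)) e₂ := A.isHolFam_hbarFam_pow_mul _ (he₁.res _ _) _
  have kc : ∀ s, A.ι _ (c₂ s) = A.hbarLoc _ ^ (N₁ + N₂ + M) *
      A.loc.res (slice_mono (inf_le_left.trans hV) s) (c s) := fun s => by
    change A.ι _ (A.hbar _ ^ (N₂ + M) * A.sheaf.res (slice_mono inf_le_left s) (c₁ s)) = _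
    rw [map_mul, map_pow, ← A.ι_res, ← hcc s, map_mul, map_pow, A.hbarLoc_res, A.loc.res_res,
      ← mul_assoc, HbarAlgebra.hbarLoc, ← pow_add]
    congr 2
    ring
  have kβ : ∀ s, A.ι _ (β₂ s) = A.hbarLoc _ ^ (N₁ + N₂ + M) *
      A.loc.res (slice_mono (inf_le_right.trans hV') s) (β s) := fun s => by
    change A.ι _ (A.hbar _ ^ (N₁ + M) * A.sheaf.res (slice_mono inf_le_right s) (β₁ s)) = _
    rw [map_mul, map_pow, ← A.ι_res, ← hββ s, map_mul, map_pow, A.hbarLoc_res, A.loc.res_res,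
      ← mul_assoc, HbarAlgebra.hbarLoc, ← pow_add]
    congr 2
    ring
  have ke : ∀ s, A.ι _ (e₂ s) = A.hbarLoc _ ^ (N₁ + N₂ + M) *
      A.loc.res (slice_mono (hW₂'.trans hV₂) s) (e s) := fun s => by
    change A.ι _ (A.hbar _ ^ (N₁ + N₂) * A.sheaf.res (slice_mono hW₂' s) (e₁ s)) = _
    rw [map_mul, map_pow, ← A.ι_res, ← hee s, map_mul, map_pow, A.hbarLoc_res, A.loc.res_res,
      ← mul_assoc, HbarAlgebra.hbarLoc, ← pow_add]
  have hzero := huniq c₂ β₂ e₂ hc₂ he₂ ?_ ?_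
  · refine ⟨W, hW.trans (inf_le_left.trans hV), hpW, funext fun s => ?_⟩
    refine (A.isUnit_hbarLoc_pow (slice W s) (N₁ + N₂ + M)).mul_left_cancel ?_
    have h3 := congrArg (A.ι (slice W s)) (congrFun hzero s)
    rw [Fam.res_apply, ← A.ι_res, kc, map_mul, map_pow, A.hbarLoc_res, A.loc.res_res] at h3
    rw [Fam.res_apply, h3, Pi.zero_apply, Pi.zero_apply, map_zero, mul_zero]
  · refine A.ι_injective _ ?_
    rw [kc, hc0, map_zero, mul_zero, map_zero]
  · funext s
    refine A.ι_injective _ ?_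
    change A.ι _ (A.sheaf.res (g₁ s) (c₂ (s.1 * s.2)) + A.sheaf.res (g₂ s) (β₂ s.2)) =
      A.ι _ (A.scal _ (PowerSeries.C ((s.1 : ℂ) - 1)) *
        (A.scal _ (PowerSeries.C ((s.1 : ℂ) - 1)) * e₂ s))
    have h6 := A.scalLoc_comm (slice W₂' s) ((s.1 : ℂ) - 1) (A.hbarLoc (slice W₂' s) ^ (N₁ + N₂ + M))
    have h7 := congrArg (A.loc.res (slice_mono (hW₂'.trans hV₂) s)) (heq s)
    rw [map_add, map_mul, map_mul, A.scalLoc_res, A.loc.res_res, A.loc.res_res] at h7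
    rw [map_add, map_mul, map_mul, ← A.ι_res, ← A.ι_res, kc, kβ, ke, map_mul, map_mul, map_pow,
      map_pow, A.hbarLoc_res, A.hbarLoc_res, A.loc.res_res, A.loc.res_res, ← mul_add, h7]
    change _ = A.scalLoc _ _ * (A.scalLoc _ _ * _)
    rw [h6.left_comm, h6.left_comm]

end DQAlgebra

end LocDecomposition

/-! ### Germs and sections of inverse images -/

namespace RSp

section Stalks

variable {X Y : RSp.{u}}

/-- The stalk at `x` of the structure sheaf. -/
noncomputable abbrev RingStalk (X : RSp.{u}) (x : X.top) : RingCat.{u} :=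
  TopCat.Presheaf.stalk (X := X.top) X.ring.obj x

/-- The germ at `x` of a section of the structure sheaf. -/
noncomputable def ringGerm {U : Opens X.top} {x : X.top} (hx : x ∈ U) :
    X.ring.obj.obj (op U) →+* X.RingStalk x :=
  (TopCat.Presheaf.germ (X := X.top) X.ring.obj U x hx).hom

lemma ringGerm_res {U V : Opens X.top} {x : X.top} (hx : x ∈ V) (h : V ≤ U)
    (a : X.ring.obj.obj (op U)) : ringGerm hx (X.ring.res h a) = ringGerm (h hx) a :=
  TopCat.Presheaf.germ_res_apply (X := X.top) X.ring.obj (homOfLE h) x hx a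

lemma exists_ringGerm {x : X.top} (b : X.RingStalk x) (O : Opens X.top) (hO : x ∈ O) :
    ∃ (U : Opens X.top) (_ : U ≤ O) (hx : x ∈ U) (a : X.ring.obj.obj (op U)),
      ringGerm hx a = b := by
  obtain ⟨U, hx, a, ha⟩ := TopCat.Presheaf.exists_germ_eq (X := X.top) X.ring.obj b
  exact ⟨U ⊓ O, inf_le_right, ⟨hx, hO⟩, X.ring.res inf_le_left a, (ringGerm_res _ _ _).trans ha⟩

lemma exists_res_eq_of_ringGerm_eq {U V : Opens X.top} {x : X.top} {hU : x ∈ U} {hV : x ∈ V}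
    {a : X.ring.obj.obj (op U)} {b : X.ring.obj.obj (op V)} (h : ringGerm hU a = ringGerm hV b) :
    ∃ (W : Opens X.top) (h₁ : W ≤ U) (h₂ : W ≤ V), x ∈ W ∧ X.ring.res h₁ a = X.ring.res h₂ b := by
  obtain ⟨W, hW, i, j, hij⟩ := TopCat.Presheaf.germ_eq (X := X.top) X.ring.obj x hU hV a b h
  exact ⟨W, leOfHom i, leOfHom j, hW, hij⟩

/-- The map on stalks given by a morphism of ringed spaces. -/
lemma exists_stalkHom (f : X ⟶ Y) {x : X.top} {y : Y.top} (hxy : f.base x = y) :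
    ∃ φ : Y.RingStalk y →+* X.RingStalk x, ∀ (V : Opens Y.top) (hy : y ∈ V)
      (hx : x ∈ (Opens.map f.base).obj V) (a : Y.ring.obj.obj (op V)),
        φ (ringGerm hy a) = ringGerm hx (f.app V a) := by
  subst hxy
  refine ⟨((TopCat.Presheaf.stalkFunctor RingCat (f.base x)).map f.comap.hom ≫
    TopCat.Presheaf.stalkPushforward RingCat f.base X.ring.obj x).hom, fun V hy hx a => ?_⟩
  have h1 := TopCat.Presheaf.stalkFunctor_map_germ (C := RingCat) V (f.base x) hy f.comap.hom
  have h2 := TopCat.Presheaf.stalkPushforward_germ RingCat f.base X.ring.obj V x hy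
  have h3 := congrArg (fun g => g.hom a) h1
  have h4 := congrArg (fun g => g.hom (f.app V a)) h2
  exact (congrArg (TopCat.Presheaf.stalkPushforward RingCat f.base X.ring.obj x).hom h3).trans h4

/-- The stalk at `x` of a module. -/
noncomputable abbrev ModStalk (M : X.Mod) (x : X.top) : Type u :=
  TopCat.Presheaf.stalk (C := Ab.{u}) (X := X.top) M.val.presheaf x

noncomputable instance (M : X.Mod) (x : X.top) : Module (X.RingStalk x) (ModStalk M x) :=
  inferInstanceAs (Module (TopCat.Presheaf.stalk (C := RingCat.{u}) (X := X.top) X.ring.obj x)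
    (TopCat.Presheaf.stalk (C := Ab.{u}) (X := X.top) M.val.presheaf x))

/-- The germ at `x` of a section of a module. -/
noncomputable def secGerm (M : X.Mod) {U : Opens X.top} {x : X.top} (hx : x ∈ U) :
    Sec M U →+ ModStalk M x :=
  (TopCat.Presheaf.germ (C := Ab.{u}) (X := X.top) M.val.presheaf U x hx).hom

lemma secGerm_res (M : X.Mod) {U V : Opens X.top} {x : X.top} (hx : x ∈ V) (h : V ≤ U)
    (s : Sec M U) : secGerm M hx (secRes M h s) = secGerm M (h hx) s :=
  TopCat.Presheaf.germ_res_apply (X := X.top) M.val.presheaf (homOfLE h) x hx s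

lemma secGerm_smul (M : X.Mod) {U : Opens X.top} {x : X.top} (hx : x ∈ U)
    (r : X.ring.obj.obj (op U)) (s : Sec M U) :
    secGerm M hx (r • s) = ringGerm hx r • secGerm M hx s :=
  PresheafOfModules.germ_ringCat_smul M.val x U hx r s

lemma exists_res_eq_of_secGerm_eq (M : X.Mod) {U V : Opens X.top} {x : X.top} {hU : x ∈ U}
    {hV : x ∈ V} {s : Sec M U} {s' : Sec M V} (h : secGerm M hU s = secGerm M hV s') :
    ∃ (W : Opens X.top) (h₁ : W ≤ U) (h₂ : W ≤ V), x ∈ W ∧ secRes M h₁ s = secRes M h₂ s' := by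
  obtain ⟨W, hW, i, j, hij⟩ := TopCat.Presheaf.germ_eq (X := X.top) M.val.presheaf x hU hV s s' h
  exact ⟨W, leOfHom i, leOfHom j, hW, hij⟩

lemma sec_ext (M : X.Mod) {U : Opens X.top} {s s' : Sec M U}
    (h : ∀ x (hx : x ∈ U), secGerm M hx s = secGerm M hx s') : s = s' :=
  TopCat.Presheaf.section_ext (X := X.top) (⟨M.val.presheaf, M.isSheaf⟩ : TopCat.Sheaf Ab X.top)
    U s s' h

end Stalks

section Pull

variable {X Y Z : RSp.{u}}

lemma secRes_self (M : X.Mod) {U : Opens X.top} (h : U ≤ U) (s : Sec M U) : secRes M h s = s := by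
  refine sec_ext M fun x hx => secGerm_res M hx h s

/-- The morphism `N ⟶ f_* P` given by maps on sections. -/
noncomputable def homToPush (f : X ⟶ Y) (N : Y.Mod) (P : X.Mod)
    (a : ∀ V : Opens Y.top, Sec N V →+ Sec P ((Opens.map f.base).obj V))
    (hres : ∀ {U V : Opens Y.top} (h : V ≤ U) (s : Sec N U), a V (secRes N h s) =
      secRes P ((Opens.map f.base).map (homOfLE h)).le (a U s))
    (hsmul : ∀ (V : Opens Y.top) (r : Y.ring.obj.obj (op V)) (s : Sec N V),
      a V (r • s) = f.app V r • a V s) : N ⟶ (push f).obj P :=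
  ⟨PresheafOfModules.homMk
    { app := fun V => AddCommGrpCat.ofHom (a V.unop)
      naturality := fun _ _ i => AddCommGrpCat.hom_ext (AddMonoidHom.ext fun s =>
        hres (leOfHom i.unop) s) }
    (fun V r s => hsmul V.unop r s)⟩

lemma homSec_id (M : X.Mod) (U : Opens X.top) (s : Sec M U) : homSec (𝟙 M) U s = s := rfl

/-- Morphisms out of an inverse image, on the sections `1 ⊗ s`. -/
lemma homSec_homEquiv_symm (f : X ⟶ Y) {N : Y.Mod} {P : X.Mod} (u : N ⟶ (push f).obj P)
    (V : Opens Y.top) (s : Sec N V) :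
    homSec (((adj f).homEquiv N P).symm u) _ (pullSec f N V s) = homSec u V s := by
  have h1 : (adj f).homEquiv N P (((adj f).homEquiv N P).symm u) = u := Equiv.apply_symm_apply _ _
  rw [Adjunction.homEquiv_unit] at h1
  exact congrArg (fun α : N ⟶ (push f).obj P => homSec α V s) h1

lemma homSec_homEquiv (f : X ⟶ Y) {N : Y.Mod} {P : X.Mod} (u : (pull f).obj N ⟶ P)
    (V : Opens Y.top) (s : Sec N V) :
    homSec ((adj f).homEquiv N P u) V s = homSec u _ (pullSec f N V s) := by
  rw [Adjunction.homEquiv_unit]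
  rfl

lemma homSec_homEquiv_homEquiv (f : X ⟶ Y) (g : Y ⟶ Z) {N : Z.Mod} {P : X.Mod}
    (u : (pull f).obj ((pull g).obj N) ⟶ P) (V : Opens Z.top) (s : Sec N V) :
    homSec ((adj g).homEquiv _ _ ((adj f).homEquiv _ _ u)) V s =
      homSec u _ (pullSec f _ _ (pullSec g N V s)) :=
  (homSec_homEquiv g _ V s).trans (homSec_homEquiv f u _ _)

/-- Morphisms out of an inverse image are determined by their values on the sections `1 ⊗ s`. -/
lemma pull_hom_ext (f : X ⟶ Y) {N : Y.Mod} {P : X.Mod} {u v : (pull f).obj N ⟶ P}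
    (h : ∀ (V : Opens Y.top) (s : Sec N V),
      homSec u _ (pullSec f N V s) = homSec v _ (pullSec f N V s)) : u = v := by
  refine ((adj f).homEquiv N P).injective (SheafOfModules.hom_ext (PresheafOfModules.hom_ext
    fun V => ModuleCat.hom_ext (LinearMap.ext fun s => ?_)))
  have h1 := homSec_homEquiv f u V.unop s
  have h2 := homSec_homEquiv f v V.unop s
  exact h1.trans ((h _ _).trans h2.symm)

lemma pull_pull_hom_ext (f : X ⟶ Y) (g : Y ⟶ Z) {N : Z.Mod} {P : X.Mod}
    {u v : (pull f).obj ((pull g).obj N) ⟶ P}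
    (h : ∀ (V : Opens Z.top) (s : Sec N V), homSec u _ (pullSec f _ _ (pullSec g N V s)) =
      homSec v _ (pullSec f _ _ (pullSec g N V s))) : u = v := by
  refine ((adj f).homEquiv _ P).injective (pull_hom_ext g fun V s => ?_)
  exact (homSec_homEquiv f u _ _).trans ((h V s).trans (homSec_homEquiv f v _ _).symm)

lemma homSec_eqToHom_push {f g : X ⟶ Y} (h : f = g) (P : X.Mod) (V : Opens Y.top)
    (s : Sec ((push f).obj P) V) (e : push f = push g) :
    homSec ((eqToHom e : push f ⟶ push g).app P) V s =
      secRes P (le_of_eq (by rw [h])) (show Sec P ((Opens.map f.base).obj V) from s) := by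
  subst h
  exact (secRes_self P _ s).symm

/-- The canonical isomorphism `f^* g^* ≅ f'^* g'^*` sends `1 ⊗ 1 ⊗ s` to `1 ⊗ 1 ⊗ s`. -/
lemma homSec_pullSq {Y' : RSp.{u}} {f : X ⟶ Y} {g : Y ⟶ Z} {f' : X ⟶ Y'} {g' : Y' ⟶ Z}
    (h : f ≫ g = f' ≫ g') (N : Z.Mod) (V : Opens Z.top) (s : Sec N V)
    (hV : (Opens.map (f ≫ g).base).obj V ≤ (Opens.map (f' ≫ g').base).obj V) :
    homSec ((pullSq h).hom.app N) _ (pullSec f _ _ (pullSec g N V s)) =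
      secRes ((pull f').obj ((pull g').obj N)) hV (pullSec f' _ _ (pullSec g' N V s)) := by
  have h1 := (congrArg (fun w => (adj g).homEquiv _ _ ((adj f).homEquiv _ _ w))
    (Category.comp_id ((pullSq h).hom.app N)).symm).trans
      (homEquiv_conjugate (adj g) (adj f) (adj g') (adj f') (eqToHom (push_eq h).symm) N
        ((pull f').obj ((pull g').obj N)) (𝟙 _))
  rw [← homSec_homEquiv_homEquiv f g, h1, homSec_comp]
  have h2 := (homSec_homEquiv_homEquiv f' g' (𝟙 ((pull f').obj ((pull g').obj N))) V s).trans
    (homSec_id _ _ _)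
  rw [h2]
  have h3 := homSec_eqToHom_push (f := f' ≫ g') (g := f ≫ g) h.symm ((pull f').obj ((pull g').obj N))
    V (pullSec f' _ _ (pullSec g' N V s)) (congrArg push h.symm)
  exact h3

/-- The submodule generated by the sections `1 ⊗ s`. -/
noncomputable def pullSpan (f : X ⟶ Y) (N : Y.Mod) (U : Opens X.top) :
    Submodule (X.ring.obj.obj (op U)) (Sec ((pull f).obj N) U) :=
  Submodule.span _ {t | ∃ (V : Opens Y.top) (h : U ≤ (Opens.map f.base).obj V) (s : Sec N V),
    t = secRes _ h (pullSec f N V s)}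

lemma secRes_mem_span {M : X.Mod} {U V : Opens X.top} (h : V ≤ U) {S : Set (Sec M U)}
    {S' : Set (Sec M V)} (hS : ∀ s ∈ S, secRes M h s ∈ S') {s : Sec M U}
    (hs : s ∈ Submodule.span (X.ring.obj.obj (op U)) S) :
    secRes M h s ∈ Submodule.span (X.ring.obj.obj (op V)) S' := by
  induction hs using Submodule.span_induction with
  | mem s hs => exact Submodule.subset_span (hS s hs)
  | zero => rw [map_zero]; exact zero_mem _
  | add s s' _ _ hs hs' => rw [map_add]; exact add_mem hs hs'
  | smul r s _ hs => rw [secRes_smul]; exact Submodule.smul_mem _ _ hs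

lemma secRes_mem_pullSpan (f : X ⟶ Y) (N : Y.Mod) {U V : Opens X.top} (h : V ≤ U)
    {s : Sec ((pull f).obj N) U} (hs : s ∈ pullSpan f N U) :
    secRes _ h s ∈ pullSpan f N V := by
  refine secRes_mem_span h ?_ hs
  rintro _ ⟨V', h', t, rfl⟩
  exact ⟨V', h.trans h', t, secRes_secRes _ _ _ _⟩

/-- The subsheaf of the inverse image that is generated by the sections `1 ⊗ s`. -/
noncomputable def pullGen (f : X ⟶ Y) (N : Y.Mod) : SubMod ((pull f).obj N) where
  carrier U :=
    { carrier := {s | ∀ x ∈ U, ∃ (V : Opens X.top) (h : V ≤ U), x ∈ V ∧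
        secRes _ h s ∈ pullSpan f N V}
      add_mem' := by
        intro s s' hs hs' x hx
        obtain ⟨V, h, hxV, hV⟩ := hs x hx
        obtain ⟨V', h', hxV', hV'⟩ := hs' x hx
        refine ⟨V ⊓ V', inf_le_left.trans h, ⟨hxV, hxV'⟩, ?_⟩
        rw [map_add]
        refine add_mem ?_ ?_
        · rw [← secRes_secRes _ h inf_le_left]
          exact secRes_mem_pullSpan f N _ hV
        · rw [← secRes_secRes _ h' inf_le_right]
          exact secRes_mem_pullSpan f N _ hV'
      zero_mem' := fun x hx => ⟨U, le_rfl, hx, by rw [map_zero]; exact zero_mem _⟩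
      smul_mem' := by
        intro r s hs x hx
        obtain ⟨V, h, hxV, hV⟩ := hs x hx
        exact ⟨V, h, hxV, by rw [secRes_smul]; exact Submodule.smul_mem _ _ hV⟩ }
  res_mem := by
    intro U V h s hs x hx
    obtain ⟨W, h', hxW, hW⟩ := hs x (h hx)
    refine ⟨W ⊓ V, inf_le_right, ⟨hxW, hx⟩, ?_⟩
    rw [secRes_secRes, ← secRes_secRes _ h' inf_le_left]
    exact secRes_mem_pullSpan f N _ hW
  of_local := by
    intro U s hs x hx
    obtain ⟨V, h, hxV, hV⟩ := hs x hx
    obtain ⟨W, h', hxW, hW⟩ := hV x hxV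
    rw [secRes_secRes] at hW
    exact ⟨W, h'.trans h, hxW, hW⟩

/-- The inclusion of a subsheaf. -/
noncomputable def SubMod.incl {M : X.Mod} (S : SubMod M) : S.toMod ⟶ M :=
  ⟨{ app := fun V => ModuleCat.ofHom (S.carrier V.unop).subtype
     naturality := fun _ => rfl }⟩

/-- The corestriction of a morphism to a subsheaf. -/
noncomputable def SubMod.lift {M N : X.Mod} (S : SubMod M) (φ : N ⟶ M)
    (h : ∀ V s, homSec φ V s ∈ S.carrier V) : N ⟶ S.toMod :=
  ⟨{ app := fun V => ModuleCat.ofHom ((homSec φ V.unop).codRestrict _ (h V.unop))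
     naturality := fun {V V'} i => by
       ext (s : Sec N V.unop)
       exact Subtype.ext (homSec_res φ (leOfHom i.unop) s) }⟩

/-- An inverse image is locally generated by the sections `1 ⊗ s`. -/
lemma exists_mem_pullSpan (f : X ⟶ Y) (N : Y.Mod) {U : Opens X.top} (s : Sec ((pull f).obj N) U)
    {x : X.top} (hx : x ∈ U) : ∃ (V : Opens X.top) (h : V ≤ U), x ∈ V ∧
      secRes _ h s ∈ pullSpan f N V := by
  have hmem : ∀ (V : Opens Y.top) (s : Sec N V), pullSec f N V s ∈ (pullGen f N).carrier _ :=
    fun V s x hx => ⟨_, le_rfl, hx, Submodule.subset_span ⟨V, le_rfl, s, rfl⟩⟩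
  let u : N ⟶ (push f).obj (pullGen f N).toMod := homToPush f N (pullGen f N).toMod
    (fun V => AddMonoidHom.mk' (fun s => (⟨pullSec f N V s, hmem V s⟩ :
        (pullGen f N).carrier ((Opens.map f.base).obj V)))
      fun s s' => Subtype.ext (map_add (pullSec f N V) s s'))
    (fun h s => Subtype.ext (pullSec_res f N h s)) (fun V r s => Subtype.ext (pullSec_smul f N V r s))
  have hid : ((adj f).homEquiv N _).symm u ≫ (pullGen f N).incl = 𝟙 _ := by
    refine pull_hom_ext f fun V s => ?_
    rw [homSec_comp, homSec_homEquiv_symm]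
    change (homSec u V s : (pullGen f N).carrier _).1 = pullSec f N V s
    rfl
  have h1 : homSec (((adj f).homEquiv N _).symm u ≫ (pullGen f N).incl) U s = s := by
    rw [hid]; rfl
  have h2 : (homSec (((adj f).homEquiv N _).symm u) U s : (pullGen f N).carrier U).1 = s := h1
  rw [← h2]
  exact (homSec (((adj f).homEquiv N _).symm u) U s : (pullGen f N).carrier U).2 x hx

end Pull

end RSp

/-! ### Skyscraper modules -/

namespace RSp

section Skyscraper

variable {X Y Z : RSp.{u}} (x : X.top) (G : Type u) [AddCommGroup G]

/-- The sections over `O` of the skyscraper module at `x` given by the coinduced module of the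
additive maps from the stalk at `x` of the structure sheaf to `G`. They are zero if `x` is not
in `O`. -/
def SkySec (O : Opens X.top) : Type u := PLift (x ∈ O) → (X.RingStalk x →+ G)

noncomputable instance (O : Opens X.top) : AddCommGroup (SkySec x G O) :=
  inferInstanceAs (AddCommGroup (PLift (x ∈ O) → (X.RingStalk x →+ G)))

noncomputable instance (O : Opens X.top) : Module (X.ring.obj.obj (op O)) (SkySec x G O) where
  smul a χ := fun h => (χ h).comp (AddMonoidHom.mulRight (ringGerm h.down a))
  one_smul χ := funext fun h => AddMonoidHom.ext fun b => by
    change χ h (b * ringGerm h.down 1) = χ h b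
    rw [map_one, mul_one]
  mul_smul a a' χ := funext fun h => AddMonoidHom.ext fun b => by
    change χ h (b * ringGerm h.down (a * a')) = χ h (b * ringGerm h.down a * ringGerm h.down a')
    rw [map_mul (ringGerm h.down), mul_assoc]
  smul_zero a := rfl
  smul_add a χ χ' := rfl
  add_smul a a' χ := funext fun h => AddMonoidHom.ext fun b => by
    change χ h (b * ringGerm h.down (a + a')) =
      χ h (b * ringGerm h.down a) + χ h (b * ringGerm h.down a')
    rw [map_add, mul_add, map_add]
  zero_smul χ := funext fun h => AddMonoidHom.ext fun b => by
    change χ h (b * ringGerm h.down 0) = 0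
    rw [map_zero, mul_zero, map_zero]

/-- Restriction of sections of the skyscraper module. -/
noncomputable def SkySec.res {U V : Opens X.top} (h : V ≤ U) : SkySec x G U →+ SkySec x G V :=
  AddMonoidHom.mk' (fun χ k => χ ⟨h k.down⟩) fun _ _ => rfl

/-- The skyscraper module as a presheaf of abelian groups. -/
noncomputable def skyPresheaf : (Opens X.top)ᵒᵖ ⥤ Ab.{u} where
  obj O := AddCommGrpCat.of (SkySec x G O.unop)
  map i := AddCommGrpCat.ofHom (SkySec.res x G (leOfHom i.unop))
  map_id _ := rfl
  map_comp _ _ := rfl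

noncomputable instance (O : (Opens X.top)ᵒᵖ) : Module (X.ring.obj.obj O) ((skyPresheaf x G).obj O) :=
  inferInstanceAs (Module (X.ring.obj.obj (op O.unop)) (SkySec x G O.unop))

lemma skyPresheaf_isSheaf :
    Presheaf.IsSheaf (Opens.grothendieckTopology X.top) (skyPresheaf x G) := by
  refine (TopCat.Presheaf.isSheaf_iff_isSheafUniqueGluing (X := X.top) _).2 ?_
  intro ι V (a : ∀ i, SkySec x G (V i)) ha
  replace ha : ∀ i j, SkySec.res x G (inf_le_left : V i ⊓ V j ≤ V i) (a i) =
    SkySec.res x G inf_le_right (a j) := ha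
  have hex : ∀ h : PLift (x ∈ iSup V), ∃ i, x ∈ V i := fun h => Opens.mem_iSup.1 h.down
  refine ⟨(fun h => a (hex h).choose ⟨(hex h).choose_spec⟩ : SkySec x G (iSup V)), fun i => ?_, ?_⟩
  · refine funext fun (h : PLift (x ∈ V i)) => ?_
    have h' : PLift (x ∈ iSup V) := ⟨Opens.mem_iSup.2 ⟨i, h.down⟩⟩
    exact congrFun (ha (hex h').choose i) ⟨(hex h').choose_spec, h.down⟩
  · intro (c : SkySec x G (iSup V)) hc
    refine funext fun h => ?_
    exact congrFun (show SkySec.res x G (le_iSup V (hex h).choose) c = a (hex h).choose from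
      hc (hex h).choose) ⟨(hex h).choose_spec⟩

/-- The skyscraper module at `x` given by the additive maps from the stalk at `x` of the structure
sheaf to `G`. -/
noncomputable def skyMod : X.Mod :=
  ⟨PresheafOfModules.ofPresheaf (skyPresheaf x G) fun {U V} i r (s : SkySec x G U.unop) => by
    refine funext fun (h : PLift (x ∈ V.unop)) => AddMonoidHom.ext fun b => ?_
    exact congrArg (fun c => s ⟨leOfHom i.unop h.down⟩ (b * c))
      (ringGerm_res h.down (leOfHom i.unop) r).symm, skyPresheaf_isSheaf x G⟩

/-- The section of the skyscraper module, evaluated on the stalk. -/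
noncomputable def skyVal {O : Opens X.top} (hO : x ∈ O) :
    Sec (skyMod x G) O →+ (X.RingStalk x →+ G) :=
  AddMonoidHom.mk' (fun χ => (show SkySec x G O from χ) ⟨hO⟩) fun _ _ => rfl

variable {x G}

lemma skyVal_smul {O : Opens X.top} (hO : x ∈ O) (a : X.ring.obj.obj (op O))
    (χ : Sec (skyMod x G) O) (b : X.RingStalk x) :
    skyVal x G hO (a • χ) b = skyVal x G hO χ (b * ringGerm hO a) := rfl

lemma skyVal_res {U V : Opens X.top} (hV : x ∈ V) (h : V ≤ U) (χ : Sec (skyMod x G) U) :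
    skyVal x G hV (secRes _ h χ) = skyVal x G (h hV) χ := rfl

/-- Balanced additive maps `χ_m` on the stalk of the structure sheaf at `x`, for the sections `m`
of `N` near the image of `x`, define a morphism from the inverse image of `N` to a skyscraper module
with `1 ⊗ m ↦ χ_m`. -/
lemma exists_hom_sky (f : X ⟶ Y) (g : Y ⟶ Z) (N : Z.Mod)
    (χ : ∀ V : Opens Z.top, x ∈ (Opens.map f.base).obj ((Opens.map g.base).obj V) →
      Sec N V →+ (X.RingStalk x →+ G))
    (hres : ∀ {U V : Opens Z.top} (h : V ≤ U) (hx) (hx') (s : Sec N U),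
      χ V hx (secRes N h s) = χ U hx' s)
    (hsmul : ∀ (V : Opens Z.top) (hx) (r : Z.ring.obj.obj (op V)) (s : Sec N V)
      (b : X.RingStalk x), χ V hx (r • s) b = χ V hx s (b * ringGerm hx (f.app _ (g.app V r)))) :
    ∃ Ψ : (pull f).obj ((pull g).obj N) ⟶ skyMod x G, ∀ (V : Opens Z.top) (s : Sec N V)
      (hx : x ∈ (Opens.map f.base).obj ((Opens.map g.base).obj V)),
      skyVal x G hx (homSec Ψ _ (pullSec f _ _ (pullSec g N V s))) = χ V hx s := by
  let u : N ⟶ (push (f ≫ g)).obj (skyMod x G) := homToPush (f ≫ g) N (skyMod x G)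
    (fun V => AddMonoidHom.mk' (fun s => (fun h => χ V h.down s :
        SkySec x G ((Opens.map (f ≫ g).base).obj V)))
      fun s s' => funext fun h => map_add (χ V h.down) s s')
    (fun h s => funext fun k => hres h k.down _ s)
    (fun V r s => funext fun h => AddMonoidHom.ext fun b => hsmul V h.down r s b)
  let u' : N ⟶ (push g).obj ((push f).obj (skyMod x G)) := u
  refine ⟨((adj f).homEquiv _ _).symm (((adj g).homEquiv _ _).symm u'), fun V s hx => ?_⟩
  rw [homSec_homEquiv_symm, homSec_homEquiv_symm]
  rfl

end Skyscraper

end RSp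

/-- Let `s`, `q : R₁ → R₂` be ring homomorphisms that agree on the image of `p : R₀ → R₁`, let `ev`
be a retraction of `p` and let `T` be a central element of `R₂`. If each element of `R₂` has a
decomposition `s c + q β + T e` with `ev c = 0`, and if `c` is unique, then `b ↦ c` is an
additive map. -/
lemma exists_residue {R₀ R₁ R₂ : Type*} [Ring R₀] [Ring R₁] [Ring R₂] (s q : R₁ →+* R₂)
    (ev : R₁ →+* R₀) (p : R₀ →+* R₁) (hev : ∀ r, ev (p r) = r) (hsq : ∀ r, s (p r) = q (p r))
    (T : R₂) (hT : ∀ b, T * b = b * T)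
    (hex : ∀ b, ∃ c β e, ev c = 0 ∧ b = s c + q β + T * e)
    (huniq : ∀ c β e, ev c = 0 → s c + q β = T * e → c = 0) :
    ∃ K : R₂ →+ R₁, (∀ b r, K (b * s (p r)) = K b * p r) ∧ (∀ b, K (b * T) = 0) ∧
      (∀ a, K (q a) = 0) ∧ ∀ a, K (s a) = a - p (ev a) := by
  choose c β e hc hb using hex
  have key : ∀ b c' β' e', ev c' = 0 → b = s c' + q β' + T * e' → c b = c' := by
    intro b c' β' e' hc' hb'
    refine sub_eq_zero.1 (huniq (c b - c') (β b - β') (e' - e b) ?_ ?_)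
    · rw [map_sub, hc, hc', sub_zero]
    · have h1 : s (c b) + q (β b) + T * e b = s c' + q β' + T * e' := (hb b).symm.trans hb'
      rw [map_sub, map_sub, mul_sub]
      rw [← sub_eq_zero] at h1 ⊢
      rw [← h1]
      abel
  refine ⟨AddMonoidHom.mk' c fun b b' => key _ _ (β b + β b') (e b + e b') ?_ ?_, fun b r =>
    key _ _ (β b * p r) (e b * s (p r)) ?_ ?_, fun b => key _ _ 0 b (map_zero _) ?_,
    fun a => key _ _ a 0 (map_zero _) ?_, fun a => key _ _ (p (ev a)) 0 ?_ ?_⟩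
  · rw [map_add, hc, hc, add_zero]
  · nth_rewrite 1 [hb b, hb b']
    rw [map_add, map_add, mul_add]
    abel
  · change ev (c b * p r) = 0
    rw [map_mul, hc, zero_mul]
  · change b * s (p r) = s (c b * p r) + q (β b * p r) + T * (e b * s (p r))
    nth_rewrite 1 [hb b]
    rw [add_mul, add_mul, map_mul, map_mul, hsq, mul_assoc]
  · rw [map_zero, map_zero, add_zero, zero_add, hT]
  · rw [map_zero, mul_zero, add_zero, zero_add]
  · rw [map_sub, hev, sub_self]
  · rw [map_sub, hsq, mul_zero, add_zero, sub_add_cancel]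

/-! ### The residue map of a module -/

namespace RSp

variable {X Y : RSp.{u}}

/-- To prove a local property at `x` of the sections of an inverse image, it is enough to consider
the sections `a ⊗ s`. -/
lemma pull_induction (f : X ⟶ Y) (N : Y.Mod) (x : X.top)
    {Q : ∀ O : Opens X.top, x ∈ O → Sec ((pull f).obj N) O → Prop}
    (res : ∀ (U V : Opens X.top) (h : V ≤ U) (hV : x ∈ V) (s : Sec ((pull f).obj N) U),
      Q V hV (secRes _ h s) → Q U (h hV) s)
    (zero : ∀ (O : Opens X.top) (hO : x ∈ O), Q O hO 0)
    (add : ∀ (O : Opens X.top) (hO : x ∈ O) (s s' : Sec ((pull f).obj N) O), Q O hO s →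
      Q O hO s' → Q O hO (s + s'))
    (smul_mem : ∀ (O : Opens X.top) (hO : x ∈ O) (V : Opens Y.top)
      (h : O ≤ (Opens.map f.base).obj V) (a : X.ring.obj.obj (op O)) (s : Sec N V),
      Q O hO (a • secRes _ h (pullSec f N V s)))
    (O : Opens X.top) (hO : x ∈ O) (s : Sec ((pull f).obj N) O) : Q O hO s := by
  obtain ⟨V, h, hxV, hs⟩ := exists_mem_pullSpan f N s hO
  refine res O V h hxV s ?_
  refine Submodule.closure_induction (p := fun t _ => Q V hxV t) (zero V hxV)
    (fun t t' _ _ ht ht' => add V hxV t t' ht ht') ?_ hs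
  rintro a _ ⟨V', h', t, rfl⟩
  exact smul_mem V hxV V' h' a t

end RSp

/-- An additive map from the stalk of the structure sheaf of `X₂` at a point `w` over `z` to the
stalk at `z`, which sends a function `b(t₁, t₂, x) = c(t₁ t₂, x) + β(t₂, x) + (t₁ - 1)² e(t₁, t₂, x)`
with `c(t, x) = 0` to `c`, where `z = (t, x)` and `w = (1, t, x)`. -/
structure CStarDiagram.Residue (D : CStarDiagram.{u}) (z : D.X₁.top) where
  w : D.X₂.top
  sig_w : D.sig.base w = z
  q₂₃_w : D.q₂₃.base w = z
  idMu_w : D.idMu.base w = D.e (D.mu.base z)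
  T : D.X₂.RingStalk w
  germ_tau : ∀ (O : Opens D.X₁.top) (hO : w ∈ (Opens.map D.idMu.base).obj O),
    RSp.ringGerm hO (D.idMu.app O (D.tau O ^ 2)) = T
  comm : ∀ b, T * b = b * T
  K : D.X₂.RingStalk w →+ D.X₁.RingStalk z
  K_mul_const : ∀ (V : Opens D.X₀.top) (hz : z ∈ (Opens.map D.p₂.base).obj V)
    (hw : w ∈ (Opens.map D.sig.base).obj ((Opens.map D.p₂.base).obj V)) (r : D.X₀.ring.obj.obj (op V))
    (b : D.X₂.RingStalk w), K (b * RSp.ringGerm hw (D.sig.app _ (D.p₂.app V r))) =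
      K b * RSp.ringGerm hz (D.p₂.app V r)
  K_mul_T : ∀ b, K (b * T) = 0
  K_q₂₃ : ∀ (O : Opens D.X₁.top) (hw : w ∈ (Opens.map D.q₂₃.base).obj O)
    (a : D.X₁.ring.obj.obj (op O)), K (RSp.ringGerm hw (D.q₂₃.app O a)) = 0
  K_sig : ∀ (O : Opens D.X₁.top) (hz : z ∈ O) (hw : w ∈ (Opens.map D.sig.base).obj O)
    (a : D.X₁.ring.obj.obj (op O)), ∃ (V : Opens D.X₀.top)
      (hV : z ∈ (Opens.map D.p₂.base).obj V) (r : D.X₀.ring.obj.obj (op V)),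
      K (RSp.ringGerm hw (D.sig.app O a)) = RSp.ringGerm hz a - RSp.ringGerm hV (D.p₂.app V r)

namespace CStarDiagram.Residue

open RSp

variable {D : CStarDiagram.{u}} {z : D.X₁.top} (ρ : D.Residue z) (N : D.X₀.Mod)

lemma mem_sig {O : Opens D.X₁.top} (hz : z ∈ O) : ρ.w ∈ (Opens.map D.sig.base).obj O :=
  show D.sig.base ρ.w ∈ O from ρ.sig_w.symm ▸ hz

lemma mem_q₂₃ {O : Opens D.X₁.top} (hz : z ∈ O) : ρ.w ∈ (Opens.map D.q₂₃.base).obj O :=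
  show D.q₂₃.base ρ.w ∈ O from ρ.q₂₃_w.symm ▸ hz

lemma mem_of_sig {O : Opens D.X₁.top} (hw : ρ.w ∈ (Opens.map D.sig.base).obj O) : z ∈ O :=
  ρ.sig_w ▸ (show D.sig.base ρ.w ∈ O from hw)

/-- The canonical isomorphism `q₂₃^* p₂^* N ≅ sig^* p₂^* N`. -/
noncomputable def _root_.CStarDiagram.kappa (D : CStarDiagram.{u}) (N : D.X₀.Mod) :
    (pull D.q₂₃).obj ((pull D.p₂).obj N) ⟶ (pull D.sig).obj ((pull D.p₂).obj N) :=
  (pullSq D.q₂₃_p₂).hom.app N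

lemma _root_.CStarDiagram.kappa_pullSec (D : CStarDiagram.{u}) (N : D.X₀.Mod) (V : Opens D.X₀.top)
    (s : Sec N V) (h : (Opens.map D.q₂₃.base).obj ((Opens.map D.p₂.base).obj V) ≤
      (Opens.map D.sig.base).obj ((Opens.map D.p₂.base).obj V)) :
    homSec (D.kappa N) _ (pullSec D.q₂₃ _ _ (pullSec D.p₂ N V s)) =
      secRes _ h (pullSec D.sig _ _ (pullSec D.p₂ N V s)) :=
  homSec_pullSq D.q₂₃_p₂ N V s h

lemma _root_.CStarDiagram.map_q₂₃_le (D : CStarDiagram.{u}) (V : Opens D.X₀.top) :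
    (Opens.map D.q₂₃.base).obj ((Opens.map D.p₂.base).obj V) ≤
      (Opens.map D.sig.base).obj ((Opens.map D.p₂.base).obj V) :=
  show (Opens.map (D.q₂₃ ≫ D.p₂).base).obj V ≤ (Opens.map (D.sig ≫ D.p₂).base).obj V from
    le_of_eq (by rw [D.q₂₃_p₂])

/-- A morphism that extends the residue map to `sig^* p₂^* N`, with values in the stalk of
`p₂^* N`. -/
def IsExtension {N : D.X₀.Mod}
    (Ψ : (pull D.sig).obj ((pull D.p₂).obj N) ⟶ skyMod ρ.w (ModStalk ((pull D.p₂).obj N) z)) :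
    Prop :=
  ∀ (V : Opens D.X₀.top) (s : Sec N V)
    (hw : ρ.w ∈ (Opens.map D.sig.base).obj ((Opens.map D.p₂.base).obj V))
    (hz : z ∈ (Opens.map D.p₂.base).obj V) (b : D.X₂.RingStalk ρ.w),
      skyVal ρ.w _ hw (homSec Ψ _ (pullSec D.sig _ _ (pullSec D.p₂ N V s))) b =
        ρ.K b • secGerm ((pull D.p₂).obj N) hz (pullSec D.p₂ N V s)

lemma exists_isExtension : ∃ Ψ : (pull D.sig).obj ((pull D.p₂).obj N) ⟶
    skyMod ρ.w (ModStalk ((pull D.p₂).obj N) z), ρ.IsExtension Ψ := by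
  obtain ⟨Ψ, hΨ⟩ := exists_hom_sky (x := ρ.w) (G := ModStalk ((pull D.p₂).obj N) z) D.sig D.p₂ N
    (fun V hw => AddMonoidHom.mk' (fun s => AddMonoidHom.mk' (fun b =>
        ρ.K b • secGerm ((pull D.p₂).obj N) (ρ.mem_of_sig hw) (pullSec D.p₂ N V s))
        fun b b' => by rw [map_add, add_smul])
      fun s s' => AddMonoidHom.ext fun b => by
        change ρ.K b • secGerm ((pull D.p₂).obj N) (ρ.mem_of_sig hw) (pullSec D.p₂ N V (s + s')) =
          ρ.K b • _ + ρ.K b • _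
        rw [map_add, map_add, smul_add])
    (fun h hx hx' s => AddMonoidHom.ext fun b => by
      change ρ.K b • secGerm ((pull D.p₂).obj N) (ρ.mem_of_sig hx) (pullSec D.p₂ N _ (secRes _ h s)) =
        ρ.K b • _
      rw [pullSec_res, secGerm_res])
    (fun V hx r s b => by
      change ρ.K b • secGerm ((pull D.p₂).obj N) (ρ.mem_of_sig hx) (pullSec D.p₂ N V (r • s)) =
        ρ.K (b * _) • secGerm ((pull D.p₂).obj N) (ρ.mem_of_sig hx) (pullSec D.p₂ N V s)
      rw [pullSec_smul, secGerm_smul, ρ.K_mul_const V (ρ.mem_of_sig hx) hx, mul_smul])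
  exact ⟨Ψ, fun V s hw hz b => congrArg (fun φ => φ b) (hΨ V s hw)⟩

variable {N}
variable {Ψ : (pull D.sig).obj ((pull D.p₂).obj N) ⟶ skyMod ρ.w (ModStalk ((pull D.p₂).obj N) z)}

lemma skyVal_sig_smul (hΨ : ρ.IsExtension Ψ) (O : Opens D.X₁.top) (hz : z ∈ O) (hw : ρ.w ∈ (Opens.map D.sig.base).obj O)
    (V : Opens D.X₀.top) (h : O ≤ (Opens.map D.p₂.base).obj V) (a : D.X₁.ring.obj.obj (op O)) (s : Sec N V)
    (b : D.X₂.RingStalk ρ.w) :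
    skyVal ρ.w _ hw (homSec Ψ _ (pullSec D.sig _ _ (a • secRes _ h (pullSec D.p₂ N V s)))) b =
      ρ.K (b * ringGerm hw (D.sig.app O a)) • secGerm ((pull D.p₂).obj N) (h hz) (pullSec D.p₂ N V s) := by
  rw [pullSec_smul, map_smul, skyVal_smul, pullSec_res, homSec_res, skyVal_res]
  exact hΨ V s _ _ _

lemma skyVal_mul_T (hΨ : ρ.IsExtension Ψ) (O : Opens D.X₂.top) (hO : ρ.w ∈ O)
    (c : Sec ((pull D.sig).obj ((pull D.p₂).obj N)) O)
    (b : D.X₂.RingStalk ρ.w) :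
    skyVal ρ.w _ hO (homSec Ψ O c) (b * ρ.T) = 0 := by
  revert b
  refine pull_induction D.sig ((pull D.p₂).obj N) ρ.w (Q := fun O hO c => ∀ b,
    skyVal ρ.w _ hO (homSec Ψ O c) (b * ρ.T) = 0) ?_ ?_ ?_ ?_ O hO c
  · intro U V h hV s hs b
    rw [← hs b, homSec_res, skyVal_res]
  · intro O hO b
    rw [map_zero, map_zero]
    rfl
  · intro O hO s s' hs hs' b
    rw [map_add, map_add, AddMonoidHom.add_apply, hs, hs', add_zero]
  · intro O hO V h a s b
    rw [map_smul, skyVal_smul, homSec_res, skyVal_res, mul_assoc, ρ.comm, ← mul_assoc]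
    generalize b * ringGerm hO a = b
    have hw : ρ.w ∈ (Opens.map D.sig.base).obj V := h hO
    revert b
    refine pull_induction D.p₂ N z (Q := fun V hV s => ∀ b,
      skyVal ρ.w _ (ρ.mem_sig hV) (homSec Ψ _ (pullSec D.sig _ V s)) (b * ρ.T) = 0) ?_ ?_ ?_ ?_ V
        (ρ.mem_of_sig hw) s
    · intro U V h hV s hs b
      rw [← hs b, pullSec_res, homSec_res, skyVal_res]
    · intro O hO b
      rw [map_zero, map_zero, map_zero]
      rfl
    · intro O hO s s' hs hs' b
      rw [map_add, map_add, map_add, AddMonoidHom.add_apply, hs, hs', add_zero]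
    · intro O hO V h a s b
      rw [ρ.skyVal_sig_smul hΨ O hO (ρ.mem_sig hO), mul_assoc, ρ.comm, ← mul_assoc, ρ.K_mul_T,
        zero_smul]

lemma exists_skyVal_sig (hΨ : ρ.IsExtension Ψ) (O : Opens D.X₁.top) (hO : z ∈ O) (s : Sec ((pull D.p₂).obj N) O) :
    ∃ (V : Opens D.X₀.top) (hV : z ∈ (Opens.map D.p₂.base).obj V) (m : Sec N V),
      skyVal ρ.w _ (ρ.mem_sig hO) (homSec Ψ _ (pullSec D.sig _ O s)) 1 =
        secGerm _ hO s - secGerm _ hV (pullSec D.p₂ N V m) := by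
  refine pull_induction D.p₂ N z (Q := fun O hO s => ∃ (V : Opens D.X₀.top)
    (hV : z ∈ (Opens.map D.p₂.base).obj V) (m : Sec N V),
      skyVal ρ.w _ (ρ.mem_sig hO) (homSec Ψ _ (pullSec D.sig _ O s)) 1 =
        secGerm _ hO s - secGerm _ hV (pullSec D.p₂ N V m)) ?_ ?_ ?_ ?_ O hO s
  · rintro U V h hV s ⟨V', hV', m, hm⟩
    refine ⟨V', hV', m, ?_⟩
    rw [secGerm_res] at hm
    rw [← hm, pullSec_res, homSec_res, skyVal_res]
  · intro O hO
    refine ⟨⊤, trivial, 0, ?_⟩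
    rw [map_zero, map_zero, map_zero, map_zero, map_zero, map_zero, sub_zero]
    rfl
  · rintro O hO s s' ⟨V, hV, m, hm⟩ ⟨V', hV', m', hm'⟩
    refine ⟨V ⊓ V', ⟨hV, hV'⟩, secRes _ inf_le_left m + secRes _ inf_le_right m', ?_⟩
    have h1 : ∀ hVV : z ∈ (Opens.map D.p₂.base).obj (V ⊓ V'), secGerm _ hVV
        (pullSec D.p₂ N _ (secRes N (inf_le_left : V ⊓ V' ≤ V) m)) =
        secGerm _ hV (pullSec D.p₂ N V m) := fun hVV => by
      rw [pullSec_res, secGerm_res]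
    have h2 : ∀ hVV : z ∈ (Opens.map D.p₂.base).obj (V ⊓ V'), secGerm _ hVV
        (pullSec D.p₂ N _ (secRes N (inf_le_right : V ⊓ V' ≤ V') m')) =
        secGerm _ hV' (pullSec D.p₂ N V' m') := fun hVV => by
      rw [pullSec_res, secGerm_res]
    have h3 : secGerm _ (⟨hV, hV'⟩ : z ∈ (Opens.map D.p₂.base).obj (V ⊓ V')) (pullSec D.p₂ N _
        (secRes N (inf_le_left : V ⊓ V' ≤ V) m + secRes N (inf_le_right : V ⊓ V' ≤ V') m')) =
        secGerm _ hV (pullSec D.p₂ N V m) + secGerm _ hV' (pullSec D.p₂ N V' m') := by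
      rw [map_add, map_add]
      exact congrArg₂ (· + ·) (h1 _) (h2 _)
    rw [map_add, map_add, map_add, AddMonoidHom.add_apply, hm, hm', map_add, h3]
    abel
  · intro O hO V h a s
    obtain ⟨V', hV', r, hr⟩ := ρ.K_sig O hO (ρ.mem_sig hO) a
    have hVV : z ∈ (Opens.map D.p₂.base).obj (V ⊓ V') := ⟨h hO, hV'⟩
    refine ⟨V ⊓ V', hVV, D.X₀.ring.res (inf_le_right : V ⊓ V' ≤ V') r •
      secRes N (inf_le_left : V ⊓ V' ≤ V) s, ?_⟩
    rw [ρ.skyVal_sig_smul hΨ O hO (ρ.mem_sig hO), one_mul, hr, sub_smul, secGerm_smul, secGerm_res,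
      pullSec_smul, secGerm_smul, pullSec_res, secGerm_res]
    congr 2
    have h1 := RingSheaf.app_res D.X₀.ring D.p₂.comap (inf_le_right : V ⊓ V' ≤ V') r
    have h2 : D.p₂.app (V ⊓ V') (D.X₀.ring.res inf_le_right r) =
      D.X₁.ring.res ((Opens.map D.p₂.base).map (homOfLE inf_le_right)).le (D.p₂.app V' r) := h1
    rw [h2, ringGerm_res]

lemma skyVal_q₂₃ (hΨ : ρ.IsExtension Ψ) (O : Opens D.X₁.top) (hO : z ∈ O) (s : Sec ((pull D.p₂).obj N) O) :
    skyVal ρ.w _ (ρ.mem_q₂₃ hO) (homSec Ψ _ (homSec (D.kappa N) _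
      (pullSec D.q₂₃ _ O s))) 1 = 0 := by
  refine pull_induction D.p₂ N z (Q := fun O hO s => skyVal ρ.w _ (ρ.mem_q₂₃ hO)
    (homSec Ψ _ (homSec (D.kappa N) _ (pullSec D.q₂₃ _ O s))) 1 = 0)
      ?_ ?_ ?_ ?_ O hO s
  · intro U V h hV s hs
    rw [← hs, pullSec_res, homSec_res, homSec_res, skyVal_res]
  · intro O hO
    rw [map_zero, map_zero, map_zero, map_zero]
    rfl
  · intro O hO s s' hs hs'
    rw [map_add, map_add, map_add, map_add, AddMonoidHom.add_apply, hs, hs', add_zero]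
  · intro O hO V h a s
    rw [pullSec_smul, map_smul, map_smul, skyVal_smul, one_mul, pullSec_res, homSec_res, homSec_res,
      skyVal_res]
    rw [D.kappa_pullSec N V s (D.map_q₂₃_le V), homSec_res, skyVal_res]
    have h3 := hΨ V s (ρ.mem_sig (O := (Opens.map D.p₂.base).obj V) (h hO)) (h hO)
      (ringGerm (ρ.mem_q₂₃ hO) (D.q₂₃.app O a))
    rwa [ρ.K_q₂₃ O, zero_smul] at h3

end CStarDiagram.Residue

namespace EquivMod

open RSp

variable {D : CStarDiagram.{u}} (M : EquivMod D.toActionDiagram)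

/-- The cocycle condition, on the sections `φ(s)`. -/
lemma exists_cocycle_hom : ∃ F : (pull D.idMu).obj ((pull D.p₂).obj M.mod) ⟶
      (pull D.sig).obj ((pull D.p₂).obj M.mod),
    (∀ (V : Opens D.X₀.top) (s : Sec M.mod V)
      (h : (Opens.map D.idMu.base).obj ((Opens.map D.p₂.base).obj V) ≤
        (Opens.map D.q₂₃.base).obj ((Opens.map D.mu.base).obj V)),
      homSec F _ (pullSec D.idMu _ _ (pullSec D.p₂ M.mod V s)) =
        secRes _ h (homSec (D.kappa M.mod) _ (pullSec D.q₂₃ _ _ (M.act V s)))) ∧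
    (∀ (V : Opens D.X₀.top) (s : Sec M.mod V)
      (h : (Opens.map D.idMu.base).obj ((Opens.map D.mu.base).obj V) ≤
        (Opens.map D.sig.base).obj ((Opens.map D.mu.base).obj V)),
      homSec F _ (pullSec D.idMu _ _ (M.act V s)) =
        secRes _ h (pullSec D.sig _ _ (M.act V s))) := by
  let κ' : (pull D.idMu).obj ((pull D.p₂).obj M.mod) ⟶ (pull D.q₂₃).obj ((pull D.mu).obj M.mod) :=
    (pullSq D.idMu_p₂).hom.app M.mod
  let κ'' : (pull D.idMu).obj ((pull D.mu).obj M.mod) ⟶ (pull D.sig).obj ((pull D.mu).obj M.mod) :=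
    (pullSq D.idMu_mu).hom.app M.mod
  refine ⟨κ' ≫ (pull D.q₂₃).map M.iso.hom ≫ D.kappa M.mod, fun V s h => ?_, fun V s h => ?_⟩
  · have h1 : homSec κ' _ (pullSec D.idMu _ _ (pullSec D.p₂ M.mod V s)) =
        secRes _ h (pullSec D.q₂₃ _ _ (pullSec D.mu M.mod V s)) :=
      homSec_pullSq D.idMu_p₂ M.mod V s h
    rw [homSec_comp, homSec_comp, h1, homSec_res, homSec_res, homSec_pullSec]
    rfl
  · have h1 : homSec κ'' _ (pullSec D.idMu _ _ (pullSec D.mu M.mod V s)) =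
        secRes _ h (pullSec D.sig _ _ (pullSec D.mu M.mod V s)) :=
      homSec_pullSq D.idMu_mu M.mod V s h
    have h2 : (pull D.idMu).map M.iso.hom ≫ κ' ≫ (pull D.q₂₃).map M.iso.hom ≫ D.kappa M.mod =
      κ'' ≫ (pull D.sig).map M.iso.hom := M.cocycle
    have h3 := congrArg (fun α => homSec α _ (pullSec D.idMu _ _ (pullSec D.mu M.mod V s))) h2
    beta_reduce at h3
    rw [homSec_comp _ (κ' ≫ _), homSec_comp κ'', homSec_pullSec, h1, homSec_res,
      homSec_pullSec] at h3
    exact h3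

variable {M}

/-- The germs of `φ(s)` for an invariant section `s` of `M`: at each point, `φ(s)` is the pull-back
of a section of `M`. -/
lemma IsInvariant.exists_secGerm_act {U : Opens D.X₀.top} {s : Sec M.mod U}
    (hs : M.IsInvariant U s) {z : D.X₁.top} (ρ : D.Residue z)
    (hz : z ∈ (Opens.map D.mu.base).obj U) :
    ∃ (V : Opens D.X₀.top) (hV : z ∈ (Opens.map D.p₂.base).obj V) (m : Sec M.mod V),
      secGerm _ hz (M.act U s) = secGerm _ hV (pullSec D.p₂ M.mod V m) := by
  obtain ⟨O, h, h', hO, c, hc⟩ := (M.isInvariant_iff U s).1 hs (D.mu.base z) hz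
  obtain ⟨F, hF, hF'⟩ := M.exists_cocycle_hom
  obtain ⟨Ψ, hΨ⟩ := ρ.exists_isExtension M.mod
  have hw : ρ.w ∈ (Opens.map D.idMu.base).obj O := show D.idMu.base ρ.w ∈ O from ρ.idMu_w ▸ hO
  have e1 := congrArg (fun t => homSec F _ (pullSec D.idMu _ _ t)) hc
  have le1 : (Opens.map D.idMu.base).obj ((Opens.map D.p₂.base).obj U) ≤
      (Opens.map D.q₂₃.base).obj ((Opens.map D.mu.base).obj U) :=
    show (Opens.map (D.idMu ≫ D.p₂).base).obj U ≤ (Opens.map (D.q₂₃ ≫ D.mu).base).obj U from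
      le_of_eq (by rw [D.idMu_p₂])
  have le2 : (Opens.map D.idMu.base).obj ((Opens.map D.mu.base).obj U) ≤
      (Opens.map D.sig.base).obj ((Opens.map D.mu.base).obj U) :=
    show (Opens.map (D.idMu ≫ D.mu).base).obj U ≤ (Opens.map (D.sig ≫ D.mu).base).obj U from
      le_of_eq (by rw [D.idMu_mu])
  beta_reduce at e1
  rw [map_add, map_add, pullSec_res, pullSec_res, homSec_res, homSec_res, hF _ _ le1, hF' _ _ le2,
    pullSec_smul, map_smul] at e1
  have e2 := congrArg (fun t => skyVal ρ.w _ hw (homSec Ψ _ t) 1) e1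
  beta_reduce at e2
  rw [map_add, map_add, AddMonoidHom.add_apply, map_smul, skyVal_smul, ρ.germ_tau O hw,
    ρ.skyVal_mul_T hΨ, homSec_res, homSec_res, homSec_res, homSec_res, skyVal_res, skyVal_res,
    skyVal_res, skyVal_res, ρ.skyVal_q₂₃ hΨ _ hz, add_zero] at e2
  obtain ⟨V, hV, m, hm⟩ := ρ.exists_skyVal_sig hΨ _ hz (M.act U s)
  exact ⟨V, hV, m, sub_eq_zero.1 (hm.symm.trans e2)⟩

end EquivMod

/-! ### The residue map of an F-action -/

section ConcreteResidue

variable (E : Type) [NormedAddCommGroup E] [NormedSpace ℂ E]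
  {X : Type u} [TopologicalSpace X] [ChartedSpace E X] [IsManifold 𝓘(ℂ, E) ω X]

namespace HbarAlgebra

open RSp

variable (A : HbarAlgebra X)

/-- The sections of `A^loc_{ℂˣ × X}`. -/
abbrev FamSec₁ (W : Opens (ℂˣ × X)) : Type u := (A.locClass E 𝓘(ℂ, ℂ) ℂˣ).carrier W

/-- The sections of `A^loc_{ℂˣ × ℂˣ × X}`. -/
abbrev FamSec₂ (W : Opens ((ℂˣ × ℂˣ) × X)) : Type u :=
  (A.locClass E (𝓘(ℂ, ℂ).prod 𝓘(ℂ, ℂ)) (ℂˣ × ℂˣ)).carrier W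

/-- The stalk of `A^loc`. -/
def Stalk₀ (x : X) : Type u := A.sp₀.RingStalk x

/-- The stalk of `A^loc_{ℂˣ × X}`. -/
def Stalk₁ (p : ℂˣ × X) : Type u := (A.sp₁ E).RingStalk p

/-- The stalk of `A^loc_{ℂˣ × ℂˣ × X}`. -/
def Stalk₂ (p : (ℂˣ × ℂˣ) × X) : Type u := (A.sp₂ E).RingStalk p

noncomputable instance (x : X) : Ring (A.Stalk₀ x) := inferInstanceAs (Ring (A.sp₀.RingStalk x))

noncomputable instance (p : ℂˣ × X) : Ring (A.Stalk₁ E p) :=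
  inferInstanceAs (Ring ((A.sp₁ E).RingStalk p))

noncomputable instance (p : (ℂˣ × ℂˣ) × X) : Ring (A.Stalk₂ E p) :=
  inferInstanceAs (Ring ((A.sp₂ E).RingStalk p))

variable {A}

/-- The germ of a section of `A^loc`. -/
noncomputable def germ₀ {U : Opens X} {x : X} (h : x ∈ U) :
    A.loc.obj.obj (op U) →+* A.Stalk₀ x := ringGerm (X := A.sp₀) h

/-- The germ of a section of `A^loc_{ℂˣ × X}`. -/
noncomputable def germ₁ {W : Opens (ℂˣ × X)} {p : ℂˣ × X} (h : p ∈ W) :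
    A.FamSec₁ E W →+* A.Stalk₁ E p := ringGerm (X := A.sp₁ E) h

/-- The germ of a section of `A^loc_{ℂˣ × ℂˣ × X}`. -/
noncomputable def germ₂ {W : Opens ((ℂˣ × ℂˣ) × X)} {p : (ℂˣ × ℂˣ) × X} (h : p ∈ W) :
    A.FamSec₂ E W →+* A.Stalk₂ E p := ringGerm (X := A.sp₂ E) h

variable {E}

/-- Restriction of sections of `A^loc_{ℂˣ × X}`. -/
noncomputable def res₁ {W W' : Opens (ℂˣ × X)} (h : W' ≤ W) : A.FamSec₁ E W →+* A.FamSec₁ E W' :=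
  (A.sp₁ E).ring.res h

/-- Restriction of sections of `A^loc_{ℂˣ × ℂˣ × X}`. -/
noncomputable def res₂ {W W' : Opens ((ℂˣ × ℂˣ) × X)} (h : W' ≤ W) :
    A.FamSec₂ E W →+* A.FamSec₂ E W' := (A.sp₂ E).ring.res h

lemma germ₁_res {W W' : Opens (ℂˣ × X)} {p : ℂˣ × X} (hp : p ∈ W') (h : W' ≤ W)
    (a : A.FamSec₁ E W) : germ₁ E hp (res₁ h a) = germ₁ E (h hp) a :=
  ringGerm_res (X := A.sp₁ E) hp h a

lemma germ₂_res {W W' : Opens ((ℂˣ × ℂˣ) × X)} {p : (ℂˣ × ℂˣ) × X} (hp : p ∈ W') (h : W' ≤ W)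
    (a : A.FamSec₂ E W) : germ₂ E hp (res₂ h a) = germ₂ E (h hp) a :=
  ringGerm_res (X := A.sp₂ E) hp h a

lemma exists_germ₀ {x : X} (b : A.Stalk₀ x) : ∃ (U : Opens X) (hx : x ∈ U)
    (a : A.loc.obj.obj (op U)), germ₀ hx a = b := by
  obtain ⟨U, -, hx, a, ha⟩ := exists_ringGerm (X := A.sp₀) b ⊤ trivial
  exact ⟨U, hx, a, ha⟩

lemma exists_germ₁ {p : ℂˣ × X} (b : A.Stalk₁ E p) (O : Opens (ℂˣ × X)) (hO : p ∈ O) :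
    ∃ (U : Opens (ℂˣ × X)) (_ : U ≤ O) (hp : p ∈ U) (a : A.FamSec₁ E U), germ₁ E hp a = b :=
  exists_ringGerm (X := A.sp₁ E) b O hO

lemma exists_germ₂ {p : (ℂˣ × ℂˣ) × X} (b : A.Stalk₂ E p) (O : Opens ((ℂˣ × ℂˣ) × X))
    (hO : p ∈ O) : ∃ (U : Opens ((ℂˣ × ℂˣ) × X)) (_ : U ≤ O) (hp : p ∈ U) (a : A.FamSec₂ E U),
      germ₂ E hp a = b :=
  exists_ringGerm (X := A.sp₂ E) b O hO

lemma exists_res_eq_zero_of_germ₀ {U : Opens X} {x : X} {h : x ∈ U} {a : A.loc.obj.obj (op U)}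
    (ha : germ₀ h a = 0) : ∃ (V : Opens X) (hV : V ≤ U), x ∈ V ∧ A.loc.res hV a = 0 := by
  have h1 : germ₀ h a = germ₀ h 0 := ha.trans (map_zero (germ₀ h)).symm
  obtain ⟨V, hV, _, hxV, h2⟩ := exists_res_eq_of_ringGerm_eq (X := A.sp₀) h1
  exact ⟨V, hV, hxV, h2.trans (map_zero (A.loc.res hV))⟩

lemma exists_res_eq_of_germ₂_eq {U : Opens ((ℂˣ × ℂˣ) × X)} {p : (ℂˣ × ℂˣ) × X} {h : p ∈ U}
    {a b : A.FamSec₂ E U} (hab : germ₂ E h a = germ₂ E h b) :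
    ∃ (V : Opens ((ℂˣ × ℂˣ) × X)) (hV : V ≤ U), p ∈ V ∧ res₂ hV a = res₂ hV b := by
  obtain ⟨V, hV, _, hpV, h2⟩ := exists_res_eq_of_ringGerm_eq (X := A.sp₂ E) hab
  exact ⟨V, hV, hpV, h2⟩

/-- The open set of the points `(t₁, t₂, x)` with `(t₁ t₂, x) ∈ W`. -/
def sigPre (W : Opens (ℂˣ × X)) : Opens ((ℂˣ × ℂˣ) × X) :=
  ⟨{p | (p.1.1 * p.1.2, p.2) ∈ W}, W.isOpen.preimage
    (by fun_prop : Continuous fun p : (ℂˣ × ℂˣ) × X => (p.1.1 * p.1.2, p.2))⟩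

/-- The open set of the points `(t₁, t₂, x)` with `(t₂, x) ∈ W`. -/
def q₂₃Pre (W : Opens (ℂˣ × X)) : Opens ((ℂˣ × ℂˣ) × X) :=
  ⟨{p | (p.1.2, p.2) ∈ W}, W.isOpen.preimage
    (by fun_prop : Continuous fun p : (ℂˣ × ℂˣ) × X => (p.1.2, p.2))⟩

/-- The open set `ℂˣ × V`. -/
def projPre (V : Opens X) : Opens (ℂˣ × X) := ⟨{p | p.2 ∈ V}, V.isOpen.preimage continuous_snd⟩

/-- The pull-back of families under `(t₁, t₂) ↦ t₁ t₂`. -/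
noncomputable def sigFam (W : Opens (ℂˣ × X)) : A.FamSec₁ E W →+* A.FamSec₂ E (sigPre W) :=
  (A.sigHom (E := E)).app W

/-- The pull-back of families under `(t₁, t₂) ↦ t₂`. -/
noncomputable def q₂₃Fam (W : Opens (ℂˣ × X)) : A.FamSec₁ E W →+* A.FamSec₂ E (q₂₃Pre W) :=
  (A.q₂₃Hom (E := E)).app W

/-- The constant families. -/
noncomputable def projFam (V : Opens X) : A.loc.obj.obj (op V) →+* A.FamSec₁ E (projPre V) :=
  (A.projHom (E := E)).app V

lemma projFam_val (V : Opens X) (r : A.loc.obj.obj (op V)) (t : ℂˣ) :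
    (projFam (E := E) V r).1 t = r := A.constLoc_apply V r t

/-- The evaluation of families at `t`. -/
noncomputable def evalFam (t : ℂˣ) (W : Opens (ℂˣ × X)) :
    A.FamSec₁ E W →+* A.loc.obj.obj (op (slice W t)) :=
  (Pi.evalRingHom (fun t => A.loc.obj.obj (op (slice W t))) t).comp
    ((A.locClass E 𝓘(ℂ, ℂ) ℂˣ).carrier W).subtype

lemma evalFam_apply (t : ℂˣ) (W : Opens (ℂˣ × X)) (a : A.FamSec₁ E W) :
    evalFam t W a = a.1 t := rfl

variable (A E) in
/-- The inclusion `x ↦ (t, x)` of a fibre, with the evaluation of families at `t`. -/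
noncomputable def fibreHom (t : ℂˣ) : A.sp₀ ⟶ A.sp₁ E where
  base := TopCat.ofHom ⟨fun x : X => (t, x), by fun_prop⟩
  comap := ⟨{
    app := fun W => RingCat.ofHom (evalFam (A := A) (E := E) t W.unop)
    naturality := fun _ _ _ => rfl }⟩

variable (A E) in
/-- The stalk maps at the points over `(1, t, x₀)`. -/
lemma exists_stalk_maps (t : ℂˣ) (x₀ : X) :
    ∃ (s q : A.Stalk₁ E (t, x₀) →+* A.Stalk₂ E ((1, t), x₀)) (p : A.Stalk₀ x₀ →+* A.Stalk₁ E (t, x₀))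
      (ev : A.Stalk₁ E (t, x₀) →+* A.Stalk₀ x₀),
      (∀ (W : Opens (ℂˣ × X)) (h : (t, x₀) ∈ W) (h' : ((1, t), x₀) ∈ sigPre W) (a : A.FamSec₁ E W),
        s (germ₁ E h a) = germ₂ E h' (sigFam W a)) ∧
      (∀ (W : Opens (ℂˣ × X)) (h : (t, x₀) ∈ W) (h' : ((1, t), x₀) ∈ q₂₃Pre W)
        (a : A.FamSec₁ E W), q (germ₁ E h a) = germ₂ E h' (q₂₃Fam W a)) ∧
      (∀ (V : Opens X) (h : x₀ ∈ V) (h' : (t, x₀) ∈ projPre V) (r : A.loc.obj.obj (op V)),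
        p (germ₀ h r) = germ₁ E h' (projFam V r)) ∧
      (∀ (W : Opens (ℂˣ × X)) (h : (t, x₀) ∈ W) (h' : x₀ ∈ slice W t) (a : A.FamSec₁ E W),
        ev (germ₁ E h a) = germ₀ h' (evalFam t W a)) := by
  have hsig : (A.sigHom (E := E)).base ((1, t), x₀) = (t, x₀) :=
    show ((1 * t, x₀) : ℂˣ × X) = (t, x₀) by rw [one_mul]
  obtain ⟨s, hs⟩ := exists_stalkHom (A.sigHom (E := E)) hsig
  obtain ⟨q, hq⟩ := exists_stalkHom (A.q₂₃Hom (E := E)) (x := ((1, t), x₀)) (y := (t, x₀)) rfl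
  obtain ⟨p, hp⟩ := exists_stalkHom (A.projHom (E := E)) (x := (t, x₀)) (y := x₀) rfl
  obtain ⟨ev, hev⟩ := exists_stalkHom (A.fibreHom E t) (x := x₀) (y := (t, x₀)) rfl
  exact ⟨s, q, p, ev, hs, hq, hp, hev⟩

end HbarAlgebra

namespace DQAlgebra

open HbarAlgebra

variable {E} [FiniteDimensional ℂ E] (A : DQAlgebra E X) (t : ℂˣ) (x₀ : X)

/-- The residue map on the stalks over `(1, t, x₀)`, for a section `τ` whose values are
`t₁ - 1`. -/
lemma exists_stalk_residue (τ : A.FamSec₂ E ⊤) (hτ : ∀ s, τ.1 s = A.scalLoc _ ((s.1 : ℂ) - 1))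
    (s q : A.Stalk₁ E (t, x₀) →+* A.Stalk₂ E ((1, t), x₀)) (p : A.Stalk₀ x₀ →+* A.Stalk₁ E (t, x₀))
    (ev : A.Stalk₁ E (t, x₀) →+* A.Stalk₀ x₀)
    (hs : ∀ (W : Opens (ℂˣ × X)) (h : (t, x₀) ∈ W) (h' : ((1, t), x₀) ∈ sigPre W)
      (a : A.FamSec₁ E W), s (germ₁ E h a) = germ₂ E h' (sigFam W a))
    (hq : ∀ (W : Opens (ℂˣ × X)) (h : (t, x₀) ∈ W) (h' : ((1, t), x₀) ∈ q₂₃Pre W)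
      (a : A.FamSec₁ E W), q (germ₁ E h a) = germ₂ E h' (q₂₃Fam W a))
    (hp : ∀ (V : Opens X) (h : x₀ ∈ V) (h' : (t, x₀) ∈ projPre V) (r : A.loc.obj.obj (op V)),
        p (germ₀ h r) = germ₁ E h' (projFam V r))
    (hev : ∀ (W : Opens (ℂˣ × X)) (h : (t, x₀) ∈ W) (h' : x₀ ∈ slice W t) (a : A.FamSec₁ E W),
        ev (germ₁ E h a) = germ₀ h' (evalFam t W a))
    (T : A.Stalk₂ E ((1, t), x₀)) (hT : T = germ₂ E (W := ⊤) trivial (τ ^ 2)) :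
    (∀ b, T * b = b * T) ∧ ∃ K : A.Stalk₂ E ((1, t), x₀) →+ A.Stalk₁ E (t, x₀),
      (∀ b r, K (b * s (p r)) = K b * p r) ∧ (∀ b, K (b * T) = 0) ∧
      (∀ a, K (q a) = 0) ∧ ∀ a, K (s a) = a - p (ev a) := by
  have hcomm : ∀ b, T * b = b * T := by
    intro b
    obtain ⟨U, -, hU, b, rfl⟩ := exists_germ₂ b ⊤ trivial
    rw [hT, ← germ₂_res hU (le_top : U ≤ ⊤), ← map_mul, ← map_mul]
    refine congrArg _ (Subtype.ext (funext fun r => ?_))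
    change A.loc.res _ (τ.1 r ^ 2) * b.1 r = b.1 r * A.loc.res _ (τ.1 r ^ 2)
    rw [hτ, map_pow, scalLoc_res]
    exact (A.scalLoc_comm _ _ _).pow_left 2
  refine ⟨hcomm, exists_residue s q ev p ?_ ?_ T hcomm ?_ ?_⟩
  · intro r
    obtain ⟨V, hV, r, rfl⟩ := exists_germ₀ r
    rw [hp V hV hV, hev (projPre V) hV hV]
    exact congrArg (germ₀ hV) (projFam_val (E := E) V r t)
  · intro r
    obtain ⟨V, hV, r, rfl⟩ := exists_germ₀ r
    have h1 : sigFam (E := E) (projPre V) (projFam V r) = q₂₃Fam (projPre V) (projFam V r) :=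
      Subtype.ext (funext fun s =>
        (projFam_val V r (s.1 * s.2)).trans (projFam_val V r s.2).symm)
    rw [hp V hV hV, hs (projPre V) hV hV, hq (projPre V) hV hV]
    exact congrArg (germ₂ E (W := sigPre (projPre V)) hV) h1
  · intro b
    obtain ⟨U, -, hU, b, rfl⟩ := exists_germ₂ b ⊤ trivial
    obtain ⟨W₁, W₂, hW, h₁, h₂, c, β, e, hp₁, hp₂, hc, hβ, he, hc0, heq⟩ :=
      A.exists_locFam_decomposition b.2 hU
    have hle₁ : W₂ ≤ sigPre W₁ := fun p hp => h₁ p.1 hp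
    have hle₂ : W₂ ≤ q₂₃Pre W₁ := fun p hp => h₂ p.1 hp
    refine ⟨germ₁ E hp₁ ⟨c, hc⟩, germ₁ E hp₁ ⟨β, hβ⟩, germ₂ E hp₂ ⟨e, he⟩, ?_, ?_⟩
    · rw [hev W₁ hp₁ hp₁, evalFam_apply]
      exact (congrArg _ hc0).trans (map_zero _)
    · rw [hs W₁ hp₁ (hle₁ hp₂), hq W₁ hp₁ (hle₂ hp₂), hT, ← germ₂_res hp₂ hW,
        ← germ₂_res hp₂ (le_top : W₂ ≤ ⊤), ← germ₂_res hp₂ hle₁, ← germ₂_res hp₂ hle₂,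
        ← map_mul, ← map_add, ← map_add]
      refine congrArg _ (Subtype.ext (funext fun r => (heq r).trans ?_))
      change _ = A.loc.res _ (c (r.1 * r.2)) + A.loc.res _ (β r.2) +
        A.loc.res _ (τ.1 r ^ 2) * e r
      rw [hτ, map_pow, scalLoc_res, pow_two, mul_assoc]
  · intro c β e hc0 heq
    obtain ⟨U, -, hU, c, rfl⟩ := exists_germ₁ c ⊤ trivial
    rw [hev U hU hU] at hc0
    obtain ⟨V, hV, hxV, hVc⟩ := exists_res_eq_zero_of_germ₀ hc0
    obtain ⟨W, hWV, hW, β, rfl⟩ := exists_germ₁ β (U ⊓ projPre V) ⟨hU, hxV⟩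
    have hWU : W ≤ U := hWV.trans inf_le_left
    have hw₁ : ((1, t), x₀) ∈ sigPre W := show ((1 * t, x₀) : ℂˣ × X) ∈ W from (one_mul t).symm ▸ hW
    have hw₂ : ((1, t), x₀) ∈ q₂₃Pre W := hW
    obtain ⟨O, hO, hwO, e, rfl⟩ := exists_germ₂ e (sigPre W ⊓ q₂₃Pre W) ⟨hw₁, hw₂⟩
    have hO₁ : O ≤ sigPre W := hO.trans inf_le_left
    have hO₂ : O ≤ q₂₃Pre W := hO.trans inf_le_right
    rw [← germ₁_res hW hWU, hs W hW hw₁, hq W hW hw₂, hT, ← germ₂_res hwO (le_top : O ≤ ⊤),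
      ← germ₂_res hwO hO₁, ← germ₂_res hwO hO₂, ← map_mul, ← map_add] at heq
    obtain ⟨O', hO', hwO', heq⟩ := exists_res_eq_of_germ₂_eq heq
    have hc₀ : (res₁ hWU c).1 t = 0 := by
      have hsl : slice W t ≤ V := fun x hx => (hWV hx).2
      have h1 := congrArg (A.loc.res hsl) hVc
      rw [A.loc.res_res, map_zero] at h1
      exact h1
    have hsum : ∀ r : ℂˣ × ℂˣ, A.loc.res (fun x hx => hO₁ (hO' hx) : slice O' r ≤ slice W (r.1 * r.2))
        ((res₁ hWU c).1 (r.1 * r.2)) + A.loc.res (fun x hx => hO₂ (hO' hx)) (β.1 r.2) =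
        A.scalLoc _ ((r.1 : ℂ) - 1) * (A.scalLoc _ ((r.1 : ℂ) - 1) * (res₂ hO' e).1 r) := by
      intro r
      have h1 := congrFun (congrArg Subtype.val heq) r
      change A.loc.res _ (A.loc.res _ ((res₁ hWU c).1 (r.1 * r.2)) + A.loc.res _ (β.1 r.2)) =
        A.loc.res _ (A.loc.res _ (τ.1 r ^ 2) * e.1 r) at h1
      rw [hτ, map_pow, map_mul, map_pow, scalLoc_res, scalLoc_res, pow_two, mul_assoc, map_add] at h1
      exact (congrArg₂ (· + ·) (A.loc.res_res _ _ _) (A.loc.res_res _ _ _)).symm.trans h1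
    obtain ⟨W', hW', hpW', hz⟩ := A.exists_locFam_res_eq_zero (W₁ := W) (W₂ := O') _ _ hW hwO'
      (res₁ hWU c).2 β.2 (res₂ hO' e).2 hc₀ hsum
    rw [← germ₁_res hW hWU, ← germ₁_res hpW' hW', ← map_zero (germ₁ E hpW')]
    exact congrArg _ (Subtype.ext hz)

end DQAlgebra

namespace FAction

open HbarAlgebra RSp

variable {E} [MulAction ℂˣ X] [ContinuousSMul ℂˣ X] {A : DQAlgebra E X} {m : ℤ} (θ : FAction A m)
  (hθ : θ.LambdaExists)

lemma tau_val (W : Opens (ℂˣ × X)) (t : ℂˣ) :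
    (tau A W : A.FamSec₁ E W).1 t = A.scalLoc _ ((t : ℂ) - 1) := by
  have h : A.ι (slice W t) (A.scal _ (PowerSeries.C ((t : ℂ) - 1)) * 1) =
    A.ι (slice W t) (A.scal _ (PowerSeries.C ((t : ℂ) - 1))) := by rw [mul_one]
  exact h

lemma idMu_tau_val (s : ℂˣ × ℂˣ) :
    ((θ.idMuHom hθ).app ⊤ (tau A ⊤) : A.FamSec₂ E ⊤).1 s = A.scalLoc _ ((s.1 : ℂ) - 1) := by
  change θ.locAt s.2 (slice ⊤ s.1) ((tau A ⊤ : A.FamSec₁ E ⊤).1 s.1) = _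
  rw [tau_val, scalLoc, locAt_ι]
  have h1 := θ.at_C s.2 (slice ⊤ s.1) ((s.1 : ℂ) - 1) 1
  rw [mul_one, map_one, mul_one] at h1
  rw [h1]
  rfl

/-- The residue map at each point of `ℂˣ × X`. -/
lemma nonempty_residue [FiniteDimensional ℂ E] (t : ℂˣ) (x₀ : X) :
    Nonempty ((θ.cDiagram hθ).Residue (t, x₀)) := by
  have hsig : (A.sigHom (E := E)).base ((1, t), x₀) = (t, x₀) :=
    show ((1 * t, x₀) : ℂˣ × X) = (t, x₀) by rw [one_mul]
  obtain ⟨s, q, p, ev, hs, hq, hp, hev⟩ := exists_stalk_maps E A.toHbarAlgebra t x₀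
  let τ : A.FamSec₂ E ⊤ := (θ.idMuHom hθ).app ⊤ (tau A ⊤)
  let T : A.Stalk₂ E ((1, t), x₀) := germ₂ E (W := ⊤) trivial (τ ^ 2)
  obtain ⟨hT, K, hK₁, hK₂, hK₃, hK₄⟩ := A.exists_stalk_residue t x₀ τ (θ.idMu_tau_val hθ) s q p ev
    hs hq hp hev T rfl
  refine ⟨{
    w := ((1, t), x₀)
    sig_w := hsig
    q₂₃_w := rfl
    idMu_w := rfl
    T := T
    germ_tau := fun O hO => ?_
    comm := hT
    K := K
    K_mul_const := fun V hz hw r b => ?_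
    K_mul_T := hK₂
    K_q₂₃ := fun O hw a => ?_
    K_sig := fun O hz hw a => ?_ }⟩
  · have h1 : (θ.idMuHom hθ).app O ((A.sp₁ E).ring.res le_top (tau A ⊤)) =
        (A.sp₂ E).ring.res ((Opens.map (θ.idMuHom hθ).base).map (homOfLE le_top)).le
          ((θ.idMuHom hθ).app ⊤ (tau A ⊤)) :=
      RingSheaf.app_res (A.sp₁ E).ring (θ.idMuHom hθ).comap (le_top : O ≤ ⊤) _
    have h2 : (A.sp₁ E).ring.res le_top (tau A ⊤) = tau A O := res_tau A _
    have h3 := ringGerm_res (X := A.sp₂ E) hO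
      ((Opens.map (θ.idMuHom hθ).base).map (homOfLE (le_top : O ≤ ⊤))).le
      ((θ.idMuHom hθ).app ⊤ (tau A ⊤))
    have h4 : ringGerm (X := A.sp₂ E) hO ((θ.idMuHom hθ).app O (tau A O)) =
        germ₂ E (W := ⊤) trivial τ :=
      (congrArg (ringGerm (X := A.sp₂ E) hO) ((congrArg _ h2.symm).trans h1)).trans h3
    have h5 : ringGerm (X := A.sp₂ E) hO ((θ.idMuHom hθ).app O (tau A O ^ 2)) =
        ringGerm (X := A.sp₂ E) hO ((θ.idMuHom hθ).app O (tau A O)) ^ 2 :=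
      (congrArg _ (map_pow ((θ.idMuHom hθ).app O) _ 2)).trans (map_pow _ _ 2)
    exact h5.trans ((congrArg (· ^ 2) h4).trans (map_pow (germ₂ E (W := ⊤) _) τ 2).symm)
  · refine Eq.trans ?_ ((hK₁ b (germ₀ (U := V) (x := x₀) hz r)).trans ?_)
    · exact congrArg (fun y : A.Stalk₂ E ((1, t), x₀) => K ((show A.Stalk₂ E ((1, t), x₀) from b) * y)) (((congrArg s (hp V hz hz r)).trans (hs _ hz hw _)).symm)
    · exact congrArg (fun y => K b * y) (hp V hz hz r)
  · exact (congrArg K (hq O hw hw a)).symm.trans (hK₃ _)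
  · refine ⟨slice O t, hz, evalFam t O a, ?_⟩
    refine (congrArg K (hs O hz hw a)).symm.trans ((hK₄ _).trans ?_)
    exact congrArg (fun y => germ₁ E (W := O) (p := (t, x₀)) hz a - y)
      ((congrArg p (hev O hz hz a)).trans (hp (slice O t) hz hz _))

end FAction

end ConcreteResidue

/-! ### Infinitesimally invariant sections are invariant -/

namespace RSp

section Evaluation

variable {X Y : RSp.{u}} {ε : X ⟶ Y} {p : Y ⟶ X} (h : ε ≫ p = 𝟙 X) (N : X.Mod)

lemma app_eq_res_of_eq {f g : X ⟶ Y} (h : f = g) (V : Opens Y.top) (b : Y.ring.obj.obj (op V))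
    (hle : (Opens.map f.base).obj V ≤ (Opens.map g.base).obj V) :
    f.app V b = X.ring.res hle (g.app V b) := by
  subst h
  exact (RingSheaf.res_self _ _ _).symm

lemma map_section_le (h : ε ≫ p = 𝟙 X) (V : Opens X.top) :
    (Opens.map ε.base).obj ((Opens.map p.base).obj V) ≤ V :=
  show (Opens.map (ε ≫ p).base).obj V ≤ (Opens.map (𝟙 X : X ⟶ X).base).obj V from
    le_of_eq (by rw [h])

/-- Restriction of the inverse image `p^* N` to the image of a section `ε` of `p`. -/
noncomputable def evalHom (h : ε ≫ p = 𝟙 X) (N : X.Mod) : (pull p).obj N ⟶ (push ε).obj N :=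
  ((adj p).homEquiv N ((push ε).obj N)).symm (homToPush p N ((push ε).obj N)
    (fun V => (secRes N (map_section_le h V) : Sec N V →+
      Sec N ((Opens.map ε.base).obj ((Opens.map p.base).obj V))))
    (fun _ s => (secRes_secRes N _ _ s).trans (secRes_secRes N _ _ s).symm)
    (fun V r s => (secRes_smul N _ r s).trans (congrArg (· • secRes N (map_section_le h V) s)
      (app_eq_res_of_eq h V r (map_section_le h V)).symm)))

/-- The restriction to the image of `ε` of a section of `p^* N`. -/
noncomputable def evalSec (O : Opens Y.top) :
    Sec ((pull p).obj N) O →+ Sec N ((Opens.map ε.base).obj O) :=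
  AddMonoidHom.mk' (homSec (evalHom h N) O) (map_add (homSec (evalHom h N) O))

lemma evalSec_res {O O' : Opens Y.top} (hO : O' ≤ O) (s : Sec ((pull p).obj N) O) :
    evalSec h N O' (secRes _ hO s) =
      secRes N ((Opens.map ε.base).map (homOfLE hO)).le (evalSec h N O s) :=
  homSec_res (evalHom h N) hO s

lemma evalSec_smul (O : Opens Y.top) (r : Y.ring.obj.obj (op O)) (s : Sec ((pull p).obj N) O) :
    evalSec h N O (r • s) = ε.app O r • evalSec h N O s :=
  (homSec (evalHom h N) O).map_smul r s

lemma evalSec_pullSec (V : Opens X.top) (s : Sec N V) :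
    evalSec h N _ (pullSec p N V s) = secRes N (map_section_le h V) s :=
  homSec_homEquiv_symm p _ V s

lemma secGerm_eq_of_secRes_eq (M : X.Mod) {U V W : Opens X.top} {h₁ : W ≤ U} {h₂ : W ≤ V}
    {s : Sec M U} {s' : Sec M V} (hs : secRes M h₁ s = secRes M h₂ s') {x : X.top} (hx : x ∈ W) :
    secGerm M (h₁ hx) s = secGerm M (h₂ hx) s' := by
  rw [← secGerm_res M hx h₁, hs, secGerm_res]

/-- The germs of two sections of `N` agree if those of their inverse images do. -/
lemma secGerm_eq_of_pullSec (h : ε ≫ p = 𝟙 X) (N : X.Mod) {x : X.top} {V V' : Opens X.top} (hV : x ∈ V) (hV' : x ∈ V')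
    {m : Sec N V} {m' : Sec N V'} (hz : ε.base x ∈ (Opens.map p.base).obj V)
    (hz' : ε.base x ∈ (Opens.map p.base).obj V')
    (hm : secGerm _ hz (pullSec p N V m) = secGerm _ hz' (pullSec p N V' m')) :
    secGerm N hV m = secGerm N hV' m' := by
  obtain ⟨W, h₁, h₂, hW, heq⟩ := exists_res_eq_of_secGerm_eq _ hm
  have h3 := congrArg (evalSec h N W) heq
  rw [evalSec_res, evalSec_res, evalSec_pullSec, evalSec_pullSec, secRes_secRes,
    secRes_secRes] at h3
  exact secGerm_eq_of_secRes_eq N h3 (x := x) hW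

/-- The germ of an inverse image depends only on the germ. -/
lemma secGerm_pullSec_congr (f : Y ⟶ X) {y : Y.top} {x : X.top} (hyx : f.base y = x)
    {V V' : Opens X.top} {hV : x ∈ V} {hV' : x ∈ V'} {m : Sec N V} {m' : Sec N V'}
    (hm : secGerm N hV m = secGerm N hV' m') (hy : y ∈ (Opens.map f.base).obj V)
    (hy' : y ∈ (Opens.map f.base).obj V') :
    secGerm _ hy (pullSec f N V m) = secGerm _ hy' (pullSec f N V' m') := by
  subst hyx
  obtain ⟨W, h₁, h₂, hW, heq⟩ := exists_res_eq_of_secGerm_eq _ hm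
  have h3 := congrArg (pullSec f N W) heq
  rw [pullSec_res, pullSec_res] at h3
  exact secGerm_eq_of_secRes_eq _ h3 (x := y) hW

end Evaluation

end RSp

instance connectedSpace_units_complex : ConnectedSpace ℂˣ := by
  have hc : Continuous fun z : ℂ => Units.mk0 (Complex.exp z) (Complex.exp_ne_zero z) := by
    refine Units.continuous_iff.2 ⟨Complex.continuous_exp, ?_⟩
    exact Complex.continuous_exp.inv₀ Complex.exp_ne_zero
  refine Function.Surjective.connectedSpace (fun t => ?_) hc
  exact ⟨Complex.log t, Units.ext (Complex.exp_log t.ne_zero)⟩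

namespace EquivMod

open RSp

variable {D : CStarDiagram.{u}} {M : EquivMod D.toActionDiagram} {U : Opens D.X₀.top}
  {s : Sec M.mod U}

/-- At the points `(1, x)`, the section `φ(s)` agrees with the pull-back of `s`. -/
lemma IsInvariant.secGerm_act_one (hs : M.IsInvariant U s) {ε : D.X₀ ⟶ D.X₁}
    (hε : ε ≫ D.p₂ = 𝟙 D.X₀) (hτ : ∀ O, ε.app O (D.tau O ^ 2) = 0) {x : D.X₀.top} (hx : x ∈ U)
    (he : ε.base x = D.e x) (ρ : D.Residue (ε.base x))
    (hz : ε.base x ∈ (Opens.map D.mu.base).obj U) (hz' : ε.base x ∈ (Opens.map D.p₂.base).obj U) :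
    secGerm _ hz (M.act U s) = secGerm _ hz' (pullSec D.p₂ M.mod U s) := by
  obtain ⟨V, hV, m₀, hm₀⟩ := hs.exists_secGerm_act ρ hz
  obtain ⟨O, h, h', hO, c, hc⟩ := (M.isInvariant_iff U s).1 hs x hx
  rw [← he] at hO
  have hpx : D.p₂.base (ε.base x) = x := congrArg (fun f : D.X₀ ⟶ D.X₀ => f.base x) hε
  have hxV : x ∈ V := hpx ▸ (show D.p₂.base (ε.base x) ∈ V from hV)
  have h1 : secGerm M.mod hxV m₀ = secGerm M.mod hx s := by
    have hm₁ := hm₀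
    rw [← secGerm_res _ hO h, hc] at hm₁
    obtain ⟨W, h₁, h₂, hW, heq⟩ := exists_res_eq_of_secGerm_eq _ hm₁
    have h3 := congrArg (evalSec hε M.mod W) heq
    rw [evalSec_res, evalSec_res, evalSec_pullSec, map_add, evalSec_smul, hτ, zero_smul, add_zero,
      evalSec_res, evalSec_pullSec, secRes_secRes, secRes_secRes, secRes_secRes] at h3
    exact (secGerm_eq_of_secRes_eq M.mod h3 (x := x) hW).symm
  rw [hm₀]
  exact secGerm_pullSec_congr M.mod D.p₂ hpx h1 _ _

/-- A section that is infinitesimally invariant is invariant: the points of the orbit of `x` at which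
`φ(s)` agrees with the pull-back of `s` form an open and closed set. -/
lemma IsInvariant.secGerm_act {T : Type} [TopologicalSpace T] [ConnectedSpace T] {ε : T → (D.X₀ ⟶ D.X₁)}
    (hs : M.IsInvariant U s) (hε : ∀ t, ε t ≫ D.p₂ = 𝟙 D.X₀) {t₁ : T}
    (hτ : ∀ O, (ε t₁).app O (D.tau O ^ 2) = 0) {x : D.X₀.top} (hx : x ∈ U)
    (he : (ε t₁).base x = D.e x) (hcont : Continuous fun t => (ε t).base x)
    (hρ : ∀ t, Nonempty (D.Residue ((ε t).base x)))
    (hmu : ∀ t, (ε t).base x ∈ (Opens.map D.mu.base).obj U) (t : T)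
    (hz' : (ε t).base x ∈ (Opens.map D.p₂.base).obj U) :
    secGerm _ (hmu t) (M.act U s) = secGerm _ hz' (pullSec D.p₂ M.mod U s) := by
  have hpx : ∀ t, D.p₂.base ((ε t).base x) = x :=
    fun t => congrArg (fun f : D.X₀ ⟶ D.X₀ => f.base x) (hε t)
  have hp : ∀ t, (ε t).base x ∈ (Opens.map D.p₂.base).obj U :=
    fun t => show D.p₂.base ((ε t).base x) ∈ U from (hpx t).symm ▸ hx
  let S : Set T := {t | secGerm _ (hmu t) (M.act U s) = secGerm _ (hp t) (pullSec D.p₂ M.mod U s)}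
  have hopen : IsOpen S := by
    refine isOpen_iff_mem_nhds.2 fun t ht => ?_
    obtain ⟨W, h₁, h₂, hW, heq⟩ := exists_res_eq_of_secGerm_eq _
      (show secGerm _ (hmu t) _ = secGerm _ (hp t) _ from ht)
    exact Filter.mem_of_superset ((W.isOpen.preimage hcont).mem_nhds hW) fun t' ht' =>
      secGerm_eq_of_secRes_eq _ heq ht'
  have hclosed : IsClosed S := by
    refine isClosed_of_closure_subset fun t ht => ?_
    obtain ⟨ρ⟩ := hρ t
    obtain ⟨V, hV, m₀, hm₀⟩ := hs.exists_secGerm_act ρ (hmu t)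
    obtain ⟨W, h₁, h₂, hW, heq⟩ := exists_res_eq_of_secGerm_eq _ hm₀
    obtain ⟨t', ht', hS⟩ := mem_closure_iff.1 ht _ (W.isOpen.preimage hcont) hW
    have hxV : x ∈ V := hpx t ▸ (show D.p₂.base ((ε t).base x) ∈ V from hV)
    have h3 := secGerm_eq_of_pullSec (hε t') M.mod hxV hx _ _
      ((secGerm_eq_of_secRes_eq _ heq ht').symm.trans hS)
    exact hm₀.trans (secGerm_pullSec_congr M.mod D.p₂ (hpx t) h3 _ _)
  obtain ⟨ρ⟩ := hρ t₁
  have huniv : S = Set.univ := IsClopen.eq_univ ⟨hclosed, hopen⟩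
    ⟨t₁, hs.secGerm_act_one (hε t₁) hτ hx he ρ _ _⟩
  exact (huniv.symm ▸ Set.mem_univ t : t ∈ S)

end EquivMod

namespace FAction

open HbarAlgebra RSp

variable {E : Type} [NormedAddCommGroup E] [NormedSpace ℂ E]
  {X : Type u} [TopologicalSpace X] [ChartedSpace E X] [IsManifold 𝓘(ℂ, E) ω X]
  [MulAction ℂˣ X] [ContinuousSMul ℂˣ X] {A : DQAlgebra E X} {m : ℤ} {θ : FAction A m}
  {hθ : θ.LambdaExists}

lemma fibreHom_projHom (A : HbarAlgebra X) (t : ℂˣ) :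
    A.fibreHom E t ≫ A.projHom (E := E) = 𝟙 A.sp₀ := by
  refine hom_ext' rfl fun V b => ?_
  exact (projFam_val (E := E) (X := X) (A := A) V b t).trans (A.loc.res_self le_rfl b).symm

lemma fibreHom_tau_sq (A : DQAlgebra E X) (O : Opens (ℂˣ × X)) :
    (A.fibreHom E 1).app O (tau A O ^ 2) = 0 := by
  refine (map_pow _ _ 2).trans ?_
  have h4 : (A.fibreHom E 1).app O (tau A O) = 0 := by
    refine (tau_val O 1).trans ?_
    rw [Units.val_one, sub_self, scalLoc, map_zero, map_zero, map_zero]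
    rfl
  rw [h4, zero_pow two_ne_zero]

/-- The invariant sections over an invariant open set are those with `φ(s) = 1 ⊗ s`. -/
lemma secRes_act [FiniteDimensional ℂ E] {M : θ.ModF hθ} {U : Opens X}
    {s : Sec (X := A.sp₀) M.mod U}
    (hs : EquivMod.IsInvariant (D := θ.cDiagram hθ) (M := M) U s) (hU : ∀ t : ℂˣ, ∀ x ∈ U, t • x ∈ U)
    (h : (Opens.map (θ.cDiagram hθ).p₂.base).obj U ≤ (Opens.map (θ.cDiagram hθ).mu.base).obj U) :
    secRes _ h (M.act (D := θ.cDiagram hθ) U s) = pullSec (θ.cDiagram hθ).p₂ M.mod U s := by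
  let ε : ℂˣ → ((θ.cDiagram hθ).X₀ ⟶ (θ.cDiagram hθ).X₁) := fun t => A.fibreHom E t
  have hε : ∀ t, ε t ≫ (θ.cDiagram hθ).p₂ = 𝟙 (θ.cDiagram hθ).X₀ := fun t => fibreHom_projHom _ t
  have hτ : ∀ O, (ε 1).app O ((θ.cDiagram hθ).tau O ^ 2) = 0 := fun O => fibreHom_tau_sq A O
  refine sec_ext _ fun z hz => ?_
  obtain ⟨t, x⟩ : ℂˣ × X := z
  have hcont : Continuous fun t : ℂˣ => (ε t).base x := by
    change Continuous fun t : ℂˣ => (t, x)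
    fun_prop
  have hρ : ∀ t, Nonempty ((θ.cDiagram hθ).Residue ((ε t).base x)) :=
    fun t => θ.nonempty_residue hθ t x
  have hmu : ∀ t, (ε t).base x ∈ (Opens.map (θ.cDiagram hθ).mu.base).obj U := fun t => hU t x hz
  have h1 := hs.secGerm_act hε hτ (x := x) hz rfl hcont hρ hmu t hz
  exact (secGerm_res _ hz h _).trans h1

end FAction

/-! ### The adjunction -/

namespace RSp

variable {X : RSp.{u}}

lemma SubMod.hom_ext {M N : X.Mod} (S : SubMod M) {u v : N ⟶ S.toMod}
    (h : u ≫ S.incl = v ≫ S.incl) : u = v := by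
  refine SheafOfModules.hom_ext (PresheafOfModules.hom_ext fun V => ModuleCat.hom_ext
    (LinearMap.ext fun s => ?_))
  exact Subtype.ext (congrArg (fun w : N ⟶ M => homSec w V.unop s) h)

lemma SubMod.homSec_incl_mem {M N : X.Mod} (S : SubMod M) (u : N ⟶ S.toMod) (V : Opens X.top)
    (s : Sec N V) : homSec (u ≫ S.incl) V s ∈ S.carrier V :=
  (show S.carrier V from homSec u V s).2

end RSp

namespace EquivMod

open RSp

variable {D : CStarDiagram.{u}} {Y : RSp.{u}} (p : D.X₀ ⟶ Y) (hp : D.mu ≫ p = D.p₂ ≫ p)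
  (h₁ : ∀ x, D.mu.base (D.e x) = x) (h₂ : ∀ x, D.p₂.base (D.e x) = x)

lemma map_mu_le (hp : D.mu ≫ p = D.p₂ ≫ p) (V : Opens Y.top) : (Opens.map D.mu.base).obj ((Opens.map p.base).obj V) ≤
    (Opens.map D.p₂.base).obj ((Opens.map p.base).obj V) :=
  show (Opens.map (D.mu ≫ p).base).obj V ≤ (Opens.map (D.p₂ ≫ p).base).obj V from
    le_of_eq (by rw [hp])

lemma map_p₂_le (hp : D.mu ≫ p = D.p₂ ≫ p) (V : Opens Y.top) : (Opens.map D.p₂.base).obj ((Opens.map p.base).obj V) ≤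
    (Opens.map D.mu.base).obj ((Opens.map p.base).obj V) :=
  show (Opens.map (D.p₂ ≫ p).base).obj V ≤ (Opens.map (D.mu ≫ p).base).obj V from
    le_of_eq (by rw [hp])

/-- The sections `1 ⊗ s` of `p^* N` satisfy `φ(1 ⊗ s) = 1 ⊗ (1 ⊗ s)`. -/
lemma act_invariantPull (N : Y.Mod) (V : Opens Y.top) (s : Sec N V) :
    ((invariantPull (D := D.toActionDiagram) p hp).obj N).act (D := D) _ (pullSec p N V s) =
      secRes _ (map_mu_le p hp V) (pullSec D.p₂ _ _ (pullSec p N V s)) :=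
  homSec_pullSq hp N V s _

lemma isInvariant_pullSec (h₁ : ∀ x, D.mu.base (D.e x) = x) (N : Y.Mod) (V : Opens Y.top) (s : Sec N V) :
    ((invariantPull (D := D.toActionDiagram) p hp).obj N).IsInvariant (D := D) _ (pullSec p N V s) := by
  refine (isInvariant_iff (D := D) ((invariantPull (D := D.toActionDiagram) p hp).obj N) _
    (pullSec p N V s)).2 fun x hx => ?_
  refine ⟨(Opens.map D.mu.base).obj ((Opens.map p.base).obj V), le_rfl, map_mu_le p hp V,
    show D.mu.base (D.e x) ∈ _ from (h₁ x).symm ▸ hx, 0, ?_⟩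
  rw [act_invariantPull, smul_zero, add_zero]
  exact secRes_self _ _ _

/-- A morphism `p^* N ⟶ M` whose values on the sections `1 ⊗ s` are invariant is compatible with
the equivariant structures. -/
lemma pullSq_comp_map
    (hact : ∀ (M : EquivMod D.toActionDiagram) (V : Opens Y.top)
      (s : Sec M.mod ((Opens.map p.base).obj V)), M.IsInvariant _ s →
        secRes _ (map_p₂_le p hp V) (M.act _ s) = pullSec D.p₂ M.mod _ s)
    {N : Y.Mod} {M : EquivMod D.toActionDiagram} (f : (pull p).obj N ⟶ M.mod)
    (hf : ∀ (V : Opens Y.top) (s : Sec N V), M.IsInvariant _ (homSec f _ (pullSec p N V s))) :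
    ((invariantPull (D := D.toActionDiagram) p hp).obj N).iso.hom ≫ (pull D.p₂).map f =
      (pull D.mu).map f ≫ M.iso.hom := by
  let κ : (pull D.mu).obj ((pull p).obj N) ⟶ (pull D.p₂).obj ((pull p).obj N) :=
    (pullSq hp).hom.app N
  change κ ≫ (pull D.p₂).map f = (pull D.mu).map f ≫ M.iso.hom
  refine pull_pull_hom_ext D.mu p fun V s => ?_
  have h3 : homSec κ _ (pullSec D.mu _ _ (pullSec p N V s)) =
      secRes ((pull D.p₂).obj ((pull p).obj N)) (map_mu_le p hp V)
        (pullSec D.p₂ _ _ (pullSec p N V s)) := homSec_pullSq hp N V s _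
  have h4 := congrArg (secRes _ (map_mu_le p hp V)) (hact M V _ (hf V s))
  rw [secRes_secRes, secRes_self] at h4
  rw [homSec_comp, homSec_comp, homSec_pullSec, h3, homSec_res, homSec_pullSec]
  exact h4.symm

/-- The inverse image along `p` is left adjoint to the functor of invariant sections, if the sections
over the sets `p⁻¹ V` that are infinitesimally invariant are invariant. -/
noncomputable def invariantAdjunction
    (hact : ∀ (M : EquivMod D.toActionDiagram) (V : Opens Y.top)
      (s : Sec M.mod ((Opens.map p.base).obj V)), M.IsInvariant _ s →
        secRes _ (map_p₂_le p hp V) (M.act _ s) = pullSec D.p₂ M.mod _ s) :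
    invariantPull (D := D.toActionDiagram) p hp ⊣ invariants p hp h₁ h₂ :=
  Adjunction.mkOfHomEquiv
    { homEquiv := fun N M =>
        { toFun := fun f => (invSub p hp h₁ h₂ M).lift ((adj p).homEquiv N M.mod f.hom) fun V s => by
            have h := IsInvariant.map f (isInvariant_pullSec p hp h₁ N V s)
            exact (homSec_homEquiv p f.hom V s).symm ▸ h
          invFun := fun g =>
            { hom := ((adj p).homEquiv N M.mod).symm (g ≫ (invSub p hp h₁ h₂ M).incl)
              comm := pullSq_comp_map p hp hact _ fun V s =>
                (homSec_homEquiv_symm p (g ≫ (invSub p hp h₁ h₂ M).incl) V s).symm ▸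
                  (invSub p hp h₁ h₂ M).homSec_incl_mem g V s }
          left_inv := fun f => EquivMod.Hom.ext (Equiv.symm_apply_apply _ _)
          right_inv := fun g => SubMod.hom_ext _ 
            (Equiv.apply_symm_apply ((adj p).homEquiv N M.mod) (g ≫ (invSub p hp h₁ h₂ M).incl)) }
      homEquiv_naturality_left_symm := fun {N N' M} f g => EquivMod.Hom.ext
        ((adj p).homEquiv_naturality_left_symm f (g ≫ (invSub p hp h₁ h₂ M).incl))
      homEquiv_naturality_right := fun {N M M'} f g => SubMod.hom_ext _
        ((adj p).homEquiv_naturality_right f.hom g.hom) }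

end EquivMod

theorem proposition6p2 {E : Type} [NormedAddCommGroup E] [NormedSpace ℂ E] [FiniteDimensional ℂ E]
    {X : Type u} [TopologicalSpace X] [T2Space X] [SecondCountableTopology X] [ChartedSpace E X]
    [IsManifold 𝓘(ℂ, E) ω X] [MulAction ℂˣ X] [ContMDiffSMul 𝓘(ℂ, ℂ) 𝓘(ℂ, E) ω ℂˣ X]
    [ProperSMul ℂˣ X] (hfree : ∀ (t : ℂˣ) (x : X), t • x = x → t = 1) (A : DQAlgebra E X) (m : ℤ)
    (hm : m ≠ 0) (θ : FAction A m) :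
    ∃ hθ : θ.LambdaExists, Nonempty (θ.pStar hθ ⊣ θ.pInv hθ) := by
  refine ⟨θ.lambdaExists, ⟨EquivMod.invariantAdjunction (D := θ.cDiagram θ.lambdaExists) θ.quotHom
    θ.muHom_quotHom _ _ fun M V s hs => ?_⟩⟩
  exact FAction.secRes_act (hθ := θ.lambdaExists) (U := quotInv V) hs
    (fun t x (hx : quotMap X x ∈ V) => show quotMap X (t • x) ∈ V from (quotMap_smul t x).symm ▸ hx) _
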